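/- **Conventions.** 2-categories are strict. For 2-categories $\mathcal A,\mathcal C$, $p\mathcal Hom_p(\mathcal A,\mathcal C)$ is the 2-category of pseudo-functors, pseudo-natural transformations and modifications. A pair $(i:A\to X,\ p:Y\to B)$ of morphisms of $\mathcal C$ has the *lifting property* if for all $a:A\to Y$, $b:X\to B$ and every invertible 2-cell $\gamma: pa\Rightarrow bi$ there are $f:X\to Y$ and invertible 2-cells $\lambda:a\Rightarrow fi$, $\rho:pf\Rightarrow b$ with $\rho i\circ p\lambda=\gamma$. A *closed 2-bmodel 2-category* is a 2-category $\mathcal C$ with three classes of morphisms, called fibrations, cofibrations and weak equivalences, such that: - (M0b) $\mathcal C$ has all weighted bi-limits and bi-colimits of pseudo-functors $F:\mathcal P\to\mathcal C$, where $\mathcal P$ is a 2-category with finitely many objects, 1-cells and 2-cells and the weight (a pseudo-functor $W:\mathcal P\to\mathcal Cat$ for bi-limits, $W:\mathcal P^{op}\to\mathcal Cat$ for bi-colimits) takes finite categories as values; - (M2) every morphism $f$ is isomorphic to a composite $pi$ with $i$ a cofibration and weak equivalence and $p$ a fibration, and also to a composite $pi$ with $i$ a cofibration and $p$ a fibration and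 weak equivalence; - (M5) if $h\cong gf$ and two of $f,g,h$ are weak equivalences, so is the third; every isomorphism is a weak equivalence; - (M6a) $p$ is a fibration iff $(i,p)$ has the lifting property for every $i$ that is both a cofibration and a weak equivalence; - (M6b) $i$ is a cofibration iff $(i,p)$ has the lifting property for every $p$ that is both a fibration and a weak equivalence; - (M6c) $f$ is a weak equivalence iff $f\cong uv$ where $u$ has the right lifting property with respect to all cofibrations and $v$ has the left lifting property with respect to all fibrations. **Theorem.** Let $\mathsf J$ be a filtered (directed) poset with a least element in which every set $\{k\mid k\le j\}$ is finite, and let $\mathcal C$ be a closed 2-bmodel 2-category. Call a morphism of $p\mathcal Hom_p(\mathsf J^{op},\mathcal C)$ a cofibration (respectively a weak equivalence) if all its components are cofibrations (respectively weak equivalences) in $\mathcal C$, and a fibration if it has the right lifting property with respect to all morphisms that are both cofibrations and weak equivalences. Then $p\mathcal Hom_p(\mathsf J^{op},\mathcal C)$ is a closed 2-bmodel 2-category. Moreover, let $p:Y\to B$ be a morphism of $p\mathcal Hom_p(\mathsf J^{op},\mathcal C)$. For $j\in\mathsf J$, choose bi-limits $\pi_k:L_Y\to Y_k$ and $\pi_k:L_B\to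 B_k$ of the restrictions of $Y$ and $B$ to $\{k\mid k<j\}$; morphisms $\ell:L_Y\to L_B$, $a_Y:Y_j\to L_Y$, $a_B:B_j\to L_B$ with invertible morphisms of pseudo-cones $\mu_k:\pi_k\ell\Rightarrow p_k\pi_k$, $\eta_k:\pi_ka_Y\Rightarrow Y_{k<j}$, $\varepsilon_k:\pi_ka_B\Rightarrow B_{k<j}$; a bi-pullback $\pi_0:P\to L_Y$, $\pi_1:P\to B_j$, $\alpha:\ell\pi_0\cong a_B\pi_1$; and a morphism $q_j:Y_j\to P$ with invertible 2-cells $\beta_0:\pi_0q_j\Rightarrow a_Y$, $\beta_1:\pi_1q_j\Rightarrow p_j$ such that, for all $k<j$, the two invertible 2-cells $\pi_k\ell\pi_0q_j\Rightarrow B_{k<j}p_j$, namely the one obtained by pasting $\alpha$, $\beta_1$ and $\varepsilon_k$, and the one obtained by pasting $\beta_0$, $\mu_k$, $\eta_k$ and the structural 2-cell $p_kY_{k<j}\cong B_{k<j}p_j$ of $p$, coincide. Such choices exist for every $j$, and for any such choices: 1. $p$ is a fibration if and only if $q_j$ is a fibration in $\mathcal C$ for every $j\in\mathsf J$; 2.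 $p$ is both a fibration and a weak equivalence if and only if $q_j$ is both a fibration and a weak equivalence in $\mathcal C$ for every $j\in\mathsf J$. -/

import Mathlib

open CategoryTheory CategoryTheory.Bicategory
open scoped CategoryTheory.Pseudofunctor.StrongTrans

namespace TwoBModel

universe w v u w₁ v₁ u₁

/-! ### Finite weighted bi-limits and bi-colimits

A 2-category is a bicategory that is `Bicategory.Strict`.  Composition is written in diagrammatic
order, so that `f ≫ g` is the composite written `g f` in the classical order. -/

/-- A bicategory with finitely many objects, 1-cells and 2-cells. -/
structure FiniteBicategory (P : Type u) [Bicategory.{w, v} P] : Prop where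
  obj : Finite P
  hom : ∀ a b : P, Finite (a ⟶ b)
  hom₂ : ∀ (a b : P) (f g : a ⟶ b), Finite (f ⟶ g)

/-- A category with finitely many objects and arrows. -/
structure FiniteCategory (E : Type u) [Category.{v} E] : Prop where
  obj : Finite E
  hom : ∀ a b : E, Finite (a ⟶ b)

section Weighted

variable {P : Type} [Bicategory.{0, 0} P] {C : Type u} [Bicategory.{w, v} C]

/-- A cone over `F : P ⥤ᵖ C` with weight `W : P ⥤ᵖ Cat` and vertex `X`: a pseudo-natural
transformation from `W` to `C(X, F -)`, written out in components. -/
structure WeightedCone (W : P ⥤ᵖ Cat.{0, 0}) (F : P ⥤ᵖ C) (X : C) where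
  app (a : P) : W.obj a ⥤ (X ⟶ F.obj a)
  naturality {a b : P} (s : a ⟶ b) (x : W.obj a) :
    (app b).obj ((W.map s).toFunctor.obj x) ≅ (app a).obj x ≫ F.map s
  naturality_map {a b : P} (s : a ⟶ b) {x y : W.obj a} (m : x ⟶ y) :
    (app b).map ((W.map s).toFunctor.map m) ≫ (naturality s y).hom =
      (naturality s x).hom ≫ (app a).map m ▷ F.map s
  naturality_naturality {a b : P} {s t : a ⟶ b} (η : s ⟶ t) (x : W.obj a) :
    (app b).map ((W.map₂ η).toNatTrans.app x) ≫ (naturality t x).hom =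
      (naturality s x).hom ≫ (app a).obj x ◁ F.map₂ η
  naturality_id (a : P) (x : W.obj a) :
    (naturality (𝟙 a) x).hom ≫ (app a).obj x ◁ (F.mapId a).hom =
      (app a).map ((W.mapId a).hom.toNatTrans.app x) ≫ (ρ_ ((app a).obj x)).inv
  naturality_comp {a b c : P} (s : a ⟶ b) (t : b ⟶ c) (x : W.obj a) :
    (naturality (s ≫ t) x).hom ≫ (app a).obj x ◁ (F.mapComp s t).hom =
      (app c).map ((W.mapComp s t).hom.toNatTrans.app x) ≫
        (naturality t ((W.map s).toFunctor.obj x)).hom ≫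
          (naturality s x).hom ▷ F.map t ≫ (α_ _ _ _).hom

namespace WeightedCone

variable {W : P ⥤ᵖ Cat.{0, 0}} {F : P ⥤ᵖ C} {X : C}

/-- A morphism of weighted cones: a modification. -/
@[ext]
structure Hom (c d : WeightedCone W F X) where
  app (a : P) : c.app a ⟶ d.app a
  naturality {a b : P} (s : a ⟶ b) (x : W.obj a) :
    (app b).app ((W.map s).toFunctor.obj x) ≫ (d.naturality s x).hom =
      (c.naturality s x).hom ≫ (app a).app x ▷ F.map s

instance : Category (WeightedCone W F X) where
  Hom := Hom
  id c := { app := fun a => 𝟙 (c.app a), naturality := by intros; simp }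
  comp m n :=
    { app := fun a => m.app a ≫ n.app a
      naturality := by
        intros
        simp [n.naturality, reassoc_of% m.naturality] }
  id_comp _ := Hom.ext (by funext; simp)
  comp_id _ := Hom.ext (by funext; simp)
  assoc _ _ _ := Hom.ext (by funext; simp)

/-- Restriction of a weighted cone along a 1-cell between vertices. -/
@[simps]
def pull {L : C} (c : WeightedCone W F L) (f : X ⟶ L) : WeightedCone W F X where
  app a :=
    { obj := fun x => f ≫ (c.app a).obj x
      map := fun m => f ◁ (c.app a).map m }
  naturality s x := whiskerLeftIso f (c.naturality s x) ≪≫ (α_ _ _ _).symm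
  naturality_map s x y m := by
    have h := congrArg (fun t => f ◁ t) (c.naturality_map s m)
    simp only [whiskerLeft_comp] at h
    simp [reassoc_of% h]
  naturality_naturality η x := by
    have h := congrArg (fun t => f ◁ t) (c.naturality_naturality η x)
    simp only [whiskerLeft_comp] at h
    simp [reassoc_of% h]
  naturality_id a x := by
    have h := congrArg (fun t => f ◁ t) (c.naturality_id a x)
    simp only [whiskerLeft_comp] at h
    simp [reassoc_of% h]
  naturality_comp s t x := by
    have h := congrArg (fun t => f ◁ t) (c.naturality_comp s t x)
    simp only [whiskerLeft_comp] at h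
    simp [reassoc_of% h]

/-- The functor `C(X, L) ⥤ WeightedCone W F X` induced by a cone with vertex `L`. -/
@[simps]
def pullFunctor {L : C} (c : WeightedCone W F L) (X : C) : (X ⟶ L) ⥤ WeightedCone W F X where
  obj f := c.pull f
  map {f g} μ :=
    { app := fun a => { app := fun x => μ ▷ (c.app a).obj x
                        naturality := fun x y m => (whisker_exchange μ ((c.app a).map m)) }
      naturality := fun s x => by
        change μ ▷ _ ≫ g ◁ (c.naturality s x).hom ≫ (α_ _ _ _).inv =
          (f ◁ (c.naturality s x).hom ≫ (α_ _ _ _).inv) ≫ μ ▷ _ ▷ _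
        rw [← whisker_exchange_assoc]
        simp }
  map_id f := Hom.ext (by funext a; ext x; simp; rfl)
  map_comp μ ν := Hom.ext (by funext a; ext x; simp; rfl)

/-- `c` exhibits `L` as the bi-limit of `F` weighted by `W`: composition with `c` is an
equivalence of categories `C(X, L) ≃ pHom(P, Cat)(W, C(X, F -))` for all `X`. -/
def IsBilimit {L : C} (c : WeightedCone W F L) : Prop :=
  ∀ X : C, (c.pullFunctor X).IsEquivalence

end WeightedCone

/-- A cocone under `F : P ⥤ᵖ C` with weight `W : Pᵒᵖ ⥤ᵖ Cat` and vertex `X`: a pseudo-natural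
transformation from `W` to `C(F -, X)`, written out in components. -/
structure WeightedCocone (W : Pᵒᵖ ⥤ᵖ Cat.{0, 0}) (F : P ⥤ᵖ C) (X : C) where
  app (a : P) : W.obj (.op a) ⥤ (F.obj a ⟶ X)
  naturality {a b : P} (s : a ⟶ b) (x : W.obj (.op b)) :
    (app a).obj ((W.map s.op).toFunctor.obj x) ≅ F.map s ≫ (app b).obj x
  naturality_map {a b : P} (s : a ⟶ b) {x y : W.obj (.op b)} (m : x ⟶ y) :
    (app a).map ((W.map s.op).toFunctor.map m) ≫ (naturality s y).hom =
      (naturality s x).hom ≫ F.map s ◁ (app b).map m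
  naturality_naturality {a b : P} {s t : a ⟶ b} (η : s ⟶ t) (x : W.obj (.op b)) :
    (app a).map ((W.map₂ (_root_.Bicategory.Opposite.op2 η)).toNatTrans.app x) ≫
        (naturality t x).hom =
      (naturality s x).hom ≫ F.map₂ η ▷ (app b).obj x
  naturality_id (a : P) (x : W.obj (.op a)) :
    (naturality (𝟙 a) x).hom ≫ (F.mapId a).hom ▷ (app a).obj x =
      (app a).map ((W.mapId (.op a)).hom.toNatTrans.app x) ≫ (λ_ ((app a).obj x)).inv
  naturality_comp {a b c : P} (s : a ⟶ b) (t : b ⟶ c) (x : W.obj (.op c)) :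
    (naturality (s ≫ t) x).hom ≫ (F.mapComp s t).hom ▷ (app c).obj x =
      (app a).map ((W.mapComp t.op s.op).hom.toNatTrans.app x) ≫
        (naturality s ((W.map t.op).toFunctor.obj x)).hom ≫
          F.map s ◁ (naturality t x).hom ≫ (α_ _ _ _).inv

namespace WeightedCocone

variable {W : Pᵒᵖ ⥤ᵖ Cat.{0, 0}} {F : P ⥤ᵖ C} {X : C}

/-- A morphism of weighted cocones: a modification. -/
@[ext]
structure Hom (c d : WeightedCocone W F X) where
  app (a : P) : c.app a ⟶ d.app a
  naturality {a b : P} (s : a ⟶ b) (x : W.obj (.op b)) :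
    (app a).app ((W.map s.op).toFunctor.obj x) ≫ (d.naturality s x).hom =
      (c.naturality s x).hom ≫ F.map s ◁ (app b).app x

instance : Category (WeightedCocone W F X) where
  Hom := Hom
  id c := { app := fun a => 𝟙 (c.app a), naturality := by intros; simp }
  comp m n :=
    { app := fun a => m.app a ≫ n.app a
      naturality := by
        intros
        simp [n.naturality, reassoc_of% m.naturality] }
  id_comp _ := Hom.ext (by funext; simp)
  comp_id _ := Hom.ext (by funext; simp)
  assoc _ _ _ := Hom.ext (by funext; simp)

/-- Extension of a weighted cocone along a 1-cell between vertices. -/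
@[simps]
def push {L : C} (c : WeightedCocone W F L) (f : L ⟶ X) : WeightedCocone W F X where
  app a :=
    { obj := fun x => (c.app a).obj x ≫ f
      map := fun m => (c.app a).map m ▷ f }
  naturality s x := whiskerRightIso (c.naturality s x) f ≪≫ (α_ _ _ _)
  naturality_map s x y m := by
    have h := congrArg (fun t => t ▷ f) (c.naturality_map s m)
    simp only [comp_whiskerRight] at h
    simp [reassoc_of% h]
  naturality_naturality η x := by
    have h := congrArg (fun t => t ▷ f) (c.naturality_naturality η x)
    simp only [comp_whiskerRight] at h
    simp [reassoc_of% h]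
  naturality_id a x := by
    have h := congrArg (fun t => t ▷ f) (c.naturality_id a x)
    simp only [comp_whiskerRight] at h
    simp [reassoc_of% h]
  naturality_comp s t x := by
    have h := congrArg (fun t => t ▷ f) (c.naturality_comp s t x)
    simp only [comp_whiskerRight] at h
    simp [reassoc_of% h]

/-- The functor `C(L, X) ⥤ WeightedCocone W F X` induced by a cocone with vertex `L`. -/
@[simps]
def pushFunctor {L : C} (c : WeightedCocone W F L) (X : C) :
    (L ⟶ X) ⥤ WeightedCocone W F X where
  obj f := c.push f
  map {f g} μ :=
    { app := fun a => { app := fun x => (c.app a).obj x ◁ μ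
                        naturality := fun x y m => (whisker_exchange ((c.app a).map m) μ).symm }
      naturality := fun s x => by
        change _ ◁ μ ≫ (c.naturality s x).hom ▷ g ≫ (α_ _ _ _).hom =
          ((c.naturality s x).hom ▷ f ≫ (α_ _ _ _).hom) ≫ _ ◁ _ ◁ μ
        rw [whisker_exchange_assoc]
        simp }
  map_id f := Hom.ext (by funext a; ext x; simp; rfl)
  map_comp μ ν := Hom.ext (by funext a; ext x; simp; rfl)

/-- `c` exhibits `L` as the bi-colimit of `F` weighted by `W`: composition with `c` is an
equivalence of categories `C(L, X) ≃ pHom(Pᵒᵖ, Cat)(W, C(F -, X))` for all `X`. -/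
def IsBicolimit {L : C} (c : WeightedCocone W F L) : Prop :=
  ∀ X : C, (c.pushFunctor X).IsEquivalence

end WeightedCocone

end Weighted

/-- All finite weighted bi-limits exist. -/
def HasFiniteWeightedBilimits (C : Type u) [Bicategory.{w, v} C] : Prop :=
  ∀ (P : Type) [Bicategory.{0, 0} P] [Bicategory.Strict P] (W : P ⥤ᵖ Cat.{0, 0}) (F : P ⥤ᵖ C),
    FiniteBicategory P → (∀ a, FiniteCategory (W.obj a)) →
      ∃ (L : C) (c : WeightedCone W F L), c.IsBilimit

/-- All finite weighted bi-colimits exist. -/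
def HasFiniteWeightedBicolimits (C : Type u) [Bicategory.{w, v} C] : Prop :=
  ∀ (P : Type) [Bicategory.{0, 0} P] [Bicategory.Strict P] (W : Pᵒᵖ ⥤ᵖ Cat.{0, 0}) (F : P ⥤ᵖ C),
    FiniteBicategory P → (∀ a, FiniteCategory (W.obj a)) →
      ∃ (L : C) (c : WeightedCocone W F L), c.IsBicolimit


/-! ### Pseudo-cones, bi-limits and bi-pullbacks -/

section Cones

variable {C : Type u} [Bicategory.{w, v} C]

/-- The constant pseudofunctor. -/
@[simps]
def const (B : Type u₁) [Bicategory.{w₁, v₁} B] (X : C) : B ⥤ᵖ C where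
  obj _ := X
  map _ := 𝟙 X
  map₂ _ := 𝟙 (𝟙 X)
  mapId _ := Iso.refl _
  mapComp _ _ := (λ_ (𝟙 X)).symm
  map₂_whisker_left := by intros; simp
  map₂_whisker_right := by intros; simp
  map₂_associator := by intros; simp
  map₂_left_unitor := by intros; simp
  map₂_right_unitor := by intros; simp

/-- The transformation of constant pseudofunctors given by a 1-cell. -/
@[simps]
def constMap (B : Type u₁) [Bicategory.{w₁, v₁} B] {X Y : C} (f : X ⟶ Y) :
    const B X ⟶ const B Y where
  app _ := f
  naturality _ := λ_ f ≪≫ (ρ_ f).symm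
  naturality_naturality _ := by
    change 𝟙 (𝟙 X) ▷ f ≫ (λ_ f ≪≫ (ρ_ f).symm).hom = (λ_ f ≪≫ (ρ_ f).symm).hom ≫ f ◁ 𝟙 (𝟙 Y)
    simp
  naturality_id _ := by
    change (λ_ f ≪≫ (ρ_ f).symm).hom ≫ f ◁ 𝟙 (𝟙 Y) = 𝟙 (𝟙 X) ▷ f ≫ (λ_ f).hom ≫ (ρ_ f).inv
    simp
  naturality_comp _ _ := by
    change (λ_ f ≪≫ (ρ_ f).symm).hom ≫ f ◁ (λ_ (𝟙 Y)).inv =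
      (λ_ (𝟙 X)).inv ▷ f ≫ (α_ (𝟙 X) (𝟙 X) f).hom ≫ 𝟙 X ◁ (λ_ f ≪≫ (ρ_ f).symm).hom ≫
        (α_ (𝟙 X) f (𝟙 Y)).inv ≫ (λ_ f ≪≫ (ρ_ f).symm).hom ▷ 𝟙 Y ≫ (α_ f (𝟙 Y) (𝟙 Y)).hom
    simp only [Iso.trans_hom, Iso.symm_hom]
    bicategory

/-- The modification of constant transformations given by a 2-cell. -/
@[simps]
def constMap₂ (B : Type u₁) [Bicategory.{w₁, v₁} B] {X Y : C} {f g : X ⟶ Y} (μ : f ⟶ g) :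
    constMap B f ⟶ constMap B g where
  as := { app := fun _ => μ
          naturality := fun _ => by
            change 𝟙 X ◁ μ ≫ (λ_ g ≪≫ (ρ_ g).symm).hom = (λ_ f ≪≫ (ρ_ f).symm).hom ≫ μ ▷ 𝟙 Y
            simp }

variable {B : Type u₁} [Bicategory.{w₁, v₁} B]

/-- The category of pseudo-cones over `G` with vertex `X`: pseudo-natural transformations from the
constant pseudofunctor at `X` to `G`, and modifications. -/
abbrev PseudoCone (G : B ⥤ᵖ C) (X : C) := const B X ⟶ G

/-- The functor `C(X, L) ⥤ PseudoCone G X` given by composition with a pseudo-cone. -/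
@[simps]
def PseudoCone.pullFunctor {G : B ⥤ᵖ C} {L : C} (c : PseudoCone G L) (X : C) :
    (X ⟶ L) ⥤ PseudoCone G X where
  obj f := constMap B f ≫ c
  map μ := constMap₂ B μ ▷ c
  map_id f := by ext a; exact id_whiskerRight f (c.app a)
  map_comp μ ν := by ext a; exact comp_whiskerRight μ ν (c.app a)

/-- `c` exhibits `L` as the bi-limit of `G`: composition with `c` is an equivalence of categories
`C(X, L) ≃ PseudoCone G X` for all `X`. -/
def PseudoCone.IsBilimit {G : B ⥤ᵖ C} {L : C} (c : PseudoCone G L) : Prop :=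
  ∀ X : C, (PseudoCone.pullFunctor c X).IsEquivalence

/-- The square `π₀ ≫ p ≅ π₁ ≫ f` is a bi-pullback: for all `X`, the functor from `C(X, Q)` to the category of
triples `(h₀, h₁, γ : h₀ ≫ p ≅ h₁ ≫ f)` is essentially surjective (first clause) and
fully faithful (second clause). -/
structure IsBipullback {Q Y Z D : C} {p : Y ⟶ D} {f : Z ⟶ D} (π₀ : Q ⟶ Y) (π₁ : Q ⟶ Z)
    (α : π₀ ≫ p ≅ π₁ ≫ f) : Prop where
  lift : ∀ ⦃X : C⦄ (h₀ : X ⟶ Y) (h₁ : X ⟶ Z) (γ : h₀ ≫ p ≅ h₁ ≫ f),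
    ∃ (u : X ⟶ Q) (β₀ : u ≫ π₀ ≅ h₀) (β₁ : u ≫ π₁ ≅ h₁),
      β₀.hom ▷ p ≫ γ.hom =
        (α_ u π₀ p).hom ≫ u ◁ α.hom ≫ (α_ u π₁ f).inv ≫ β₁.hom ▷ f
  lift₂ : ∀ ⦃X : C⦄ (u u' : X ⟶ Q) (ρ₀ : u ≫ π₀ ⟶ u' ≫ π₀) (ρ₁ : u ≫ π₁ ⟶ u' ≫ π₁),
    ρ₀ ▷ p ≫ (α_ u' π₀ p).hom ≫ u' ◁ α.hom ≫ (α_ u' π₁ f).inv =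
      (α_ u π₀ p).hom ≫ u ◁ α.hom ≫ (α_ u π₁ f).inv ≫ ρ₁ ▷ f →
    ∃! μ : u ⟶ u', μ ▷ π₀ = ρ₀ ∧ μ ▷ π₁ = ρ₁

end Cones

/-! ### Closed 2-bmodel 2-categories -/

section Model

variable {C : Type u} [Bicategory.{w, v} C]

/-- The pair `(i, p)` has the lifting property: every square `a ≫ p ≅ i ≫ b` has a filler
`f` with invertible 2-cells `l : a ≅ i ≫ f` and `r : f ≫ p ≅ b` whose pasting is the given one. -/
def HasLifting {A X Y B : C} (i : A ⟶ X) (p : Y ⟶ B) : Prop :=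
  ∀ (a : A ⟶ Y) (b : X ⟶ B) (γ : a ≫ p ≅ i ≫ b),
    ∃ (f : X ⟶ Y) (l : a ≅ i ≫ f) (r : f ≫ p ≅ b),
      l.hom ▷ p ≫ (α_ i f p).hom ≫ i ◁ r.hom = γ.hom

/-- The bicategory `C` is a 2-category and, with the classes `cof`, `fib`, `weq` of cofibrations,
fibrations and weak equivalences, a closed 2-bmodel 2-category. -/
structure IsClosedTwoBModel (cof fib weq : MorphismProperty C) : Prop where
  strict : Bicategory.Strict C
  bilimits : HasFiniteWeightedBilimits C
  bicolimits : HasFiniteWeightedBicolimits C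
  factor_trivCof_fib : ∀ ⦃X Y : C⦄ (f : X ⟶ Y), ∃ (Z : C) (i : X ⟶ Z) (p : Z ⟶ Y),
    (cof i ∧ weq i) ∧ fib p ∧ Nonempty (f ≅ i ≫ p)
  factor_cof_trivFib : ∀ ⦃X Y : C⦄ (f : X ⟶ Y), ∃ (Z : C) (i : X ⟶ Z) (p : Z ⟶ Y),
    cof i ∧ (fib p ∧ weq p) ∧ Nonempty (f ≅ i ≫ p)
  weq_comp : ∀ ⦃X Z Y : C⦄ (f : X ⟶ Z) (g : Z ⟶ Y) (h : X ⟶ Y), Nonempty (h ≅ f ≫ g) →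
    weq f → weq g → weq h
  weq_right : ∀ ⦃X Z Y : C⦄ (f : X ⟶ Z) (g : Z ⟶ Y) (h : X ⟶ Y), Nonempty (h ≅ f ≫ g) →
    weq f → weq h → weq g
  weq_left : ∀ ⦃X Z Y : C⦄ (f : X ⟶ Z) (g : Z ⟶ Y) (h : X ⟶ Y), Nonempty (h ≅ f ≫ g) →
    weq g → weq h → weq f
  weq_of_iso : ∀ ⦃X Y : C⦄ (f : X ⟶ Y) (g : Y ⟶ X), f ≫ g = 𝟙 X → g ≫ f = 𝟙 Y → weq f
  fib_iff : ∀ ⦃Y B : C⦄ (p : Y ⟶ B),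
    fib p ↔ ∀ ⦃A X : C⦄ (i : A ⟶ X), cof i → weq i → HasLifting i p
  cof_iff : ∀ ⦃A X : C⦄ (i : A ⟶ X),
    cof i ↔ ∀ ⦃Y B : C⦄ (p : Y ⟶ B), fib p → weq p → HasLifting i p
  weq_iff : ∀ ⦃X Y : C⦄ (f : X ⟶ Y),
    weq f ↔ ∃ (Z : C) (r : X ⟶ Z) (s : Z ⟶ Y), Nonempty (f ≅ r ≫ s) ∧
      (∀ ⦃A D : C⦄ (i : A ⟶ D), cof i → HasLifting i s) ∧
      (∀ ⦃D B : C⦄ (p : D ⟶ B), fib p → HasLifting r p)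

end Model

/-! ### The 2-category of pseudofunctors on a poset -/

section Diagrams

variable {J : Type u₁} [PartialOrder J] {C : Type u} [Bicategory.{w, v} C]

/-- The 2-category `pHom_p(Jᵒᵖ, C)` of pseudofunctors, pseudo-natural transformations and
modifications, for a poset `J`. -/
abbrev Diag (J : Type u₁) [PartialOrder J] (C : Type u) [Bicategory.{w, v} C] :=
  LocallyDiscrete Jᵒᵖ ⥤ᵖ C

/-- `j : J`, regarded as an object of `Jᵒᵖ`. -/
abbrev pt (j : J) : LocallyDiscrete Jᵒᵖ := ⟨.op j⟩

/-- The arrow `j ⟶ k` of `Jᵒᵖ` for `k ≤ j`. -/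
abbrev down {k j : J} (h : k ≤ j) : pt j ⟶ pt k := (homOfLE h).op.toLoc

/-- The morphisms of diagrams that belong pointwise to a class. -/
def Pointwise (J : Type u₁) [PartialOrder J] (S : MorphismProperty C) :
    MorphismProperty (Diag J C) :=
  fun _ _ f => ∀ j : J, S (f.app (pt j))

/-- The morphisms of diagrams with the right lifting property with respect to all morphisms that
are both pointwise cofibrations and pointwise weak equivalences. -/
def DiagFib (J : Type u₁) [PartialOrder J] (cof weq : MorphismProperty C) :
    MorphismProperty (Diag J C) :=
  fun _ _ p => ∀ ⦃A X : Diag J C⦄ (i : A ⟶ X),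
    Pointwise J cof i → Pointwise J weq i → HasLifting i p

/-- The inclusion `Sᵒᵖ ⟶ Jᵒᵖ` on arrows, for `S ⊆ J`. -/
abbrev inclHom {S : Set J} {a b : LocallyDiscrete (↥S)ᵒᵖ} (s : a ⟶ b) :
    pt (a.as.unop : J) ⟶ pt (b.as.unop : J) :=
  down (leOfHom s.as.unop)

/-- Restriction of a diagram to a subset of the poset. -/
@[simps]
def restrict (S : Set J) (Y : Diag J C) : Diag S C where
  obj a := Y.obj (pt (a.as.unop : J))
  map s := Y.map (inclHom s)
  map₂ {a b s t} η := Y.map₂ (eqToHom (by rw [LocallyDiscrete.eq_of_hom η]))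
  mapId a := Y.mapId (pt (a.as.unop : J))
  mapComp s t := Y.mapComp (inclHom s) (inclHom t)
  map₂_id s := (congrArg Y.map₂ (Subsingleton.elim _ _)).trans (Y.map₂_id _)
  map₂_comp η θ := (congrArg Y.map₂ (Subsingleton.elim _ _)).trans (Y.map₂_comp _ _)
  map₂_whisker_left s t t' η :=
    (congrArg Y.map₂ (Subsingleton.elim _ _)).trans (Y.map₂_whisker_left (inclHom s) _)
  map₂_whisker_right η s :=
    (congrArg Y.map₂ (Subsingleton.elim _ _)).trans (Y.map₂_whisker_right _ (inclHom s))
  map₂_associator s t r :=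
    (congrArg Y.map₂ (Subsingleton.elim _ _)).trans
      (Y.map₂_associator (inclHom s) (inclHom t) (inclHom r))
  map₂_left_unitor s :=
    (congrArg Y.map₂ (Subsingleton.elim _ _)).trans (Y.map₂_left_unitor (inclHom s))
  map₂_right_unitor s :=
    (congrArg Y.map₂ (Subsingleton.elim _ _)).trans (Y.map₂_right_unitor (inclHom s))

/-- Restriction of a morphism of diagrams to a subset of the poset. -/
@[simps]
def restrictMap (S : Set J) {Y B : Diag J C} (p : Y ⟶ B) : restrict S Y ⟶ restrict S B where
  app a := p.app (pt (a.as.unop : J))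
  naturality s := p.naturality (inclHom s)
  naturality_naturality _ := p.naturality_naturality _
  naturality_id _ := p.naturality_id _
  naturality_comp _ _ := p.naturality_comp _ _

theorem below_le {j : J} (k : Set.Iio j) : (k : J) ≤ j := le_of_lt k.2

theorem downCone_aux_comp {X A A' A'' : C} {x : X ⟶ A} {y : X ⟶ A'} {z : X ⟶ A''} {s : A ⟶ A'}
    {t : A' ⟶ A''} {st : A ⟶ A''} (m : y ≅ x ≫ s) (n : z ≅ y ≫ t) (r : z ≅ x ≫ st)
    (c : st ≅ s ≫ t) (h : r.hom ≫ x ◁ c.hom = n.hom ≫ m.hom ▷ t ≫ (α_ x s t).hom) :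
    (λ_ z ≪≫ r).hom ≫ x ◁ c.hom =
      (λ_ (𝟙 X)).inv ▷ z ≫ (α_ (𝟙 X) (𝟙 X) z).hom ≫ 𝟙 X ◁ (λ_ z ≪≫ n).hom ≫
        (α_ (𝟙 X) y t).inv ≫ (λ_ y ≪≫ m).hom ▷ t ≫ (α_ x s t).hom := by
  simp only [Iso.trans_hom, Category.assoc, h]
  simp

theorem downCone_aux_id {X A : C} {x : X ⟶ A} {s : A ⟶ A} (r : x ≅ x ≫ s) (c : s ≅ 𝟙 A)
    (h : r.hom = (ρ_ x).inv ≫ x ◁ c.inv) :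
    (λ_ x ≪≫ r).hom ≫ x ◁ c.hom = 𝟙 (𝟙 X) ▷ x ≫ (λ_ x).hom ≫ (ρ_ x).inv := by
  simp [h, ← whiskerLeft_comp]

/-- The pseudo-cone `Y_{k<j} : Y_j ⟶ Y_k` over the restriction of `Y` to `{k | k < j}`, with the
structural 2-cells of `Y`. -/
@[simps]
def downCone (Y : Diag J C) (j : J) : PseudoCone (restrict (Set.Iio j) Y) (Y.obj (pt j)) where
  app a := Y.map (down (below_le a.as.unop))
  naturality {a b} s := λ_ _ ≪≫ Y.mapComp (down (below_le a.as.unop)) (inclHom s)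
  naturality_naturality {a b s t} η := by
    obtain rfl := LocallyDiscrete.eq_of_hom η
    obtain rfl : η = 𝟙 _ := Subsingleton.elim _ _
    rw [(restrict (Set.Iio j) Y).map₂_id]
    exact (congrArg (· ≫ _) (id_whiskerRight _ _)).trans ((Category.id_comp _).trans
      ((congrArg (_ ≫ ·) (whiskerLeft_id _ _)).trans (Category.comp_id _)).symm)
  naturality_id a := by
    refine downCone_aux_id (Y.mapComp (down (below_le a.as.unop)) (𝟙 (pt (a.as.unop : J))))
      (Y.mapId _) ?_
    refine (Y.mapComp_id_right_hom _).trans ?_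
    exact (congrArg (· ≫ _) ((congrArg Y.map₂ (Subsingleton.elim _ (𝟙 _))).trans
      (Y.map₂_id _))).trans (Category.id_comp _)
  naturality_comp {a b c} s t := by
    refine downCone_aux_comp (Y.mapComp (down (below_le a.as.unop)) (inclHom s))
      (Y.mapComp (down (below_le b.as.unop)) (inclHom t))
      (Y.mapComp (down (below_le a.as.unop)) (inclHom s ≫ inclHom t))
      (Y.mapComp (inclHom s) (inclHom t)) ?_
    refine (Y.mapComp_assoc_right_hom _ _ _).trans ?_
    exact (congrArg (· ≫ _) ((congrArg Y.map₂ (Subsingleton.elim _ (𝟙 _))).trans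
      (Y.map₂_id _))).trans (Category.id_comp _)

/-- A choice of the matching morphism of `p : Y ⟶ B` at `j`, consisting of bi-limits
`LY`, `LB` of `Y` and `B` over `{k | k < j}`, the 1-cells `LY ⟶ LB`, `Y_j ⟶ LY` and `B_j ⟶ LB`
induced by the corresponding pseudo-cones, a bi-pullback `Q` of `LY ⟶ LB` along `B_j ⟶ LB`, and
the induced 1-cell `q : Y_j ⟶ Q`. -/
structure Matching {Y B : Diag J C} (p : Y ⟶ B) (j : J) where
  LY : C
  πY : PseudoCone (restrict (Set.Iio j) Y) LY
  isBilimit_πY : πY.IsBilimit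
  LB : C
  πB : PseudoCone (restrict (Set.Iio j) B) LB
  isBilimit_πB : πB.IsBilimit
  limp : LY ⟶ LB
  μ : constMap _ limp ≫ πB ≅ πY ≫ restrictMap (Set.Iio j) p
  aY : Y.obj (pt j) ⟶ LY
  η : constMap _ aY ≫ πY ≅ downCone Y j
  aB : B.obj (pt j) ⟶ LB
  δ : constMap _ aB ≫ πB ≅ downCone B j
  Q : C
  π₀ : Q ⟶ LY
  π₁ : Q ⟶ B.obj (pt j)
  α : π₀ ≫ limp ≅ π₁ ≫ aB
  isBipullback : IsBipullback π₀ π₁ α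
  q : Y.obj (pt j) ⟶ Q
  β₀ : q ≫ π₀ ≅ aY
  β₁ : q ≫ π₁ ≅ p.app (pt j)
  compat : ∀ k : Set.Iio j,
    β₀.hom ▷ (limp ≫ πB.app (pt k)) ≫ aY ◁ μ.hom.as.app (pt k) ≫ (α_ _ _ _).inv ≫
        η.hom.as.app (pt k) ▷ p.app (pt (k : J)) ≫ (p.naturality (down (below_le k))).hom =
      (α_ _ _ _).inv ≫ (α_ _ _ _).hom ▷ πB.app (pt k) ≫ (q ◁ α.hom) ▷ πB.app (pt k) ≫
        (α_ _ _ _).inv ▷ πB.app (pt k) ≫ (β₁.hom ▷ aB) ▷ πB.app (pt k) ≫ (α_ _ _ _).hom ≫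
          p.app (pt j) ◁ δ.hom.as.app (pt k)

end Diagrams

end TwoBModel

/-!
The 1-cells of diagrams on `J` are compared with 1-cells of `C` one element of `J` at a time.

*Lifting.* For a morphism `p : Y ⟶ B` and `j : J`, a `Triple` over `{k | k < j}` with vertex `x`
is a cone over the restriction of `Y`, a 1-cell `x ⟶ B_j`, and invertible 2-cells identifying the
two induced cones over `B`. The object `P` of a matching datum carries a universal triple
(`isUniv_matchTriple`), and `q_j` is the 1-cell that the triple `downTriple p j` with vertex `Y_j`
induces (`Matching.exists_triple`). Hence `q_j` has the lifting property against a 1-cell `u` of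
`C` if and only if `downTriple p j` has it in the form `Triple.HasLift`, which mentions neither
limits nor choices (`Triple.IsUniv.hasLifting_iff`).

*Recursion.* Every `{k | k < j}` is finite, so `J` is well-founded. A filler of a square of
diagrams, and likewise a factorization of a morphism of diagrams, is a compatible system of values
at the elements of `J`, of 2-cells between them and, for factorizations, of coherence conditions. An
extension of such a system from `{k | k < j}` to `j` is a filler, respectively a factorization, of
a single 1-cell of `C`. The recursion that combines these extensions is carried out once, for
sections of two-dimensional data over a poset (`Disp.exists_sec`). A coherent system cannot be

defined by plain recursion on its values, since each step uses the compatibility of the previous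
ones; instead, sections that follow a fixed choice of extensions are shown to be unique, and so they
glue. The results are `hasLifting_of_hasLift` (if each component `i_j` lifts against the triple of
`p` at `j`, then `i` lifts against `p`) and `exists_factorization` (factorizations in `C` give
factorizations of morphisms of diagrams, with a right factor whose triples have the lifting
property).

*Retracts.* If `p` lifts against all morphisms that are pointwise in a class `L`, factor it by
`exists_factorization`; as it lifts against its own left factor, it is a retract of the right
factor, and the lifting property of triples passes to retracts (`Triple.HasLift.of_retract`). With
the converse from the recursion this gives `hasLifting_pointwise_iff`: lifting against morphisms
pointwise in `L` is the same as lifting of all triples, i.e. of all `q_j`, against `L`. For `L` the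
trivial cofibrations this is the description of the fibrations. For trivial fibrations one needs
that lifting of the triples against all cofibrations makes the components of `p` weak
equivalences. This follows by lifting against a constant diagram over `{k | k ≤ j}`
(`hasLifting_app`), and a further retract argument gives `IsClosedTwoBModel.diagTrivFib_iff`. The
remaining axioms on lifting and weak equivalences reduce to those of `C` in the same way.

*Limits and colimits.* Weighted bi-limits and bi-colimits of diagrams are pointwise: the universal
property of the chosen (co)limits at each `j` yields transition 1-cells and coherence 2-cells, and
its uniqueness part yields their coherence conditions. This is done for an abstract notion of cone
(`ConeTheory.exists_diagram`) and of cocone (`CoconeTheory.exists_diagram`). Strictness of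
the bicategory of diagrams is inherited from `C` because its associators and unitors are
componentwise (`strict_pseudofunctor`).
-/

namespace TwoBModel

universe w v u w₁ v₁ u₁ t r

/-! ### Strictness of the bicategory of pseudofunctors -/

section Strict

variable {K : Type u₁} [Bicategory.{w₁, v₁} K] {C : Type u} [Bicategory.{w, v} C]

/-- An invertible modification whose components are equalities is an equality of transformations. -/
theorem strongTrans_eq_of_iso {F G : K ⥤ᵖ C} {η θ : F ⟶ G} (Γ : η ≅ θ)
    (h : ∀ a, η.app a = θ.app a) (hΓ : ∀ a, Γ.hom.as.app a = eqToHom (h a)) :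
    ∃ e : η = θ, Γ = eqToIso e := by
  obtain ⟨ηa, ηn, _, _, _⟩ := η
  obtain ⟨θa, θn, _, _, _⟩ := θ
  obtain rfl : ηa = θa := funext h
  have : @ηn = @θn := by
    funext a b f
    ext
    have := Γ.hom.as.naturality f
    rw [hΓ, hΓ] at this
    simpa using this.symm
  subst this
  refine ⟨rfl, ?_⟩
  ext a
  exact hΓ a

/-- The associators and unitors of pseudonatural transformations are componentwise, so they are
identities if those of the target are. -/
theorem strict_pseudofunctor (hC : Bicategory.Strict C) : Bicategory.Strict (K ⥤ᵖ C) := by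
  have hl {F G : K ⥤ᵖ C} (f : F ⟶ G) := strongTrans_eq_of_iso (λ_ f)
    (fun a => hC.id_comp (f.app a)) fun a => congrArg Iso.hom (hC.leftUnitor_eqToIso (f.app a))
  have hr {F G : K ⥤ᵖ C} (f : F ⟶ G) := strongTrans_eq_of_iso (ρ_ f)
    (fun a => hC.comp_id (f.app a)) fun a => congrArg Iso.hom (hC.rightUnitor_eqToIso (f.app a))
  have ha {F G H I : K ⥤ᵖ C} (f : F ⟶ G) (g : G ⟶ H) (h : H ⟶ I) :=
    strongTrans_eq_of_iso (α_ f g h) (fun a => hC.assoc (f.app a) (g.app a) (h.app a))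
      fun a => congrArg Iso.hom (hC.associator_eqToIso (f.app a) (g.app a) (h.app a))
  exact ⟨fun f => (hl f).1, fun f => (hr f).1, fun f g h => (ha f g h).1,
    fun f => (hl f).2, fun f => (hr f).2, fun f g h => (ha f g h).2⟩

end Strict

/-! ### Diagrams on a poset in elementary terms -/

section Raw

theorem comp_comp_hom_eq_id_iff {D : Type u} [Category.{v} D] {x y z : D} (a : x ⟶ y) (b : y ⟶ z)
    (e : z ≅ x) : a ≫ b ≫ e.hom = 𝟙 _ ↔ a ≫ b = e.inv := by
  rw [← Category.assoc, ← Iso.eq_comp_inv, Category.id_comp]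

variable {I : Type u₁} [PartialOrder I] {C : Type u} [Bicategory.{w, v} C]

theorem eq_id_of_iso_comp_eq {x y z : C} {m : x ⟶ y} {f g : y ⟶ z} {r s : x ⟶ z} {t : x ⟶ z}
    {a : r ≅ m ≫ f} {b : f ≅ g} {c : r ⟶ s} {d : s ⟶ t} {e : t ⟶ m ≫ g}
    (h : a.hom ≫ m ◁ b.hom = c ≫ d ≫ e) : c ≫ d ≫ e ≫ m ◁ b.inv ≫ a.inv = 𝟙 _ := by
  simp [← reassoc_of% h]

namespace Diag

/-- The value of a diagram at an element of the poset. -/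
abbrev ob (X : Diag I C) (j : I) : C := X.obj (pt j)

/-- The transition 1-cell `X_j ⟶ X_k` for `k ≤ j`. -/
def mp (X : Diag I C) {j k : I} (h : k ≤ j) : X.ob j ⟶ X.ob k := X.map (down h)

/-- The structural 2-cell `X_{l ≤ j} ≅ X_{l ≤ k} X_{k ≤ j}`. -/
def cmp (X : Diag I C) {j k l : I} (h : k ≤ j) (h' : l ≤ k) :
    X.mp (h'.trans h) ≅ X.mp h ≫ X.mp h' := X.mapComp (down h) (down h')

/-- The structural 2-cell `X_{j ≤ j} ≅ 𝟙`. -/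
def idm (X : Diag I C) (j : I) : X.mp (le_refl j) ≅ 𝟙 (X.ob j) := X.mapId (pt j)

theorem map₂_eq (X : Diag I C) {a b : LocallyDiscrete Iᵒᵖ} {s : a ⟶ b} (η : s ⟶ s) :
    X.map₂ η = 𝟙 _ :=
  (congrArg X.map₂ (Subsingleton.elim _ (𝟙 _))).trans (X.map₂_id _)

theorem cmp_assoc (X : Diag I C) {j k l m : I} (h : k ≤ j) (h' : l ≤ k) (h'' : m ≤ l) :
    (X.cmp h (h''.trans h')).hom ≫ X.mp h ◁ (X.cmp h' h'').hom =
      (X.cmp (h'.trans h) h'').hom ≫ (X.cmp h h').hom ▷ X.mp h'' ≫ (α_ _ _ _).hom :=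
  (X.mapComp_assoc_right_hom (down h) (down h') (down h'')).trans
    ((congrArg (· ≫ _) (X.map₂_eq _)).trans (Category.id_comp _))

theorem cmp_id_left (X : Diag I C) {j k : I} (h : k ≤ j) :
    (X.cmp (le_refl j) h).hom ≫ (X.idm j).hom ▷ X.mp h = (λ_ _).inv :=
  (comp_comp_hom_eq_id_iff _ _ (λ_ (X.mp h))).mp
    ((X.map₂_left_unitor (down h)).symm.trans (X.map₂_eq _))

theorem cmp_id_right (X : Diag I C) {j k : I} (h : k ≤ j) :
    (X.cmp h (le_refl k)).hom ≫ X.mp h ◁ (X.idm k).hom = (ρ_ _).inv :=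
  (comp_comp_hom_eq_id_iff _ _ (ρ_ (X.mp h))).mp
    ((X.map₂_right_unitor (down h)).symm.trans (X.map₂_eq _))

/-- A diagram from its values, transition 1-cells and structural 2-cells. -/
def mk' (ob : I → C) (mp : ∀ {j k : I}, k ≤ j → (ob j ⟶ ob k))
    (idm : ∀ j, mp (le_refl j) ≅ 𝟙 (ob j))
    (cmp : ∀ {j k l : I} (h : k ≤ j) (h' : l ≤ k), mp (h'.trans h) ≅ mp h ≫ mp h')
    (assoc : ∀ {j k l m : I} (h : k ≤ j) (h' : l ≤ k) (h'' : m ≤ l),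
      (cmp h (h''.trans h')).hom ≫ mp h ◁ (cmp h' h'').hom =
        (cmp (h'.trans h) h'').hom ≫ (cmp h h').hom ▷ mp h'' ≫ (α_ _ _ _).hom)
    (id_left : ∀ {j k : I} (h : k ≤ j),
      (cmp (le_refl j) h).hom ≫ (idm j).hom ▷ mp h = (λ_ _).inv)
    (id_right : ∀ {j k : I} (h : k ≤ j),
      (cmp h (le_refl k)).hom ≫ mp h ◁ (idm k).hom = (ρ_ _).inv) : Diag I C where
  obj a := ob a.as.unop
  map s := mp (leOfHom s.as.unop)
  map₂ _ := 𝟙 _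
  mapId a := idm a.as.unop
  mapComp s t := cmp (leOfHom s.as.unop) (leOfHom t.as.unop)
  map₂_whisker_left s t t' η := by
    obtain rfl := LocallyDiscrete.eq_of_hom η
    simp
  map₂_whisker_right {a b c s t} η r := by
    obtain rfl := LocallyDiscrete.eq_of_hom η
    simp
  map₂_associator s t r := (eq_id_of_iso_comp_eq
    (assoc (leOfHom s.as.unop) (leOfHom t.as.unop) (leOfHom r.as.unop))).symm
  map₂_left_unitor s := ((comp_comp_hom_eq_id_iff _ _ (λ_ _)).mpr (id_left _)).symm
  map₂_right_unitor s := ((comp_comp_hom_eq_id_iff _ _ (ρ_ _)).mpr (id_right _)).symm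

end Diag

variable {X Y Z : Diag I C}

/-- The structural 2-cell of a morphism of diagrams. -/
def nat (τ : X ⟶ Y) {j k : I} (h : k ≤ j) : X.mp h ≫ τ.app (pt k) ≅ τ.app (pt j) ≫ Y.mp h :=
  τ.naturality (down h)

theorem nat_id (τ : X ⟶ Y) (j : I) :
    (nat τ (le_refl j)).hom ≫ τ.app (pt j) ◁ (Y.idm j).hom =
      (X.idm j).hom ▷ τ.app (pt j) ≫ (λ_ _).hom ≫ (ρ_ _).inv :=
  τ.naturality_id (pt j)

theorem nat_comp (τ : X ⟶ Y) {j k l : I} (h : k ≤ j) (h' : l ≤ k) :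
    (nat τ (h'.trans h)).hom ≫ τ.app (pt j) ◁ (Y.cmp h h').hom =
      (X.cmp h h').hom ▷ τ.app (pt l) ≫ (α_ _ _ _).hom ≫ X.mp h ◁ (nat τ h').hom ≫
        (α_ _ _ _).inv ≫ (nat τ h).hom ▷ Y.mp h' ≫ (α_ _ _ _).hom :=
  τ.naturality_comp (down h) (down h')

/-- A morphism of diagrams from its components and structural 2-cells. -/
def mkTrans (app : ∀ j, X.ob j ⟶ Y.ob j)
    (nat : ∀ {j k : I} (h : k ≤ j), X.mp h ≫ app k ≅ app j ≫ Y.mp h)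
    (nat_id : ∀ j, (nat (le_refl j)).hom ≫ app j ◁ (Y.idm j).hom =
      (X.idm j).hom ▷ app j ≫ (λ_ _).hom ≫ (ρ_ _).inv)
    (nat_comp : ∀ {j k l : I} (h : k ≤ j) (h' : l ≤ k),
      (nat (h'.trans h)).hom ≫ app j ◁ (Y.cmp h h').hom =
      (X.cmp h h').hom ▷ app l ≫ (α_ _ _ _).hom ≫ X.mp h ◁ (nat h').hom ≫
        (α_ _ _ _).inv ≫ (nat h).hom ▷ Y.mp h' ≫ (α_ _ _ _).hom) : X ⟶ Y where
  app a := app a.as.unop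
  naturality s := nat (leOfHom s.as.unop)
  naturality_naturality η := by
    obtain rfl := LocallyDiscrete.eq_of_hom η
    rw [X.map₂_eq, Y.map₂_eq]
    simp
  naturality_id a := nat_id a.as.unop
  naturality_comp s t := nat_comp (leOfHom s.as.unop) (leOfHom t.as.unop)

theorem modification_nat {σ τ : X ⟶ Y} (Γ : σ ⟶ τ) {j k : I} (h : k ≤ j) :
    X.mp h ◁ Γ.as.app (pt k) ≫ (nat τ h).hom = (nat σ h).hom ≫ Γ.as.app (pt j) ▷ Y.mp h :=
  Γ.as.naturality (down h)

/-- A modification from its components. -/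
def mkMod {σ τ : X ⟶ Y} (app : ∀ j, σ.app (pt j) ⟶ τ.app (pt j))
    (h : ∀ {j k : I} (h : k ≤ j),
      X.mp h ◁ app k ≫ (nat τ h).hom = (nat σ h).hom ≫ app j ▷ Y.mp h) : σ ⟶ τ where
  as := { app := fun a => app a.as.unop
          naturality := fun s => h (leOfHom s.as.unop) }

/-- An invertible modification from its components. -/
def mkModIso {σ τ : X ⟶ Y} (app : ∀ j, σ.app (pt j) ≅ τ.app (pt j))
    (h : ∀ {j k : I} (h : k ≤ j),
      X.mp h ◁ (app k).hom ≫ (nat τ h).hom = (nat σ h).hom ≫ (app j).hom ▷ Y.mp h) : σ ≅ τ :=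
  Pseudofunctor.StrongTrans.isoMk (fun a => app a.as.unop) fun s => h (leOfHom s.as.unop)

/-- The component of an invertible modification. -/
def isoApp {σ τ : X ⟶ Y} (Γ : σ ≅ τ) (j : I) : σ.app (pt j) ≅ τ.app (pt j) where
  hom := Γ.hom.as.app (pt j)
  inv := Γ.inv.as.app (pt j)
  hom_inv_id := congrArg (fun m : σ ⟶ σ => m.as.app (pt j)) Γ.hom_inv_id
  inv_hom_id := congrArg (fun m : τ ⟶ τ => m.as.app (pt j)) Γ.inv_hom_id

theorem mod_ext {σ τ : X ⟶ Y} {Γ Θ : σ ⟶ τ} (h : ∀ j, Γ.as.app (pt j) = Θ.as.app (pt j)) :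
    Γ = Θ := by
  ext a
  exact h a.as.unop

theorem nat_comp_hom (σ : X ⟶ Y) (τ : Y ⟶ Z) {j k : I} (h : k ≤ j) :
    (nat (σ ≫ τ) h).hom = (α_ _ _ _).inv ≫ (nat σ h).hom ▷ τ.app (pt k) ≫ (α_ _ _ _).hom ≫
      σ.app (pt j) ◁ (nat τ h).hom ≫ (α_ _ _ _).inv :=
  Pseudofunctor.StrongTrans.categoryStruct_comp_naturality_hom σ τ (down h)

theorem nat_id_hom (X : Diag I C) {j k : I} (h : k ≤ j) :
    (nat (𝟙 X) h).hom = (ρ_ _).hom ≫ (λ_ _).inv :=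
  Pseudofunctor.StrongTrans.categoryStruct_id_naturality_hom (F := X) (down h)

end Raw

/-! ### Pasting identities for transported structure -/

section Pasting
variable {C : Type u} [Bicategory.{w, v} C]

/-- Associativity of the structural 2-cells `c` of a family `L`, after whiskering with the 1-cell
`em`, when these 2-cells are transported from those of a diagram `G` along comparison 1-cells
`L ⟶ G`. A jointly faithful family of such comparisons then gives associativity itself. -/
theorem transport_assoc {Lj Lk Ll Lm Gj Gk Gl Gm : C} {jk : Lj ⟶ Lk} {kl : Lk ⟶ Ll} {lm : Ll ⟶ Lm}
  {jl : Lj ⟶ Ll} {km : Lk ⟶ Lm} {jm : Lj ⟶ Lm}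
  {gjk : Gj ⟶ Gk} {gkl : Gk ⟶ Gl} {glm : Gl ⟶ Gm}
  {gjl : Gj ⟶ Gl} {gkm : Gk ⟶ Gm} {gjm : Gj ⟶ Gm}
  {ej : Lj ⟶ Gj} {ek : Lk ⟶ Gk} {el : Ll ⟶ Gl} {em : Lm ⟶ Gm}
  {tjk : jk ≫ ek ≅ ej ≫ gjk} {tkl : kl ≫ el ≅ ek ≫ gkl} {tlm : lm ≫ em ≅ el ≫ glm}
  {tjl : jl ≫ el ≅ ej ≫ gjl} {tkm : km ≫ em ≅ ek ≫ gkm} {tjm : jm ≫ em ≅ ej ≫ gjm}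
  {cjkl : jl ⟶ jk ≫ kl} {cklm : km ⟶ kl ≫ lm} {cjlm : jm ⟶ jl ≫ lm} {cjkm : jm ⟶ jk ≫ km}
  {djkl : gjl ⟶ gjk ≫ gkl} {dklm : gkm ⟶ gkl ≫ glm} {djlm : gjm ⟶ gjl ≫ glm}
  {djkm : gjm ⟶ gjk ≫ gkm}
  (hjkl : tjl.hom ≫ ej ◁ djkl = cjkl ▷ el ≫ (α_ _ _ _).hom ≫ jk ◁ tkl.hom ≫
        (α_ _ _ _).inv ≫ tjk.hom ▷ gkl ≫ (α_ _ _ _).hom)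
  (hklm : tkm.hom ≫ ek ◁ dklm = cklm ▷ em ≫ (α_ _ _ _).hom ≫ kl ◁ tlm.hom ≫
        (α_ _ _ _).inv ≫ tkl.hom ▷ glm ≫ (α_ _ _ _).hom)
  (hjkm : tjm.hom ≫ ej ◁ djkm = cjkm ▷ em ≫ (α_ _ _ _).hom ≫ jk ◁ tkm.hom ≫
        (α_ _ _ _).inv ≫ tjk.hom ▷ gkm ≫ (α_ _ _ _).hom)
  (hjlm : tjm.hom ≫ ej ◁ djlm = cjlm ▷ em ≫ (α_ _ _ _).hom ≫ jl ◁ tlm.hom ≫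
        (α_ _ _ _).inv ≫ tjl.hom ▷ glm ≫ (α_ _ _ _).hom)
  (hd : djkm ≫ gjk ◁ dklm = djlm ≫ djkl ▷ glm ≫ (α_ _ _ _).hom) :
  (cjkm ≫ jk ◁ cklm) ▷ em = (cjlm ≫ cjkl ▷ lm ≫ (α_ _ _ _).hom) ▷ em := by
  obtain ⟨Θ, hΘ⟩ : ∃ Θ : (jk ≫ kl ≫ lm) ≫ em ≅ ej ≫ gjk ≫ gkl ≫ glm, Θ.hom = (α_ _ _ _).hom ≫
      jk ◁ ((α_ _ _ _).hom ≫ kl ◁ tlm.hom ≫ (α_ _ _ _).inv ≫ tkl.hom ▷ glm ≫ (α_ _ _ _).hom) ≫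
        (α_ _ _ _).inv ≫ tjk.hom ▷ _ ≫ (α_ _ _ _).hom :=
    ⟨α_ _ _ _ ≪≫ whiskerLeftIso jk (α_ _ _ _ ≪≫ whiskerLeftIso kl tlm ≪≫ (α_ _ _ _).symm ≪≫
      whiskerRightIso tkl glm ≪≫ α_ _ _ _) ≪≫ (α_ _ _ _).symm ≪≫
        whiskerRightIso tjk _ ≪≫ α_ _ _ _, rfl⟩
  rw [← cancel_mono Θ.hom]
  trans tjm.hom ≫ ej ◁ (djkm ≫ gjk ◁ dklm)
  · have e1 : tjm.hom ≫ ej ◁ (djkm ≫ gjk ◁ dklm) =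
        (tjm.hom ≫ ej ◁ djkm) ≫ ej ◁ gjk ◁ dklm := by simp
    rw [e1, hjkm]
    calc _ = cjkm ▷ em ⊗≫ jk ◁ (tkm.hom ≫ ek ◁ dklm) ⊗≫ tjk.hom ▷ (gkl ≫ glm) ⊗≫ 𝟙 _ := by
          rw [hklm]; rw [hΘ]; bicategory
      _ = cjkm ▷ em ⊗≫ jk ◁ tkm.hom ⊗≫ ((jk ≫ ek) ◁ dklm ≫ tjk.hom ▷ (gkl ≫ glm)) ⊗≫ 𝟙 _ := by
        bicategory
      _ = _ := by
        rw [whisker_exchange]; bicategory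
  · rw [hd]
    have e1 : tjm.hom ≫ ej ◁ (djlm ≫ djkl ▷ glm ≫ (α_ gjk gkl glm).hom) =
        (tjm.hom ≫ ej ◁ djlm) ≫ ej ◁ (djkl ▷ glm ≫ (α_ gjk gkl glm).hom) := by simp
    rw [e1, hjlm]
    calc _ = cjlm ▷ em ⊗≫ jl ◁ tlm.hom ⊗≫ (tjl.hom ≫ ej ◁ djkl) ▷ glm ⊗≫ 𝟙 _ := by
          bicategory
      _ = cjlm ▷ em ⊗≫ (jl ◁ tlm.hom ≫ cjkl ▷ (el ≫ glm)) ⊗≫ jk ◁ tkl.hom ▷ glm ⊗≫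
            tjk.hom ▷ gkl ▷ glm ⊗≫ 𝟙 _ := by
        rw [hjkl]; bicategory
      _ = _ := by
        rw [whisker_exchange]; rw [hΘ]; bicategory

/-- The left unit law for transported structural 2-cells. -/
theorem transport_id_left {Lj Lk Gj Gk : C} {jk : Lj ⟶ Lk} {jj : Lj ⟶ Lj} {gjk : Gj ⟶ Gk}
    {gjj : Gj ⟶ Gj} {ej : Lj ⟶ Gj} {ek : Lk ⟶ Gk} {tjk : jk ≫ ek ≅ ej ≫ gjk}
    {tjj : jj ≫ ej ≅ ej ≫ gjj} {c : jk ⟶ jj ≫ jk} {d : gjk ⟶ gjj ≫ gjk} {l : jj ⟶ 𝟙 Lj}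
    {g : gjj ⟶ 𝟙 Gj}
    (hc : tjk.hom ≫ ej ◁ d = c ▷ ek ≫ (α_ _ _ _).hom ≫ jj ◁ tjk.hom ≫
        (α_ _ _ _).inv ≫ tjj.hom ▷ gjk ≫ (α_ _ _ _).hom)
    (hi : tjj.hom ≫ ej ◁ g = l ▷ ej ≫ (λ_ _).hom ≫ (ρ_ _).inv)
    (hd : d ≫ g ▷ gjk = (λ_ _).inv) :
    (c ≫ l ▷ jk) ▷ ek = (λ_ jk).inv ▷ ek := by
  obtain ⟨Θ, hΘ⟩ : ∃ Θ : (𝟙 Lj ≫ jk) ≫ ek ≅ ej ≫ gjk, Θ.hom = (λ_ jk).hom ▷ ek ≫ tjk.hom :=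
    ⟨whiskerRightIso (λ_ jk) ek ≪≫ tjk, rfl⟩
  rw [← cancel_mono Θ.hom, hΘ]
  calc _ = c ▷ ek ⊗≫ (l ▷ (jk ≫ ek) ≫ 𝟙 Lj ◁ tjk.hom) ⊗≫ 𝟙 _ := by bicategory
    _ = c ▷ ek ⊗≫ jj ◁ tjk.hom ⊗≫ (l ▷ ej ≫ (λ_ _).hom ≫ (ρ_ _).inv) ▷ gjk ⊗≫ 𝟙 _ := by
      rw [← whisker_exchange]; bicategory
    _ = (c ▷ ek ≫ (α_ _ _ _).hom ≫ jj ◁ tjk.hom ≫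
        (α_ _ _ _).inv ≫ tjj.hom ▷ gjk ≫ (α_ _ _ _).hom) ⊗≫ ej ◁ g ▷ gjk ⊗≫ 𝟙 _ := by
      rw [← hi]; bicategory
    _ = tjk.hom ≫ ej ◁ (d ≫ g ▷ gjk) ⊗≫ 𝟙 _ := by rw [← hc]; bicategory
    _ = _ := by rw [hd]; bicategory

/-- The right unit law for transported structural 2-cells. -/
theorem transport_id_right {Lj Lk Gj Gk : C} {jk : Lj ⟶ Lk} {kk : Lk ⟶ Lk} {gjk : Gj ⟶ Gk}
    {gkk : Gk ⟶ Gk} {ej : Lj ⟶ Gj} {ek : Lk ⟶ Gk} {tjk : jk ≫ ek ≅ ej ≫ gjk}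
    {tkk : kk ≫ ek ≅ ek ≫ gkk} {c : jk ⟶ jk ≫ kk} {d : gjk ⟶ gjk ≫ gkk} {l : kk ⟶ 𝟙 Lk}
    {g : gkk ⟶ 𝟙 Gk}
    (hc : tjk.hom ≫ ej ◁ d = c ▷ ek ≫ (α_ _ _ _).hom ≫ jk ◁ tkk.hom ≫
        (α_ _ _ _).inv ≫ tjk.hom ▷ gkk ≫ (α_ _ _ _).hom)
    (hi : tkk.hom ≫ ek ◁ g = l ▷ ek ≫ (λ_ _).hom ≫ (ρ_ _).inv)
    (hd : d ≫ gjk ◁ g = (ρ_ _).inv) :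
    (c ≫ jk ◁ l) ▷ ek = (ρ_ jk).inv ▷ ek := by
  obtain ⟨Θ, hΘ⟩ : ∃ Θ : (jk ≫ 𝟙 Lk) ≫ ek ≅ ej ≫ gjk, Θ.hom = (ρ_ jk).hom ▷ ek ≫ tjk.hom :=
    ⟨whiskerRightIso (ρ_ jk) ek ≪≫ tjk, rfl⟩
  rw [← cancel_mono Θ.hom, hΘ]
  calc _ = c ▷ ek ⊗≫ jk ◁ (l ▷ ek ≫ (λ_ _).hom ≫ (ρ_ _).inv) ⊗≫ tjk.hom ▷ 𝟙 _ ⊗≫ 𝟙 _ := by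
          bicategory
    _ = c ▷ ek ⊗≫ jk ◁ tkk.hom ⊗≫ ((jk ≫ ek) ◁ g ≫ tjk.hom ▷ 𝟙 _) ⊗≫ 𝟙 _ := by
      rw [← hi]; bicategory
    _ = (c ▷ ek ≫ (α_ _ _ _).hom ≫ jk ◁ tkk.hom ≫
        (α_ _ _ _).inv ≫ tjk.hom ▷ gkk ≫ (α_ _ _ _).hom) ≫ ej ◁ gjk ◁ g ⊗≫ 𝟙 _ := by
      rw [whisker_exchange]; bicategory
    _ = tjk.hom ≫ ej ◁ (d ≫ gjk ◁ g) ⊗≫ 𝟙 _ := by rw [← hc]; bicategory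
    _ = _ := by rw [hd]; bicategory

/-- The unit law for the naturality 2-cells `n` of a 1-cell into a diagram with transported

structure, when these are determined by the naturality 2-cells of its composite with the
comparison. -/
theorem transport_nat_id {Xj Lj Gj : C} {jj : Lj ⟶ Lj} {gjj : Gj ⟶ Gj} {xjj : Xj ⟶ Xj}
    {ej : Lj ⟶ Gj} {fj : Xj ⟶ Lj} {dj : Xj ⟶ Gj}
    {tjj : jj ≫ ej ≅ ej ≫ gjj} {l : jj ⟶ 𝟙 Lj} {g : gjj ⟶ 𝟙 Gj} {x : xjj ⟶ 𝟙 Xj}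
    {ξ : fj ≫ ej ≅ dj} {nd : xjj ≫ dj ⟶ dj ≫ gjj} {n : xjj ≫ fj ⟶ fj ≫ jj}
    (hi : tjj.hom ≫ ej ◁ g = l ▷ ej ≫ (λ_ _).hom ≫ (ρ_ _).inv)
    (hd : nd ≫ dj ◁ g = x ▷ dj ≫ (λ_ _).hom ≫ (ρ_ _).inv)
    (hn : xjj ◁ ξ.hom ≫ nd = ((α_ _ _ _).inv ≫ n ▷ ej ≫ (α_ _ _ _).hom ≫ fj ◁ tjj.hom ≫
        (α_ _ _ _).inv) ≫ ξ.hom ▷ gjj) :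
    (n ≫ fj ◁ l) ▷ ej = (x ▷ fj ≫ (λ_ _).hom ≫ (ρ_ _).inv) ▷ ej := by
  obtain ⟨Θ, hΘ⟩ : ∃ Θ : (fj ≫ 𝟙 Lj) ≫ ej ≅ dj, Θ.hom = (ρ_ fj).hom ▷ ej ≫ ξ.hom :=
    ⟨whiskerRightIso (ρ_ fj) ej ≪≫ ξ, rfl⟩
  rw [← cancel_mono Θ.hom, hΘ]
  calc _ = n ▷ ej ⊗≫ fj ◁ (l ▷ ej ≫ (λ_ _).hom ≫ (ρ_ _).inv) ⊗≫ ξ.hom ▷ 𝟙 _ ⊗≫ 𝟙 _ := by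
          bicategory
    _ = n ▷ ej ⊗≫ fj ◁ tjj.hom ⊗≫ ((fj ≫ ej) ◁ g ≫ ξ.hom ▷ 𝟙 _) ⊗≫ 𝟙 _ := by
      rw [← hi]; bicategory
    _ = 𝟙 _ ⊗≫ (((α_ _ _ _).inv ≫ n ▷ ej ≫ (α_ _ _ _).hom ≫ fj ◁ tjj.hom ≫
        (α_ _ _ _).inv) ≫ ξ.hom ▷ gjj) ≫ dj ◁ g ⊗≫ 𝟙 _ := by
      rw [whisker_exchange]; bicategory
    _ = 𝟙 _ ⊗≫ xjj ◁ ξ.hom ≫ (nd ≫ dj ◁ g) ⊗≫ 𝟙 _ := by rw [← hn]; bicategory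
    _ = 𝟙 _ ⊗≫ (xjj ◁ ξ.hom ≫ x ▷ dj) ⊗≫ 𝟙 _ := by rw [hd]; bicategory
    _ = _ := by rw [whisker_exchange]; bicategory

/-- The composition law for naturality 2-cells of a 1-cell into a diagram with transported

structure. -/
theorem transport_nat_comp {Xj Xk Xl Lj Lk Ll Gj Gk Gl : C}
    {jk : Lj ⟶ Lk} {kl : Lk ⟶ Ll} {jl : Lj ⟶ Ll} {gjk : Gj ⟶ Gk} {gkl : Gk ⟶ Gl} {gjl : Gj ⟶ Gl}
    {xjk : Xj ⟶ Xk} {xkl : Xk ⟶ Xl} {xjl : Xj ⟶ Xl}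
    {ej : Lj ⟶ Gj} {ek : Lk ⟶ Gk} {el : Ll ⟶ Gl} {fj : Xj ⟶ Lj} {fk : Xk ⟶ Lk} {fl : Xl ⟶ Ll}
    {dj : Xj ⟶ Gj} {dk : Xk ⟶ Gk} {dl : Xl ⟶ Gl}
    {tjk : jk ≫ ek ≅ ej ≫ gjk} {tkl : kl ≫ el ≅ ek ≫ gkl} {tjl : jl ≫ el ≅ ej ≫ gjl}
    {cL : jl ⟶ jk ≫ kl} {cG : gjl ⟶ gjk ≫ gkl} {cX : xjl ⟶ xjk ≫ xkl}
    {ξj : fj ≫ ej ≅ dj} {ξk : fk ≫ ek ≅ dk} {ξl : fl ≫ el ≅ dl}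
    {djk : xjk ≫ dk ⟶ dj ≫ gjk} {dkl : xkl ≫ dl ⟶ dk ≫ gkl} {djl : xjl ≫ dl ⟶ dj ≫ gjl}
    {njk : xjk ≫ fk ⟶ fj ≫ jk} {nkl : xkl ≫ fl ⟶ fk ≫ kl} {njl : xjl ≫ fl ⟶ fj ≫ jl}
    (hL : tjl.hom ≫ ej ◁ cG = cL ▷ el ≫ (α_ _ _ _).hom ≫ jk ◁ tkl.hom ≫
        (α_ _ _ _).inv ≫ tjk.hom ▷ gkl ≫ (α_ _ _ _).hom)
    (hd : djl ≫ dj ◁ cG = cX ▷ dl ≫ (α_ _ _ _).hom ≫ xjk ◁ dkl ≫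
        (α_ _ _ _).inv ≫ djk ▷ gkl ≫ (α_ _ _ _).hom)
    (hjk : xjk ◁ ξk.hom ≫ djk = ((α_ _ _ _).inv ≫ njk ▷ ek ≫ (α_ _ _ _).hom ≫ fj ◁ tjk.hom ≫
        (α_ _ _ _).inv) ≫ ξj.hom ▷ gjk)
    (hkl : xkl ◁ ξl.hom ≫ dkl = ((α_ _ _ _).inv ≫ nkl ▷ el ≫ (α_ _ _ _).hom ≫ fk ◁ tkl.hom ≫
        (α_ _ _ _).inv) ≫ ξk.hom ▷ gkl)
    (hjl : xjl ◁ ξl.hom ≫ djl = ((α_ _ _ _).inv ≫ njl ▷ el ≫ (α_ _ _ _).hom ≫ fj ◁ tjl.hom ≫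
        (α_ _ _ _).inv) ≫ ξj.hom ▷ gjl) :
    (njl ≫ fj ◁ cL) ▷ el = (cX ▷ fl ≫ (α_ _ _ _).hom ≫ xjk ◁ nkl ≫
        (α_ _ _ _).inv ≫ njk ▷ kl ≫ (α_ _ _ _).hom) ▷ el := by
  obtain ⟨Θ, hΘ⟩ : ∃ Θ : (fj ≫ jk ≫ kl) ≫ el ≅ dj ≫ gjk ≫ gkl, Θ.hom = (α_ _ _ _).hom ≫
      fj ◁ ((α_ _ _ _).hom ≫ jk ◁ tkl.hom ≫ (α_ _ _ _).inv ≫ tjk.hom ▷ gkl ≫ (α_ _ _ _).hom) ≫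
      (α_ _ _ _).inv ≫ ξj.hom ▷ _ :=
    ⟨α_ _ _ _ ≪≫ whiskerLeftIso fj (α_ _ _ _ ≪≫ whiskerLeftIso jk tkl ≪≫ (α_ _ _ _).symm ≪≫
      whiskerRightIso tjk _ ≪≫ α_ _ _ _) ≪≫ (α_ _ _ _).symm ≪≫ whiskerRightIso ξj _, rfl⟩
  rw [← cancel_mono Θ.hom, hΘ]
  trans (α_ _ _ _).hom ≫ xjl ◁ ξl.hom ≫ (djl ≫ dj ◁ cG)
  · symm
    calc _ = 𝟙 _ ⊗≫ (xjl ◁ ξl.hom ≫ djl) ≫ dj ◁ cG := by bicategory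
      _ = njl ▷ el ⊗≫ fj ◁ tjl.hom ⊗≫ (ξj.hom ▷ gjl ≫ dj ◁ cG) := by rw [hjl]; bicategory
      _ = njl ▷ el ⊗≫ fj ◁ (tjl.hom ≫ ej ◁ cG) ⊗≫ ξj.hom ▷ (gjk ≫ gkl) := by
        rw [← whisker_exchange]; bicategory
      _ = _ := by rw [hL]; bicategory
  · rw [hd]
    calc _ = 𝟙 _ ⊗≫ (xjl ◁ ξl.hom ≫ cX ▷ dl) ⊗≫ xjk ◁ dkl ⊗≫ djk ▷ gkl ⊗≫ 𝟙 _ := by bicategory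
      _ = cX ▷ fl ▷ el ⊗≫ xjk ◁ (xkl ◁ ξl.hom ≫ dkl) ⊗≫ djk ▷ gkl ⊗≫ 𝟙 _ := by
        rw [whisker_exchange]; bicategory
      _ = cX ▷ fl ▷ el ⊗≫ xjk ◁ nkl ▷ el ⊗≫ xjk ◁ fk ◁ tkl.hom ⊗≫
            (xjk ◁ ξk.hom ≫ djk) ▷ gkl ⊗≫ 𝟙 _ := by
        rw [hkl]; bicategory
      _ = cX ▷ fl ▷ el ⊗≫ xjk ◁ nkl ▷ el ⊗≫ ((xjk ≫ fk) ◁ tkl.hom ≫ njk ▷ (ek ≫ gkl)) ⊗≫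
            fj ◁ tjk.hom ▷ gkl ⊗≫ ξj.hom ▷ gjk ▷ gkl ⊗≫ 𝟙 _ := by
        rw [hjk]; bicategory
      _ = _ := by rw [whisker_exchange]; bicategory

/-- Naturality of a family of 2-cells between 1-cells into a diagram with transported structure. -/
theorem transport_mod {Xj Xk Lj Lk Gj Gk : C}
    {jk : Lj ⟶ Lk} {gjk : Gj ⟶ Gk} {xjk : Xj ⟶ Xk}
    {ej : Lj ⟶ Gj} {ek : Lk ⟶ Gk} {fj gj : Xj ⟶ Lj} {fk gk : Xk ⟶ Lk}
    {tjk : jk ≫ ek ≅ ej ≫ gjk} {μj : fj ⟶ gj} {μk : fk ⟶ gk}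
    {nf : xjk ≫ fk ⟶ fj ≫ jk} {ng : xjk ≫ gk ⟶ gj ≫ jk}
    (h : xjk ◁ (μk ▷ ek) ≫ (α_ _ _ _).inv ≫ ng ▷ ek ≫ (α_ _ _ _).hom ≫ gj ◁ tjk.hom ≫
        (α_ _ _ _).inv = ((α_ _ _ _).inv ≫ nf ▷ ek ≫ (α_ _ _ _).hom ≫ fj ◁ tjk.hom ≫
        (α_ _ _ _).inv) ≫ (μj ▷ ej) ▷ gjk) :
    (xjk ◁ μk ≫ ng) ▷ ek = (nf ≫ μj ▷ jk) ▷ ek := by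
  obtain ⟨Θ, hΘ⟩ : ∃ Θ : (gj ≫ jk) ≫ ek ≅ (gj ≫ ej) ≫ gjk, Θ.hom = (α_ _ _ _).hom ≫
      gj ◁ tjk.hom ≫ (α_ _ _ _).inv :=
    ⟨α_ _ _ _ ≪≫ whiskerLeftIso gj tjk ≪≫ (α_ _ _ _).symm, rfl⟩
  rw [← cancel_mono Θ.hom, hΘ]
  calc _ = 𝟙 _ ⊗≫ (xjk ◁ (μk ▷ ek) ≫ (α_ _ _ _).inv ≫ ng ▷ ek ≫ (α_ _ _ _).hom ≫ gj ◁ tjk.hom ≫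
        (α_ _ _ _).inv) ⊗≫ 𝟙 _ := by bicategory
    _ = nf ▷ ek ⊗≫ (fj ◁ tjk.hom ≫ μj ▷ (ej ≫ gjk)) ⊗≫ 𝟙 _ := by rw [h]; bicategory
    _ = _ := by rw [whisker_exchange]; bicategory

end Pasting

/-! ### Pasting identities for cotransported structure -/

section Pasting
variable {C : Type u} [Bicategory.{w, v} C]

/-- The dual of `transport_assoc`, for comparison 1-cells out of a diagram `G`. -/
theorem cotransport_assoc {Lj Lk Ll Lm Gj Gk Gl Gm : C} {jk : Lj ⟶ Lk} {kl : Lk ⟶ Ll}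
    {lm : Ll ⟶ Lm} {jl : Lj ⟶ Ll} {km : Lk ⟶ Lm} {jm : Lj ⟶ Lm}
    {gjk : Gj ⟶ Gk} {gkl : Gk ⟶ Gl} {glm : Gl ⟶ Gm}
    {gjl : Gj ⟶ Gl} {gkm : Gk ⟶ Gm} {gjm : Gj ⟶ Gm}
    {ej : Gj ⟶ Lj} {ek : Gk ⟶ Lk} {el : Gl ⟶ Ll} {em : Gm ⟶ Lm}
    {tjk : gjk ≫ ek ≅ ej ≫ jk} {tkl : gkl ≫ el ≅ ek ≫ kl} {tlm : glm ≫ em ≅ el ≫ lm}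
    {tjl : gjl ≫ el ≅ ej ≫ jl} {tkm : gkm ≫ em ≅ ek ≫ km} {tjm : gjm ≫ em ≅ ej ≫ jm}
    {cjkl : jl ⟶ jk ≫ kl} {cklm : km ⟶ kl ≫ lm} {cjlm : jm ⟶ jl ≫ lm} {cjkm : jm ⟶ jk ≫ km}
    {djkl : gjl ⟶ gjk ≫ gkl} {dklm : gkm ⟶ gkl ≫ glm} {djlm : gjm ⟶ gjl ≫ glm}
    {djkm : gjm ⟶ gjk ≫ gkm}
    (hjkl : tjl.hom ≫ ej ◁ cjkl = djkl ▷ el ≫ (α_ _ _ _).hom ≫ gjk ◁ tkl.hom ≫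
        (α_ _ _ _).inv ≫ tjk.hom ▷ kl ≫ (α_ _ _ _).hom)
    (hklm : tkm.hom ≫ ek ◁ cklm = dklm ▷ em ≫ (α_ _ _ _).hom ≫ gkl ◁ tlm.hom ≫
        (α_ _ _ _).inv ≫ tkl.hom ▷ lm ≫ (α_ _ _ _).hom)
    (hjkm : tjm.hom ≫ ej ◁ cjkm = djkm ▷ em ≫ (α_ _ _ _).hom ≫ gjk ◁ tkm.hom ≫
        (α_ _ _ _).inv ≫ tjk.hom ▷ km ≫ (α_ _ _ _).hom)
    (hjlm : tjm.hom ≫ ej ◁ cjlm = djlm ▷ em ≫ (α_ _ _ _).hom ≫ gjl ◁ tlm.hom ≫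
        (α_ _ _ _).inv ≫ tjl.hom ▷ lm ≫ (α_ _ _ _).hom)
    (hd : djkm ≫ gjk ◁ dklm = djlm ≫ djkl ▷ glm ≫ (α_ _ _ _).hom) :
    ej ◁ (cjkm ≫ jk ◁ cklm) = ej ◁ (cjlm ≫ cjkl ▷ lm ≫ (α_ _ _ _).hom) := by
  rw [← cancel_epi tjm.hom]
  calc _ = (tjm.hom ≫ ej ◁ cjkm) ⊗≫ ej ◁ jk ◁ cklm ⊗≫ 𝟙 _ := by bicategory
    _ = djkm ▷ em ⊗≫ gjk ◁ tkm.hom ⊗≫ (tjk.hom ▷ km ≫ (ej ≫ jk) ◁ cklm) ⊗≫ 𝟙 _ := by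
      rw [hjkm]; bicategory
    _ = djkm ▷ em ⊗≫ gjk ◁ (tkm.hom ≫ ek ◁ cklm) ⊗≫ tjk.hom ▷ (kl ≫ lm) ⊗≫ 𝟙 _ := by
      rw [← whisker_exchange]; bicategory
    _ = (djkm ≫ gjk ◁ dklm) ▷ em ⊗≫ gjk ◁ gkl ◁ tlm.hom ⊗≫ gjk ◁ tkl.hom ▷ lm ⊗≫
          tjk.hom ▷ kl ▷ lm ⊗≫ 𝟙 _ := by
      rw [hklm]; bicategory
    _ = djlm ▷ em ⊗≫ (djkl ▷ (glm ≫ em) ≫ (gjk ≫ gkl) ◁ tlm.hom) ⊗≫ gjk ◁ tkl.hom ▷ lm ⊗≫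
          tjk.hom ▷ kl ▷ lm ⊗≫ 𝟙 _ := by
      rw [hd]; bicategory
    _ = djlm ▷ em ⊗≫ gjl ◁ tlm.hom ⊗≫ (djkl ▷ el ≫ (α_ _ _ _).hom ≫ gjk ◁ tkl.hom ≫
        (α_ _ _ _).inv ≫ tjk.hom ▷ kl ≫ (α_ _ _ _).hom) ▷ lm ⊗≫ 𝟙 _ := by
      rw [← whisker_exchange]; bicategory
    _ = (djlm ▷ em ≫ (α_ _ _ _).hom ≫ gjl ◁ tlm.hom ≫
        (α_ _ _ _).inv ≫ tjl.hom ▷ lm ≫ (α_ _ _ _).hom) ⊗≫ ej ◁ cjkl ▷ lm ⊗≫ 𝟙 _ := by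
      rw [← hjkl]; bicategory
    _ = _ := by rw [← hjlm]; bicategory

theorem cotransport_id_left {Lj Lk Gj Gk : C} {jk : Lj ⟶ Lk} {jj : Lj ⟶ Lj} {gjk : Gj ⟶ Gk}
    {gjj : Gj ⟶ Gj} {ej : Gj ⟶ Lj} {ek : Gk ⟶ Lk} {tjk : gjk ≫ ek ≅ ej ≫ jk}
    {tjj : gjj ≫ ej ≅ ej ≫ jj} {c : jk ⟶ jj ≫ jk} {d : gjk ⟶ gjj ≫ gjk} {l : jj ⟶ 𝟙 Lj}
    {g : gjj ⟶ 𝟙 Gj}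
    (hc : tjk.hom ≫ ej ◁ c = d ▷ ek ≫ (α_ _ _ _).hom ≫ gjj ◁ tjk.hom ≫
        (α_ _ _ _).inv ≫ tjj.hom ▷ jk ≫ (α_ _ _ _).hom)
    (hi : tjj.hom ≫ ej ◁ l = g ▷ ej ≫ (λ_ _).hom ≫ (ρ_ _).inv)
    (hd : d ≫ g ▷ gjk = (λ_ _).inv) :
    ej ◁ (c ≫ l ▷ jk) = ej ◁ (λ_ jk).inv := by
  rw [← cancel_epi tjk.hom]
  calc _ = (tjk.hom ≫ ej ◁ c) ⊗≫ ej ◁ l ▷ jk ⊗≫ 𝟙 _ := by bicategory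
    _ = d ▷ ek ⊗≫ gjj ◁ tjk.hom ⊗≫ (tjj.hom ≫ ej ◁ l) ▷ jk ⊗≫ 𝟙 _ := by rw [hc]; bicategory
    _ = d ▷ ek ⊗≫ (gjj ◁ tjk.hom ≫ g ▷ (ej ≫ jk)) ⊗≫ 𝟙 _ := by rw [hi]; bicategory
    _ = (d ≫ g ▷ gjk) ▷ ek ⊗≫ tjk.hom ⊗≫ 𝟙 _ := by rw [whisker_exchange]; bicategory
    _ = _ := by rw [hd]; bicategory

theorem cotransport_id_right {Lj Lk Gj Gk : C} {jk : Lj ⟶ Lk} {kk : Lk ⟶ Lk} {gjk : Gj ⟶ Gk}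
    {gkk : Gk ⟶ Gk} {ej : Gj ⟶ Lj} {ek : Gk ⟶ Lk} {tjk : gjk ≫ ek ≅ ej ≫ jk}
    {tkk : gkk ≫ ek ≅ ek ≫ kk} {c : jk ⟶ jk ≫ kk} {d : gjk ⟶ gjk ≫ gkk} {l : kk ⟶ 𝟙 Lk}
    {g : gkk ⟶ 𝟙 Gk}
    (hc : tjk.hom ≫ ej ◁ c = d ▷ ek ≫ (α_ _ _ _).hom ≫ gjk ◁ tkk.hom ≫
        (α_ _ _ _).inv ≫ tjk.hom ▷ kk ≫ (α_ _ _ _).hom)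
    (hi : tkk.hom ≫ ek ◁ l = g ▷ ek ≫ (λ_ _).hom ≫ (ρ_ _).inv)
    (hd : d ≫ gjk ◁ g = (ρ_ _).inv) :
    ej ◁ (c ≫ jk ◁ l) = ej ◁ (ρ_ jk).inv := by
  rw [← cancel_epi tjk.hom]
  calc _ = (tjk.hom ≫ ej ◁ c) ⊗≫ ej ◁ jk ◁ l ⊗≫ 𝟙 _ := by bicategory
    _ = d ▷ ek ⊗≫ gjk ◁ tkk.hom ⊗≫ (tjk.hom ▷ kk ≫ (ej ≫ jk) ◁ l) ⊗≫ 𝟙 _ := by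
      rw [hc]; bicategory
    _ = d ▷ ek ⊗≫ gjk ◁ (tkk.hom ≫ ek ◁ l) ⊗≫ tjk.hom ▷ 𝟙 _ ⊗≫ 𝟙 _ := by
      rw [← whisker_exchange]; bicategory
    _ = (d ≫ gjk ◁ g) ▷ ek ⊗≫ tjk.hom ⊗≫ 𝟙 _ := by rw [hi]; bicategory
    _ = _ := by rw [hd]; bicategory

theorem cotransport_nat_id {Xj Lj Gj : C} {jj : Lj ⟶ Lj} {gjj : Gj ⟶ Gj} {xjj : Xj ⟶ Xj}
    {ej : Gj ⟶ Lj} {fj : Lj ⟶ Xj} {dj : Gj ⟶ Xj}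
    {tjj : gjj ≫ ej ≅ ej ≫ jj} {l : jj ⟶ 𝟙 Lj} {g : gjj ⟶ 𝟙 Gj} {x : xjj ⟶ 𝟙 Xj}
    {ξ : ej ≫ fj ≅ dj} {nd : gjj ≫ dj ⟶ dj ≫ xjj} {n : jj ≫ fj ⟶ fj ≫ xjj}
    (hi : tjj.hom ≫ ej ◁ l = g ▷ ej ≫ (λ_ _).hom ≫ (ρ_ _).inv)
    (hd : nd ≫ dj ◁ x = g ▷ dj ≫ (λ_ _).hom ≫ (ρ_ _).inv)
    (hn : gjj ◁ ξ.hom ≫ nd = ((α_ _ _ _).inv ≫ tjj.hom ▷ fj ≫ (α_ _ _ _).hom ≫ ej ◁ n ≫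
        (α_ _ _ _).inv) ≫ ξ.hom ▷ xjj) :
    ej ◁ (n ≫ fj ◁ x) = ej ◁ (l ▷ fj ≫ (λ_ _).hom ≫ (ρ_ _).inv) := by
  obtain ⟨Θ, hΘ⟩ : ∃ Θ : ej ≫ fj ≫ 𝟙 Xj ≅ dj, Θ.hom = ej ◁ (ρ_ fj).hom ≫ ξ.hom :=
    ⟨whiskerLeftIso ej (ρ_ fj) ≪≫ ξ, rfl⟩
  obtain ⟨Υ, hΥ⟩ : ∃ Υ : gjj ≫ ej ≫ fj ≅ ej ≫ jj ≫ fj, Υ.hom = (α_ _ _ _).inv ≫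
      tjj.hom ▷ fj ≫ (α_ _ _ _).hom :=
    ⟨(α_ _ _ _).symm ≪≫ whiskerRightIso tjj fj ≪≫ α_ _ _ _, rfl⟩
  rw [← cancel_mono Θ.hom, hΘ, ← cancel_epi Υ.hom, hΥ]
  calc _ = 𝟙 _ ⊗≫ tjj.hom ▷ fj ⊗≫ ej ◁ n ⊗≫ ((ej ≫ fj) ◁ x ≫ ξ.hom ▷ 𝟙 _) ⊗≫ 𝟙 _ := by
          bicategory
    _ = 𝟙 _ ⊗≫ (((α_ _ _ _).inv ≫ tjj.hom ▷ fj ≫ (α_ _ _ _).hom ≫ ej ◁ n ≫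
        (α_ _ _ _).inv) ≫ ξ.hom ▷ xjj) ≫ dj ◁ x ⊗≫ 𝟙 _ := by
      rw [whisker_exchange]; bicategory
    _ = gjj ◁ ξ.hom ≫ (nd ≫ dj ◁ x) ⊗≫ 𝟙 _ := by rw [← hn]; bicategory
    _ = (gjj ◁ ξ.hom ≫ g ▷ dj) ⊗≫ 𝟙 _ := by rw [hd]; bicategory
    _ = 𝟙 _ ⊗≫ (g ▷ ej ≫ (λ_ _).hom ≫ (ρ_ _).inv) ▷ fj ⊗≫ ξ.hom ⊗≫ 𝟙 _ := by
      rw [whisker_exchange]; bicategory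
    _ = _ := by rw [← hi]; bicategory

theorem cotransport_nat_comp {Xj Xk Xl Lj Lk Ll Gj Gk Gl : C}
    {jk : Lj ⟶ Lk} {kl : Lk ⟶ Ll} {jl : Lj ⟶ Ll} {gjk : Gj ⟶ Gk} {gkl : Gk ⟶ Gl} {gjl : Gj ⟶ Gl}
    {xjk : Xj ⟶ Xk} {xkl : Xk ⟶ Xl} {xjl : Xj ⟶ Xl}
    {ej : Gj ⟶ Lj} {ek : Gk ⟶ Lk} {el : Gl ⟶ Ll} {fj : Lj ⟶ Xj} {fk : Lk ⟶ Xk} {fl : Ll ⟶ Xl}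
    {dj : Gj ⟶ Xj} {dk : Gk ⟶ Xk} {dl : Gl ⟶ Xl}
    {tjk : gjk ≫ ek ≅ ej ≫ jk} {tkl : gkl ≫ el ≅ ek ≫ kl} {tjl : gjl ≫ el ≅ ej ≫ jl}
    {cL : jl ⟶ jk ≫ kl} {cG : gjl ⟶ gjk ≫ gkl} {cX : xjl ⟶ xjk ≫ xkl}
    {ξj : ej ≫ fj ≅ dj} {ξk : ek ≫ fk ≅ dk} {ξl : el ≫ fl ≅ dl}
    {djk : gjk ≫ dk ⟶ dj ≫ xjk} {dkl : gkl ≫ dl ⟶ dk ≫ xkl} {djl : gjl ≫ dl ⟶ dj ≫ xjl}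
    {njk : jk ≫ fk ⟶ fj ≫ xjk} {nkl : kl ≫ fl ⟶ fk ≫ xkl} {njl : jl ≫ fl ⟶ fj ≫ xjl}
    (hL : tjl.hom ≫ ej ◁ cL = cG ▷ el ≫ (α_ _ _ _).hom ≫ gjk ◁ tkl.hom ≫
        (α_ _ _ _).inv ≫ tjk.hom ▷ kl ≫ (α_ _ _ _).hom)
    (hd : djl ≫ dj ◁ cX = cG ▷ dl ≫ (α_ _ _ _).hom ≫ gjk ◁ dkl ≫
        (α_ _ _ _).inv ≫ djk ▷ xkl ≫ (α_ _ _ _).hom)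
    (hjk : gjk ◁ ξk.hom ≫ djk = ((α_ _ _ _).inv ≫ tjk.hom ▷ fk ≫ (α_ _ _ _).hom ≫ ej ◁ njk ≫
        (α_ _ _ _).inv) ≫ ξj.hom ▷ xjk)
    (hkl : gkl ◁ ξl.hom ≫ dkl = ((α_ _ _ _).inv ≫ tkl.hom ▷ fl ≫ (α_ _ _ _).hom ≫ ek ◁ nkl ≫
        (α_ _ _ _).inv) ≫ ξk.hom ▷ xkl)
    (hjl : gjl ◁ ξl.hom ≫ djl = ((α_ _ _ _).inv ≫ tjl.hom ▷ fl ≫ (α_ _ _ _).hom ≫ ej ◁ njl ≫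
        (α_ _ _ _).inv) ≫ ξj.hom ▷ xjl) :
    ej ◁ (njl ≫ fj ◁ cX) = ej ◁ (cL ▷ fl ≫ (α_ _ _ _).hom ≫ jk ◁ nkl ≫
        (α_ _ _ _).inv ≫ njk ▷ xkl ≫ (α_ _ _ _).hom) := by
  obtain ⟨Θ, hΘ⟩ : ∃ Θ : ej ≫ fj ≫ xjk ≫ xkl ≅ dj ≫ xjk ≫ xkl, Θ.hom = (α_ _ _ _).inv ≫
      ξj.hom ▷ _ := ⟨(α_ _ _ _).symm ≪≫ whiskerRightIso ξj _, rfl⟩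
  obtain ⟨Υ, hΥ⟩ : ∃ Υ : gjl ≫ el ≫ fl ≅ ej ≫ jl ≫ fl, Υ.hom = (α_ _ _ _).inv ≫
      tjl.hom ▷ fl ≫ (α_ _ _ _).hom :=
    ⟨(α_ _ _ _).symm ≪≫ whiskerRightIso tjl fl ≪≫ α_ _ _ _, rfl⟩
  rw [← cancel_mono Θ.hom, hΘ, ← cancel_epi Υ.hom, hΥ]
  trans gjl ◁ ξl.hom ≫ (djl ≫ dj ◁ cX)
  · symm
    calc _ = (gjl ◁ ξl.hom ≫ djl) ≫ dj ◁ cX := by bicategory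
      _ = 𝟙 _ ⊗≫ tjl.hom ▷ fl ⊗≫ ej ◁ njl ⊗≫ (ξj.hom ▷ xjl ≫ dj ◁ cX) := by
        rw [hjl]; bicategory
      _ = _ := by rw [← whisker_exchange]; bicategory
  · rw [hd]
    symm
    calc _ = 𝟙 _ ⊗≫ (tjl.hom ≫ ej ◁ cL) ▷ fl ⊗≫ ej ◁ jk ◁ nkl ⊗≫ ej ◁ njk ▷ xkl ⊗≫
            ξj.hom ▷ xjk ▷ xkl ⊗≫ 𝟙 _ := by bicategory
      _ = 𝟙 _ ⊗≫ cG ▷ el ▷ fl ⊗≫ gjk ◁ tkl.hom ▷ fl ⊗≫ (tjk.hom ▷ (kl ≫ fl) ≫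
            (ej ≫ jk) ◁ nkl) ⊗≫ ej ◁ njk ▷ xkl ⊗≫ ξj.hom ▷ xjk ▷ xkl ⊗≫ 𝟙 _ := by
        rw [hL]; bicategory
      _ = 𝟙 _ ⊗≫ cG ▷ el ▷ fl ⊗≫ gjk ◁ tkl.hom ▷ fl ⊗≫ gjk ◁ ek ◁ nkl ⊗≫
            (((α_ _ _ _).inv ≫ tjk.hom ▷ fk ≫ (α_ _ _ _).hom ≫ ej ◁ njk ≫
        (α_ _ _ _).inv) ≫ ξj.hom ▷ xjk) ▷ xkl ⊗≫ 𝟙 _ := by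
        rw [← whisker_exchange]; bicategory
      _ = 𝟙 _ ⊗≫ cG ▷ el ▷ fl ⊗≫ gjk ◁ (((α_ _ _ _).inv ≫ tkl.hom ▷ fl ≫ (α_ _ _ _).hom ≫
            ek ◁ nkl ≫ (α_ _ _ _).inv) ≫ ξk.hom ▷ xkl) ⊗≫ djk ▷ xkl ⊗≫ 𝟙 _ := by
        rw [← hjk]; bicategory
      _ = 𝟙 _ ⊗≫ (cG ▷ (el ≫ fl) ≫ (gjk ≫ gkl) ◁ ξl.hom) ⊗≫ gjk ◁ dkl ⊗≫ djk ▷ xkl ⊗≫ 𝟙 _ := by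
        rw [← hkl]; bicategory
      _ = _ := by rw [← whisker_exchange]; bicategory

theorem cotransport_mod {Xj Xk Lj Lk Gj Gk : C}
    {jk : Lj ⟶ Lk} {gjk : Gj ⟶ Gk} {xjk : Xj ⟶ Xk}
    {ej : Gj ⟶ Lj} {ek : Gk ⟶ Lk} {fj gj : Lj ⟶ Xj} {fk gk : Lk ⟶ Xk}
    {tjk : gjk ≫ ek ≅ ej ≫ jk} {μj : fj ⟶ gj} {μk : fk ⟶ gk}
    {nf : jk ≫ fk ⟶ fj ≫ xjk} {ng : jk ≫ gk ⟶ gj ≫ xjk}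
    (h : gjk ◁ (ek ◁ μk) ≫ (α_ _ _ _).inv ≫ tjk.hom ▷ gk ≫ (α_ _ _ _).hom ≫ ej ◁ ng ≫
        (α_ _ _ _).inv = ((α_ _ _ _).inv ≫ tjk.hom ▷ fk ≫ (α_ _ _ _).hom ≫ ej ◁ nf ≫
        (α_ _ _ _).inv) ≫ (ej ◁ μj) ▷ xjk) :
    ej ◁ (jk ◁ μk ≫ ng) = ej ◁ (nf ≫ μj ▷ xjk) := by
  obtain ⟨Υ, hΥ⟩ : ∃ Υ : gjk ≫ ek ≫ fk ≅ ej ≫ jk ≫ fk, Υ.hom = (α_ _ _ _).inv ≫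
      tjk.hom ▷ fk ≫ (α_ _ _ _).hom :=
    ⟨(α_ _ _ _).symm ≪≫ whiskerRightIso tjk fk ≪≫ α_ _ _ _, rfl⟩
  rw [← cancel_epi Υ.hom, hΥ]
  calc _ = 𝟙 _ ⊗≫ (tjk.hom ▷ fk ≫ (ej ≫ jk) ◁ μk) ⊗≫ ej ◁ ng ⊗≫ 𝟙 _ := by bicategory
    _ = (gjk ◁ (ek ◁ μk) ≫ (α_ _ _ _).inv ≫ tjk.hom ▷ gk ≫ (α_ _ _ _).hom ≫ ej ◁ ng ≫
        (α_ _ _ _).inv) ⊗≫ 𝟙 _ := by rw [← whisker_exchange]; bicategory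
    _ = _ := by rw [h]; bicategory

end Pasting

/-! ### Pointwise construction of universal families -/

section ConeTheory

variable {I : Type u₁} [PartialOrder I] {C : Type u} [Bicategory.{w, v} C]

/-- A notion of cone over a family `G` of diagrams: for each `x : C` and `k`, a type of structures
on families of 1-cells `x ⟶ (G i)_k`, a notion of morphism, and actions of the 1-cells of `C`
(by precomposition) and of the transition 1-cells (by postcomposition) for which the coherence
2-cells are morphisms. -/
structure ConeTheory {ι : Type t} (G : ι → Diag I C) where
  Str : ∀ {x : C} {k : I}, (∀ i, x ⟶ (G i).ob k) → Type r
  Mor : ∀ {x : C} {k : I} {d e : ∀ i, x ⟶ (G i).ob k}, Str d → Str e → (∀ i, d i ⟶ e i) → Prop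
  mor_comp : ∀ {x : C} {k : I} {d e f : ∀ i, x ⟶ (G i).ob k} {D : Str d} {E : Str e} {F : Str f}
    {m : ∀ i, d i ⟶ e i} {n : ∀ i, e i ⟶ f i}, Mor D E m → Mor E F n → Mor D F fun i => m i ≫ n i
  mor_inv : ∀ {x : C} {k : I} {d e : ∀ i, x ⟶ (G i).ob k} {D : Str d} {E : Str e}
    {m : ∀ i, d i ≅ e i}, Mor D E (fun i => (m i).hom) → Mor E D fun i => (m i).inv
  pull : ∀ {x y : C} (f : y ⟶ x) {k : I} {d : ∀ i, x ⟶ (G i).ob k}, Str d → Str fun i => f ≫ d i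
  push : ∀ {x : C} {j k : I} (h : k ≤ j) {d : ∀ i, x ⟶ (G i).ob j}, Str d →
    Str fun i => d i ≫ (G i).mp h
  mor_pull : ∀ {x y : C} (f : y ⟶ x) {k : I} {d e : ∀ i, x ⟶ (G i).ob k} {D : Str d} {E : Str e}
    {m : ∀ i, d i ⟶ e i}, Mor D E m → Mor (pull f D) (pull f E) fun i => f ◁ m i
  mor_push : ∀ {x : C} {j k : I} (h : k ≤ j) {d e : ∀ i, x ⟶ (G i).ob j} {D : Str d} {E : Str e}
    {m : ∀ i, d i ⟶ e i}, Mor D E m → Mor (push h D) (push h E) fun i => m i ▷ (G i).mp h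
  mor_whisker : ∀ {x y : C} {f g : y ⟶ x} (μ : f ⟶ g) {k : I} {d : ∀ i, x ⟶ (G i).ob k}
    (D : Str d), Mor (pull f D) (pull g D) fun i => μ ▷ d i
  mor_pull_pull : ∀ {x y z : C} (f : z ⟶ y) (g : y ⟶ x) {k : I} {d : ∀ i, x ⟶ (G i).ob k}
    (D : Str d), Mor (pull (f ≫ g) D) (pull f (pull g D)) fun i => (α_ f g (d i)).hom
  mor_pull_id : ∀ {x : C} {k : I} {d : ∀ i, x ⟶ (G i).ob k} (D : Str d),
    Mor (pull (𝟙 x) D) D fun i => (λ_ (d i)).hom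
  mor_pull_push : ∀ {x y : C} (f : y ⟶ x) {j k : I} (h : k ≤ j) {d : ∀ i, x ⟶ (G i).ob j}
    (D : Str d), Mor (push h (pull f D)) (pull f (push h D)) fun i => (α_ f (d i) _).hom
  mor_push_id : ∀ {x : C} {k : I} {d : ∀ i, x ⟶ (G i).ob k} (D : Str d),
    Mor (push (le_refl k) D) D fun i => d i ◁ ((G i).idm k).hom ≫ (ρ_ (d i)).hom
  mor_push_push : ∀ {x : C} {j k l : I} (h : k ≤ j) (h' : l ≤ k) {d : ∀ i, x ⟶ (G i).ob j}
    (D : Str d), Mor (push (h'.trans h) D) (push h' (push h D))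
      fun i => d i ◁ ((G i).cmp h h').hom ≫ (α_ _ _ _).inv

namespace ConeTheory

variable {ι : Type t} {G : ι → Diag I C} (T : ConeTheory.{w, v, u, u₁, t, r} G)

/-- Universality of a structured family: composition with it is an equivalence from `C(x, L)` to
the structured families with vertex `x`. -/
structure IsUniv {L : C} {k : I} {p : ∀ i, L ⟶ (G i).ob k} (S : T.Str p) : Prop where
  lift : ∀ {x : C} {d : ∀ i, x ⟶ (G i).ob k} (D : T.Str d), ∃ (f : x ⟶ L) (e : ∀ i, f ≫ p i ≅ d i),
    T.Mor (T.pull f S) D fun i => (e i).hom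
  lift₂ : ∀ {x : C} (f g : x ⟶ L) (m : ∀ i, f ≫ p i ⟶ g ≫ p i),
    T.Mor (T.pull f S) (T.pull g S) m → ∃! μ : f ⟶ g, ∀ i, μ ▷ p i = m i

variable {T}

theorem IsUniv.ext {L : C} {k : I} {p : ∀ i, L ⟶ (G i).ob k} {S : T.Str p} (hS : T.IsUniv S)
    {x : C} {f g : x ⟶ L} {μ ν : f ⟶ g} (h : ∀ i, μ ▷ p i = ν ▷ p i) : μ = ν :=
  (hS.lift₂ f g _ (T.mor_whisker ν S)).unique h fun _ => rfl

theorem IsUniv.lift₂_iso {L : C} {k : I} {p : ∀ i, L ⟶ (G i).ob k} {S : T.Str p} (hS : T.IsUniv S)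
    {x : C} {f g : x ⟶ L} (m : ∀ i, f ≫ p i ≅ g ≫ p i)
    (hm : T.Mor (T.pull f S) (T.pull g S) fun i => (m i).hom) :
    ∃ μ : f ≅ g, ∀ i, μ.hom ▷ p i = (m i).hom := by
  obtain ⟨a, ha, -⟩ := hS.lift₂ f g _ hm
  obtain ⟨b, hb, -⟩ := hS.lift₂ g f _ (T.mor_inv hm)
  exact ⟨⟨a, b, hS.ext fun i => by simp [ha, hb], hS.ext fun i => by simp [ha, hb]⟩, ha⟩

/-- Pointwise universal families assemble to a diagram with a universal family of morphisms. -/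
theorem exists_diagram (L : I → C) (p : ∀ k i, L k ⟶ (G i).ob k) (S : ∀ k, T.Str (p k))
    (hS : ∀ k, T.IsUniv (S k)) :
    ∃ (D : Diag I C) (E : ∀ i, D ⟶ G i) (S : ∀ k, T.Str fun i => (E i).app (pt k)),
      (∀ {j k : I} (h : k ≤ j),
        T.Mor (T.pull (D.mp h) (S k)) (T.push h (S j)) fun i => (nat (E i) h).hom) ∧
      (∀ (X : Diag I C) (d : ∀ i, X ⟶ G i) (Sd : ∀ k, T.Str fun i => (d i).app (pt k)),
        (∀ {j k : I} (h : k ≤ j),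
          T.Mor (T.pull (X.mp h) (Sd k)) (T.push h (Sd j)) fun i => (nat (d i) h).hom) →
        ∃ (f : X ⟶ D) (e : ∀ i, f ≫ E i ≅ d i), ∀ k,
          T.Mor (T.pull (f.app (pt k)) (S k)) (Sd k) fun i => (isoApp (e i) k).hom) ∧
      (∀ (X : Diag I C) (f g : X ⟶ D) (m : ∀ i, f ≫ E i ⟶ g ≫ E i),
        (∀ k, T.Mor (T.pull (f.app (pt k)) (S k)) (T.pull (g.app (pt k)) (S k))
          fun i => (m i).as.app (pt k)) →
        ∃! μ : f ⟶ g, ∀ i, μ ▷ E i = m i) := by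
  -- transition 1-cells `mp` with 2-cells `nt` to those of the `G i`; structural 2-cells over these
  choose mp nt hnt using fun {j k : I} (h : k ≤ j) => (hS k).lift (T.push h (S j))
  have hid : ∀ j, ∃ l : mp (le_refl j) ≅ 𝟙 (L j), ∀ i, l.hom ▷ p j i =
      ((nt (le_refl j) i).hom ≫ p j i ◁ ((G i).idm j).hom ≫ (ρ_ _).hom) ≫ (λ_ _).inv := fun j =>
    (hS j).lift₂_iso (fun i => (nt (le_refl j) i ≪≫ whiskerLeftIso _ ((G i).idm j) ≪≫ ρ_ _) ≪≫
      (λ_ _).symm) (T.mor_comp (T.mor_comp (hnt _) (T.mor_push_id _))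
        (T.mor_inv (m := fun i => λ_ (p j i)) (T.mor_pull_id _)))
  choose idm hidm using hid
  have hcmp : ∀ {j k l : I} (h : k ≤ j) (h' : l ≤ k), ∃ c : mp (h'.trans h) ≅ mp h ≫ mp h', ∀ i,
      c.hom ▷ p l i = ((((nt (h'.trans h) i).hom ≫ p j i ◁ ((G i).cmp h h').hom ≫ (α_ _ _ _).inv) ≫
        (nt h i).inv ▷ (G i).mp h') ≫ (α_ _ _ _).hom) ≫ mp h ◁ (nt h' i).inv ≫ (α_ _ _ _).inv :=
    fun {j k l} h h' => (hS l).lift₂_iso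
      (fun i => (((nt (h'.trans h) i ≪≫ whiskerLeftIso _ ((G i).cmp h h') ≪≫ (α_ _ _ _).symm) ≪≫
        whiskerRightIso (nt h i).symm ((G i).mp h')) ≪≫ (α_ _ _ _)) ≪≫
          whiskerLeftIso _ (nt h' i).symm ≪≫ (α_ _ _ _).symm)
      (T.mor_comp (T.mor_comp (T.mor_comp (T.mor_comp (hnt _) (T.mor_push_push h h' _))
        (T.mor_push _ (T.mor_inv (hnt _)))) (T.mor_pull_push _ _ _))
        (T.mor_comp (T.mor_pull _ (T.mor_inv (hnt _)))
          (T.mor_inv (m := fun i => α_ _ _ (p l i)) (T.mor_pull_pull _ _ _))))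
  choose cmp hcmp using @hcmp
  have hcmp' : ∀ {j k l : I} (h : k ≤ j) (h' : l ≤ k) (i : ι),
      (nt (h'.trans h) i).hom ≫ p j i ◁ ((G i).cmp h h').hom =
        (cmp h h').hom ▷ p l i ≫ (α_ _ _ _).hom ≫ mp h ◁ (nt h' i).hom ≫ (α_ _ _ _).inv ≫
          (nt h i).hom ▷ (G i).mp h' ≫ (α_ _ _ _).hom := fun h h' i => by
    rw [hcmp]
    simp [← whiskerLeft_comp_assoc, ← comp_whiskerRight_assoc]
  have hidm' : ∀ j i, (nt (le_refl j) i).hom ≫ p j i ◁ ((G i).idm j).hom =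
      (idm j).hom ▷ p j i ≫ (λ_ _).hom ≫ (ρ_ _).inv := fun j i => by
    rw [hidm]; simp
  let D : Diag I C := Diag.mk' L mp idm cmp
    (fun h h' h'' => (hS _).ext fun i => transport_assoc (hcmp' _ _ i) (hcmp' _ _ i) (hcmp' _ _ i)
      (hcmp' _ _ i) ((G i).cmp_assoc h h' h''))
    (fun h => (hS _).ext fun i => transport_id_left (hcmp' _ _ i) (hidm' _ i) ((G i).cmp_id_left h))
    (fun h => (hS _).ext fun i =>
      transport_id_right (hcmp' _ _ i) (hidm' _ i) ((G i).cmp_id_right h))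
  let E : ∀ i, D ⟶ G i := fun i => mkTrans (fun k => p k i) (fun h => nt h i) (fun j => hidm' j i)
    (fun h h' => hcmp' h h' i)
  refine ⟨D, E, S, fun h => hnt h, fun X d Sd hd => ?_, fun X f g m hm => ?_⟩
  · choose f ξ hξ using fun k => (hS k).lift (Sd k)
    have hn : ∀ {j k : I} (h : k ≤ j), ∃ n : X.mp h ≫ f k ≅ f j ≫ mp h, ∀ i, n.hom ▷ p k i =
        (α_ _ _ _).hom ≫ X.mp h ◁ (ξ k i).hom ≫ (nat (d i) h).hom ≫ (ξ j i).inv ▷ (G i).mp h ≫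
          (α_ _ _ _).hom ≫ f j ◁ (nt h i).inv ≫ (α_ _ _ _).inv := fun {j k} h =>
      (hS k).lift₂_iso (fun i => α_ _ _ _ ≪≫ whiskerLeftIso _ (ξ k i) ≪≫ nat (d i) h ≪≫
        whiskerRightIso (ξ j i).symm _ ≪≫ α_ _ _ _ ≪≫ whiskerLeftIso _ (nt h i).symm ≪≫
          (α_ _ _ _).symm)
        (T.mor_comp (T.mor_pull_pull _ _ _) (T.mor_comp (T.mor_pull _ (hξ k)) (T.mor_comp (hd h)
          (T.mor_comp (T.mor_push _ (T.mor_inv (hξ j))) (T.mor_comp (T.mor_pull_push _ _ _)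
            (T.mor_comp (T.mor_pull _ (T.mor_inv (hnt _)))
              (T.mor_inv (m := fun i => α_ _ _ (p k i)) (T.mor_pull_pull _ _ _))))))))
    choose n hn using @hn
    have hn' : ∀ {j k : I} (h : k ≤ j) (i : ι), X.mp h ◁ (ξ k i).hom ≫ (nat (d i) h).hom =
        ((α_ _ _ _).inv ≫ (n h).hom ▷ p k i ≫ (α_ _ _ _).hom ≫ f j ◁ (nt h i).hom ≫
        (α_ _ _ _).inv) ≫ (ξ j i).hom ▷ (G i).mp h := fun h i => by
      rw [hn]
      simp [← whiskerLeft_comp_assoc, ← comp_whiskerRight]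
    refine ⟨mkTrans (X := X) (Y := D) f n
      (fun j => (hS _).ext fun i => transport_nat_id (hidm' _ i) (nat_id (d i) j) (hn' _ i))
      (fun h h' => (hS _).ext fun i => transport_nat_comp (hcmp' _ _ i) (nat_comp (d i) h h')
        (hn' _ i) (hn' _ i) (hn' _ i)), fun i => mkModIso (fun k => ξ k i) fun h => ?_, hξ⟩
    rw [nat_comp_hom]
    exact hn' h i
  · choose μ hμ hu using fun k => (hS k).lift₂ _ _ _ (hm k)
    refine ⟨mkMod μ fun {j k} h => (hS k).ext fun i =>
        transport_mod (tjk := nt h i) (ej := p j i) ?_,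
      fun i => mod_ext fun j => hμ j i,
      fun ν hν => mod_ext fun j => hu j _ fun i => ?_⟩
    · have := modification_nat (m i) h
      rw [nat_comp_hom, nat_comp_hom] at this
      erw [hμ, hμ]
      exact this
    · rw [← hν i]
      rfl

end ConeTheory
end ConeTheory

/-! ### Pointwise construction of couniversal families -/

section CoconeTheory

variable {I : Type u₁} [PartialOrder I] {C : Type u} [Bicategory.{w, v} C]

/-- A notion of cocone under a family `G` of diagrams; the dual of `ConeTheory`. -/
structure CoconeTheory {ι : Type t} (G : ι → Diag I C) where
  Str : ∀ {x : C} {k : I}, (∀ i, (G i).ob k ⟶ x) → Type r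
  Mor : ∀ {x : C} {k : I} {d e : ∀ i, (G i).ob k ⟶ x}, Str d → Str e → (∀ i, d i ⟶ e i) → Prop
  mor_comp : ∀ {x : C} {k : I} {d e f : ∀ i, (G i).ob k ⟶ x} {D : Str d} {E : Str e} {F : Str f}
    {m : ∀ i, d i ⟶ e i} {n : ∀ i, e i ⟶ f i}, Mor D E m → Mor E F n → Mor D F fun i => m i ≫ n i
  mor_inv : ∀ {x : C} {k : I} {d e : ∀ i, (G i).ob k ⟶ x} {D : Str d} {E : Str e}
    {m : ∀ i, d i ≅ e i}, Mor D E (fun i => (m i).hom) → Mor E D fun i => (m i).inv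
  push : ∀ {x y : C} (f : x ⟶ y) {k : I} {d : ∀ i, (G i).ob k ⟶ x}, Str d → Str fun i => d i ≫ f
  pull : ∀ {x : C} {j k : I} (h : k ≤ j) {d : ∀ i, (G i).ob k ⟶ x}, Str d →
    Str fun i => (G i).mp h ≫ d i
  mor_push : ∀ {x y : C} (f : x ⟶ y) {k : I} {d e : ∀ i, (G i).ob k ⟶ x} {D : Str d} {E : Str e}
    {m : ∀ i, d i ⟶ e i}, Mor D E m → Mor (push f D) (push f E) fun i => m i ▷ f
  mor_pull : ∀ {x : C} {j k : I} (h : k ≤ j) {d e : ∀ i, (G i).ob k ⟶ x} {D : Str d} {E : Str e}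
    {m : ∀ i, d i ⟶ e i}, Mor D E m → Mor (pull h D) (pull h E) fun i => (G i).mp h ◁ m i
  mor_whisker : ∀ {x y : C} {f g : x ⟶ y} (μ : f ⟶ g) {k : I} {d : ∀ i, (G i).ob k ⟶ x}
    (D : Str d), Mor (push f D) (push g D) fun i => d i ◁ μ
  mor_push_push : ∀ {x y z : C} (f : x ⟶ y) (g : y ⟶ z) {k : I} {d : ∀ i, (G i).ob k ⟶ x}
    (D : Str d), Mor (push g (push f D)) (push (f ≫ g) D) fun i => (α_ (d i) f g).hom
  mor_push_id : ∀ {x : C} {k : I} {d : ∀ i, (G i).ob k ⟶ x} (D : Str d),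
    Mor (push (𝟙 x) D) D fun i => (ρ_ (d i)).hom
  mor_pull_push : ∀ {x y : C} (f : x ⟶ y) {j k : I} (h : k ≤ j) {d : ∀ i, (G i).ob k ⟶ x}
    (D : Str d), Mor (push f (pull h D)) (pull h (push f D)) fun i => (α_ _ (d i) f).hom
  mor_pull_id : ∀ {x : C} {k : I} {d : ∀ i, (G i).ob k ⟶ x} (D : Str d),
    Mor (pull (le_refl k) D) D fun i => ((G i).idm k).hom ▷ d i ≫ (λ_ (d i)).hom
  mor_pull_pull : ∀ {x : C} {j k l : I} (h : k ≤ j) (h' : l ≤ k) {d : ∀ i, (G i).ob l ⟶ x}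
    (D : Str d), Mor (pull (h'.trans h) D) (pull h (pull h' D))
      fun i => ((G i).cmp h h').hom ▷ d i ≫ (α_ _ _ _).hom

namespace CoconeTheory

variable {ι : Type t} {G : ι → Diag I C} (T : CoconeTheory.{w, v, u, u₁, t, r} G)

/-- Universality of a structured family: composition with it is an equivalence from `C(L, x)` to
the structured families with vertex `x`. -/
structure IsUniv {L : C} {k : I} {p : ∀ i, (G i).ob k ⟶ L} (S : T.Str p) : Prop where
  lift : ∀ {x : C} {d : ∀ i, (G i).ob k ⟶ x} (D : T.Str d), ∃ (f : L ⟶ x) (e : ∀ i, p i ≫ f ≅ d i),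
    T.Mor (T.push f S) D fun i => (e i).hom
  lift₂ : ∀ {x : C} (f g : L ⟶ x) (m : ∀ i, p i ≫ f ⟶ p i ≫ g),
    T.Mor (T.push f S) (T.push g S) m → ∃! μ : f ⟶ g, ∀ i, p i ◁ μ = m i

variable {T}

theorem IsUniv.ext {L : C} {k : I} {p : ∀ i, (G i).ob k ⟶ L} {S : T.Str p} (hS : T.IsUniv S)
    {x : C} {f g : L ⟶ x} {μ ν : f ⟶ g} (h : ∀ i, p i ◁ μ = p i ◁ ν) : μ = ν :=
  (hS.lift₂ f g _ (T.mor_whisker ν S)).unique h fun _ => rfl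

theorem IsUniv.lift₂_iso {L : C} {k : I} {p : ∀ i, (G i).ob k ⟶ L} {S : T.Str p} (hS : T.IsUniv S)
    {x : C} {f g : L ⟶ x} (m : ∀ i, p i ≫ f ≅ p i ≫ g)
    (hm : T.Mor (T.push f S) (T.push g S) fun i => (m i).hom) :
    ∃ μ : f ≅ g, ∀ i, p i ◁ μ.hom = (m i).hom := by
  obtain ⟨a, ha, -⟩ := hS.lift₂ f g _ hm
  obtain ⟨b, hb, -⟩ := hS.lift₂ g f _ (T.mor_inv hm)
  exact ⟨⟨a, b, hS.ext fun i => by simp [ha, hb], hS.ext fun i => by simp [ha, hb]⟩, ha⟩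

/-- Pointwise universal families assemble to a diagram with a universal family of morphisms. -/
theorem exists_diagram (L : I → C) (p : ∀ k i, (G i).ob k ⟶ L k) (S : ∀ k, T.Str (p k))
    (hS : ∀ k, T.IsUniv (S k)) :
    ∃ (D : Diag I C) (E : ∀ i, G i ⟶ D) (S : ∀ k, T.Str fun i => (E i).app (pt k)),
      (∀ {j k : I} (h : k ≤ j),
        T.Mor (T.pull h (S k)) (T.push (D.mp h) (S j)) fun i => (nat (E i) h).hom) ∧
      (∀ (X : Diag I C) (d : ∀ i, G i ⟶ X) (Sd : ∀ k, T.Str fun i => (d i).app (pt k)),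
        (∀ {j k : I} (h : k ≤ j),
          T.Mor (T.pull h (Sd k)) (T.push (X.mp h) (Sd j)) fun i => (nat (d i) h).hom) →
        ∃ (f : D ⟶ X) (e : ∀ i, E i ≫ f ≅ d i), ∀ k,
          T.Mor (T.push (f.app (pt k)) (S k)) (Sd k) fun i => (isoApp (e i) k).hom) ∧
      (∀ (X : Diag I C) (f g : D ⟶ X) (m : ∀ i, E i ≫ f ⟶ E i ≫ g),
        (∀ k, T.Mor (T.push (f.app (pt k)) (S k)) (T.push (g.app (pt k)) (S k))
          fun i => (m i).as.app (pt k)) →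
        ∃! μ : f ⟶ g, ∀ i, E i ◁ μ = m i) := by
  -- transition 1-cells `mp` with 2-cells `nt` from those of the `G i`, and structural 2-cells
  choose mp nt hnt using fun {j k : I} (h : k ≤ j) => (hS j).lift (T.pull h (S k))
  have hid : ∀ j, ∃ l : mp (le_refl j) ≅ 𝟙 (L j), ∀ i, p j i ◁ l.hom =
      (nt (le_refl j) i).hom ≫ (((G i).idm j).hom ▷ p j i ≫ (λ_ _).hom) ≫ (ρ_ _).inv := fun j =>
    (hS j).lift₂_iso (fun i => nt (le_refl j) i ≪≫ (whiskerRightIso ((G i).idm j) _ ≪≫ λ_ _) ≪≫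
      (ρ_ _).symm) (T.mor_comp (hnt _) (T.mor_comp (T.mor_pull_id _)
        (T.mor_inv (m := fun i => ρ_ (p j i)) (T.mor_push_id _))))
  choose idm hidm using hid
  have hcmp : ∀ {j k l : I} (h : k ≤ j) (h' : l ≤ k), ∃ c : mp (h'.trans h) ≅ mp h ≫ mp h', ∀ i,
      p j i ◁ c.hom = (nt (h'.trans h) i).hom ≫ (((G i).cmp h h').hom ▷ p l i ≫ (α_ _ _ _).hom) ≫
        (G i).mp h ◁ (nt h' i).inv ≫ (α_ _ _ _).inv ≫ (nt h i).inv ▷ mp h' ≫ (α_ _ _ _).hom :=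
    fun {j k l} h h' => (hS j).lift₂_iso
      (fun i => nt (h'.trans h) i ≪≫ (whiskerRightIso ((G i).cmp h h') _ ≪≫ α_ _ _ _) ≪≫
        whiskerLeftIso _ (nt h' i).symm ≪≫ (α_ _ _ _).symm ≪≫
          whiskerRightIso (nt h i).symm (mp h') ≪≫ α_ _ _ _)
      (T.mor_comp (hnt _) (T.mor_comp (T.mor_pull_pull h h' _) (T.mor_comp
        (T.mor_pull _ (T.mor_inv (hnt _))) (T.mor_comp
          (T.mor_inv (m := fun i => α_ _ (p k i) _) (T.mor_pull_push _ _ _))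
          (T.mor_comp (T.mor_push _ (T.mor_inv (hnt _))) (T.mor_push_push _ _ _))))))
  choose cmp hcmp using @hcmp
  have hcmp' : ∀ {j k l : I} (h : k ≤ j) (h' : l ≤ k) (i : ι),
      (nt (h'.trans h) i).inv ≫ p j i ◁ (cmp h h').hom =
        ((G i).cmp h h').hom ▷ p l i ≫ (α_ _ _ _).hom ≫ (G i).mp h ◁ (nt h' i).inv ≫
          (α_ _ _ _).inv ≫ (nt h i).inv ▷ mp h' ≫ (α_ _ _ _).hom := fun h h' i => by
    rw [hcmp]
    simp
  have hidm' : ∀ j i, (nt (le_refl j) i).inv ≫ p j i ◁ (idm j).hom =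
      ((G i).idm j).hom ▷ p j i ≫ (λ_ _).hom ≫ (ρ_ _).inv := fun j i => by
    rw [hidm]; simp
  let D : Diag I C := Diag.mk' L mp idm cmp
    (fun h h' h'' => (hS _).ext fun i => cotransport_assoc (tjk := (nt _ i).symm)
      (tkl := (nt _ i).symm) (tlm := (nt _ i).symm) (tjl := (nt _ i).symm) (tkm := (nt _ i).symm)
      (tjm := (nt _ i).symm) (hcmp' _ _ i) (hcmp' _ _ i) (hcmp' _ _ i)
      (hcmp' _ _ i) ((G i).cmp_assoc h h' h''))
    (fun h => (hS _).ext fun i => cotransport_id_left (tjk := (nt _ i).symm)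
      (tjj := (nt _ i).symm) (hcmp' _ _ i) (hidm' _ i) ((G i).cmp_id_left h))
    (fun h => (hS _).ext fun i => cotransport_id_right (tjk := (nt _ i).symm)
      (tkk := (nt _ i).symm) (hcmp' _ _ i) (hidm' _ i) ((G i).cmp_id_right h))
  let E : ∀ i, G i ⟶ D := fun i => mkTrans (Y := D) (fun k => p k i) (fun h => (nt h i).symm)
    (fun j => hidm' j i) (fun h h' => hcmp' h h' i)
  refine ⟨D, E, S, fun h => T.mor_inv (hnt h), fun X d Sd hd => ?_, fun X f g m hm => ?_⟩
  · choose f ξ hξ using fun k => (hS k).lift (Sd k)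
    have hn : ∀ {j k : I} (h : k ≤ j), ∃ n : mp h ≫ f k ≅ f j ≫ X.mp h, ∀ i, p j i ◁ n.hom =
        (α_ _ _ _).inv ≫ (nt h i).hom ▷ f k ≫ (α_ _ _ _).hom ≫ (G i).mp h ◁ (ξ k i).hom ≫
          (nat (d i) h).hom ≫ (ξ j i).inv ▷ X.mp h ≫ (α_ _ _ _).hom := fun {j k} h =>
      (hS j).lift₂_iso (fun i => (α_ _ _ _).symm ≪≫ whiskerRightIso (nt h i) (f k) ≪≫ α_ _ _ _ ≪≫
        whiskerLeftIso _ (ξ k i) ≪≫ nat (d i) h ≪≫ whiskerRightIso (ξ j i).symm _ ≪≫ α_ _ _ _)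
        (T.mor_comp (T.mor_inv (m := fun i => α_ (p j i) _ _) (T.mor_push_push _ _ _))
          (T.mor_comp (T.mor_push _ (hnt h)) (T.mor_comp (T.mor_pull_push _ _ _)
            (T.mor_comp (T.mor_pull _ (hξ k)) (T.mor_comp (hd h)
              (T.mor_comp (T.mor_push _ (T.mor_inv (hξ j))) (T.mor_push_push _ _ _)))))))
    choose n hn using @hn
    have hn' : ∀ {j k : I} (h : k ≤ j) (i : ι), (G i).mp h ◁ (ξ k i).hom ≫ (nat (d i) h).hom =
        ((α_ _ _ _).inv ≫ (nt h i).inv ▷ f k ≫ (α_ _ _ _).hom ≫ p j i ◁ (n h).hom ≫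
        (α_ _ _ _).inv) ≫ (ξ j i).hom ▷ X.mp h := fun h i => by
      rw [hn]
      simp [← comp_whiskerRight, ← comp_whiskerRight_assoc]
    refine ⟨mkTrans (X := D) (Y := X) f n
      (fun j => (hS _).ext fun i => cotransport_nat_id (tjj := (nt _ i).symm) (hidm' _ i)
        (nat_id (d i) j) (hn' _ i))
      (fun h h' => (hS _).ext fun i => cotransport_nat_comp (tjk := (nt _ i).symm)
        (tkl := (nt _ i).symm) (tjl := (nt _ i).symm) (hcmp' _ _ i) (nat_comp (d i) h h')
        (hn' _ i) (hn' _ i) (hn' _ i)), fun i => mkModIso (fun k => ξ k i) fun h => ?_, hξ⟩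
    rw [nat_comp_hom]
    exact hn' h i
  · choose μ hμ hu using fun k => (hS k).lift₂ _ _ _ (hm k)
    refine ⟨mkMod μ fun {j k} h => (hS j).ext fun i =>
      cotransport_mod (tjk := (nt h i).symm) (ek := p k i) ?_,
      fun i => mod_ext fun j => hμ j i,
      fun ν hν => mod_ext fun j => hu j _ fun i => ?_⟩
    · have := modification_nat (m i) h
      rw [nat_comp_hom, nat_comp_hom] at this
      erw [hμ, hμ]
      exact this
    · rw [← hν i]
      rfl

end CoconeTheory
end CoconeTheory

/-! ### Weighted bi-limits of diagrams -/

section EvalComp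

variable {P : Type} [Bicategory.{0, 0} P] {I : Type u₁} [PartialOrder I]
  {C : Type u} [Bicategory.{w, v} C]

theorem inv_square {D : Type u} [Category.{v} D] {x y z t : D} {a : x ⟶ y} {e : y ≅ z} {s : x ≅ t}
    {b : t ⟶ z} (h : a ≫ e.hom = s.hom ≫ b) : b ≫ e.inv = s.inv ≫ a := by
  rw [Iso.eq_inv_comp, ← Category.assoc, ← h]
  simp

theorem inv_square_id {x y : C} {m : x ⟶ y} {i : x ⟶ x} {i' : y ⟶ y} {n : m ≫ i' ≅ i ≫ m}
    {a : m ≫ i' ⟶ m ≫ 𝟙 y} {b : i ≫ m ⟶ 𝟙 x ≫ m} {e : m ≫ 𝟙 y ⟶ 𝟙 x ≫ m}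
    (h : a ≫ e = n.hom ≫ b) (he : e = (ρ_ m).hom ≫ (λ_ m).inv) :
    n.inv ≫ a = b ≫ (λ_ _).hom ≫ (ρ_ _).inv := by
  rw [Iso.inv_comp_eq, ← reassoc_of% h, he]
  simp

theorem inv_square_comp {x y z x' y' z' : C} {mx : x ⟶ x'} {my : y ⟶ y'} {mz : z ⟶ z'} {f : x ⟶ y}
    {g : y ⟶ z} {fg : x ⟶ z} {f' : x' ⟶ y'} {g' : y' ⟶ z'} {fg' : x' ⟶ z'}
    {n : mx ≫ f' ≅ f ≫ my} {n' : my ≫ g' ≅ g ≫ mz} {s : mx ≫ fg' ≅ fg ≫ mz}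
    {a : mx ≫ fg' ⟶ mx ≫ f' ≫ g'} {b : fg ≫ mz ⟶ (f ≫ g) ≫ mz}
    {e : mx ≫ f' ≫ g' ⟶ (f ≫ g) ≫ mz}
    (h : a ≫ e = s.hom ≫ b) (he : e = (α_ _ _ _).inv ≫ n.hom ▷ g' ≫ (α_ _ _ _).hom ≫
      f ◁ n'.hom ≫ (α_ _ _ _).inv) :
    s.inv ≫ a = b ≫ (α_ _ _ _).hom ≫ f ◁ n'.inv ≫ (α_ _ _ _).inv ≫ n.inv ▷ g' ≫
      (α_ _ _ _).hom := by
  rw [Iso.inv_comp_eq, ← reassoc_of% h, he]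
  simp [← comp_whiskerRight_assoc, ← whiskerLeft_comp_assoc]

theorem as_app_congr {X Y : Diag I C} {σ τ : X ⟶ Y} {Γ Θ : σ ⟶ τ} (h : Γ = Θ) (k : I) :
    Γ.as.app (pt k) = Θ.as.app (pt k) := by rw [h]

/-- The pseudofunctor `a ↦ (F a)_k`. -/
def evalComp (F : P ⥤ᵖ Diag I C) (k : I) : P ⥤ᵖ C where
  obj a := (F.obj a).ob k
  map s := (F.map s).app (pt k)
  map₂ η := (F.map₂ η).as.app (pt k)
  mapId a := isoApp (F.mapId a) k
  mapComp s t := isoApp (F.mapComp s t) k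
  map₂_id s := as_app_congr (F.map₂_id s) k
  map₂_comp η θ := as_app_congr (F.map₂_comp η θ) k
  map₂_whisker_left s _ _ η := as_app_congr (F.map₂_whisker_left s η) k
  map₂_whisker_right η s := as_app_congr (F.map₂_whisker_right η s) k
  map₂_associator s t r := as_app_congr (F.map₂_associator s t r) k
  map₂_left_unitor s := as_app_congr (F.map₂_left_unitor s) k
  map₂_right_unitor s := as_app_congr (F.map₂_right_unitor s) k

/-- The transformation `(F a)_j ⟶ (F a)_k` for `k ≤ j`. -/
def evalTrans (F : P ⥤ᵖ Diag I C) {j k : I} (h : k ≤ j) : evalComp F j ⟶ evalComp F k where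
  app a := (F.obj a).mp h
  naturality s := (nat (F.map s) h).symm
  naturality_naturality η := inv_square (modification_nat (F.map₂ η) h)
  naturality_id a := inv_square_id (modification_nat (F.mapId a).hom h) (nat_id_hom _ h)
  naturality_comp s t := inv_square_comp (modification_nat (F.mapComp s t).hom h)
    (nat_comp_hom _ _ h)

section Postcomp

/-- This and the following lemmas express that the conditions on a weighted cone pass to its
postcomposition with a transformation; here, naturality in the object of the weight. -/
theorem postcomp_map {x a b a' b' : C} {y z : x ⟶ a} {y' z' : x ⟶ b} {q : a ⟶ b} {q' : a' ⟶ b'}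
    {ta : a ⟶ a'} {tb : b ⟶ b'} {n : y' ⟶ y ≫ q} {n' : z' ⟶ z ≫ q} {m : y ⟶ z} {m' : y' ⟶ z'}
    {t : q ≫ tb ⟶ ta ≫ q'} (h : m' ≫ n' = n ≫ m ▷ q) :
    m' ▷ tb ≫ n' ▷ tb ≫ (α_ _ _ _).hom ≫ z ◁ t ≫ (α_ _ _ _).inv =
      (n ▷ tb ≫ (α_ _ _ _).hom ≫ y ◁ t ≫ (α_ _ _ _).inv) ≫ (m ▷ ta) ▷ q' := by
  calc _ = (m' ≫ n') ▷ tb ⊗≫ z ◁ t ⊗≫ 𝟙 _ := by bicategory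
    _ = n ▷ tb ⊗≫ (m ▷ (q ≫ tb) ≫ z ◁ t) ⊗≫ 𝟙 _ := by rw [h]; bicategory
    _ = _ := by rw [← whisker_exchange]; bicategory

theorem postcomp_nat {x a b a' b' : C} {y : x ⟶ a} {y₁ y₂ : x ⟶ b} {q r : a ⟶ b} {q' r' : a' ⟶ b'}
    {ta : a ⟶ a'} {tb : b ⟶ b'} {n : y₁ ⟶ y ≫ q} {n' : y₂ ⟶ y ≫ r} {m : y₁ ⟶ y₂}
    {t : q ≫ tb ⟶ ta ≫ q'} {t' : r ≫ tb ⟶ ta ≫ r'} {e : q ⟶ r} {e' : q' ⟶ r'}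
    (h : m ≫ n' = n ≫ y ◁ e) (h' : e ▷ tb ≫ t' = t ≫ ta ◁ e') :
    m ▷ tb ≫ n' ▷ tb ≫ (α_ _ _ _).hom ≫ y ◁ t' ≫ (α_ _ _ _).inv =
      (n ▷ tb ≫ (α_ _ _ _).hom ≫ y ◁ t ≫ (α_ _ _ _).inv) ≫ (y ≫ ta) ◁ e' := by
  calc _ = (m ≫ n') ▷ tb ⊗≫ y ◁ t' ⊗≫ 𝟙 _ := by bicategory
    _ = n ▷ tb ⊗≫ y ◁ (e ▷ tb ≫ t') ⊗≫ 𝟙 _ := by rw [h]; bicategory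
    _ = _ := by rw [h']; bicategory

theorem postcomp_id {x a a' : C} {y y' : x ⟶ a} {q : a ⟶ a} {q' : a' ⟶ a'}
    {ta : a ⟶ a'} {n : y' ⟶ y ≫ q} {m : y' ⟶ y} {t : q ≫ ta ⟶ ta ≫ q'} {i : q ⟶ 𝟙 a}
    {i' : q' ⟶ 𝟙 a'} (h : n ≫ y ◁ i = m ≫ (ρ_ y).inv)
    (h' : t ≫ ta ◁ i' = i ▷ ta ≫ (λ_ _).hom ≫ (ρ_ _).inv) :
    (n ▷ ta ≫ (α_ _ _ _).hom ≫ y ◁ t ≫ (α_ _ _ _).inv) ≫ (y ≫ ta) ◁ i' =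
      m ▷ ta ≫ (ρ_ _).inv := by
  calc _ = n ▷ ta ⊗≫ y ◁ (t ≫ ta ◁ i') ⊗≫ 𝟙 _ := by bicategory
    _ = (n ≫ y ◁ i) ▷ ta ⊗≫ 𝟙 _ := by rw [h']; bicategory
    _ = _ := by rw [h]; bicategory

theorem postcomp_comp {x a b c a' b' c' : C} {y : x ⟶ a} {y₁ : x ⟶ b} {y₂ y₂' : x ⟶ c} {q : a ⟶ b}
    {r : b ⟶ c} {s : a ⟶ c} {q' : a' ⟶ b'} {r' : b' ⟶ c'} {s' : a' ⟶ c'}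
    {ta : a ⟶ a'} {tb : b ⟶ b'} {tc : c ⟶ c'} {nq : y₁ ⟶ y ≫ q} {nr : y₂ ⟶ y₁ ≫ r}
    {ns : y₂' ⟶ y ≫ s} {m : y₂' ⟶ y₂} {tq : q ≫ tb ⟶ ta ≫ q'} {tr : r ≫ tc ⟶ tb ≫ r'}
    {ts : s ≫ tc ⟶ ta ≫ s'} {e : s ⟶ q ≫ r} {e' : s' ⟶ q' ≫ r'}
    (h : ns ≫ y ◁ e = m ≫ nr ≫ nq ▷ r ≫ (α_ _ _ _).hom)
    (h' : ts ≫ ta ◁ e' = e ▷ tc ≫ (α_ _ _ _).hom ≫ q ◁ tr ≫ (α_ _ _ _).inv ≫ tq ▷ r' ≫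
      (α_ _ _ _).hom) :
    (ns ▷ tc ≫ (α_ _ _ _).hom ≫ y ◁ ts ≫ (α_ _ _ _).inv) ≫ (y ≫ ta) ◁ e' =
      m ▷ tc ≫ (nr ▷ tc ≫ (α_ _ _ _).hom ≫ y₁ ◁ tr ≫ (α_ _ _ _).inv) ≫
        (nq ▷ tb ≫ (α_ _ _ _).hom ≫ y ◁ tq ≫ (α_ _ _ _).inv) ▷ r' ≫ (α_ _ _ _).hom := by
  calc _ = ns ▷ tc ⊗≫ y ◁ (ts ≫ ta ◁ e') ⊗≫ 𝟙 _ := by bicategory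
    _ = (ns ≫ y ◁ e) ▷ tc ⊗≫ y ◁ q ◁ tr ⊗≫ y ◁ tq ▷ r' ⊗≫ 𝟙 _ := by rw [h']; bicategory
    _ = m ▷ tc ⊗≫ nr ▷ tc ⊗≫ (nq ▷ (r ≫ tc) ≫ (y ≫ q) ◁ tr) ⊗≫ y ◁ tq ▷ r' ⊗≫ 𝟙 _ := by
      rw [h]; bicategory
    _ = _ := by rw [← whisker_exchange]; bicategory

theorem postcomp_vcomp {x a b a' b' a'' b'' : C} {y : x ⟶ a} {y' : x ⟶ b} {q : a ⟶ b} {q' : a' ⟶ b'}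
    {q'' : a'' ⟶ b''} {sa : a ⟶ a'} {sb : b ⟶ b'} {ta : a' ⟶ a''} {tb : b' ⟶ b''}
    {n : y' ⟶ y ≫ q} {s : q ≫ sb ⟶ sa ≫ q'} {t : q' ≫ tb ⟶ ta ≫ q''} :
    (α_ _ _ _).inv ≫ (n ▷ sb ≫ (α_ _ _ _).hom ≫ y ◁ s ≫ (α_ _ _ _).inv) ▷ tb ≫ (α_ _ _ _).hom ≫
        (y ≫ sa) ◁ t ≫ (α_ _ _ _).inv =
      (n ▷ (sb ≫ tb) ≫ (α_ _ _ _).hom ≫ y ◁ ((α_ _ _ _).inv ≫ s ▷ tb ≫ (α_ _ _ _).hom ≫ sa ◁ t ≫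
        (α_ _ _ _).inv) ≫ (α_ _ _ _).inv) ≫ (α_ _ _ _).inv ▷ q'' := by
  bicategory

theorem postcomp_one {x a b : C} {y : x ⟶ a} {y' : x ⟶ b} {q : a ⟶ b} {n : y' ⟶ y ≫ q} :
    (ρ_ _).hom ≫ n = (n ▷ 𝟙 b ≫ (α_ _ _ _).hom ≫ y ◁ ((ρ_ q).hom ≫ (λ_ q).inv) ≫
      (α_ _ _ _).inv) ≫ (ρ_ _).hom ▷ q := by
  bicategory

variable {W : P ⥤ᵖ Cat.{0, 0}} {Q Q' : P ⥤ᵖ C} {x y : C}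

/-- Postcomposition of a weighted cone with a transformation. -/
@[simps]
def WeightedCone.postcomp (c : WeightedCone W Q x) (τ : Q ⟶ Q') : WeightedCone W Q' x where
  app a := { obj := fun y => (c.app a).obj y ≫ τ.app a
             map := fun m => (c.app a).map m ▷ τ.app a }
  naturality s y := whiskerRightIso (c.naturality s y) _ ≪≫ α_ _ _ _ ≪≫
    whiskerLeftIso _ (τ.naturality s) ≪≫ (α_ _ _ _).symm
  naturality_map s y z m := postcomp_map (c.naturality_map s m)
  naturality_naturality η y := postcomp_nat (c.naturality_naturality η y)
    (τ.naturality_naturality η)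
  naturality_id a y := postcomp_id (c.naturality_id a y) (τ.naturality_id a)
  naturality_comp s t y := postcomp_comp (c.naturality_comp s t y) (τ.naturality_comp s t)

/-- A weighted cone structure on a family of 1-cells. -/
structure WStr (W : P ⥤ᵖ Cat.{0, 0}) (Q : P ⥤ᵖ C) {x : C}
    (d : ∀ i : (Σ a : P, W.obj a), x ⟶ Q.obj i.1) where
  map (a : P) (y z : W.obj a) (m : y ⟶ z) : d ⟨a, y⟩ ⟶ d ⟨a, z⟩
  map_id (a : P) (y : W.obj a) : map a y y (𝟙 y) = 𝟙 _
  map_comp {a : P} {y z t : W.obj a} (m : y ⟶ z) (n : z ⟶ t) :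
    map a y t (m ≫ n) = map a y z m ≫ map a z t n
  naturality {a b : P} (s : a ⟶ b) (y : W.obj a) :
    d ⟨b, (W.map s).toFunctor.obj y⟩ ≅ d ⟨a, y⟩ ≫ Q.map s
  naturality_map {a b : P} (s : a ⟶ b) {y z : W.obj a} (m : y ⟶ z) :
    map b ((W.map s).toFunctor.obj y) ((W.map s).toFunctor.obj z) ((W.map s).toFunctor.map m) ≫
        (naturality s z).hom =
      (naturality s y).hom ≫ map a y z m ▷ Q.map s
  naturality_naturality {a b : P} {s t : a ⟶ b} (η : s ⟶ t) (y : W.obj a) :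
    map b ((W.map s).toFunctor.obj y) ((W.map t).toFunctor.obj y) ((W.map₂ η).toNatTrans.app y) ≫
        (naturality t y).hom =
      (naturality s y).hom ≫ d ⟨a, y⟩ ◁ Q.map₂ η
  naturality_id (a : P) (y : W.obj a) :
    (naturality (𝟙 a) y).hom ≫ d ⟨a, y⟩ ◁ (Q.mapId a).hom =
      map a ((W.map (𝟙 a)).toFunctor.obj y) y ((W.mapId a).hom.toNatTrans.app y) ≫
        (ρ_ (d ⟨a, y⟩)).inv
  naturality_comp {a b c : P} (s : a ⟶ b) (t : b ⟶ c) (y : W.obj a) :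
    (naturality (s ≫ t) y).hom ≫ d ⟨a, y⟩ ◁ (Q.mapComp s t).hom =
      map c ((W.map (s ≫ t)).toFunctor.obj y)
        ((W.map t).toFunctor.obj ((W.map s).toFunctor.obj y)) ((W.mapComp s t).hom.toNatTrans.app y) ≫
        (naturality t ((W.map s).toFunctor.obj y)).hom ≫
          (naturality s y).hom ▷ Q.map t ≫ (α_ _ _ _).hom

/-- The weighted cone given by a structured family. -/
@[simps]
def WStr.toCone {d : ∀ i : (Σ a : P, W.obj a), x ⟶ Q.obj i.1} (S : WStr W Q d) :
    WeightedCone W Q x where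
  app a := { obj := fun y => d ⟨a, y⟩, map := S.map a _ _, map_id := S.map_id a,
             map_comp := S.map_comp }
  naturality := S.naturality
  naturality_map := S.naturality_map
  naturality_naturality := S.naturality_naturality
  naturality_id := S.naturality_id
  naturality_comp := S.naturality_comp

/-- The structured family underlying a weighted cone. -/
@[simps]
def WStr.ofCone (c : WeightedCone W Q x) :
    WStr W Q fun i : (Σ a : P, W.obj a) => (c.app i.1).obj i.2 where
  map _ _ _ m := (c.app _).map m
  map_id _ _ := (c.app _).map_id _
  map_comp _ _ := (c.app _).map_comp _ _
  naturality := c.naturality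
  naturality_map := c.naturality_map
  naturality_naturality := c.naturality_naturality
  naturality_id := c.naturality_id
  naturality_comp := c.naturality_comp

/-- A family of 2-cells between structured families that is a morphism of weighted cones. -/
structure WStr.Mor {d e : ∀ i : (Σ a : P, W.obj a), x ⟶ Q.obj i.1} (S : WStr W Q d)
    (T : WStr W Q e) (m : ∀ i, d i ⟶ e i) : Prop where
  map {a : P} {y z : W.obj a} (f : y ⟶ z) : S.map a y z f ≫ m ⟨a, z⟩ = m ⟨a, y⟩ ≫ T.map a y z f
  naturality {a b : P} (s : a ⟶ b) (y : W.obj a) :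
    m ⟨b, (W.map s).toFunctor.obj y⟩ ≫ (T.naturality s y).hom =
      (S.naturality s y).hom ≫ m ⟨a, y⟩ ▷ Q.map s

namespace WStr

variable {d e f : ∀ i : (Σ a : P, W.obj a), x ⟶ Q.obj i.1} {S : WStr W Q d} {T : WStr W Q e}
  {U : WStr W Q f}

/-- Restriction of a structured family along a 1-cell. -/
def pull (S : WStr W Q d) (g : y ⟶ x) : WStr W Q fun i => g ≫ d i := ofCone (S.toCone.pull g)

/-- Postcomposition of a structured family with a transformation. -/
def post (S : WStr W Q d) (τ : Q ⟶ Q') : WStr W Q' fun i => d i ≫ τ.app i.1 :=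
  ofCone (S.toCone.postcomp τ)

theorem pull_map (S : WStr W Q d) (g : y ⟶ x) {a : P} {y z : W.obj a} (m : y ⟶ z) :
    (S.pull g).map a y z m = g ◁ S.map a y z m := rfl

theorem pull_naturality_hom (S : WStr W Q d) (g : y ⟶ x) {a b : P} (s : a ⟶ b) (y : W.obj a) :
    ((S.pull g).naturality s y).hom = g ◁ (S.naturality s y).hom ≫ (α_ _ _ _).inv := rfl

theorem post_map (S : WStr W Q d) (τ : Q ⟶ Q') {a : P} {y z : W.obj a} (m : y ⟶ z) :
    (S.post τ).map a y z m = S.map a y z m ▷ τ.app a := rfl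

theorem post_naturality_hom (S : WStr W Q d) (τ : Q ⟶ Q') {a b : P} (s : a ⟶ b) (y : W.obj a) :
    ((S.post τ).naturality s y).hom = (S.naturality s y).hom ▷ τ.app b ≫ (α_ _ _ _).hom ≫
      d ⟨a, y⟩ ◁ (τ.naturality s).hom ≫ (α_ _ _ _).inv := rfl

theorem Mor.comp {m : ∀ i, d i ⟶ e i} {n : ∀ i, e i ⟶ f i} (hm : S.Mor T m) (hn : T.Mor U n) :
    S.Mor U fun i => m i ≫ n i :=
  ⟨fun f => by rw [reassoc_of% (hm.map f), hn.map, Category.assoc],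
    fun s y => by simp [hn.naturality, reassoc_of% (hm.naturality s y)]⟩

theorem Mor.inv {m : ∀ i, d i ≅ e i} (hm : S.Mor T fun i => (m i).hom) :
    T.Mor S fun i => (m i).inv :=
  ⟨fun f => inv_square (hm.map f), fun {a b} s y => by
    rw [Iso.inv_comp_eq, reassoc_of% (hm.naturality s y), ← comp_whiskerRight, Iso.hom_inv_id]
    simp⟩

theorem Mor.pull {m : ∀ i, d i ⟶ e i} (hm : S.Mor T m) (g : y ⟶ x) :
    (S.pull g).Mor (T.pull g) fun i => g ◁ m i :=
  ⟨fun f => by simp only [pull_map, ← whiskerLeft_comp, hm.map], fun s y => by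
    have := congrArg (g ◁ ·) (hm.naturality s y)
    simp only [whiskerLeft_comp] at this
    simp [pull_naturality_hom, reassoc_of% this]⟩

theorem Mor.post {m : ∀ i, d i ⟶ e i} (hm : S.Mor T m) (τ : Q ⟶ Q') :
    (S.post τ).Mor (T.post τ) fun i => m i ▷ τ.app i.1 :=
  ⟨fun f => by simp only [post_map, ← comp_whiskerRight, hm.map],
    fun s y => postcomp_map (hm.naturality s y)⟩

theorem mor_whiskerRight (S : WStr W Q d) {g h : y ⟶ x} (μ : g ⟶ h) :
    (S.pull g).Mor (S.pull h) fun i => μ ▷ d i :=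
  ⟨fun f => whisker_exchange _ _, fun s y => by
    rw [pull_naturality_hom, pull_naturality_hom, ← whisker_exchange_assoc]
    simp⟩

theorem mor_pull_pull (S : WStr W Q d) {z : C} (g : z ⟶ y) (h : y ⟶ x) :
    (S.pull (g ≫ h)).Mor ((S.pull h).pull g) fun i => (α_ g h (d i)).hom :=
  ⟨fun f => by simp [pull_map], fun s y => by simp [pull_naturality_hom]⟩

theorem mor_pull_id (S : WStr W Q d) : (S.pull (𝟙 x)).Mor S fun i => (λ_ (d i)).hom :=
  ⟨fun f => by simp [pull_map], fun s y => by simp [pull_naturality_hom]⟩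

theorem mor_pull_post (S : WStr W Q d) (g : y ⟶ x) (τ : Q ⟶ Q') :
    ((S.pull g).post τ).Mor ((S.post τ).pull g) fun i => (α_ g (d i) (τ.app i.1)).hom :=
  ⟨fun f => by simp [pull_map, post_map],
    fun s y => by simp [pull_naturality_hom, post_naturality_hom]⟩

theorem mor_post_mod (S : WStr W Q d) {σ τ : Q ⟶ Q'} (Γ : σ ⟶ τ) :
    (S.post σ).Mor (S.post τ) fun i => d i ◁ Γ.as.app i.1 :=
  ⟨fun f => (whisker_exchange _ _).symm, fun {a b} s y => by
    have := congrArg (d ⟨a, y⟩ ◁ ·) (Γ.as.naturality s)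
    simp only [whiskerLeft_comp] at this
    rw [post_naturality_hom, post_naturality_hom, whisker_exchange_assoc]
    simp [reassoc_of% this]⟩

theorem mor_post_comp (S : WStr W Q d) {Q'' : P ⥤ᵖ C} (σ : Q ⟶ Q') (τ : Q' ⟶ Q'') :
    (S.post (σ ≫ τ)).Mor ((S.post σ).post τ) fun i => (α_ (d i) _ _).inv :=
  ⟨fun _ => associator_inv_naturality_left _ _ _, fun _ _ => postcomp_vcomp⟩

theorem mor_post_id (S : WStr W Q d) : (S.post (𝟙 Q)).Mor S fun i => (ρ_ (d i)).hom :=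
  ⟨fun _ => rightUnitor_naturality _, fun _ _ => postcomp_one⟩

end WStr

end Postcomp

theorem evalTransId_aux {x y : C} {f : x ⟶ y} {xi : x ⟶ x} {yi : y ⟶ y} {n : xi ≫ f ≅ f ≫ yi}
    {i : xi ⟶ 𝟙 x} {j : yi ⟶ 𝟙 y}
    (h : n.hom ≫ f ◁ j = i ▷ f ≫ (λ_ _).hom ≫ (ρ_ _).inv) :
    f ◁ j ≫ (ρ_ _).hom ≫ (λ_ _).inv = n.inv ≫ i ▷ f := by
  rw [Iso.eq_inv_comp, reassoc_of% h]
  simp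

theorem evalTransComp_aux {x y z x' y' z' : C} {fx : x ⟶ x'} {fy : y ⟶ y'} {fz : z ⟶ z'}
    {m : x ⟶ y} {n : y ⟶ z} {mn : x ⟶ z} {m' : x' ⟶ y'} {n' : y' ⟶ z'} {mn' : x' ⟶ z'}
    {a : mn ≫ fz ≅ fx ≫ mn'} {b : m ≫ fy ≅ fx ≫ m'} {c : n ≫ fz ≅ fy ≫ n'} {e : mn ⟶ m ≫ n}
    {e' : mn' ⟶ m' ≫ n'}
    (h : a.hom ≫ fx ◁ e' = e ▷ fz ≫ (α_ _ _ _).hom ≫ m ◁ c.hom ≫ (α_ _ _ _).inv ≫ b.hom ▷ n' ≫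
      (α_ _ _ _).hom) :
    fx ◁ e' ≫ (α_ _ _ _).inv ≫ b.inv ▷ n' ≫ (α_ _ _ _).hom ≫ m ◁ c.inv ≫ (α_ _ _ _).inv =
      a.inv ≫ e ▷ fz := by
  rw [Iso.eq_inv_comp, reassoc_of% h]
  simp [← comp_whiskerRight_assoc, ← whiskerLeft_comp_assoc]

/-- The unit constraint of the transition transformations `evalTrans F`. -/
def evalTransId (F : P ⥤ᵖ Diag I C) (k : I) : evalTrans F (le_refl k) ⟶ 𝟙 _ where
  as := { app := fun a => ((F.obj a).idm k).hom
          naturality := fun s => evalTransId_aux (nat_id (F.map s) k) }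

/-- The composition constraint of the transition transformations `evalTrans F`. -/
def evalTransComp (F : P ⥤ᵖ Diag I C) {j k l : I} (h : k ≤ j) (h' : l ≤ k) :
    evalTrans F (h'.trans h) ⟶ evalTrans F h ≫ evalTrans F h' where
  as := { app := fun a => ((F.obj a).cmp h h').hom
          naturality := fun s => evalTransComp_aux (nat_comp (F.map s) h h') }

/-- Weighted cones over the values of a pseudofunctor to diagrams, as a notion of cone. -/
def weightedConeTheory (W : P ⥤ᵖ Cat.{0, 0}) (F : P ⥤ᵖ Diag I C) :
    ConeTheory (fun i : (Σ a : P, W.obj a) => F.obj i.1) where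
  Str {_ k} d := WStr W (evalComp F k) d
  Mor S T m := S.Mor T m
  mor_comp hm hn := hm.comp hn
  mor_inv hm := hm.inv
  pull f _ _ S := S.pull f
  push h _ S := S.post (evalTrans F h)
  mor_pull f _ _ _ _ _ _ hm := hm.pull f
  mor_push h _ _ _ _ _ hm := hm.post (evalTrans F h)
  mor_whisker μ _ _ S := S.mor_whiskerRight μ
  mor_pull_pull f g _ _ S := S.mor_pull_pull f g
  mor_pull_id S := S.mor_pull_id
  mor_pull_push f _ _ h _ S := S.mor_pull_post f (evalTrans F h)
  mor_push_id S := (S.mor_post_mod (evalTransId F _)).comp S.mor_post_id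
  mor_push_push h h' _ S := (S.mor_post_mod (evalTransComp F h h')).comp (S.mor_post_comp _ _)
end EvalComp

section WeightedBilimits

variable {P : Type} [Bicategory.{0, 0} P]

section

variable {C : Type u} [Bicategory.{w, v} C] {W : P ⥤ᵖ Cat.{0, 0}} {Q : P ⥤ᵖ C} {x L : C}

namespace WStr

/-- A family of 2-cells that is a morphism of structured families, as a morphism of cones. -/
def Mor.toHom {c d : WeightedCone W Q x}
    {m : ∀ i : (Σ a : P, W.obj a), (c.app i.1).obj i.2 ⟶ (d.app i.1).obj i.2}
    (h : (ofCone c).Mor (ofCone d) m) : c ⟶ d :=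
  show WeightedCone.Hom c d from
  { app := fun a => { app := fun y => m ⟨a, y⟩, naturality := fun _ _ f => h.map f }
    naturality := fun s y => h.naturality s y }

theorem mor_of_hom {c d : WeightedCone W Q x} (m : c ⟶ d) :
    (ofCone c).Mor (ofCone d) fun i => (WeightedCone.Hom.app m i.1).app i.2 :=
  ⟨fun f => (WeightedCone.Hom.app m _).naturality f, fun s y => WeightedCone.Hom.naturality m s y⟩

theorem hom_ext {c d : WeightedCone W Q x} {m n : c ⟶ d}
    (h : ∀ a y, (WeightedCone.Hom.app m a).app y = (WeightedCone.Hom.app n a).app y) : m = n :=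
  WeightedCone.Hom.ext (funext fun a => NatTrans.ext (funext fun y => h a y))

end WStr

namespace WeightedCone

/-- Essential surjectivity in the universal property of a bi-limit, in terms of structured
families. -/
theorem IsBilimit.lift {c : WeightedCone W Q L} (hc : c.IsBilimit) (d : WeightedCone W Q x) :
    ∃ (f : x ⟶ L) (e : ∀ i : (Σ a : P, W.obj a), f ≫ (c.app i.1).obj i.2 ≅ (d.app i.1).obj i.2),
      ((WStr.ofCone c).pull f).Mor (WStr.ofCone d) fun i => (e i).hom := by
  have := hc x
  let e := (c.pullFunctor x).objObjPreimageIso d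
  refine ⟨(c.pullFunctor x).objPreimage d, fun i =>
    ⟨(Hom.app e.hom i.1).app i.2, (Hom.app e.inv i.1).app i.2, ?_, ?_⟩, WStr.mor_of_hom e.hom⟩
  · exact congrArg (fun m => (Hom.app m i.1).app i.2) e.hom_inv_id
  · exact congrArg (fun m => (Hom.app m i.1).app i.2) e.inv_hom_id

/-- Full faithfulness in the universal property of a bi-limit, in terms of structured families. -/
theorem IsBilimit.lift₂ {c : WeightedCone W Q L} (hc : c.IsBilimit) (f g : x ⟶ L)
    (m : ∀ i : (Σ a : P, W.obj a), f ≫ (c.app i.1).obj i.2 ⟶ g ≫ (c.app i.1).obj i.2)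
    (hm : ((WStr.ofCone c).pull f).Mor ((WStr.ofCone c).pull g) m) :
    ∃! μ : f ⟶ g, ∀ i, μ ▷ (c.app i.1).obj i.2 = m i := by
  have := hc x
  obtain ⟨μ, hμ⟩ := (c.pullFunctor x).map_surjective
    (WStr.Mor.toHom (c := c.pull f) (d := c.pull g) hm)
  refine ⟨μ, fun i => congrArg (fun m => (Hom.app m i.1).app i.2) hμ, fun ν hν => ?_⟩
  refine (c.pullFunctor x).map_injective ((WStr.hom_ext fun a y => ?_).trans hμ.symm)
  exact hν ⟨a, y⟩

theorem isBilimit_of_lift {c : WeightedCone W Q L}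
    (h : ∀ (x : C) (d : WeightedCone W Q x), ∃ (f : x ⟶ L)
      (e : ∀ i : (Σ a : P, W.obj a), f ≫ (c.app i.1).obj i.2 ≅ (d.app i.1).obj i.2),
      ((WStr.ofCone c).pull f).Mor (WStr.ofCone d) fun i => (e i).hom)
    (h₂ : ∀ (x : C) (f g : x ⟶ L)
      (m : ∀ i : (Σ a : P, W.obj a), f ≫ (c.app i.1).obj i.2 ⟶ g ≫ (c.app i.1).obj i.2),
      ((WStr.ofCone c).pull f).Mor ((WStr.ofCone c).pull g) m →
      ∃! μ : f ⟶ g, ∀ i, μ ▷ (c.app i.1).obj i.2 = m i) : c.IsBilimit := fun x =>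
  { faithful := ⟨fun {f g} μ ν h => (h₂ x f g _ (WStr.mor_of_hom ((c.pullFunctor x).map ν))).unique
      (fun i => congrArg (fun m => (Hom.app m i.1).app i.2) h) fun _ => rfl⟩
    full := ⟨fun {f g} m => by
      obtain ⟨μ, hμ, -⟩ := h₂ x f g _ (WStr.mor_of_hom m)
      exact ⟨μ, WStr.hom_ext fun a y => hμ ⟨a, y⟩⟩⟩
    essSurj := ⟨fun d => by
      obtain ⟨f, e, he⟩ := h x d
      exact ⟨f, ⟨⟨WStr.Mor.toHom (c := c.pull f) he, WStr.Mor.toHom (d := c.pull f) he.inv,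
        WStr.hom_ext fun a y => (e ⟨a, y⟩).hom_inv_id,
        WStr.hom_ext fun a y => (e ⟨a, y⟩).inv_hom_id⟩⟩⟩⟩ }

end WeightedCone

end

variable {I : Type u₁} [PartialOrder I] {C : Type u} [Bicategory.{w, v} C]

section

variable {W : P ⥤ᵖ Cat.{0, 0}} {F : P ⥤ᵖ Diag I C} {X : Diag I C}

/-- A family of 2-cells `c` is compatible with the transition 1-cells, as a modification, if and
only if the naturality 2-cells `n`, `n'` of its source and target are compatible with `c`, as a
morphism of structured families. -/
theorem nat_square_iff {x y a a' b b' : C} {m : x ⟶ y} {d : y ⟶ a} {e : x ⟶ a'} {d' : y ⟶ b}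
    {e' : x ⟶ b'} {q : a ⟶ b} {q' : a' ⟶ b'} {ta : a' ⟶ a} {tb : b' ⟶ b} {c : d' ⟶ d ≫ q}
    {c' : e' ⟶ e ≫ q'} {n : m ≫ d ⟶ e ≫ ta} {n' : m ≫ d' ⟶ e' ≫ tb} {t : q' ≫ tb ≅ ta ≫ q}
    {s : m ≫ d ≫ q ⟶ (e ≫ q') ≫ tb}
    (hs : s = (α_ _ _ _).inv ≫ n ▷ q ≫ (α_ _ _ _).hom ≫ e ◁ t.inv ≫ (α_ _ _ _).inv) :
    m ◁ c ≫ s = n' ≫ c' ▷ tb ↔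
      n' ≫ c' ▷ tb ≫ (α_ _ _ _).hom ≫ e ◁ t.hom ≫ (α_ _ _ _).inv =
        (m ◁ c ≫ (α_ _ _ _).inv) ≫ n ▷ q := by
  subst hs
  constructor
  · intro h
    rw [← reassoc_of% h]
    simp [← whiskerLeft_comp_assoc]
  · intro h
    rw [← cancel_mono ((α_ _ _ _).hom ≫ e ◁ t.hom ≫ (α_ _ _ _).inv)]
    simp [h, ← whiskerLeft_comp_assoc]

/-- The value at `k` of a weighted cone of diagrams. -/
def evalCone (c : WeightedCone W F X) (k : I) : WeightedCone W (evalComp F k) (X.ob k) where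
  app a := { obj := fun y => ((c.app a).obj y).app (pt k)
             map := fun m => ((c.app a).map m).as.app (pt k)
             map_id := fun y => as_app_congr ((c.app a).map_id y) k
             map_comp := fun m n => as_app_congr ((c.app a).map_comp m n) k }
  naturality s y := isoApp (c.naturality s y) k
  naturality_map s _ _ m := as_app_congr (c.naturality_map s m) k
  naturality_naturality η y := as_app_congr (c.naturality_naturality η y) k
  naturality_id a y := as_app_congr (c.naturality_id a y) k
  naturality_comp s t y := as_app_congr (c.naturality_comp s t y) k

theorem evalCone_nat (c : WeightedCone W F X) {j k : I} (h : k ≤ j) :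
    ((WStr.ofCone (evalCone c k)).pull (X.mp h)).Mor
      ((WStr.ofCone (evalCone c j)).post (evalTrans F h))
      fun i => (nat ((c.app i.1).obj i.2) h).hom :=
  ⟨fun f => modification_nat ((c.app _).map f) h, fun s y =>
    (nat_square_iff (nat_comp_hom _ _ h)).1 (modification_nat (c.naturality s y).hom h)⟩

end

/-- The pointwise bi-limits assemble to a bi-limit of diagrams. -/
theorem Diag.hasFiniteWeightedBilimits (hC : HasFiniteWeightedBilimits C) :
    HasFiniteWeightedBilimits (Diag I C) := by
  intro P _ _ W F hP hW
  -- the bi-limits of the values at each `k`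
  choose L c hc using fun k => hC P W (evalComp F k) hP hW
  obtain ⟨D, E, S, hS, h₁, h₂⟩ := (weightedConeTheory W F).exists_diagram L
    (fun k i => ((c k).app i.1).obj i.2) (fun k => WStr.ofCone (c k))
    (fun k => ⟨fun D => (hc k).lift D.toCone, fun f g m hm => (hc k).lift₂ f g m hm⟩)
  let cE : WeightedCone W F D :=
    { app := fun a => { obj := fun y => E ⟨a, y⟩
                        map := fun {y z} m =>
                          mkMod (fun k => (S k).map a y z m) fun h => (hS h).map m
                        map_id := fun y => mod_ext fun k => (S k).map_id a y
                        map_comp := fun m n => mod_ext fun k => (S k).map_comp m n }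
      naturality := fun {a b} s y => mkModIso (fun k => (S k).naturality s y) fun h =>
        (nat_square_iff (nat_comp_hom _ _ h)).2 ((hS h).naturality s y)
      naturality_map := fun s _ _ m => mod_ext fun k => (S k).naturality_map s m
      naturality_naturality := fun η y => mod_ext fun k => (S k).naturality_naturality η y
      naturality_id := fun a y => mod_ext fun k => (S k).naturality_id a y
      naturality_comp := fun s t y => mod_ext fun k => (S k).naturality_comp s t y }
  refine ⟨D, cE, WeightedCone.isBilimit_of_lift (fun X d => ?_) fun X f g m hm => ?_⟩
  · obtain ⟨f, e, he⟩ := h₁ X (fun i => (d.app i.1).obj i.2) (fun k => WStr.ofCone (evalCone d k))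
      (fun h => evalCone_nat d h)
    exact ⟨f, e, ⟨fun m => mod_ext fun k => (he k).map m,
      fun s y => mod_ext fun k => (he k).naturality s y⟩⟩
  · exact h₂ X f g m fun k => ⟨fun m => as_app_congr (hm.map m) k,
      fun s y => as_app_congr (hm.naturality s y) k⟩

end WeightedBilimits

/-! ### Weighted bi-colimits of diagrams -/

section Precomp

variable {C : Type u} [Bicategory.{w, v} C]

/-- This and the following lemmas express that the conditions on a weighted cocone pass to its
precomposition with a transformation; here, naturality in the object of the weight. -/
theorem precomp_map {x a b a' b' : C} {y z : b' ⟶ x} {y' z' : a' ⟶ x} {q : a ⟶ b} {q' : a' ⟶ b'}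
    {ta : a ⟶ a'} {tb : b ⟶ b'} {n : y' ⟶ q' ≫ y} {n' : z' ⟶ q' ≫ z} {m : y ⟶ z} {m' : y' ⟶ z'}
    {t : ta ≫ q' ⟶ q ≫ tb} (h : m' ≫ n' = n ≫ q' ◁ m) :
    ta ◁ m' ≫ ta ◁ n' ≫ (α_ _ _ _).inv ≫ t ▷ z ≫ (α_ _ _ _).hom =
      (ta ◁ n ≫ (α_ _ _ _).inv ≫ t ▷ y ≫ (α_ _ _ _).hom) ≫ q ◁ tb ◁ m := by
  calc _ = ta ◁ (m' ≫ n') ⊗≫ t ▷ z ⊗≫ 𝟙 _ := by bicategory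
    _ = ta ◁ n ⊗≫ ((ta ≫ q') ◁ m ≫ t ▷ z) ⊗≫ 𝟙 _ := by rw [h]; bicategory
    _ = _ := by rw [whisker_exchange]; bicategory

theorem precomp_nat {x a b a' b' : C} {y : b' ⟶ x} {y₁ y₂ : a' ⟶ x} {q r : a ⟶ b} {q' r' : a' ⟶ b'}
    {ta : a ⟶ a'} {tb : b ⟶ b'} {n : y₁ ⟶ q' ≫ y} {n' : y₂ ⟶ r' ≫ y} {m : y₁ ⟶ y₂}
    {t : ta ≫ q' ⟶ q ≫ tb} {t' : ta ≫ r' ⟶ r ≫ tb} {e : q ⟶ r} {e' : q' ⟶ r'}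
    (h : m ≫ n' = n ≫ e' ▷ y) (h' : ta ◁ e' ≫ t' = t ≫ e ▷ tb) :
    ta ◁ m ≫ ta ◁ n' ≫ (α_ _ _ _).inv ≫ t' ▷ y ≫ (α_ _ _ _).hom =
      (ta ◁ n ≫ (α_ _ _ _).inv ≫ t ▷ y ≫ (α_ _ _ _).hom) ≫ e ▷ (tb ≫ y) := by
  calc _ = ta ◁ (m ≫ n') ⊗≫ t' ▷ y ⊗≫ 𝟙 _ := by bicategory
    _ = ta ◁ n ⊗≫ (ta ◁ e' ≫ t') ▷ y ⊗≫ 𝟙 _ := by rw [h]; bicategory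
    _ = _ := by rw [h']; bicategory

theorem precomp_id {x a a' : C} {y y' : a' ⟶ x} {q : a ⟶ a} {q' : a' ⟶ a'}
    {ta : a ⟶ a'} {n : y' ⟶ q' ≫ y} {m : y' ⟶ y} {t : ta ≫ q' ⟶ q ≫ ta} {i : q ⟶ 𝟙 a}
    {i' : q' ⟶ 𝟙 a'} (h : n ≫ i' ▷ y = m ≫ (λ_ y).inv)
    (h' : ta ◁ i' ≫ (ρ_ _).hom ≫ (λ_ _).inv = t ≫ i ▷ ta) :
    (ta ◁ n ≫ (α_ _ _ _).inv ≫ t ▷ y ≫ (α_ _ _ _).hom) ≫ i ▷ (ta ≫ y) =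
      ta ◁ m ≫ (λ_ _).inv := by
  calc _ = ta ◁ n ⊗≫ (t ≫ i ▷ ta) ▷ y ⊗≫ 𝟙 _ := by bicategory
    _ = ta ◁ (n ≫ i' ▷ y) ⊗≫ 𝟙 _ := by rw [← h']; bicategory
    _ = _ := by rw [h]; bicategory

theorem precomp_comp {x a b c a' b' c' : C} {y : c' ⟶ x} {y₁ : b' ⟶ x} {y₂ y₂' : a' ⟶ x} {q : a ⟶ b}
    {r : b ⟶ c} {s : a ⟶ c} {q' : a' ⟶ b'} {r' : b' ⟶ c'} {s' : a' ⟶ c'}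
    {ta : a ⟶ a'} {tb : b ⟶ b'} {tc : c ⟶ c'} {nr : y₁ ⟶ r' ≫ y} {nq : y₂ ⟶ q' ≫ y₁}
    {ns : y₂' ⟶ s' ≫ y} {m : y₂' ⟶ y₂} {tq : ta ≫ q' ⟶ q ≫ tb} {tr : tb ≫ r' ⟶ r ≫ tc}
    {ts : ta ≫ s' ⟶ s ≫ tc} {e : s ⟶ q ≫ r} {e' : s' ⟶ q' ≫ r'}
    (h : ns ≫ e' ▷ y = m ≫ nq ≫ q' ◁ nr ≫ (α_ _ _ _).inv)
    (h' : ta ◁ e' ≫ (α_ _ _ _).inv ≫ tq ▷ r' ≫ (α_ _ _ _).hom ≫ q ◁ tr ≫ (α_ _ _ _).inv =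
      ts ≫ e ▷ tc) :
    (ta ◁ ns ≫ (α_ _ _ _).inv ≫ ts ▷ y ≫ (α_ _ _ _).hom) ≫ e ▷ (tc ≫ y) =
      ta ◁ m ≫ (ta ◁ nq ≫ (α_ _ _ _).inv ≫ tq ▷ y₁ ≫ (α_ _ _ _).hom) ≫
        q ◁ (tb ◁ nr ≫ (α_ _ _ _).inv ≫ tr ▷ y ≫ (α_ _ _ _).hom) ≫ (α_ _ _ _).inv := by
  calc _ = ta ◁ ns ⊗≫ (ts ≫ e ▷ tc) ▷ y ⊗≫ 𝟙 _ := by bicategory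
    _ = ta ◁ (ns ≫ e' ▷ y) ⊗≫ tq ▷ r' ▷ y ⊗≫ q ◁ tr ▷ y ⊗≫ 𝟙 _ := by rw [← h']; bicategory
    _ = ta ◁ m ⊗≫ ta ◁ nq ⊗≫ ((ta ≫ q') ◁ nr ≫ tq ▷ (r' ≫ y)) ⊗≫ q ◁ tr ▷ y ⊗≫ 𝟙 _ := by
      rw [h]; bicategory
    _ = _ := by rw [whisker_exchange]; bicategory

theorem precomp_vcomp {x a b a' b' a'' b'' : C} {y : b'' ⟶ x} {y' : a'' ⟶ x} {q : a ⟶ b}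
    {q' : a' ⟶ b'} {q'' : a'' ⟶ b''} {sa : a ⟶ a'} {sb : b ⟶ b'} {ta : a' ⟶ a''} {tb : b' ⟶ b''}
    {n : y' ⟶ q'' ≫ y} {s : sa ≫ q' ⟶ q ≫ sb} {t : ta ≫ q'' ⟶ q' ≫ tb} :
    (α_ _ _ _).hom ≫ sa ◁ (ta ◁ n ≫ (α_ _ _ _).inv ≫ t ▷ y ≫ (α_ _ _ _).hom) ≫ (α_ _ _ _).inv ≫
        s ▷ (tb ≫ y) ≫ (α_ _ _ _).hom =
      ((sa ≫ ta) ◁ n ≫ (α_ _ _ _).inv ≫ (((((α_ _ _ _).hom ≫ sa ◁ t) ≫ (α_ _ _ _).inv) ≫ s ▷ tb) ≫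
        (α_ _ _ _).hom) ▷ y ≫ (α_ _ _ _).hom) ≫ q ◁ (α_ _ _ _).hom := by
  bicategory

theorem precomp_one {x a b : C} {y : b ⟶ x} {y' : a ⟶ x} {q : a ⟶ b} {n : y' ⟶ q ≫ y} :
    (λ_ _).hom ≫ n = (𝟙 a ◁ n ≫ (α_ _ _ _).inv ≫ ((λ_ q).hom ≫ (ρ_ q).inv) ▷ y ≫
      (α_ _ _ _).hom) ≫ q ◁ (λ_ _).hom := by
  bicategory

variable {P : Type} [Bicategory.{0, 0} P] {W : Pᵒᵖ ⥤ᵖ Cat.{0, 0}} {Q Q' : P ⥤ᵖ C} {x y : C}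

/-- Precomposition of a weighted cocone with a transformation. -/
@[simps]
def WeightedCocone.precomp (c : WeightedCocone W Q' x) (τ : Q ⟶ Q') : WeightedCocone W Q x where
  app a := { obj := fun y => τ.app a ≫ (c.app a).obj y
             map := fun m => τ.app a ◁ (c.app a).map m }
  naturality s y := whiskerLeftIso _ (c.naturality s y) ≪≫ (α_ _ _ _).symm ≪≫
    whiskerRightIso (τ.naturality s).symm _ ≪≫ α_ _ _ _
  naturality_map s y z m := precomp_map (c.naturality_map s m)
  naturality_naturality η y := precomp_nat (c.naturality_naturality η y)
    (inv_square (τ.naturality_naturality η))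
  naturality_id a y := precomp_id (c.naturality_id a y) (evalTransId_aux (τ.naturality_id a))
  naturality_comp s t y := precomp_comp (c.naturality_comp s t y)
    (evalTransComp_aux (τ.naturality_comp s t))

/-- A weighted cocone structure on a family of 1-cells. -/
structure CoWStr (W : Pᵒᵖ ⥤ᵖ Cat.{0, 0}) (Q : P ⥤ᵖ C) {x : C}
    (d : ∀ i : (Σ a : P, W.obj (.op a)), Q.obj i.1 ⟶ x) where
  map (a : P) (y z : W.obj (.op a)) (m : y ⟶ z) : d ⟨a, y⟩ ⟶ d ⟨a, z⟩
  map_id (a : P) (y : W.obj (.op a)) : map a y y (𝟙 y) = 𝟙 _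
  map_comp {a : P} {y z t : W.obj (.op a)} (m : y ⟶ z) (n : z ⟶ t) :
    map a y t (m ≫ n) = map a y z m ≫ map a z t n
  naturality {a b : P} (s : a ⟶ b) (y : W.obj (.op b)) :
    d ⟨a, (W.map s.op).toFunctor.obj y⟩ ≅ Q.map s ≫ d ⟨b, y⟩
  naturality_map {a b : P} (s : a ⟶ b) {y z : W.obj (.op b)} (m : y ⟶ z) :
    map a ((W.map s.op).toFunctor.obj y) ((W.map s.op).toFunctor.obj z)
        ((W.map s.op).toFunctor.map m) ≫ (naturality s z).hom =
      (naturality s y).hom ≫ Q.map s ◁ map b y z m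
  naturality_naturality {a b : P} {s t : a ⟶ b} (η : s ⟶ t) (y : W.obj (.op b)) :
    map a ((W.map s.op).toFunctor.obj y) ((W.map t.op).toFunctor.obj y)
        ((W.map₂ (_root_.Bicategory.Opposite.op2 η)).toNatTrans.app y) ≫ (naturality t y).hom =
      (naturality s y).hom ≫ Q.map₂ η ▷ d ⟨b, y⟩
  naturality_id (a : P) (y : W.obj (.op a)) :
    (naturality (𝟙 a) y).hom ≫ (Q.mapId a).hom ▷ d ⟨a, y⟩ =
      map a ((W.map (𝟙 a).op).toFunctor.obj y) y ((W.mapId (.op a)).hom.toNatTrans.app y) ≫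
        (λ_ (d ⟨a, y⟩)).inv
  naturality_comp {a b c : P} (s : a ⟶ b) (t : b ⟶ c) (y : W.obj (.op c)) :
    (naturality (s ≫ t) y).hom ≫ (Q.mapComp s t).hom ▷ d ⟨c, y⟩ =
      map a ((W.map (s ≫ t).op).toFunctor.obj y)
        ((W.map s.op).toFunctor.obj ((W.map t.op).toFunctor.obj y))
        ((W.mapComp t.op s.op).hom.toNatTrans.app y) ≫
        (naturality s ((W.map t.op).toFunctor.obj y)).hom ≫
          Q.map s ◁ (naturality t y).hom ≫ (α_ _ _ _).inv

/-- The weighted cocone given by a structured family. -/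
@[simps]
def CoWStr.toCocone {d : ∀ i : (Σ a : P, W.obj (.op a)), Q.obj i.1 ⟶ x} (S : CoWStr W Q d) :
    WeightedCocone W Q x where
  app a := { obj := fun y => d ⟨a, y⟩, map := S.map a _ _, map_id := S.map_id a,
             map_comp := S.map_comp }
  naturality := S.naturality
  naturality_map := S.naturality_map
  naturality_naturality := S.naturality_naturality
  naturality_id := S.naturality_id
  naturality_comp := S.naturality_comp

/-- The structured family underlying a weighted cocone. -/
@[simps]
def CoWStr.ofCocone (c : WeightedCocone W Q x) :
    CoWStr W Q fun i : (Σ a : P, W.obj (.op a)) => (c.app i.1).obj i.2 where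
  map _ _ _ m := (c.app _).map m
  map_id _ _ := (c.app _).map_id _
  map_comp _ _ := (c.app _).map_comp _ _
  naturality := c.naturality
  naturality_map := c.naturality_map
  naturality_naturality := c.naturality_naturality
  naturality_id := c.naturality_id
  naturality_comp := c.naturality_comp

/-- A family of 2-cells between structured families that is a morphism of weighted cocones. -/
structure CoWStr.Mor {d e : ∀ i : (Σ a : P, W.obj (.op a)), Q.obj i.1 ⟶ x} (S : CoWStr W Q d)
    (T : CoWStr W Q e) (m : ∀ i, d i ⟶ e i) : Prop where
  map {a : P} {y z : W.obj (.op a)} (f : y ⟶ z) :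
    S.map a y z f ≫ m ⟨a, z⟩ = m ⟨a, y⟩ ≫ T.map a y z f
  naturality {a b : P} (s : a ⟶ b) (y : W.obj (.op b)) :
    m ⟨a, (W.map s.op).toFunctor.obj y⟩ ≫ (T.naturality s y).hom =
      (S.naturality s y).hom ≫ Q.map s ◁ m ⟨b, y⟩

namespace CoWStr

variable {d e f : ∀ i : (Σ a : P, W.obj (.op a)), Q.obj i.1 ⟶ x} {S : CoWStr W Q d}
  {T : CoWStr W Q e} {U : CoWStr W Q f}

/-- Extension of a structured family along a 1-cell. -/
def push (S : CoWStr W Q d) (g : x ⟶ y) : CoWStr W Q fun i => d i ≫ g :=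
  ofCocone (S.toCocone.push g)

/-- Precomposition of a structured family with a transformation. -/
def pre {d : ∀ i : (Σ a : P, W.obj (.op a)), Q'.obj i.1 ⟶ x} (S : CoWStr W Q' d) (τ : Q ⟶ Q') :
    CoWStr W Q fun i => τ.app i.1 ≫ d i :=
  ofCocone (S.toCocone.precomp τ)

theorem push_map (S : CoWStr W Q d) (g : x ⟶ y) {a : P} {y z : W.obj (.op a)} (m : y ⟶ z) :
    (S.push g).map a y z m = S.map a y z m ▷ g := rfl

theorem push_naturality_hom (S : CoWStr W Q d) (g : x ⟶ y) {a b : P} (s : a ⟶ b)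
    (y : W.obj (.op b)) :
    ((S.push g).naturality s y).hom = (S.naturality s y).hom ▷ g ≫ (α_ _ _ _).hom := rfl

theorem pre_map {d : ∀ i : (Σ a : P, W.obj (.op a)), Q'.obj i.1 ⟶ x} (S : CoWStr W Q' d)
    (τ : Q ⟶ Q') {a : P} {y z : W.obj (.op a)} (m : y ⟶ z) :
    (S.pre τ).map a y z m = τ.app a ◁ S.map a y z m := rfl

theorem pre_naturality_hom {d : ∀ i : (Σ a : P, W.obj (.op a)), Q'.obj i.1 ⟶ x} (S : CoWStr W Q' d)
    (τ : Q ⟶ Q') {a b : P} (s : a ⟶ b) (y : W.obj (.op b)) :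
    ((S.pre τ).naturality s y).hom = τ.app a ◁ (S.naturality s y).hom ≫ (α_ _ _ _).inv ≫
      (τ.naturality s).inv ▷ d ⟨b, y⟩ ≫ (α_ _ _ _).hom := rfl

theorem Mor.comp {m : ∀ i, d i ⟶ e i} {n : ∀ i, e i ⟶ f i} (hm : S.Mor T m) (hn : T.Mor U n) :
    S.Mor U fun i => m i ≫ n i :=
  ⟨fun f => by rw [reassoc_of% (hm.map f), hn.map, Category.assoc],
    fun s y => by simp [hn.naturality, reassoc_of% (hm.naturality s y)]⟩

theorem Mor.inv {m : ∀ i, d i ≅ e i} (hm : S.Mor T fun i => (m i).hom) :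
    T.Mor S fun i => (m i).inv :=
  ⟨fun f => inv_square (hm.map f), fun {a b} s y => by
    rw [Iso.inv_comp_eq, reassoc_of% (hm.naturality s y), ← whiskerLeft_comp, Iso.hom_inv_id]
    simp⟩

theorem Mor.push {m : ∀ i, d i ⟶ e i} (hm : S.Mor T m) (g : x ⟶ y) :
    (S.push g).Mor (T.push g) fun i => m i ▷ g :=
  ⟨fun f => by simp only [push_map, ← comp_whiskerRight, hm.map], fun s y => by
    have := congrArg (· ▷ g) (hm.naturality s y)
    simp only [comp_whiskerRight] at this
    simp [push_naturality_hom, reassoc_of% this]⟩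

theorem Mor.pre {d e : ∀ i : (Σ a : P, W.obj (.op a)), Q'.obj i.1 ⟶ x} {S : CoWStr W Q' d}
    {T : CoWStr W Q' e} {m : ∀ i, d i ⟶ e i} (hm : S.Mor T m) (τ : Q ⟶ Q') :
    (S.pre τ).Mor (T.pre τ) fun i => τ.app i.1 ◁ m i :=
  ⟨fun f => by simp only [pre_map, ← whiskerLeft_comp, hm.map],
    fun s y => precomp_map (hm.naturality s y)⟩

theorem mor_whiskerLeft (S : CoWStr W Q d) {g h : x ⟶ y} (μ : g ⟶ h) :
    (S.push g).Mor (S.push h) fun i => d i ◁ μ :=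
  ⟨fun f => (whisker_exchange _ _).symm, fun s y => by
    rw [push_naturality_hom, push_naturality_hom, whisker_exchange_assoc]
    simp⟩

theorem mor_push_push (S : CoWStr W Q d) {z : C} (g : x ⟶ y) (h : y ⟶ z) :
    ((S.push g).push h).Mor (S.push (g ≫ h)) fun i => (α_ (d i) g h).hom :=
  ⟨fun f => by simp [push_map], fun s y => by simp [push_naturality_hom]⟩

theorem mor_push_id (S : CoWStr W Q d) : (S.push (𝟙 x)).Mor S fun i => (ρ_ (d i)).hom :=
  ⟨fun f => by simp [push_map], fun s y => by simp [push_naturality_hom]⟩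

theorem mor_push_pre {d : ∀ i : (Σ a : P, W.obj (.op a)), Q'.obj i.1 ⟶ x} (S : CoWStr W Q' d)
    (g : x ⟶ y) (τ : Q ⟶ Q') :
    ((S.pre τ).push g).Mor ((S.push g).pre τ) fun i => (α_ (τ.app i.1) (d i) g).hom :=
  ⟨fun f => by simp [push_map, pre_map],
    fun s y => by simp [push_naturality_hom, pre_naturality_hom]⟩

theorem mor_pre_mod {d : ∀ i : (Σ a : P, W.obj (.op a)), Q'.obj i.1 ⟶ x} (S : CoWStr W Q' d)
    {σ τ : Q ⟶ Q'} (Γ : σ ⟶ τ) :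
    (S.pre σ).Mor (S.pre τ) fun i => Γ.as.app i.1 ▷ d i :=
  ⟨fun f => whisker_exchange _ _, fun {a b} s y => by
    have := congrArg (· ▷ d ⟨b, y⟩) (inv_square (Γ.as.naturality s))
    simp only [comp_whiskerRight] at this
    rw [pre_naturality_hom, pre_naturality_hom, ← whisker_exchange_assoc]
    simp [reassoc_of% this]⟩

theorem mor_pre_comp {Q'' : P ⥤ᵖ C} {d : ∀ i : (Σ a : P, W.obj (.op a)), Q''.obj i.1 ⟶ x}
    (S : CoWStr W Q'' d) (σ : Q ⟶ Q') (τ : Q' ⟶ Q'') :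
    (S.pre (σ ≫ τ)).Mor ((S.pre τ).pre σ) fun i => (α_ _ _ (d i)).hom :=
  ⟨fun _ => associator_naturality_right _ _ _, fun _ _ => precomp_vcomp⟩

theorem mor_pre_id (S : CoWStr W Q d) : (S.pre (𝟙 Q)).Mor S fun i => (λ_ (d i)).hom :=
  ⟨fun _ => leftUnitor_naturality _, fun _ _ => precomp_one⟩

/-- A family of 2-cells that is a morphism of structured families, as a morphism of cocones. -/
def Mor.toHom {c d : WeightedCocone W Q x}
    {m : ∀ i : (Σ a : P, W.obj (.op a)), (c.app i.1).obj i.2 ⟶ (d.app i.1).obj i.2}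
    (h : (ofCocone c).Mor (ofCocone d) m) : c ⟶ d :=
  show WeightedCocone.Hom c d from
  { app := fun a => { app := fun y => m ⟨a, y⟩, naturality := fun _ _ f => h.map f }
    naturality := fun s y => h.naturality s y }

theorem mor_of_hom {c d : WeightedCocone W Q x} (m : c ⟶ d) :
    (ofCocone c).Mor (ofCocone d) fun i => (WeightedCocone.Hom.app m i.1).app i.2 :=
  ⟨fun f => (WeightedCocone.Hom.app m _).naturality f,
    fun s y => WeightedCocone.Hom.naturality m s y⟩

theorem hom_ext {c d : WeightedCocone W Q x} {m n : c ⟶ d}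
    (h : ∀ a y, (WeightedCocone.Hom.app m a).app y = (WeightedCocone.Hom.app n a).app y) : m = n :=
  WeightedCocone.Hom.ext (funext fun a => NatTrans.ext (funext fun y => h a y))

end CoWStr

namespace WeightedCocone

variable {L : C}

/-- Essential surjectivity in the universal property of a bi-colimit, in terms of structured
families. -/
theorem IsBicolimit.lift {c : WeightedCocone W Q L} (hc : c.IsBicolimit)
    (d : WeightedCocone W Q x) :
    ∃ (f : L ⟶ x)
      (e : ∀ i : (Σ a : P, W.obj (.op a)), (c.app i.1).obj i.2 ≫ f ≅ (d.app i.1).obj i.2),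
      ((CoWStr.ofCocone c).push f).Mor (CoWStr.ofCocone d) fun i => (e i).hom := by
  have := hc x
  let e := (c.pushFunctor x).objObjPreimageIso d
  refine ⟨(c.pushFunctor x).objPreimage d, fun i =>
    ⟨(Hom.app e.hom i.1).app i.2, (Hom.app e.inv i.1).app i.2, ?_, ?_⟩, CoWStr.mor_of_hom e.hom⟩
  · exact congrArg (fun m => (Hom.app m i.1).app i.2) e.hom_inv_id
  · exact congrArg (fun m => (Hom.app m i.1).app i.2) e.inv_hom_id

/-- Full faithfulness in the universal property of a bi-colimit, in terms of structured families. -/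
theorem IsBicolimit.lift₂ {c : WeightedCocone W Q L} (hc : c.IsBicolimit) (f g : L ⟶ x)
    (m : ∀ i : (Σ a : P, W.obj (.op a)), (c.app i.1).obj i.2 ≫ f ⟶ (c.app i.1).obj i.2 ≫ g)
    (hm : ((CoWStr.ofCocone c).push f).Mor ((CoWStr.ofCocone c).push g) m) :
    ∃! μ : f ⟶ g, ∀ i, (c.app i.1).obj i.2 ◁ μ = m i := by
  have := hc x
  obtain ⟨μ, hμ⟩ := (c.pushFunctor x).map_surjective
    (CoWStr.Mor.toHom (c := c.push f) (d := c.push g) hm)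
  refine ⟨μ, fun i => congrArg (fun m => (Hom.app m i.1).app i.2) hμ, fun ν hν => ?_⟩
  refine (c.pushFunctor x).map_injective ((CoWStr.hom_ext fun a y => ?_).trans hμ.symm)
  exact hν ⟨a, y⟩

theorem isBicolimit_of_lift {c : WeightedCocone W Q L}
    (h : ∀ (x : C) (d : WeightedCocone W Q x), ∃ (f : L ⟶ x)
      (e : ∀ i : (Σ a : P, W.obj (.op a)), (c.app i.1).obj i.2 ≫ f ≅ (d.app i.1).obj i.2),
      ((CoWStr.ofCocone c).push f).Mor (CoWStr.ofCocone d) fun i => (e i).hom)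
    (h₂ : ∀ (x : C) (f g : L ⟶ x)
      (m : ∀ i : (Σ a : P, W.obj (.op a)), (c.app i.1).obj i.2 ≫ f ⟶ (c.app i.1).obj i.2 ≫ g),
      ((CoWStr.ofCocone c).push f).Mor ((CoWStr.ofCocone c).push g) m →
      ∃! μ : f ⟶ g, ∀ i, (c.app i.1).obj i.2 ◁ μ = m i) : c.IsBicolimit := fun x =>
  { faithful := ⟨fun {f g} μ ν h =>
      (h₂ x f g _ (CoWStr.mor_of_hom ((c.pushFunctor x).map ν))).unique
        (fun i => congrArg (fun m => (Hom.app m i.1).app i.2) h) fun _ => rfl⟩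
    full := ⟨fun {f g} m => by
      obtain ⟨μ, hμ, -⟩ := h₂ x f g _ (CoWStr.mor_of_hom m)
      exact ⟨μ, CoWStr.hom_ext fun a y => hμ ⟨a, y⟩⟩⟩
    essSurj := ⟨fun d => by
      obtain ⟨f, e, he⟩ := h x d
      exact ⟨f, ⟨⟨CoWStr.Mor.toHom (c := c.push f) he, CoWStr.Mor.toHom (d := c.push f) he.inv,
        CoWStr.hom_ext fun a y => (e ⟨a, y⟩).hom_inv_id,
        CoWStr.hom_ext fun a y => (e ⟨a, y⟩).inv_hom_id⟩⟩⟩⟩ }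

end WeightedCocone

end Precomp

section WeightedBicolimits

variable {P : Type} [Bicategory.{0, 0} P] {I : Type u₁} [PartialOrder I] {C : Type u}
  [Bicategory.{w, v} C]

/-- Weighted cocones under the values of a pseudofunctor to diagrams, as a notion of cocone. -/
def weightedCoconeTheory (W : Pᵒᵖ ⥤ᵖ Cat.{0, 0}) (F : P ⥤ᵖ Diag I C) :
    CoconeTheory (fun i : (Σ a : P, W.obj (.op a)) => F.obj i.1) where
  Str {_ k} d := CoWStr W (evalComp F k) d
  Mor S T m := S.Mor T m
  mor_comp hm hn := hm.comp hn
  mor_inv hm := hm.inv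
  push f _ _ S := S.push f
  pull h _ S := S.pre (evalTrans F h)
  mor_push f _ _ _ _ _ _ hm := hm.push f
  mor_pull h _ _ _ _ _ hm := hm.pre (evalTrans F h)
  mor_whisker μ _ _ S := S.mor_whiskerLeft μ
  mor_push_push f g _ _ S := S.mor_push_push f g
  mor_push_id S := S.mor_push_id
  mor_pull_push f _ _ h _ S := S.mor_push_pre f (evalTrans F h)
  mor_pull_id S := (S.mor_pre_mod (evalTransId F _)).comp S.mor_pre_id
  mor_pull_pull h h' _ S := (S.mor_pre_mod (evalTransComp F h h')).comp (S.mor_pre_comp _ _)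

section

variable {W : Pᵒᵖ ⥤ᵖ Cat.{0, 0}} {F : P ⥤ᵖ Diag I C} {X : Diag I C}

/-- The value at `k` of a weighted cocone of diagrams. -/
def evalCocone (c : WeightedCocone W F X) (k : I) : WeightedCocone W (evalComp F k) (X.ob k) where
  app a := { obj := fun y => ((c.app a).obj y).app (pt k)
             map := fun m => ((c.app a).map m).as.app (pt k)
             map_id := fun y => as_app_congr ((c.app a).map_id y) k
             map_comp := fun m n => as_app_congr ((c.app a).map_comp m n) k }
  naturality s y := isoApp (c.naturality s y) k
  naturality_map s _ _ m := as_app_congr (c.naturality_map s m) k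
  naturality_naturality η y := as_app_congr (c.naturality_naturality η y) k
  naturality_id a y := as_app_congr (c.naturality_id a y) k
  naturality_comp s t y := as_app_congr (c.naturality_comp s t y) k

/-- The dual of `nat_square_iff`. -/
theorem conat_square_iff {y x a a' b b' : C} {m : x ⟶ y} {d : a ⟶ y} {e : a' ⟶ x} {d' : b ⟶ y}
    {e' : b' ⟶ x} {q : b ⟶ a} {q' : b' ⟶ a'} {ta : a' ⟶ a} {tb : b' ⟶ b} {c : d' ⟶ q ≫ d}
    {c' : e' ⟶ q' ≫ e} {n : ta ≫ d ⟶ e ≫ m} {n' : tb ≫ d' ⟶ e' ≫ m} {t : q' ≫ ta ≅ tb ≫ q}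
    {s : tb ≫ q ≫ d ⟶ (q' ≫ e) ≫ m}
    (hs : s = (α_ _ _ _).inv ≫ t.inv ▷ d ≫ (α_ _ _ _).hom ≫ q' ◁ n ≫ (α_ _ _ _).inv) :
    tb ◁ c ≫ s = n' ≫ c' ▷ m ↔
      n' ≫ c' ▷ m ≫ (α_ _ _ _).hom =
        (tb ◁ c ≫ (α_ _ _ _).inv ≫ t.inv ▷ d ≫ (α_ _ _ _).hom) ≫ q' ◁ n := by
  subst hs
  constructor
  · intro h
    rw [← reassoc_of% h]
    simp
  · intro h
    rw [← cancel_mono (α_ _ _ _).hom]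
    simp [h]

theorem evalCocone_nat (c : WeightedCocone W F X) {j k : I} (h : k ≤ j) :
    ((CoWStr.ofCocone (evalCocone c k)).pre (evalTrans F h)).Mor
      ((CoWStr.ofCocone (evalCocone c j)).push (X.mp h))
      fun i => (nat ((c.app i.1).obj i.2) h).hom :=
  ⟨fun f => modification_nat ((c.app _).map f) h, fun s y =>
    (conat_square_iff (t := (nat (F.map s) h).symm) (nat_comp_hom _ _ h)).1
      (modification_nat (c.naturality s y).hom h)⟩

end

/-- The pointwise bi-colimits assemble to a bi-colimit of diagrams. -/
theorem Diag.hasFiniteWeightedBicolimits (hC : HasFiniteWeightedBicolimits C) :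
    HasFiniteWeightedBicolimits (Diag I C) := by
  intro P _ _ W F hP hW
  -- the bi-colimits of the values at each `k`
  choose L c hc using fun k => hC P W (evalComp F k) hP hW
  obtain ⟨D, E, S, hS, h₁, h₂⟩ := (weightedCoconeTheory W F).exists_diagram L
    (fun k i => ((c k).app i.1).obj i.2) (fun k => CoWStr.ofCocone (c k))
    (fun k => ⟨fun D => (hc k).lift D.toCocone, fun f g m hm => (hc k).lift₂ f g m hm⟩)
  let cE : WeightedCocone W F D :=
    { app := fun a => { obj := fun y => E ⟨a, y⟩
                        map := fun {y z} m => mkMod (fun k => (S k).map a y z m) fun h =>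
                          (hS h).map m
                        map_id := fun y => mod_ext fun k => (S k).map_id a y
                        map_comp := fun m n => mod_ext fun k => (S k).map_comp m n }
      naturality := fun {a b} s y => mkModIso (fun k => (S k).naturality s y) fun h =>
        (conat_square_iff (t := (nat (F.map s) h).symm) (nat_comp_hom _ _ h)).2
          ((hS h).naturality s y)
      naturality_map := fun s _ _ m => mod_ext fun k => (S k).naturality_map s m
      naturality_naturality := fun η y => mod_ext fun k => (S k).naturality_naturality η y
      naturality_id := fun a y => mod_ext fun k => (S k).naturality_id a y
      naturality_comp := fun s t y => mod_ext fun k => (S k).naturality_comp s t y }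
  refine ⟨D, cE, WeightedCocone.isBicolimit_of_lift (fun X d => ?_) fun X f g m hm => ?_⟩
  · obtain ⟨f, e, he⟩ := h₁ X (fun i => (d.app i.1).obj i.2)
      (fun k => CoWStr.ofCocone (evalCocone d k)) (fun h => evalCocone_nat d h)
    exact ⟨f, e, ⟨fun m => mod_ext fun k => (he k).map m,
      fun s y => mod_ext fun k => (he k).naturality s y⟩⟩
  · exact h₂ X f g m fun k => ⟨fun m => as_app_congr (hm.map m) k,
      fun s y => as_app_congr (hm.naturality s y) k⟩

end WeightedBicolimits

/-! ### Conical bi-limits over finite posets and bi-pullbacks -/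

section Conical

variable {P : Type} [Bicategory.{0, 0} P] {C : Type u} [Bicategory.{w, v} C]

/-- The constant weight at the terminal category. -/
abbrev constWeight (P : Type) [Bicategory.{0, 0} P] : P ⥤ᵖ Cat.{0, 0} :=
  const P (Cat.of (Discrete PUnit.{1}))

/-- A family of 1-cells with conical structure, as a structured family for the constant weight. -/
def WStr.ofFamily {F : P ⥤ᵖ C} {x : C} (d : ∀ a, x ⟶ F.obj a)
    (nat : ∀ {a b : P} (s : a ⟶ b), d b ≅ d a ≫ F.map s)
    (nat_nat : ∀ {a b : P} {s t : a ⟶ b} (η : s ⟶ t),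
      (nat s).hom ≫ d a ◁ F.map₂ η = (nat t).hom)
    (nat_id : ∀ a, (nat (𝟙 a)).hom ≫ d a ◁ (F.mapId a).hom = (ρ_ _).inv)
    (nat_comp : ∀ {a b c : P} (s : a ⟶ b) (t : b ⟶ c),
      (nat (s ≫ t)).hom ≫ d a ◁ (F.mapComp s t).hom =
        (nat t).hom ≫ (nat s).hom ▷ F.map t ≫ (α_ _ _ _).hom) :
    WStr (constWeight P) F (fun i => d i.1) where
  map a _ _ _ := 𝟙 (d a)
  map_id _ _ := rfl
  map_comp _ _ := (Category.id_comp _).symm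
  naturality s _ := nat s
  naturality_map s _ _ _ := by simp
  naturality_naturality η _ := (Category.id_comp _).trans (nat_nat η).symm
  naturality_id a _ := (nat_id a).trans (Category.id_comp _).symm
  naturality_comp s t _ := (nat_comp s t).trans (Category.id_comp _).symm

/-- The value of the constant weight has a unique object. -/
abbrev star : Cat.of (Discrete PUnit.{1}) := Discrete.mk PUnit.unit

namespace WStr

variable {F : P ⥤ᵖ C} {x : C} {d e : ∀ i : (Σ a : P, (constWeight P).obj a), x ⟶ F.obj i.1}
  (S : WStr (constWeight P) F d) (T : WStr (constWeight P) F e)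

theorem const_map (a : P) (y z : (constWeight P).obj a) (m : y ⟶ z) :
    S.map a y z m = 𝟙 (d ⟨a, star⟩) :=
  S.map_id a star

theorem const_nat_id (a : P) :
    (S.naturality (𝟙 a) star).hom ≫ d ⟨a, star⟩ ◁ (F.mapId a).hom = (ρ_ _).inv :=
  (S.naturality_id a star).trans ((congrArg (· ≫ _) (S.map_id a star)).trans (Category.id_comp _))

theorem const_nat_comp {a b c : P} (s : a ⟶ b) (t : b ⟶ c) :
    (S.naturality (s ≫ t) star).hom ≫ d ⟨a, star⟩ ◁ (F.mapComp s t).hom =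
      (S.naturality t star).hom ≫ (S.naturality s star).hom ▷ F.map t ≫ (α_ _ _ _).hom :=
  (S.naturality_comp s t star).trans
    ((congrArg (· ≫ _) (S.map_id c star)).trans (Category.id_comp _))

theorem const_mor {m : ∀ i, d i ⟶ e i}
    (h : ∀ {a b : P} (s : a ⟶ b), m ⟨b, star⟩ ≫ (T.naturality s star).hom =
      (S.naturality s star).hom ≫ m ⟨a, star⟩ ▷ F.map s) : S.Mor T m :=
  ⟨fun {a y z} f => (congrArg (· ≫ _) (S.const_map a y z f)).trans
    ((Category.id_comp _).trans ((congrArg (m ⟨a, star⟩ ≫ ·) (T.const_map a y z f)).trans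
      (Category.comp_id _)).symm), fun s _ => h s⟩

end WStr

theorem exists_isBilimit_constWeight (hC : HasFiniteWeightedBilimits C) [Bicategory.Strict P]
    (hP : FiniteBicategory P) (F : P ⥤ᵖ C) :
    ∃ (L : C) (c : WeightedCone (constWeight P) F L), c.IsBilimit :=
  hC P _ F hP fun _ => ⟨inferInstanceAs (Finite (Discrete PUnit)),
    fun _ _ => inferInstanceAs (Finite (ULift (PLift (_ = _))))⟩

theorem finiteBicategory_locallyDiscrete (K : Type) [Category.{0} K] [Finite K]
    (h : ∀ a b : K, Finite (a ⟶ b)) : FiniteBicategory (LocallyDiscrete K) where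
  obj := Finite.of_injective (fun a : LocallyDiscrete K => a.as) fun a b h => by
    cases a; cases b; cases h; rfl
  hom a b := by
    have := h a.as b.as
    exact Finite.of_injective (fun f : a ⟶ b => f.as) fun _ _ => Discrete.ext
  hom₂ a b f g := inferInstance

end Conical

section RawCone

section

variable {C : Type u} [Bicategory.{w, v} C]

theorem whiskerLeft_square {z x a b : C} {f : z ⟶ x} {y y' : x ⟶ b} {d d' : x ⟶ a} {t : a ⟶ b}
    {m : y ⟶ y'} {m' : d ⟶ d'} {n : y ⟶ d ≫ t} {n' : y' ⟶ d' ≫ t} (h : m ≫ n' = n ≫ m' ▷ t) :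
    f ◁ m ≫ f ◁ n' ≫ (α_ _ _ _).inv = (f ◁ n ≫ (α_ _ _ _).inv) ≫ (f ◁ m') ▷ t := by
  calc _ = f ◁ (m ≫ n') ⊗≫ 𝟙 _ := by bicategory
    _ = _ := by rw [h]; bicategory

theorem whiskerRight_square {z x a b : C} {f g : z ⟶ x} {μ : f ⟶ g} {y : x ⟶ b} {d : x ⟶ a}
    {t : a ⟶ b} {n : y ⟶ d ≫ t} :
    μ ▷ y ≫ g ◁ n ≫ (α_ _ _ _).inv = (f ◁ n ≫ (α_ _ _ _).inv) ≫ (μ ▷ d) ▷ t := by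
  rw [← whisker_exchange_assoc]
  simp

theorem whiskerLeft_whiskerLeft_square {w z x a b : C} {f : w ⟶ z} {g : z ⟶ x} {y : x ⟶ b}
    {d : x ⟶ a} {t : a ⟶ b} {n : y ⟶ d ≫ t} :
    (α_ f g y).hom ≫ f ◁ (g ◁ n ≫ (α_ _ _ _).inv) ≫ (α_ _ _ _).inv =
      ((f ≫ g) ◁ n ≫ (α_ _ _ _).inv) ≫ (α_ f g d).hom ▷ t := by
  bicategory

theorem whiskerLeft_postcomp_square {z x a b a' b' : C} {f : z ⟶ x} {y : x ⟶ b}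
    {d : x ⟶ a} {t : a ⟶ b} {n : y ⟶ d ≫ t} {p : a ⟶ a'} {q : b ⟶ b'} {t' : a' ⟶ b'}
    {s : t ≫ q ⟶ p ≫ t'} :
    (α_ f y q).hom ≫ f ◁ (n ▷ q ≫ (α_ _ _ _).hom ≫ d ◁ s ≫ (α_ _ _ _).inv) ≫ (α_ _ _ _).inv =
      ((f ◁ n ≫ (α_ _ _ _).inv) ▷ q ≫ (α_ _ _ _).hom ≫ (f ≫ d) ◁ s ≫ (α_ _ _ _).inv) ≫
        (α_ f d p).hom ▷ t' := by
  bicategory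

/-- The unit condition of a transformation out of a constant diagram, after cancelling the unitor
in its naturality 2-cells. -/
theorem raw_id_iff {x a : C} {d : x ⟶ a} {t : a ⟶ a} {n : d ≅ d ≫ t} {i : t ⟶ 𝟙 a} :
    ((λ_ d).hom ≫ n.hom) ≫ d ◁ i = 𝟙 (𝟙 x) ▷ d ≫ (λ_ _).hom ≫ (ρ_ _).inv ↔
      n.hom ≫ d ◁ i = (ρ_ _).inv := by
  simp

/-- The composition condition of a transformation out of a constant diagram, after cancelling the
unitors in its naturality 2-cells. -/
theorem raw_comp_iff {x a b c : C} {d : x ⟶ a} {e : x ⟶ b} {f : x ⟶ c} {s : a ⟶ b} {t : b ⟶ c}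
    {st : a ⟶ c} {ns : e ⟶ d ≫ s} {nt : f ⟶ e ≫ t} {nst : f ⟶ d ≫ st} {z : st ⟶ s ≫ t} :
    ((λ_ f).hom ≫ nst) ≫ d ◁ z = (λ_ (𝟙 x)).inv ▷ f ≫ (α_ _ _ _).hom ≫
        𝟙 x ◁ ((λ_ f).hom ≫ nt) ≫ (α_ _ _ _).inv ≫ ((λ_ e).hom ≫ ns) ▷ t ≫ (α_ _ _ _).hom ↔
      nst ≫ d ◁ z = nt ≫ ns ▷ t ≫ (α_ _ _ _).hom := by
  simp

theorem raw_comp {x a b c : C} {d : x ⟶ a} {e : x ⟶ b} {f : x ⟶ c} {s : a ⟶ b} {t : b ⟶ c}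
    {st : a ⟶ c} {ns : 𝟙 x ≫ e ⟶ d ≫ s} {nt : 𝟙 x ≫ f ⟶ e ≫ t} {nst : 𝟙 x ≫ f ⟶ d ≫ st}
    {z : st ⟶ s ≫ t}
    (h : nst ≫ d ◁ z = (λ_ (𝟙 x)).inv ▷ f ≫ (α_ _ _ _).hom ≫
        𝟙 x ◁ nt ≫ (α_ _ _ _).inv ≫ ns ▷ t ≫ (α_ _ _ _).hom) :
    ((λ_ f).inv ≫ nst) ≫ d ◁ z =
      ((λ_ f).inv ≫ nt) ≫ ((λ_ e).inv ≫ ns) ▷ t ≫ (α_ _ _ _).hom := by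
  rw [Category.assoc, h]
  bicategory

theorem constMap_nat {y x a b : C} {f : y ⟶ x} {d : x ⟶ a} {e : x ⟶ b} {s : a ⟶ b}
    {N : 𝟙 x ≫ e ⟶ d ≫ s} {n : e ⟶ d ≫ s} (hN : N = (λ_ e).hom ≫ n) :
    (α_ _ _ _).inv ≫ ((λ_ f).hom ≫ (ρ_ f).inv) ▷ e ≫ (α_ _ _ _).hom ≫ f ◁ N ≫
      (α_ _ _ _).inv = (λ_ _).hom ≫ f ◁ n ≫ (α_ _ _ _).inv := by
  rw [hN]
  bicategory

theorem raw_mor_iff {x a b : C} {d d' : x ⟶ a} {e e' : x ⟶ b} {s : a ⟶ b} {n : e ⟶ d ≫ s}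
    {N : 𝟙 x ≫ e ⟶ d ≫ s} {n' : e' ⟶ d' ≫ s} {N' : 𝟙 x ≫ e' ⟶ d' ≫ s} {m : e ⟶ e'} {m' : d ⟶ d'}
    (hN : N = (λ_ e).hom ≫ n) (hN' : N' = (λ_ e').hom ≫ n') :
    𝟙 x ◁ m ≫ N' = N ≫ m' ▷ s ↔ m ≫ n' = n ≫ m' ▷ s := by
  subst hN hN'
  rw [leftUnitor_naturality_assoc, Category.assoc, cancel_epi]

end

variable {S : Type u₁} [PartialOrder S] {C : Type u} [Bicategory.{w, v} C]

/-- A pseudo-cone over a diagram on a poset, in terms of its components and structural 2-cells. -/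
structure RawCone (Y : Diag S C) (x : C) where
  app (k : S) : x ⟶ Y.ob k
  nat {j k : S} (h : k ≤ j) : app k ≅ app j ≫ Y.mp h
  nat_id (j : S) : (nat (le_refl j)).hom ≫ app j ◁ (Y.idm j).hom = (ρ_ _).inv
  nat_comp {j k l : S} (h : k ≤ j) (h' : l ≤ k) :
    (nat (h'.trans h)).hom ≫ app j ◁ (Y.cmp h h').hom =
      (nat h').hom ≫ (nat h).hom ▷ Y.mp h' ≫ (α_ _ _ _).hom

namespace RawCone

variable {Y B : Diag S C} {x y : C}

/-- A family of 2-cells between the components of two cones that is a modification. -/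
structure IsMor (c d : RawCone Y x) (m : ∀ k, c.app k ⟶ d.app k) : Prop where
  nat {j k : S} (h : k ≤ j) : m k ≫ (d.nat h).hom = (c.nat h).hom ≫ m j ▷ Y.mp h

theorem IsMor.comp {c d e : RawCone Y x} {m : ∀ k, c.app k ⟶ d.app k} {n : ∀ k, d.app k ⟶ e.app k}
    (hm : c.IsMor d m) (hn : d.IsMor e n) : c.IsMor e fun k => m k ≫ n k :=
  ⟨fun h => by rw [Category.assoc, hn.nat h, reassoc_of% (hm.nat h), comp_whiskerRight]⟩

theorem IsMor.inv {c d : RawCone Y x} {m : ∀ k, c.app k ≅ d.app k}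
    (hm : c.IsMor d fun k => (m k).hom) : d.IsMor c fun k => (m k).inv :=
  ⟨fun h => by
    rw [Iso.inv_comp_eq, reassoc_of% (hm.nat h), ← comp_whiskerRight, Iso.hom_inv_id]
    simp⟩

/-- Restriction of a cone along a 1-cell. -/
@[simps]
def pull (c : RawCone Y x) (f : y ⟶ x) : RawCone Y y where
  app k := f ≫ c.app k
  nat h := whiskerLeftIso f (c.nat h) ≪≫ (α_ _ _ _).symm
  nat_id j := by
    have := congrArg (f ◁ ·) (c.nat_id j)
    simp only [whiskerLeft_comp] at this
    simp [reassoc_of% this]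
  nat_comp h h' := by
    have := congrArg (f ◁ ·) (c.nat_comp h h')
    simp only [whiskerLeft_comp] at this
    simp [reassoc_of% this]

/-- The image of a cone under a morphism of diagrams. -/
@[simps]
def push (c : RawCone Y x) (p : Y ⟶ B) : RawCone B x where
  app k := c.app k ≫ p.app (pt k)
  nat {j k} h := whiskerRightIso (c.nat h) _ ≪≫ α_ _ _ _ ≪≫ whiskerLeftIso _ (TwoBModel.nat p h) ≪≫
    (α_ _ _ _).symm
  nat_id j := by
    refine (postcomp_id (m := 𝟙 _) (t := (TwoBModel.nat p (le_refl j)).hom)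
      ((c.nat_id j).trans (Category.id_comp _).symm) (TwoBModel.nat_id p j)).trans ?_
    simp
  nat_comp h h' := by
    have := postcomp_comp (m := 𝟙 _) (ts := (TwoBModel.nat p (h'.trans h)).hom)
      ((c.nat_comp h h').trans (Category.id_comp _).symm) (TwoBModel.nat_comp p h h')
    refine this.trans ?_
    simp

theorem IsMor.pull {c d : RawCone Y x} {m : ∀ k, c.app k ⟶ d.app k} (hm : c.IsMor d m)
    (f : y ⟶ x) : (c.pull f).IsMor (d.pull f) fun k => f ◁ m k :=
  ⟨fun h => whiskerLeft_square (hm.nat h)⟩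

theorem IsMor.push {c d : RawCone Y x} {m : ∀ k, c.app k ⟶ d.app k} (hm : c.IsMor d m)
    (p : Y ⟶ B) : (c.push p).IsMor (d.push p) fun k => m k ▷ p.app (pt k) :=
  ⟨fun h => postcomp_map (hm.nat h)⟩

theorem isMor_whiskerRight (c : RawCone Y x) {f g : y ⟶ x} (μ : f ⟶ g) :
    (c.pull f).IsMor (c.pull g) fun k => μ ▷ c.app k :=
  ⟨fun _ => whiskerRight_square⟩

theorem isMor_pull_pull (c : RawCone Y x) {z : C} (f : z ⟶ y) (g : y ⟶ x) :
    (c.pull (f ≫ g)).IsMor ((c.pull g).pull f) fun k => (α_ f g (c.app k)).hom :=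
  ⟨fun _ => whiskerLeft_whiskerLeft_square⟩

theorem isMor_pull_pull_inv (c : RawCone Y x) {z : C} (f : z ⟶ y) (g : y ⟶ x) :
    ((c.pull g).pull f).IsMor (c.pull (f ≫ g)) fun k => (α_ f g (c.app k)).inv :=
  IsMor.inv (c := c.pull (f ≫ g)) (d := (c.pull g).pull f) (m := fun k => α_ f g (c.app k))
    (c.isMor_pull_pull f g)

theorem isMor_push_pull (c : RawCone Y x) (f : y ⟶ x) (p : Y ⟶ B) :
    ((c.pull f).push p).IsMor ((c.push p).pull f) fun k => (α_ f (c.app k) _).hom :=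
  ⟨fun _ => whiskerLeft_postcomp_square⟩

/-- Universality of a cone: composition with it is an equivalence from `C(x, L)` to the cones
with vertex `x`. -/
structure IsUniv {L : C} (c : RawCone Y L) : Prop where
  lift : ∀ {x : C} (d : RawCone Y x), ∃ (f : x ⟶ L) (e : ∀ k, f ≫ c.app k ≅ d.app k),
    (c.pull f).IsMor d fun k => (e k).hom
  lift₂ : ∀ {x : C} (f g : x ⟶ L) (m : ∀ k, f ≫ c.app k ⟶ g ≫ c.app k),
    (c.pull f).IsMor (c.pull g) m → ∃! μ : f ⟶ g, ∀ k, μ ▷ c.app k = m k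

theorem IsUniv.ext {L : C} {c : RawCone Y L} (hc : c.IsUniv) {f g : x ⟶ L} {μ ν : f ⟶ g}
    (h : ∀ k, μ ▷ c.app k = ν ▷ c.app k) : μ = ν :=
  (hc.lift₂ f g _ (c.isMor_whiskerRight ν)).unique h fun _ => rfl

theorem IsUniv.lift₂_iso {L : C} {c : RawCone Y L} (hc : c.IsUniv) {f g : x ⟶ L}
    (m : ∀ k, f ≫ c.app k ≅ g ≫ c.app k) (hm : (c.pull f).IsMor (c.pull g) fun k => (m k).hom) :
    ∃ μ : f ≅ g, ∀ k, μ.hom ▷ c.app k = (m k).hom := by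
  obtain ⟨a, ha, -⟩ := hc.lift₂ f g _ hm
  obtain ⟨b, hb, -⟩ := hc.lift₂ g f _ hm.inv
  exact ⟨⟨a, b, hc.ext fun i => by simp [ha, hb], hc.ext fun i => by simp [ha, hb]⟩, ha⟩

/-- The raw form of a pseudo-cone. -/
@[simps app]
def ofPseudoCone (c : PseudoCone Y x) : RawCone Y x where
  app k := c.app (pt k)
  nat h := (λ_ _).symm ≪≫ TwoBModel.nat (X := const _ x) c h
  nat_id j := raw_id_iff.1 ((congrArg (· ≫ _) (Iso.hom_inv_id_assoc (λ_ _) _)).trans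
    (TwoBModel.nat_id (X := const _ x) c j))
  nat_comp h h' := raw_comp (TwoBModel.nat_comp (X := const _ x) c h h')

/-- The pseudo-cone with given components and structural 2-cells. -/
def toPseudoCone (c : RawCone Y x) : PseudoCone Y x :=
  mkTrans (X := const _ x) c.app (fun h => λ_ _ ≪≫ c.nat h)
    (fun j => raw_id_iff.2 (c.nat_id j)) (fun h h' => raw_comp_iff.2 (c.nat_comp h h'))

theorem ofPseudoCone_nat (c : PseudoCone Y x) {j k : S} (h : k ≤ j) :
    (TwoBModel.nat (X := const _ x) c h).hom = (λ_ _).hom ≫ ((ofPseudoCone c).nat h).hom :=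
  (Iso.hom_inv_id_assoc (λ_ _) _).symm

theorem constMap_comp_nat (c : PseudoCone Y x) (f : y ⟶ x) {j k : S} (h : k ≤ j) :
    (TwoBModel.nat (X := const _ y) (constMap _ f ≫ c) h).hom =
      (λ_ _).hom ≫ (((ofPseudoCone c).pull f).nat h).hom :=
  constMap_nat (ofPseudoCone_nat c h)

theorem isUniv_of_isBilimit {L : C} {c : PseudoCone Y L} (hc : c.IsBilimit) :
    (ofPseudoCone c).IsUniv where
  lift {x} d := by
    have := hc x
    let e := (PseudoCone.pullFunctor c x).objObjPreimageIso (toPseudoCone d)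
    exact ⟨(PseudoCone.pullFunctor c x).objPreimage (toPseudoCone d),
      fun k => isoApp (X := const _ x) e k, ⟨fun h => (raw_mor_iff (constMap_comp_nat c _ h) rfl).1
        (modification_nat (X := const _ x) e.hom h)⟩⟩
  lift₂ {x} f g m hm := by
    have := hc x
    let Γ : (PseudoCone.pullFunctor c x).obj f ⟶ (PseudoCone.pullFunctor c x).obj g :=
      mkMod (X := const _ x) m fun h =>
        (raw_mor_iff (constMap_comp_nat c f h) (constMap_comp_nat c g h)).2 (hm.nat h)
    obtain ⟨μ, hμ⟩ := (PseudoCone.pullFunctor c x).map_surjective Γ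
    refine ⟨μ, fun k => as_app_congr (X := const _ x) hμ k, fun ν hν => ?_⟩
    refine (PseudoCone.pullFunctor c x).map_injective
      ((mod_ext (X := const _ x) fun k => ?_).trans hμ.symm)
    exact hν k

theorem constMap_toPseudoCone_nat (c : RawCone Y x) (f : y ⟶ x) {j k : S} (h : k ≤ j) :
    (TwoBModel.nat (X := const _ y) (constMap _ f ≫ toPseudoCone c) h).hom =
      (λ_ _).hom ≫ ((c.pull f).nat h).hom :=
  constMap_nat rfl

theorem IsUniv.isBilimit {L : C} {c : RawCone Y L} (hc : c.IsUniv) :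
    (toPseudoCone c).IsBilimit := fun x =>
  { faithful := ⟨fun {f g} μ ν h => hc.ext fun k => as_app_congr (X := const _ x) h k⟩
    full := ⟨fun {f g} Γ => by
      obtain ⟨μ, hμ, -⟩ := hc.lift₂ f g _ ⟨fun h => (raw_mor_iff (constMap_toPseudoCone_nat c f h)
        (constMap_toPseudoCone_nat c g h)).1 (modification_nat (X := const _ x) Γ h)⟩
      exact ⟨μ, mod_ext (X := const _ x) fun k => hμ k⟩⟩
    essSurj := ⟨fun d => by
      obtain ⟨f, e, he⟩ := hc.lift (ofPseudoCone d)
      exact ⟨f, ⟨mkModIso (X := const _ x) e fun h =>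
        (raw_mor_iff (constMap_toPseudoCone_nat c f h) (ofPseudoCone_nat d h)).2 (he.nat h)⟩⟩⟩ }

end RawCone

end RawCone

section ConicalExistence

variable {C : Type u} [Bicategory.{w, v} C]

/-- Reindexing of a diagram along a monotone map. -/
def reindex {T : Type t} [PartialOrder T] {S : Type u₁} [PartialOrder S] (e : T → S)
    (he : Monotone e) (Y : Diag S C) : Diag T C :=
  Diag.mk' (fun k => Y.ob (e k)) (fun h => Y.mp (he h)) (fun j => Y.idm (e j))
    (fun h h' => Y.cmp (he h) (he h')) (fun h h' h'' => Y.cmp_assoc (he h) (he h') (he h''))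
    (fun h => Y.cmp_id_left (he h)) (fun h => Y.cmp_id_right (he h))

namespace RawCone

/-- Bi-limits over finite posets in `Type` are bi-limits with a constant weight. -/
theorem exists_isUniv_of_type (hC : HasFiniteWeightedBilimits C) {T : Type} [PartialOrder T]
    [Finite T] (Y : Diag T C) : ∃ (L : C) (c : RawCone Y L), c.IsUniv := by
  obtain ⟨L, c, hc⟩ := exists_isBilimit_constWeight hC
    (@finiteBicategory_locallyDiscrete Tᵒᵖ _ (Finite.of_equiv T Opposite.equivToOpposite)
      fun a b => inferInstance) Y
  let S := WStr.ofCone c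
  refine ⟨L, { app := fun k => (c.app (pt k)).obj star
               nat := fun h => S.naturality (down h) star
               nat_id := fun j => S.const_nat_id (pt j)
               nat_comp := fun h h' => S.const_nat_comp (down h) (down h') }, ?_, ?_⟩
  · intro x d
    let D : WStr (constWeight (LocallyDiscrete Tᵒᵖ)) Y fun i => d.app i.1.as.unop :=
      WStr.ofFamily (F := Y) (fun a => d.app a.as.unop) (fun s => d.nat (leOfHom s.as.unop))
        (fun {a b s t} η => by
          obtain rfl := LocallyDiscrete.eq_of_hom η
          rw [Y.map₂_eq]
          simp) (fun a => d.nat_id a.as.unop)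
        (fun s t => d.nat_comp (leOfHom s.as.unop) (leOfHom t.as.unop))
    obtain ⟨f, e, he⟩ := hc.lift D.toCone
    exact ⟨f, fun k => e ⟨pt k, star⟩, ⟨fun h => he.naturality (down h) star⟩⟩
  · intro x f g m hm
    obtain ⟨μ, hμ, hu⟩ := hc.lift₂ f g (fun i => m i.1.as.unop)
      (WStr.const_mor _ _ fun s => hm.nat (leOfHom s.as.unop))
    exact ⟨μ, fun k => hμ ⟨pt k, star⟩, fun ν hν => hu ν fun i => hν i.1.as.unop⟩

/-- Families on `T` extend along a bijection `T ≃ S`. -/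
theorem exists_extend {T : Type t} {S : Type u₁} (e : T ≃ S) {A : S → Sort r} (f : ∀ t, A (e t)) :
    ∃ g : ∀ s, A s, ∀ t, g (e t) = f t :=
  ⟨Equiv.piCongrLeft A e f, Equiv.piCongrLeft_apply_apply A e f⟩

/-- Finite weighted bi-limits are indexed by bicategories in `Type`, so the poset is replaced by an
isomorphic one in `Type`. The data of a universal cone are carried back along a bijection by
`exists_extend`, which avoids transport along equalities of elements. -/
theorem exists_isUniv (hC : HasFiniteWeightedBilimits C) {S : Type u₁} [PartialOrder S]
    [Finite S] (Y : Diag S C) : ∃ (L : C) (c : RawCone Y L), c.IsUniv := by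
  obtain ⟨T, ⟨e⟩⟩ : ∃ T : Type, Nonempty (T ≃ S) := ⟨_, ⟨(Finite.equivFin S).symm⟩⟩
  have := Finite.of_equiv S e.symm
  let _ : PartialOrder T := PartialOrder.lift e e.injective
  obtain ⟨L, c, hc⟩ := exists_isUniv_of_type hC (reindex e (fun _ _ h => h) Y)
  obtain ⟨app, happ⟩ := exists_extend e (A := fun k => L ⟶ Y.ob k) c.app
  obtain ⟨capp, cnat, cid, ccomp⟩ := c
  obtain rfl : (fun t => app (e t)) = capp := funext happ
  have h₁ : ∀ t : T, ∃ n : ∀ (k : S) (h : k ≤ e t), app k ≅ app (e t) ≫ Y.mp h,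
      ∀ (t' : T) (h : t' ≤ t), n (e t') h = cnat h := fun t => by
    obtain ⟨n, hn⟩ := exists_extend e (A := fun k => ∀ h : k ≤ e t, app k ≅ app (e t) ≫ Y.mp h)
      fun t' h => cnat h
    exact ⟨n, fun t' h => congrFun (hn t') h⟩
  choose n₁ hn₁ using h₁
  obtain ⟨n, hn⟩ := exists_extend e
    (A := fun j => ∀ (k : S) (h : k ≤ j), app k ≅ app j ≫ Y.mp h) n₁
  have hn' : ∀ (t t' : T) (h : t' ≤ t), n (e t) (e t') h = cnat h := fun t t' h => by
    rw [hn, hn₁]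
  obtain rfl : (fun {j k} h => n (e j) (e k) h) = @cnat := by
    funext j k h
    exact hn' j k h
  refine ⟨L, { app := app, nat := fun {j k} h => n j k h, nat_id := ?_, nat_comp := ?_ }, ?_, ?_⟩
  · intro j
    obtain ⟨j, rfl⟩ := e.surjective j
    exact cid j
  · intro j k l h h'
    obtain ⟨j, rfl⟩ := e.surjective j
    obtain ⟨k, rfl⟩ := e.surjective k
    obtain ⟨l, rfl⟩ := e.surjective l
    exact ccomp (j := j) (k := k) (l := l) h h'
  · intro x d
    obtain ⟨f, θ, hθ⟩ := hc.lift (Y := reindex e _ Y)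
      { app := fun t => d.app (e t), nat := fun h => d.nat h, nat_id := fun t => d.nat_id (e t)
        nat_comp := fun h h' => d.nat_comp h h' }
    obtain ⟨θ', hθ'⟩ := exists_extend e (A := fun k => f ≫ app k ≅ d.app k) θ
    obtain rfl : (fun t => θ' (e t)) = θ := funext hθ'
    refine ⟨f, θ', ⟨fun {j k} h => ?_⟩⟩
    obtain ⟨j, rfl⟩ := e.surjective j
    obtain ⟨k, rfl⟩ := e.surjective k
    exact hθ.nat (j := j) (k := k) h
  · intro x f g m hm
    obtain ⟨μ, hμ, hu⟩ := hc.lift₂ f g (fun t => m (e t))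
      ⟨fun {j k} h => hm.nat (j := e j) (k := e k) h⟩
    refine ⟨μ, fun k => ?_, fun ν hν => hu ν fun t => hν (e t)⟩
    obtain ⟨k, rfl⟩ := e.surjective k
    exact hμ k

end RawCone

section Cospan

open Limits

variable {y z d : C} (p : y ⟶ d) (f : z ⟶ d)

/-- The objects of a cospan. -/
def cospanObj (_ : y ⟶ d) (_ : z ⟶ d) : WalkingCospan → C
  | .one => d
  | .left => y
  | .right => z

/-- The 1-cells of a cospan. -/
def cospanMap : ∀ {a b : WalkingCospan}, (a ⟶ b) → (cospanObj p f a ⟶ cospanObj p f b)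
  | _, _, .id _ => 𝟙 _
  | _, _, .term .left => p
  | _, _, .term .right => f

theorem cospan_coherence₁ {a b : C} (g : a ⟶ b) :
    𝟙 g = (λ_ g).inv ≫ (λ_ (𝟙 a)).inv ▷ g ≫ (α_ _ _ _).hom ≫ 𝟙 a ◁ (λ_ g).hom ≫ (λ_ g).hom := by
  bicategory

theorem cospan_coherence₂ {a b : C} (g : a ⟶ b) :
    𝟙 g = (ρ_ g).inv ≫ (λ_ g).inv ▷ 𝟙 b ≫ (α_ _ _ _).hom ≫ 𝟙 a ◁ (ρ_ g).hom ≫ (λ_ g).hom := by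
  bicategory

theorem cospan_coherence₃ {a b : C} (g : a ⟶ b) :
    𝟙 g = (ρ_ g).inv ≫ (ρ_ g).inv ▷ 𝟙 b ≫ (α_ _ _ _).hom ≫ g ◁ (λ_ (𝟙 b)).hom ≫ (ρ_ g).hom := by
  bicategory

/-- The composition constraint of the pseudofunctor given by a cospan. -/
def cospanMapComp : ∀ {a b c : WalkingCospan} (s : a ⟶ b) (t : b ⟶ c),
    cospanMap p f (s ≫ t) ≅ cospanMap p f s ≫ cospanMap p f t
  | _, _, _, .id _, .id _ => (λ_ (𝟙 _)).symm
  | _, _, _, .id _, .term .left => (λ_ p).symm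
  | _, _, _, .id _, .term .right => (λ_ f).symm
  | _, _, _, .term .left, .id _ => (ρ_ p).symm
  | _, _, _, .term .right, .id _ => (ρ_ f).symm

theorem cospanMap_assoc : ∀ {a b c e : WalkingCospan} (s : a ⟶ b) (t : b ⟶ c) (r : c ⟶ e),
    eqToHom (congrArg (cospanMap p f) (Category.assoc s t r)) = (cospanMapComp p f (s ≫ t) r).hom ≫
      (cospanMapComp p f s t).hom ▷ cospanMap p f r ≫ (α_ _ _ _).hom ≫
        cospanMap p f s ◁ (cospanMapComp p f t r).inv ≫ (cospanMapComp p f s (t ≫ r)).inv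
  | _, _, _, _, .id _, .id _, .id _ => cospan_coherence₁ (𝟙 _)
  | _, _, _, _, .id _, .id _, .term .left => cospan_coherence₁ p
  | _, _, _, _, .id _, .id _, .term .right => cospan_coherence₁ f
  | _, _, _, _, .id _, .term .left, .id _ => cospan_coherence₂ p
  | _, _, _, _, .id _, .term .right, .id _ => cospan_coherence₂ f
  | _, _, _, _, .term .left, .id _, .id _ => cospan_coherence₃ p
  | _, _, _, _, .term .right, .id _, .id _ => cospan_coherence₃ f

theorem cospanMap_id : ∀ {a b : WalkingCospan} (s : a ⟶ b),
    eqToHom (congrArg (cospanMap p f) (Category.id_comp s)) = (cospanMapComp p f (𝟙 a) s).hom ≫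
      (Iso.refl (𝟙 _)).hom ▷ cospanMap p f s ≫ (λ_ _).hom
  | _, _, .id _ => by change 𝟙 (𝟙 _) = (λ_ (𝟙 _)).inv ≫ 𝟙 (𝟙 _) ▷ 𝟙 _ ≫ (λ_ (𝟙 _)).hom; simp
  | _, _, .term .left => by change 𝟙 p = (λ_ p).inv ≫ 𝟙 (𝟙 _) ▷ p ≫ (λ_ p).hom; simp
  | _, _, .term .right => by change 𝟙 f = (λ_ f).inv ≫ 𝟙 (𝟙 _) ▷ f ≫ (λ_ f).hom; simp

theorem cospanMap_comp_id : ∀ {a b : WalkingCospan} (s : a ⟶ b),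
    eqToHom (congrArg (cospanMap p f) (Category.comp_id s)) = (cospanMapComp p f s (𝟙 b)).hom ≫
      cospanMap p f s ◁ (Iso.refl (𝟙 _)).hom ≫ (ρ_ _).hom
  | _, _, .id _ => by
    change 𝟙 (𝟙 _) = (λ_ (𝟙 _)).inv ≫ 𝟙 _ ◁ 𝟙 (𝟙 _) ≫ (ρ_ (𝟙 _)).hom
    simp
  | _, _, .term .left => by change 𝟙 p = (ρ_ p).inv ≫ p ◁ 𝟙 (𝟙 _) ≫ (ρ_ p).hom; simp
  | _, _, .term .right => by change 𝟙 f = (ρ_ f).inv ≫ f ◁ 𝟙 (𝟙 _) ≫ (ρ_ f).hom; simp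

/-- The pseudofunctor on the cospan shape given by a cospan of 1-cells. -/
def cospanPseudofunctor : LocallyDiscrete WalkingCospan ⥤ᵖ C where
  obj a := cospanObj p f a.as
  map s := cospanMap p f s.as
  map₂ η := eqToHom (by rw [LocallyDiscrete.eq_of_hom η])
  mapId _ := Iso.refl _
  mapComp s t := cospanMapComp p f s.as t.as
  map₂_whisker_left s t t' η := by
    obtain rfl := LocallyDiscrete.eq_of_hom η
    simp
  map₂_whisker_right η s := by
    obtain rfl := LocallyDiscrete.eq_of_hom η
    simp
  map₂_associator s t r := cospanMap_assoc p f s.as t.as r.as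
  map₂_left_unitor s := cospanMap_id p f s.as
  map₂_right_unitor s := cospanMap_comp_id p f s.as

end Cospan

end ConicalExistence

section Bipullback

open Limits

variable {C : Type u} [Bicategory.{w, v} C] {x y z d : C} {p : y ⟶ d} {f : z ⟶ d}

/-- The components of the cone over a cospan given by a square. -/
def cospanCone (h₀ : x ⟶ y) (h₁ : x ⟶ z) (_ : h₀ ≫ p ≅ h₁ ≫ f) :
    ∀ a : WalkingCospan, x ⟶ cospanObj p f a
  | .one => h₁ ≫ f
  | .left => h₀
  | .right => h₁

/-- The structural 2-cells of the cone over a cospan given by a square. -/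
def cospanConeNat (h₀ : x ⟶ y) (h₁ : x ⟶ z) (γ : h₀ ≫ p ≅ h₁ ≫ f) :
    ∀ {a b : WalkingCospan} (s : a ⟶ b), cospanCone h₀ h₁ γ b ≅
      cospanCone h₀ h₁ γ a ≫ cospanMap p f s
  | _, _, .id _ => (ρ_ _).symm
  | _, _, .term .left => γ.symm
  | _, _, .term .right => Iso.refl _

theorem cospanConeNat_comp (h₀ : x ⟶ y) (h₁ : x ⟶ z) (γ : h₀ ≫ p ≅ h₁ ≫ f) :
    ∀ {a b c : WalkingCospan} (s : a ⟶ b) (t : b ⟶ c),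
      (cospanConeNat h₀ h₁ γ (s ≫ t)).hom ≫ cospanCone h₀ h₁ γ a ◁ (cospanMapComp p f s t).hom =
        (cospanConeNat h₀ h₁ γ t).hom ≫ (cospanConeNat h₀ h₁ γ s).hom ▷ cospanMap p f t ≫
          (α_ _ _ _).hom
  | _, _, _, .id _, .id _ => by
    change (ρ_ _).inv ≫ _ ◁ (λ_ (𝟙 _)).inv = (ρ_ _).inv ≫ (ρ_ _).inv ▷ 𝟙 _ ≫ (α_ _ _ _).hom
    simp
  | _, _, _, .id _, .term .left => by
    change γ.inv ≫ h₀ ◁ (λ_ p).inv = γ.inv ≫ (ρ_ _).inv ▷ p ≫ (α_ _ _ _).hom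
    simp
  | _, _, _, .id _, .term .right => by
    change 𝟙 _ ≫ h₁ ◁ (λ_ f).inv = 𝟙 _ ≫ (ρ_ _).inv ▷ f ≫ (α_ _ _ _).hom
    simp
  | _, _, _, .term .left, .id _ => by
    change γ.inv ≫ h₀ ◁ (ρ_ p).inv = (ρ_ _).inv ≫ γ.inv ▷ 𝟙 _ ≫ (α_ _ _ _).hom
    simp
  | _, _, _, .term .right, .id _ => by
    change 𝟙 _ ≫ h₁ ◁ (ρ_ f).inv = (ρ_ _).inv ≫ 𝟙 _ ▷ 𝟙 _ ≫ (α_ _ _ _).hom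
    simp

theorem id_square {a b : C} {e e' : a ⟶ b} {i : b ⟶ b} (j : i ≅ 𝟙 b) {n : e ⟶ e ≫ i}
    {n' : e' ⟶ e' ≫ i} (hn : n ≫ e ◁ j.hom = (ρ_ _).inv) (hn' : n' ≫ e' ◁ j.hom = (ρ_ _).inv)
    (m : e ⟶ e') : m ≫ n' = n ≫ m ▷ i := by
  rw [← cancel_mono (e' ◁ j.hom), Category.assoc, hn', Category.assoc, ← whisker_exchange,
    reassoc_of% hn]
  simp

theorem bipullback_mor_left {x q y z d : C} {u u' : x ⟶ q} {π₀ : q ⟶ y} {π₁ : q ⟶ z} {π₂ : q ⟶ d}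
    {p : y ⟶ d} {f : z ⟶ d} {n : π₂ ≅ π₀ ≫ p} {n' : π₂ ≅ π₁ ≫ f} {ρ₀ : u ≫ π₀ ⟶ u' ≫ π₀}
    {ρ₁ : u ≫ π₁ ⟶ u' ≫ π₁}
    (h : ρ₀ ▷ p ≫ (α_ u' π₀ p).hom ≫ u' ◁ (n.symm ≪≫ n').hom ≫ (α_ u' π₁ f).inv =
      (α_ u π₀ p).hom ≫ u ◁ (n.symm ≪≫ n').hom ≫ (α_ u π₁ f).inv ≫ ρ₁ ▷ f) :
    (u ◁ n'.hom ≫ (α_ _ _ _).inv ≫ ρ₁ ▷ f ≫ (α_ _ _ _).hom ≫ u' ◁ n'.inv) ≫ u' ◁ n.hom ≫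
      (α_ _ _ _).inv = (u ◁ n.hom ≫ (α_ _ _ _).inv) ≫ ρ₀ ▷ p := by
  have h' : ρ₀ ▷ p = ((α_ u π₀ p).hom ≫ u ◁ (n.symm ≪≫ n').hom ≫ (α_ u π₁ f).inv ≫ ρ₁ ▷ f) ≫
      (α_ u' π₁ f).hom ≫ u' ◁ (n.symm ≪≫ n').inv ≫ (α_ u' π₀ p).inv := by
    rw [← h]
    simp
  rw [h']
  simp

theorem bipullback_lift {x q y z d : C} {u : x ⟶ q} {π₀ : q ⟶ y} {π₁ : q ⟶ z} {π₂ : q ⟶ d}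
    {p : y ⟶ d} {f : z ⟶ d} {n : π₂ ≅ π₀ ≫ p} {n' : π₂ ≅ π₁ ≫ f} {h₀ : x ⟶ y} {h₁ : x ⟶ z}
    {γ : h₀ ≫ p ≅ h₁ ≫ f} {e₀ : u ≫ π₀ ≅ h₀} {e₁ : u ≫ π₁ ≅ h₁} {e₂ : u ≫ π₂ ≅ h₁ ≫ f}
    (h : e₂.hom ≫ γ.inv = (u ◁ n.hom ≫ (α_ _ _ _).inv) ≫ e₀.hom ▷ p)
    (h' : e₂.hom ≫ 𝟙 _ = (u ◁ n'.hom ≫ (α_ _ _ _).inv) ≫ e₁.hom ▷ f) :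
    e₀.hom ▷ p ≫ γ.hom = (α_ u π₀ p).hom ≫ u ◁ (n.symm ≪≫ n').hom ≫ (α_ u π₁ f).inv ≫
      e₁.hom ▷ f := by
  rw [Category.comp_id] at h'
  have h₃ : e₀.hom ▷ p = ((α_ _ _ _).hom ≫ u ◁ n.inv) ≫ e₂.hom ≫ γ.inv := by
    rw [h]
    simp [← whiskerLeft_comp_assoc]
  rw [h₃, h']
  simp

theorem bipullback_unique {x q z d : C} {u u' : x ⟶ q} {π₁ : q ⟶ z} {π₂ : q ⟶ d}
    {f : z ⟶ d} {n' : π₂ ≅ π₁ ≫ f} {ρ₁ : u ≫ π₁ ⟶ u' ≫ π₁} {ν : u ⟶ u'} (h : ν ▷ π₁ = ρ₁) :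
    ν ▷ π₂ = u ◁ n'.hom ≫ (α_ _ _ _).inv ≫ ρ₁ ▷ f ≫ (α_ _ _ _).hom ≫ u' ◁ n'.inv := by
  rw [← h]
  simp only [whiskerRight_comp_symm_assoc, Iso.inv_hom_id_assoc, whisker_exchange_assoc]
  simp [← whiskerLeft_comp]

/-- A bi-pullback is a bi-limit over the cospan, where the third component of a cone is determined
up to isomorphism by the other two. -/
theorem exists_isBipullback (hC : HasFiniteWeightedBilimits C) (p : y ⟶ d) (f : z ⟶ d) :
    ∃ (q : C) (π₀ : q ⟶ y) (π₁ : q ⟶ z) (α : π₀ ≫ p ≅ π₁ ≫ f), IsBipullback π₀ π₁ α := by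
  obtain ⟨q, c, hc⟩ := exists_isBilimit_constWeight hC
    (@finiteBicategory_locallyDiscrete WalkingCospan _ inferInstance
      fun a b => inferInstance) (cospanPseudofunctor p f)
  let S := WStr.ofCone c
  let π₀ : q ⟶ y := (c.app ⟨.left⟩).obj star
  let π₁ : q ⟶ z := (c.app ⟨.right⟩).obj star
  let π₂ : q ⟶ d := (c.app ⟨.one⟩).obj star
  let n : π₂ ≅ π₀ ≫ p := S.naturality (a := ⟨.left⟩) (b := ⟨.one⟩) ⟨WalkingCospan.Hom.inl⟩ star
  let n' : π₂ ≅ π₁ ≫ f := S.naturality (a := ⟨.right⟩) (b := ⟨.one⟩) ⟨WalkingCospan.Hom.inr⟩ star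
  refine ⟨q, π₀, π₁, n.symm ≪≫ n', ⟨fun x h₀ h₁ γ => ?_, fun x u u' ρ₀ ρ₁ hρ => ?_⟩⟩
  · let D : WStr (constWeight (LocallyDiscrete WalkingCospan)) (cospanPseudofunctor p f)
        fun i => cospanCone h₀ h₁ γ i.1.as :=
      WStr.ofFamily (F := cospanPseudofunctor p f) (fun a => cospanCone h₀ h₁ γ a.as)
        (fun s => cospanConeNat h₀ h₁ γ s.as)
        (fun {a b s t} η => by
          obtain rfl := LocallyDiscrete.eq_of_hom η
          obtain rfl : η = 𝟙 _ := Subsingleton.elim _ _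
          rw [(cospanPseudofunctor p f).map₂_id]
          exact (congrArg (_ ≫ ·) (whiskerLeft_id _ _)).trans (Category.comp_id _))
        (fun a => (congrArg (_ ≫ ·) (whiskerLeft_id _ _)).trans (Category.comp_id _))
        (fun s t => cospanConeNat_comp h₀ h₁ γ s.as t.as)
    obtain ⟨u, e, he⟩ := hc.lift D.toCone
    refine ⟨u, e ⟨⟨.left⟩, star⟩, e ⟨⟨.right⟩, star⟩, ?_⟩
    have h₁ := he.naturality (a := ⟨.left⟩) (b := ⟨.one⟩) ⟨WalkingCospan.Hom.inl⟩ star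
    have h₂ := he.naturality (a := ⟨.right⟩) (b := ⟨.one⟩) ⟨WalkingCospan.Hom.inr⟩ star
    exact bipullback_lift h₁ h₂
  · -- the component at the vertex of the cospan is forced by the one at the right
    let m₂ : u ≫ π₂ ⟶ u' ≫ π₂ :=
      u ◁ n'.hom ≫ (α_ _ _ _).inv ≫ ρ₁ ▷ f ≫ (α_ _ _ _).hom ≫ u' ◁ n'.inv
    let m : ∀ i : (Σ a : LocallyDiscrete WalkingCospan, (constWeight _).obj a),
        u ≫ (c.app i.1).obj i.2 ⟶ u' ≫ (c.app i.1).obj i.2 := fun i =>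
      match i with
      | ⟨⟨.one⟩, _⟩ => m₂
      | ⟨⟨.left⟩, _⟩ => ρ₀
      | ⟨⟨.right⟩, _⟩ => ρ₁
    have key : ∀ {a b : WalkingCospan} (s : a ⟶ b), m ⟨⟨b⟩, star⟩ ≫
        ((S.pull u').naturality (a := ⟨a⟩) (b := ⟨b⟩) ⟨s⟩ star).hom =
        ((S.pull u).naturality (a := ⟨a⟩) (b := ⟨b⟩) ⟨s⟩ star).hom ≫
          m ⟨⟨a⟩, star⟩ ▷ cospanMap p f s
      | _, _, .id a => id_square (Iso.refl _) ((S.pull u).const_nat_id ⟨a⟩)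
          ((S.pull u').const_nat_id ⟨a⟩) _
      | _, _, .term .left => bipullback_mor_left hρ
      | _, _, .term .right => by
        change m₂ ≫ u' ◁ n'.hom ≫ (α_ _ _ _).inv = (u ◁ n'.hom ≫ (α_ _ _ _).inv) ≫ ρ₁ ▷ f
        simp [m₂, ← whiskerLeft_comp_assoc]
    obtain ⟨μ, hμ, hu⟩ := hc.lift₂ u u' m (WStr.const_mor _ _ fun {a b} s => key s.as)
    refine ⟨μ, ⟨hμ ⟨⟨.left⟩, star⟩, hμ ⟨⟨.right⟩, star⟩⟩, fun ν hν => hu ν fun i => ?_⟩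
    obtain ⟨⟨_ | _ | _⟩, ⟨⟨⟩⟩⟩ := i
    · change ν ▷ π₂ = m₂
      exact bipullback_unique hν.2
    · exact hν.1
    · exact hν.2

end Bipullback

/-! ### Matching triples and their universal property -/

section Triples

variable {S : Type u₁} [PartialOrder S] {C : Type u} [Bicategory.{w, v} C]

/-- For a morphism `p : Y ⟶ B` of diagrams and a cone `c` over `B` with vertex `b₀`, a triple
consists of a cone over `Y`, a 1-cell to `b₀` and an invertible 2-cell between the two induced
cones over `B`. -/
structure Triple {Y B : Diag S C} (p : Y ⟶ B) {b₀ : C} (c : RawCone B b₀) (x : C) where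
  cone : RawCone Y x
  base : x ⟶ b₀
  cell (k : S) : cone.app k ≫ p.app (pt k) ≅ base ≫ c.app k
  isMor_cell : (cone.push p).IsMor (c.pull base) fun k => (cell k).hom

namespace Triple

variable {Y B : Diag S C} {p : Y ⟶ B} {b₀ : C} {c : RawCone B b₀} {x y z : C}

/-- Restriction of a triple along a 1-cell. -/
@[simps cone base cell]
def pull (T : Triple p c x) (f : y ⟶ x) : Triple p c y where
  cone := T.cone.pull f
  base := f ≫ T.base
  cell k := α_ _ _ _ ≪≫ whiskerLeftIso f (T.cell k) ≪≫ (α_ _ _ _).symm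
  isMor_cell := (RawCone.isMor_push_pull T.cone f p).comp ((T.isMor_cell.pull f).comp
    (c.isMor_pull_pull_inv f T.base))

/-- A family of 2-cells between the components of two triples that is compatible with their

structure. -/
structure IsMor (T T' : Triple p c x) (θ : ∀ k, T.cone.app k ⟶ T'.cone.app k)
    (r : T.base ⟶ T'.base) : Prop where
  cone : T.cone.IsMor T'.cone θ
  cell (k : S) : θ k ▷ p.app (pt k) ≫ (T'.cell k).hom = (T.cell k).hom ≫ r ▷ c.app k

variable {T T' T'' : Triple p c x}

theorem IsMor.comp {θ : ∀ k, T.cone.app k ⟶ T'.cone.app k} {r : T.base ⟶ T'.base}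
    {θ' : ∀ k, T'.cone.app k ⟶ T''.cone.app k} {r' : T'.base ⟶ T''.base} (h : T.IsMor T' θ r)
    (h' : T'.IsMor T'' θ' r') : T.IsMor T'' (fun k => θ k ≫ θ' k) (r ≫ r') :=
  ⟨h.cone.comp h'.cone, fun k => by
    simp [h'.cell, reassoc_of% (h.cell k)]⟩

theorem IsMor.inv {θ : ∀ k, T.cone.app k ≅ T'.cone.app k} {r : T.base ≅ T'.base}
    (h : T.IsMor T' (fun k => (θ k).hom) r.hom) : T'.IsMor T (fun k => (θ k).inv) r.inv :=
  ⟨h.cone.inv, fun k => by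
    rw [← cancel_epi ((θ k).hom ▷ p.app (pt k)), reassoc_of% (h.cell k)]
    simp⟩

theorem isMor_id (T : Triple p c x) : T.IsMor T (fun _ => 𝟙 _) (𝟙 _) :=
  ⟨⟨fun h => by simp⟩, fun k => by simp⟩

theorem pull_square {z x a b a' : C} {f : z ⟶ x} {d d' : x ⟶ a} {e e' : x ⟶ a'} {s : a ⟶ b}
    {s' : a' ⟶ b} {m : d ⟶ d'} {m' : e ⟶ e'} {n : d ≫ s ⟶ e ≫ s'} {n' : d' ≫ s ⟶ e' ≫ s'}
    (h : m ▷ s ≫ n' = n ≫ m' ▷ s') :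
    (f ◁ m) ▷ s ≫ (α_ _ _ _).hom ≫ f ◁ n' ≫ (α_ _ _ _).inv =
      ((α_ _ _ _).hom ≫ f ◁ n ≫ (α_ _ _ _).inv) ≫ (f ◁ m') ▷ s' := by
  calc _ = 𝟙 _ ⊗≫ f ◁ (m ▷ s ≫ n') ⊗≫ 𝟙 _ := by bicategory
    _ = _ := by rw [h]; bicategory

theorem whisker_square {z x a b a' : C} {f g : z ⟶ x} {μ : f ⟶ g} {d : x ⟶ a} {e : x ⟶ a'}
    {s : a ⟶ b} {s' : a' ⟶ b} {n : d ≫ s ⟶ e ≫ s'} :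
    (μ ▷ d) ▷ s ≫ (α_ _ _ _).hom ≫ g ◁ n ≫ (α_ _ _ _).inv =
      ((α_ _ _ _).hom ≫ f ◁ n ≫ (α_ _ _ _).inv) ≫ (μ ▷ e) ▷ s' := by
  calc _ = 𝟙 _ ⊗≫ (μ ▷ (d ≫ s) ≫ g ◁ n) ⊗≫ 𝟙 _ := by bicategory
    _ = _ := by rw [← whisker_exchange]; bicategory

theorem pull_pull_square {w z x a b a' : C} {f : w ⟶ z} {g : z ⟶ x} {d : x ⟶ a} {e : x ⟶ a'}
    {s : a ⟶ b} {s' : a' ⟶ b} {n : d ≫ s ⟶ e ≫ s'} :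
    (α_ f g d).hom ▷ s ≫ (α_ _ _ _).hom ≫ f ◁ ((α_ _ _ _).hom ≫ g ◁ n ≫ (α_ _ _ _).inv) ≫
        (α_ _ _ _).inv =
      ((α_ _ _ _).hom ≫ (f ≫ g) ◁ n ≫ (α_ _ _ _).inv) ≫ (α_ f g e).hom ▷ s' := by
  bicategory

theorem IsMor.pull {θ : ∀ k, T.cone.app k ⟶ T'.cone.app k} {r : T.base ⟶ T'.base}
    (h : T.IsMor T' θ r) (f : y ⟶ x) : (T.pull f).IsMor (T'.pull f) (fun k => f ◁ θ k) (f ◁ r) :=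
  ⟨h.cone.pull f, fun k => pull_square (h.cell k)⟩

theorem isMor_whiskerRight (T : Triple p c x) {f g : y ⟶ x} (μ : f ⟶ g) :
    (T.pull f).IsMor (T.pull g) (fun k => μ ▷ T.cone.app k) (μ ▷ T.base) :=
  ⟨T.cone.isMor_whiskerRight μ, fun _ => whisker_square⟩

theorem isMor_pull_pull (T : Triple p c x) (f : z ⟶ y) (g : y ⟶ x) :
    (T.pull (f ≫ g)).IsMor ((T.pull g).pull f) (fun k => (α_ f g (T.cone.app k)).hom)
      (α_ f g T.base).hom :=
  ⟨T.cone.isMor_pull_pull f g, fun _ => pull_pull_square⟩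

theorem isMor_pull_pull_inv (T : Triple p c x) (f : z ⟶ y) (g : y ⟶ x) :
    ((T.pull g).pull f).IsMor (T.pull (f ≫ g)) (fun k => (α_ f g (T.cone.app k)).inv)
      (α_ f g T.base).inv :=
  IsMor.inv (T := T.pull (f ≫ g)) (T' := (T.pull g).pull f)
    (θ := fun k => α_ f g (T.cone.app k)) (r := α_ f g T.base) (T.isMor_pull_pull f g)

/-- Universality of a triple: composition with it is an equivalence from `C(x, q)` to the triples
with vertex `x`. -/
structure IsUniv {q : C} (T : Triple p c q) : Prop where
  lift : ∀ {x : C} (D : Triple p c x), ∃ (f : x ⟶ q) (θ : ∀ k, f ≫ T.cone.app k ≅ D.cone.app k)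
    (r : f ≫ T.base ≅ D.base), (T.pull f).IsMor D (fun k => (θ k).hom) r.hom
  lift₂ : ∀ {x : C} (f g : x ⟶ q) (θ : ∀ k, f ≫ T.cone.app k ⟶ g ≫ T.cone.app k)
    (r : f ≫ T.base ⟶ g ≫ T.base), (T.pull f).IsMor (T.pull g) θ r →
      ∃! μ : f ⟶ g, (∀ k, μ ▷ T.cone.app k = θ k) ∧ μ ▷ T.base = r

theorem IsUniv.ext {q : C} {T : Triple p c q} (hT : T.IsUniv) {f g : x ⟶ q} {μ ν : f ⟶ g}
    (h : ∀ k, μ ▷ T.cone.app k = ν ▷ T.cone.app k) (h' : μ ▷ T.base = ν ▷ T.base) : μ = ν :=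
  (hT.lift₂ f g _ _ (T.isMor_whiskerRight ν)).unique ⟨h, h'⟩ ⟨fun _ => rfl, rfl⟩

theorem IsUniv.lift₂_iso {q : C} {T : Triple p c q} (hT : T.IsUniv) {f g : x ⟶ q}
    (θ : ∀ k, f ≫ T.cone.app k ≅ g ≫ T.cone.app k) (r : f ≫ T.base ≅ g ≫ T.base)
    (h : (T.pull f).IsMor (T.pull g) (fun k => (θ k).hom) r.hom) :
    ∃ μ : f ≅ g, (∀ k, μ.hom ▷ T.cone.app k = (θ k).hom) ∧ μ.hom ▷ T.base = r.hom := by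
  obtain ⟨a, ⟨ha, ha'⟩, -⟩ := hT.lift₂ f g _ _ h
  obtain ⟨b, ⟨hb, hb'⟩, -⟩ := hT.lift₂ g f _ _ h.inv
  exact ⟨⟨a, b, hT.ext (fun i => by simp [ha, hb]) (by simp [ha', hb']),
    hT.ext (fun i => by simp [ha, hb]) (by simp [ha', hb'])⟩, ha, ha'⟩

/-- The lifting property of `i` against the 1-cell to the universal triple that a triple `E`
induces, stated without reference to the universal triple. -/
def HasLift {a x y : C} (i : a ⟶ x) (E : Triple p c y) : Prop :=
  ∀ (f : a ⟶ y) (D : Triple p c x) (s : ∀ k, f ≫ E.cone.app k ≅ i ≫ D.cone.app k)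
    (ω : f ≫ E.base ≅ i ≫ D.base),
    (E.pull f).IsMor (D.pull i) (fun k => (s k).hom) ω.hom →
    ∃ (g : x ⟶ y) (l : f ≅ i ≫ g) (θ : ∀ k, g ≫ E.cone.app k ≅ D.cone.app k)
      (r : g ≫ E.base ≅ D.base), (E.pull g).IsMor D (fun k => (θ k).hom) r.hom ∧
        (∀ k, l.hom ▷ E.cone.app k ≫ (α_ _ _ _).hom ≫ i ◁ (θ k).hom = (s k).hom) ∧
          l.hom ▷ E.base ≫ (α_ _ _ _).hom ≫ i ◁ r.hom = ω.hom

theorem hasLift_aux {a x y q g₀ : C} {i : a ⟶ x} {f : a ⟶ y} {q' : y ⟶ q} {T : q ⟶ g₀}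
    {E : y ⟶ g₀} {D : x ⟶ g₀} {h : x ⟶ q} {ψ : q' ≫ T ≅ E} {m : f ≫ E ⟶ i ≫ D} {e : h ≫ T ≅ D}
    {γ : f ≫ q' ⟶ i ≫ h} {g : x ⟶ y} {l : f ⟶ i ≫ g} {r : g ≫ q' ⟶ h}
    (hγ : γ ▷ T = (α_ _ _ _).hom ≫ f ◁ ψ.hom ≫ m ≫ i ◁ e.inv ≫ (α_ _ _ _).inv)
    (hl : l ▷ q' ≫ (α_ _ _ _).hom ≫ i ◁ r = γ) :
    l ▷ E ≫ (α_ _ _ _).hom ≫ i ◁ (g ◁ ψ.inv ≫ (α_ _ _ _).inv ≫ r ▷ T ≫ e.hom) = m := by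
  calc _ = (l ▷ E ≫ (i ≫ g) ◁ ψ.inv) ⊗≫ i ◁ r ▷ T ⊗≫ i ◁ e.hom ⊗≫ 𝟙 _ := by bicategory
    _ = f ◁ ψ.inv ⊗≫ (l ▷ q' ≫ (α_ _ _ _).hom ≫ i ◁ r) ▷ T ⊗≫ i ◁ e.hom ⊗≫ 𝟙 _ := by
      rw [← whisker_exchange]; bicategory
    _ = f ◁ (ψ.inv ≫ ψ.hom) ⊗≫ m ⊗≫ i ◁ (e.inv ≫ e.hom) ⊗≫ 𝟙 _ := by rw [hl, hγ]; bicategory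
    _ = _ := by rw [Iso.inv_hom_id, Iso.inv_hom_id]; bicategory

theorem hasLift_aux' {a x y q g₀ : C} {i : a ⟶ x} {f : a ⟶ y} {q' : y ⟶ q} {T : q ⟶ g₀}
    {E : y ⟶ g₀} {h : x ⟶ q} {ψ : q' ≫ T ≅ E}
    {γ : f ≫ q' ⟶ i ≫ h} {g : x ⟶ y} {l : f ⟶ i ≫ g} {r : g ≫ q' ⟶ h} {θ : g ≫ E ⟶ h ≫ T}
    (hr : r ▷ T = (α_ _ _ _).hom ≫ g ◁ ψ.hom ≫ θ)
    (hl : l ▷ E ≫ (α_ _ _ _).hom ≫ i ◁ θ = f ◁ ψ.inv ≫ (α_ _ _ _).inv ≫ γ ▷ T ≫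
      (α_ _ _ _).hom) :
    (l ▷ q' ≫ (α_ _ _ _).hom ≫ i ◁ r) ▷ T = γ ▷ T := by
  calc _ = 𝟙 _ ⊗≫ l ▷ q' ▷ T ⊗≫ i ◁ (r ▷ T) ⊗≫ 𝟙 _ := by bicategory
    _ = 𝟙 _ ⊗≫ (l ▷ (q' ≫ T) ≫ (i ≫ g) ◁ ψ.hom) ⊗≫ i ◁ θ ⊗≫ 𝟙 _ := by rw [hr]; bicategory
    _ = 𝟙 _ ⊗≫ f ◁ ψ.hom ⊗≫ (l ▷ E ≫ (α_ _ _ _).hom ≫ i ◁ θ) ⊗≫ 𝟙 _ := by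
      rw [← whisker_exchange]; bicategory
    _ = 𝟙 _ ⊗≫ f ◁ (ψ.hom ≫ ψ.inv) ⊗≫ γ ▷ T ⊗≫ 𝟙 _ := by rw [hl]; bicategory
    _ = _ := by rw [Iso.hom_inv_id]; bicategory

/-- The induced 1-cell to the universal triple has the lifting property if and only if the triple
has it. -/
theorem IsUniv.hasLifting_iff {q : C} {T : Triple p c q} (hT : T.IsUniv) {E : Triple p c y}
    {q' : y ⟶ q} (ψ : ∀ k, q' ≫ T.cone.app k ≅ E.cone.app k) (φ : q' ≫ T.base ≅ E.base)
    (h : (T.pull q').IsMor E (fun k => (ψ k).hom) φ.hom) {a x : C} (i : a ⟶ x) :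
    HasLifting i q' ↔ HasLift i E := by
  constructor
  · intro hi f D s ω hs
    obtain ⟨g, e, e', he⟩ := hT.lift D
    obtain ⟨γ, hγ, hγ'⟩ := hT.lift₂_iso (f := f ≫ q') (g := i ≫ g)
      (fun k => α_ _ _ _ ≪≫ whiskerLeftIso f (ψ k) ≪≫ s k ≪≫ whiskerLeftIso i (e k).symm ≪≫
        (α_ _ _ _).symm)
      (α_ _ _ _ ≪≫ whiskerLeftIso f φ ≪≫ ω ≪≫ whiskerLeftIso i e'.symm ≪≫ (α_ _ _ _).symm)
      ((T.isMor_pull_pull f q').comp ((h.pull f).comp (hs.comp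
        ((he.inv.pull i).comp (T.isMor_pull_pull_inv i g)))))
    obtain ⟨g', l, r, hl⟩ := hi f g γ
    refine ⟨g', l, fun k => whiskerLeftIso g' (ψ k).symm ≪≫ (α_ _ _ _).symm ≪≫
      whiskerRightIso r _ ≪≫ e k, whiskerLeftIso g' φ.symm ≪≫ (α_ _ _ _).symm ≪≫
      whiskerRightIso r _ ≪≫ e', (h.inv.pull g').comp ((T.isMor_pull_pull_inv g' q').comp
        ((T.isMor_whiskerRight r.hom).comp he)), fun k => ?_, ?_⟩
    · exact hasLift_aux (hγ k) hl
    · exact hasLift_aux hγ' hl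
  · intro hE f g γ
    obtain ⟨g', l, θ, r, hθ, hl, hl'⟩ := hE f (T.pull g)
      (fun k => whiskerLeftIso f (ψ k).symm ≪≫ (α_ _ _ _).symm ≪≫ whiskerRightIso γ _ ≪≫ α_ _ _ _)
      (whiskerLeftIso f φ.symm ≪≫ (α_ _ _ _).symm ≪≫ whiskerRightIso γ _ ≪≫ α_ _ _ _)
      ((h.inv.pull f).comp ((T.isMor_pull_pull_inv f q').comp
        ((T.isMor_whiskerRight γ.hom).comp (T.isMor_pull_pull i g))))
    obtain ⟨μ, hμ, hμ'⟩ := hT.lift₂_iso (f := g' ≫ q') (g := g)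
      (fun k => α_ _ _ _ ≪≫ whiskerLeftIso g' (ψ k) ≪≫ θ k)
      (α_ _ _ _ ≪≫ whiskerLeftIso g' φ ≪≫ r)
      ((T.isMor_pull_pull g' q').comp ((h.pull g').comp hθ))
    exact ⟨g', l, μ, hT.ext (fun k => hasLift_aux' (hμ k) (hl k)) (hasLift_aux' hμ' hl')⟩

end Triple

end Triples

section MatchingTriples

variable {C : Type u} [Bicategory.{w, v} C]

section Pasting

variable {x q l l' b₀ g g' : C} {π₀ : q ⟶ l} {π₁ : q ⟶ b₀} {ℓ : l ⟶ l'} {a : b₀ ⟶ l'}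
  {cY : l ⟶ g} {cB : l' ⟶ g'} {p : g ⟶ g'} {c : b₀ ⟶ g'} {μ : ℓ ≫ cB ≅ cY ≫ p}
  {δ : a ≫ cB ≅ c} {A : π₀ ≫ ℓ ⟶ π₁ ≫ a}

/-- The compatibility of a 1-cell into a bi-pullback of bi-limits with the 2-cells of a matching
datum, in the form that a matching datum records. -/
theorem match_compat {u : x ⟶ q} {h : x ⟶ l} {b : x ⟶ b₀} {γ : h ≫ ℓ ⟶ b ≫ a} {y : x ⟶ g}
    {e : h ≫ cY ⟶ y} {t : y ≫ p ⟶ b ≫ c} {β₀ : u ≫ π₀ ⟶ h} {β₁ : u ≫ π₁ ⟶ b}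
    (hγ : γ ▷ cB = (α_ _ _ _).hom ≫ h ◁ μ.hom ≫ (α_ _ _ _).inv ≫ e ▷ p ≫ t ≫ b ◁ δ.inv ≫
      (α_ _ _ _).inv)
    (hβ : β₀ ▷ ℓ ≫ γ = (α_ _ _ _).hom ≫ u ◁ A ≫ (α_ _ _ _).inv ≫ β₁ ▷ a) :
    β₀ ▷ (ℓ ≫ cB) ≫ h ◁ μ.hom ≫ (α_ _ _ _).inv ≫ e ▷ p ≫ t =
      (α_ _ _ _).inv ≫ (α_ _ _ _).hom ▷ cB ≫ (u ◁ A) ▷ cB ≫ (α_ _ _ _).inv ▷ cB ≫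
        (β₁ ▷ a) ▷ cB ≫ (α_ _ _ _).hom ≫ b ◁ δ.hom := by
  calc _ = β₀ ▷ (ℓ ≫ cB) ≫ h ◁ μ.hom ≫ (α_ _ _ _).inv ≫ e ▷ p ≫ t ≫ b ◁ (δ.inv ≫ δ.hom) := by
        rw [Iso.inv_hom_id]; simp
    _ = 𝟙 _ ⊗≫ β₀ ▷ ℓ ▷ cB ⊗≫ ((α_ _ _ _).hom ≫ h ◁ μ.hom ≫ (α_ _ _ _).inv ≫ e ▷ p ≫ t ≫
        b ◁ δ.inv ≫ (α_ _ _ _).inv) ⊗≫ b ◁ δ.hom := by bicategory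
    _ = 𝟙 _ ⊗≫ (β₀ ▷ ℓ ≫ γ) ▷ cB ⊗≫ b ◁ δ.hom := by rw [← hγ]; bicategory
    _ = _ := by rw [hβ]; bicategory

/-- The compatibility `H` says that the 1-cell `u` induces a given triple. -/
theorem match_cell {u : x ⟶ q} {h : x ⟶ l} {b : x ⟶ b₀} {y : x ⟶ g}
    {e : h ≫ cY ⟶ y} {t : y ≫ p ⟶ b ≫ c} {β₀ : u ≫ π₀ ⟶ h} {β₁ : u ≫ π₁ ⟶ b}
    (H : β₀ ▷ (ℓ ≫ cB) ≫ h ◁ μ.hom ≫ (α_ _ _ _).inv ≫ e ▷ p ≫ t =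
      (α_ _ _ _).inv ≫ (α_ _ _ _).hom ▷ cB ≫ (u ◁ A) ▷ cB ≫ (α_ _ _ _).inv ▷ cB ≫
        (β₁ ▷ a) ▷ cB ≫ (α_ _ _ _).hom ≫ b ◁ δ.hom) :
    ((α_ _ _ _).inv ≫ β₀ ▷ cY ≫ e) ▷ p ≫ t =
      ((α_ _ _ _).hom ≫ u ◁ ((α_ _ _ _).hom ≫ π₀ ◁ μ.inv ≫ (α_ _ _ _).inv ≫ A ▷ cB ≫
        (α_ _ _ _).hom ≫ π₁ ◁ δ.hom) ≫ (α_ _ _ _).inv) ≫ β₁ ▷ c := by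
  calc _ = 𝟙 _ ⊗≫ (u ≫ π₀) ◁ (μ.inv ≫ μ.hom) ⊗≫ β₀ ▷ cY ▷ p ⊗≫ e ▷ p ≫ t := by
        rw [Iso.inv_hom_id]; bicategory
    _ = 𝟙 _ ⊗≫ u ◁ π₀ ◁ μ.inv ⊗≫ ((u ≫ π₀) ◁ μ.hom ≫ β₀ ▷ (cY ≫ p)) ⊗≫ e ▷ p ≫ t := by bicategory
    _ = 𝟙 _ ⊗≫ u ◁ π₀ ◁ μ.inv ⊗≫ (β₀ ▷ (ℓ ≫ cB) ≫ h ◁ μ.hom ≫ (α_ _ _ _).inv ≫ e ▷ p ≫ t) := by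
        rw [whisker_exchange]; bicategory
    _ = 𝟙 _ ⊗≫ u ◁ π₀ ◁ μ.inv ⊗≫ u ◁ A ▷ cB ⊗≫ (β₁ ▷ (a ≫ cB) ≫ b ◁ δ.hom) := by
        rw [H]; bicategory
    _ = _ := by rw [← whisker_exchange]; bicategory

/-- The condition on a morphism of triples gives the one that the universal property of the
bi-pullback requires, after whiskering with the projections of the bi-limit. -/
theorem match_ext {f f' : x ⟶ q} {ρ₀ : f ≫ π₀ ⟶ f' ≫ π₀} {θ : f ≫ π₀ ≫ cY ⟶ f' ≫ π₀ ≫ cY}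
    {s : f ≫ π₁ ⟶ f' ≫ π₁} (hρ : ρ₀ ▷ cY = (α_ _ _ _).hom ≫ θ ≫ (α_ _ _ _).inv)
    (h : θ ▷ p ≫ (α_ _ _ _).hom ≫ f' ◁ ((α_ _ _ _).hom ≫ π₀ ◁ μ.inv ≫ (α_ _ _ _).inv ≫ A ▷ cB ≫
        (α_ _ _ _).hom ≫ π₁ ◁ δ.hom) ≫ (α_ _ _ _).inv =
      ((α_ _ _ _).hom ≫ f ◁ ((α_ _ _ _).hom ≫ π₀ ◁ μ.inv ≫ (α_ _ _ _).inv ≫ A ▷ cB ≫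
        (α_ _ _ _).hom ≫ π₁ ◁ δ.hom) ≫ (α_ _ _ _).inv) ≫ s ▷ c) :
    (ρ₀ ▷ ℓ ≫ (α_ _ _ _).hom ≫ f' ◁ A ≫ (α_ _ _ _).inv) ▷ cB =
      ((α_ _ _ _).hom ≫ f ◁ A ≫ (α_ _ _ _).inv ≫ s ▷ a) ▷ cB := by
  calc _ = 𝟙 _ ⊗≫ (f ≫ π₀) ◁ (μ.hom ≫ μ.inv) ⊗≫ ρ₀ ▷ ℓ ▷ cB ⊗≫ f' ◁ A ▷ cB ⊗≫
          (f' ≫ π₁) ◁ (δ.hom ≫ δ.inv) ⊗≫ 𝟙 _ := by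
        rw [Iso.hom_inv_id, Iso.hom_inv_id]; bicategory
    _ = 𝟙 _ ⊗≫ (f ≫ π₀) ◁ μ.hom ⊗≫ ((f ≫ π₀) ◁ μ.inv ≫ ρ₀ ▷ (ℓ ≫ cB)) ⊗≫ f' ◁ A ▷ cB ⊗≫
          (f' ≫ π₁) ◁ δ.hom ⊗≫ (f' ≫ π₁) ◁ δ.inv ⊗≫ 𝟙 _ := by bicategory
    _ = 𝟙 _ ⊗≫ (f ≫ π₀) ◁ μ.hom ⊗≫ (ρ₀ ▷ cY) ▷ p ⊗≫ f' ◁ π₀ ◁ μ.inv ⊗≫ f' ◁ A ▷ cB ⊗≫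
          (f' ≫ π₁) ◁ δ.hom ⊗≫ (f' ≫ π₁) ◁ δ.inv ⊗≫ 𝟙 _ := by rw [whisker_exchange]; bicategory
    _ = 𝟙 _ ⊗≫ (f ≫ π₀) ◁ μ.hom ⊗≫ (θ ▷ p ≫ (α_ _ _ _).hom ≫ f' ◁ ((α_ _ _ _).hom ≫ π₀ ◁ μ.inv ≫
          (α_ _ _ _).inv ≫ A ▷ cB ≫ (α_ _ _ _).hom ≫ π₁ ◁ δ.hom) ≫ (α_ _ _ _).inv) ⊗≫
          (f' ≫ π₁) ◁ δ.inv ⊗≫ 𝟙 _ := by rw [hρ]; bicategory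
    _ = 𝟙 _ ⊗≫ (f ≫ π₀) ◁ μ.hom ⊗≫ f ◁ π₀ ◁ μ.inv ⊗≫ f ◁ A ▷ cB ⊗≫ f ◁ π₁ ◁ δ.hom ⊗≫
          (s ▷ c ≫ (f' ≫ π₁) ◁ δ.inv) ⊗≫ 𝟙 _ := by rw [h]; bicategory
    _ = 𝟙 _ ⊗≫ f ◁ π₀ ◁ (μ.hom ≫ μ.inv) ⊗≫ f ◁ A ▷ cB ⊗≫ f ◁ π₁ ◁ (δ.hom ≫ δ.inv) ⊗≫
          s ▷ (a ≫ cB) ⊗≫ 𝟙 _ := by rw [← whisker_exchange]; bicategory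
    _ = _ := by rw [Iso.hom_inv_id, Iso.hom_inv_id]; bicategory

theorem match_whiskerRight {f f' : x ⟶ q} {ν : f ⟶ f'} {ρ₀ : f ≫ π₀ ⟶ f' ≫ π₀}
    {θ : f ≫ π₀ ≫ cY ⟶ f' ≫ π₀ ≫ cY} (hν : ν ▷ π₀ = ρ₀)
    (hρ : ρ₀ ▷ cY = (α_ _ _ _).hom ≫ θ ≫ (α_ _ _ _).inv) : ν ▷ (π₀ ≫ cY) = θ := by
  rw [whiskerRight_comp, hν, hρ]
  simp

end Pasting

variable {S : Type u₁} [PartialOrder S] {Y B : Diag S C} {p : Y ⟶ B} {b₀ : C} {c : RawCone B b₀}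

section

variable {l l' : C} {cY : RawCone Y l} {cB : RawCone B l'} {ℓ : l ⟶ l'}
  {μ : ∀ k, ℓ ≫ cB.app k ≅ cY.app k ≫ p.app (pt k)}
  (hμ : (cB.pull ℓ).IsMor (cY.push p) fun k => (μ k).hom) {a : b₀ ⟶ l'}
  {δ : ∀ k, a ≫ cB.app k ≅ c.app k} (hδ : (cB.pull a).IsMor c fun k => (δ k).hom)

/-- The triple on a bi-pullback of bi-limits. -/
@[simps cone base cell]
def matchTriple {q : C} (π₀ : q ⟶ l) (π₁ : q ⟶ b₀) (A : π₀ ≫ ℓ ≅ π₁ ≫ a) : Triple p c q where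
  cone := cY.pull π₀
  base := π₁
  cell k := α_ _ _ _ ≪≫ whiskerLeftIso π₀ (μ k).symm ≪≫ (α_ _ _ _).symm ≪≫
    whiskerRightIso A _ ≪≫ α_ _ _ _ ≪≫ whiskerLeftIso π₁ (δ k)
  isMor_cell := (cY.isMor_push_pull π₀ p).comp ((hμ.inv.pull π₀).comp
    ((cB.isMor_pull_pull_inv π₀ ℓ).comp ((cB.isMor_whiskerRight A.hom).comp
      ((cB.isMor_pull_pull π₁ a).comp (hδ.pull π₁)))))

/-- For a triple `D` and a 1-cell `h` into the bi-limit that induces its cone, the 2-cells of `D`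
combine to a square over the bi-limit of `B`. -/
theorem exists_matching_cell (hμ : (cB.pull ℓ).IsMor (cY.push p) fun k => (μ k).hom)
    (hδ : (cB.pull a).IsMor c fun k => (δ k).hom) (hB : cB.IsUniv) {x : C}
    (D : Triple p c x) {h : x ⟶ l} (e : ∀ k, h ≫ cY.app k ≅ D.cone.app k)
    (he : (cY.pull h).IsMor D.cone fun k => (e k).hom) :
    ∃ γ : h ≫ ℓ ≅ D.base ≫ a, ∀ k, γ.hom ▷ cB.app k =
      (α_ _ _ _).hom ≫ h ◁ (μ k).hom ≫ (α_ _ _ _).inv ≫ (e k).hom ▷ p.app (pt k) ≫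
        (D.cell k).hom ≫ D.base ◁ (δ k).inv ≫ (α_ _ _ _).inv :=
  hB.lift₂_iso (fun k => α_ _ _ _ ≪≫ whiskerLeftIso h (μ k) ≪≫ (α_ _ _ _).symm ≪≫
      whiskerRightIso (e k) _ ≪≫ D.cell k ≪≫ whiskerLeftIso D.base (δ k).symm ≪≫ (α_ _ _ _).symm)
    ((cB.isMor_pull_pull h ℓ).comp ((hμ.pull h).comp
      ((RawCone.IsMor.inv (c := (cY.pull h).push p) (d := (cY.push p).pull h)
        (m := fun k => α_ h (cY.app k) _) (cY.isMor_push_pull h p)).comp ((he.push p).comp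
        (D.isMor_cell.comp ((hδ.inv.pull D.base).comp (cB.isMor_pull_pull_inv D.base a)))))))

/-- A bi-pullback of bi-limits classifies triples. -/
theorem isUniv_matchTriple (hY : cY.IsUniv) (hB : cB.IsUniv) {q : C} {π₀ : q ⟶ l} {π₁ : q ⟶ b₀}
    {A : π₀ ≫ ℓ ≅ π₁ ≫ a} (hA : IsBipullback π₀ π₁ A) :
    (matchTriple hμ hδ π₀ π₁ A).IsUniv where
  lift {x} D := by
    obtain ⟨h, e, he⟩ := hY.lift D.cone
    obtain ⟨γ, hγ⟩ := exists_matching_cell hμ hδ hB D e he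
    obtain ⟨u, β₀, β₁, hβ⟩ := hA.lift h D.base γ
    exact ⟨u, fun k => (α_ _ _ _).symm ≪≫ whiskerRightIso β₀ _ ≪≫ e k, β₁,
      ⟨(cY.isMor_pull_pull_inv u π₀).comp ((cY.isMor_whiskerRight β₀.hom).comp he),
        fun k => match_cell (match_compat (hγ k) hβ)⟩⟩
  lift₂ {x} f g θ r h := by
    obtain ⟨ρ, hρ, -⟩ := hY.lift₂ (f ≫ π₀) (g ≫ π₀) _ ((cY.isMor_pull_pull f π₀).comp
      (h.cone.comp (cY.isMor_pull_pull_inv g π₀)))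
    obtain ⟨ν, ⟨hν, hν'⟩, hu⟩ := hA.lift₂ f g ρ r (hB.ext fun k => match_ext (hρ k) (h.cell k))
    refine ⟨ν, ⟨fun k => ?_, hν'⟩, fun ν' ⟨h₁, h₂⟩ => hu ν' ⟨hY.ext fun k => ?_, h₂⟩⟩
    · exact match_whiskerRight hν (hρ k)
    · rw [hρ k, ← h₁ k]
      exact whiskerRight_comp_symm _ _ _

end

theorem exists_isUniv_triple (hC : HasFiniteWeightedBilimits C) [Finite S] (p : Y ⟶ B)
    (c : RawCone B b₀) : ∃ (q : C) (T : Triple p c q), T.IsUniv := by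
  obtain ⟨l, cY, hY⟩ := RawCone.exists_isUniv hC Y
  obtain ⟨l', cB, hB⟩ := RawCone.exists_isUniv hC B
  obtain ⟨ℓ, μ, hμ⟩ := hB.lift (cY.push p)
  obtain ⟨a, δ, hδ⟩ := hB.lift c
  obtain ⟨q, π₀, π₁, A, hA⟩ := exists_isBipullback hC ℓ a
  exact ⟨q, matchTriple hμ hδ π₀ π₁ A, isUniv_matchTriple hμ hδ hY hB hA⟩

end MatchingTriples

section Matching

variable {J : Type u₁} [PartialOrder J] {C : Type u} [Bicategory.{w, v} C]

theorem down_cell {x a b x' a' b' : C} {f : x ⟶ a} {g : a ⟶ b} {fg : x ⟶ b} {p : x ⟶ x'}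
    {q : a ⟶ a'} {r : b ⟶ b'} {f' : x' ⟶ a'} {g' : a' ⟶ b'} {fg' : x' ⟶ b'} {z : fg ⟶ f ≫ g}
    {z' : fg' ⟶ f' ≫ g'} {n : f ≫ q ⟶ p ≫ f'} {n' : g ≫ r ⟶ q ≫ g'} {m : fg ≫ r ⟶ p ≫ fg'}
    (h : m ≫ p ◁ z' = z ▷ r ≫ (α_ _ _ _).hom ≫ f ◁ n' ≫ (α_ _ _ _).inv ≫ n ▷ g' ≫
      (α_ _ _ _).hom) :
    m ≫ p ◁ z' ≫ (α_ _ _ _).inv =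
      (z ▷ r ≫ (α_ _ _ _).hom ≫ f ◁ n' ≫ (α_ _ _ _).inv) ≫ n ▷ g' := by
  rw [reassoc_of% h]
  simp

theorem push_nat {x a b a' b' : C} {d : x ⟶ a} {e : x ⟶ b} {s : a ⟶ b} {s' : a' ⟶ b'}
    {p : a ⟶ a'} {q : b ⟶ b'} {N : 𝟙 x ≫ e ⟶ d ≫ s} {n : e ⟶ d ≫ s} {t : s ≫ q ⟶ p ≫ s'}
    (hN : N = (λ_ e).hom ≫ n) :
    (α_ _ _ _).inv ≫ N ▷ q ≫ (α_ _ _ _).hom ≫ d ◁ t ≫ (α_ _ _ _).inv =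
      (λ_ _).hom ≫ n ▷ q ≫ (α_ _ _ _).hom ≫ d ◁ t ≫ (α_ _ _ _).inv := by
  rw [hN]
  simp

/-- The cone of transition 1-cells of a diagram below `j`. -/
@[simps app nat]
def downRaw (Y : Diag J C) (j : J) : RawCone (restrict (Set.Iio j) Y) (Y.ob j) where
  app k := Y.mp (below_le k)
  nat {k _} h := Y.cmp (below_le k) h
  nat_id k := Y.cmp_id_right (below_le k)
  nat_comp {k _ _} h h' := Y.cmp_assoc (below_le k) h h'

/-- The triple below `j` of a morphism of diagrams. -/
@[simps cone base cell]
def downTriple {Y B : Diag J C} (p : Y ⟶ B) (j : J) :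
    Triple (restrictMap (Set.Iio j) p) (downRaw B j) (Y.ob j) where
  cone := downRaw Y j
  base := p.app (pt j)
  cell k := nat p (below_le k)
  isMor_cell := ⟨fun {k _} h => down_cell (nat_comp p (below_le k) h)⟩

namespace Matching

variable {Y B : Diag J C} {p : Y ⟶ B} {j : J}

/-- The object of a matching datum carries a universal triple, from which its 1-cell `q` induces the
triple below `j`. -/
theorem exists_triple (m : Matching p j) :
    ∃ (T : Triple (restrictMap (Set.Iio j) p) (downRaw B j) m.Q) (_ : T.IsUniv)
      (ψ : ∀ k, m.q ≫ T.cone.app k ≅ (downTriple p j).cone.app k)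
      (φ : m.q ≫ T.base ≅ (downTriple p j).base),
      (T.pull m.q).IsMor (downTriple p j) (fun k => (ψ k).hom) φ.hom := by
  have hμ : ((RawCone.ofPseudoCone m.πB).pull m.limp).IsMor
      ((RawCone.ofPseudoCone m.πY).push (restrictMap (Set.Iio j) p))
      fun k => (isoApp (X := const _ m.LY) m.μ k).hom :=
    ⟨fun h => (raw_mor_iff (RawCone.constMap_comp_nat m.πB m.limp h)
      ((nat_comp_hom (X := const _ m.LY) m.πY (restrictMap (Set.Iio j) p) h).trans
        (push_nat (RawCone.ofPseudoCone_nat m.πY h)))).1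
      (modification_nat (X := const _ m.LY) m.μ.hom h)⟩
  have hδ : ((RawCone.ofPseudoCone m.πB).pull m.aB).IsMor (downRaw B j)
      fun k => (isoApp (X := const _ (B.ob j)) m.δ k).hom :=
    ⟨fun h => (raw_mor_iff (RawCone.constMap_comp_nat m.πB m.aB h) rfl).1
      (modification_nat (X := const _ (B.ob j)) m.δ.hom h)⟩
  have hη : ((RawCone.ofPseudoCone m.πY).pull m.aY).IsMor (downRaw Y j)
      fun k => (isoApp (X := const _ (Y.ob j)) m.η k).hom :=
    ⟨fun h => (raw_mor_iff (RawCone.constMap_comp_nat m.πY m.aY h) rfl).1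
      (modification_nat (X := const _ (Y.ob j)) m.η.hom h)⟩
  exact ⟨matchTriple hμ hδ m.π₀ m.π₁ m.α, isUniv_matchTriple hμ hδ
    (RawCone.isUniv_of_isBilimit m.isBilimit_πY) (RawCone.isUniv_of_isBilimit m.isBilimit_πB)
    m.isBipullback, fun k => (α_ _ _ _).symm ≪≫ whiskerRightIso m.β₀ _ ≪≫
      isoApp (X := const _ (Y.ob j)) m.η k, m.β₁,
    ⟨(RawCone.isMor_pull_pull_inv _ m.q m.π₀).comp
      ((RawCone.isMor_whiskerRight _ m.β₀.hom).comp hη), fun k => match_cell (m.compat k)⟩⟩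

/-- Matching data exist below an element with finitely many predecessors. -/
theorem nonempty (hC : HasFiniteWeightedBilimits C) (p : Y ⟶ B) (hj : (Set.Iio j).Finite) :
    Nonempty (Matching p j) := by
  have := hj.to_subtype
  obtain ⟨l, cY, hY⟩ := RawCone.exists_isUniv hC (restrict (Set.Iio j) Y)
  obtain ⟨l', cB, hB⟩ := RawCone.exists_isUniv hC (restrict (Set.Iio j) B)
  obtain ⟨ℓ, μ, hμ⟩ := hB.lift (cY.push (restrictMap (Set.Iio j) p))
  obtain ⟨a, δ, hδ⟩ := hB.lift (downRaw B j)
  obtain ⟨h, e, he⟩ := hY.lift (downRaw Y j)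
  obtain ⟨q, π₀, π₁, A, hA⟩ := exists_isBipullback hC ℓ a
  obtain ⟨γ, hγ⟩ := exists_matching_cell hμ hδ hB (downTriple p j) e he
  obtain ⟨u, β₀, β₁, hβ⟩ := hA.lift h (p.app (pt j)) γ
  exact ⟨{
    LY := l
    πY := cY.toPseudoCone
    isBilimit_πY := hY.isBilimit
    LB := l'
    πB := cB.toPseudoCone
    isBilimit_πB := hB.isBilimit
    limp := ℓ
    μ := mkModIso (X := const _ l) μ fun h =>
      (raw_mor_iff (RawCone.constMap_toPseudoCone_nat cB ℓ h)
        ((nat_comp_hom (X := const _ l) cY.toPseudoCone (restrictMap (Set.Iio j) p) h).trans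
          (push_nat rfl))).2 (hμ.nat h)
    aY := h
    η := mkModIso (X := const _ (Y.ob j)) e fun hk =>
      (raw_mor_iff (RawCone.constMap_toPseudoCone_nat cY h hk) rfl).2 (he.nat hk)
    aB := a
    δ := mkModIso (X := const _ (B.ob j)) δ fun hk =>
      (raw_mor_iff (RawCone.constMap_toPseudoCone_nat cB a hk) rfl).2 (hδ.nat hk)
    Q := q
    π₀ := π₀
    π₁ := π₁
    α := A
    isBipullback := hA
    q := u
    β₀ := β₀
    β₁ := β₁
    compat := fun k => match_compat (hγ k) hβ }⟩

end Matching

end Matching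

/-! ### Construction of global sections by well-founded recursion -/

/-- A sheaf of types on the lower sets of a poset, with gluing for the covers by the sets
`Set.Iic j`. -/
structure LowerSheaf (J : Type u₁) [PartialOrder J] where
  Sec : Set J → Type t
  res : ∀ {U V : Set J}, U ⊆ V → Sec V → Sec U
  res_self : ∀ {U : Set J} (s : Sec U), res (Set.Subset.refl U) s = s
  res_res : ∀ {U V W : Set J} (h : U ⊆ V) (h' : V ⊆ W) (s : Sec W),
    res h (res h' s) = res (h.trans h') s
  sep : ∀ {U : Set J} (hU : IsLowerSet U) (s s' : Sec U),
    (∀ (j : J) (hj : j ∈ U), res (hU.Iic_subset hj) s = res (hU.Iic_subset hj) s') → s = s'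
  glue : ∀ {U : Set J} (hU : IsLowerSet U) (V : ∀ j ∈ U, Sec (Set.Iic j)),
    (∀ (j k : J) (hj : j ∈ U) (hk : k ≤ j),
      res (Set.Iic_subset_Iic.2 hk) (V j hj) = V k (hU hk hj)) →
    ∃ s : Sec U, ∀ (j : J) (hj : j ∈ U), res (hU.Iic_subset hj) s = V j hj

namespace LowerSheaf

variable {J : Type u₁} [PartialOrder J] (F : LowerSheaf.{u₁, t} J)

/-- If sections over `{k | k < j}` extend to sections over `{k | k ≤ j}` with a property, then
there is a global section with this property at every `j`: the sections that follow a fixed choice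
of extensions are unique, hence compatible. -/
theorem exists_section [WellFoundedLT J] (Q : ∀ j, F.Sec (Set.Iic j) → Prop)
    (step : ∀ (j : J) (s : F.Sec (Set.Iio j)),
      ∃ s' : F.Sec (Set.Iic j), F.res Set.Iio_subset_Iic_self s' = s ∧ Q j s') :
    ∃ s : F.Sec Set.univ, ∀ j, Q j (F.res (Set.subset_univ _) s) := by
  choose st hst hQ using step
  -- the sections that agree at every `j` with the chosen extension of their part below `j`
  let Canon : ∀ U : Set J, F.Sec U → Prop := fun U s => ∀ (j : J) (hj : Set.Iic j ⊆ U),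
    F.res hj s = st j (F.res (Set.Iio_subset_Iic_self.trans hj) s)
  have canon_res : ∀ {U V : Set J} (h : U ⊆ V) (s : F.Sec V), Canon V s → Canon U (F.res h s) := by
    intro U V h s hs j hj
    rw [F.res_res, F.res_res]
    exact hs j _
  have uniq : ∀ (j : J) (s s' : F.Sec (Set.Iic j)), Canon _ s → Canon _ s' → s = s' := by
    intro j
    induction j using WellFoundedLT.induction with
    | ind j ih =>
      intro s s' hs hs'
      rw [← F.res_self s, ← F.res_self s', hs j, hs' j]
      congr 1
      refine F.sep (isLowerSet_Iio j) _ _ fun k hk => ih k hk _ _ ?_ ?_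
      · exact canon_res _ _ (canon_res _ _ hs)
      · exact canon_res _ _ (canon_res _ _ hs')
  have glue : ∀ {U : Set J} (hU : IsLowerSet U) (V : ∀ j ∈ U, F.Sec (Set.Iic j)),
      (∀ j hj, Canon _ (V j hj)) →
      ∃ s : F.Sec U, Canon _ s ∧ ∀ (j : J) (hj : j ∈ U), F.res (hU.Iic_subset hj) s = V j hj := by
    intro U hU V hV
    obtain ⟨s, hs⟩ := F.glue hU V fun j k hj hk =>
      uniq k _ _ (canon_res _ _ (hV j hj)) (hV k _)
    refine ⟨s, fun j hj => ?_, hs⟩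
    have h := hV j (hj le_rfl) j subset_rfl
    rw [← hs j (hj le_rfl), F.res_res, F.res_res] at h
    exact h
  have ex : ∀ j : J, ∃ s : F.Sec (Set.Iic j), Canon _ s := by
    intro j
    induction j using WellFoundedLT.induction with
    | ind j ih =>
      choose V hV using ih
      obtain ⟨s, hs, -⟩ := glue (isLowerSet_Iio j) V hV
      refine ⟨st j s, fun k hk => ?_⟩
      obtain rfl | hkj := eq_or_lt_of_le (hk le_rfl : k ≤ j)
      · rw [F.res_self, hst]
      · have hk' : Set.Iic k ⊆ Set.Iio j := fun l hl => lt_of_le_of_lt (Set.mem_Iic.1 hl) hkj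
        have h := hs k hk'
        rw [← hst j s, F.res_res, F.res_res] at h
        exact h
  choose V hV using ex
  obtain ⟨s, hs, -⟩ := glue isLowerSet_univ (fun j _ => V j) fun j _ => hV j
  exact ⟨s, fun j => by
    rw [hs j]
    exact hQ j _⟩

end LowerSheaf

set_option linter.checkUnivs false in
/-- Two-dimensional data over a poset: objects over each `j`, 1-cells over `k ≤ j`, 2-cells filling
triangles and a condition on tetrahedra, together with unit 1-cells, the data `Un` that
exhibit a 1-cell as a unit, and the conditions `LU` and `RU` that a triangle is a unit
constraint. -/
structure Disp (J : Type u₁) [PartialOrder J] where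
  Ob : J → Type u
  Hom : ∀ {j k : J}, k ≤ j → Ob j → Ob k → Type v
  Tri : ∀ {j k l : J} (h : k ≤ j) (h' : l ≤ k) {x : Ob j} {y : Ob k} {z : Ob l}, Hom h x y →
    Hom h' y z → Hom (h'.trans h) x z → Type w
  Tet : ∀ {j k l m : J} (h : k ≤ j) (h' : l ≤ k) (h'' : m ≤ l) {x : Ob j} {y : Ob k} {z : Ob l}
    {t : Ob m} {a : Hom h x y} {b : Hom h' y z} {c : Hom h'' z t} {ab : Hom (h'.trans h) x z}
    {bc : Hom (h''.trans h') y t} {abc : Hom (h''.trans (h'.trans h)) x t}, Tri h h' a b ab →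
    Tri h' h'' b c bc → Tri (h'.trans h) h'' ab c abc → Tri h (h''.trans h') a bc abc → Prop
  Un : ∀ {j : J} {x : Ob j}, Hom (le_refl j) x x → Type w₁
  LU : ∀ {j k : J} (h : k ≤ j) {x : Ob j} {y : Ob k} {e : Hom (le_refl j) x x} {a : Hom h x y},
    Un e → Tri (le_refl j) h e a a → Prop
  RU : ∀ {j k : J} (h : k ≤ j) {x : Ob j} {y : Ob k} {e : Hom (le_refl k) y y} {a : Hom h x y},
    Un e → Tri h (le_refl k) a e a → Prop
  one : ∀ {j : J} (x : Ob j), Hom (le_refl j) x x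
  unOne : ∀ {j : J} (x : Ob j), Un (one x)
  lid : ∀ {j k : J} (h : k ≤ j) {x : Ob j} {y : Ob k} (a : Hom h x y),
    Tri (le_refl j) h (one x) a a
  lu_lid : ∀ {j k : J} (h : k ≤ j) {x : Ob j} {y : Ob k} (a : Hom h x y), LU h (unOne x) (lid h a)
  ru_lid : ∀ {j : J} (x : Ob j), RU (le_refl j) (unOne x) (lid (le_refl j) (one x))
  tet_lid : ∀ {j l m : J} (h' : l ≤ j) (h'' : m ≤ l) {x : Ob j} {z : Ob l} {t : Ob m}
    {b : Hom h' x z} {c : Hom h'' z t} {bc : Hom (h''.trans h') x t} (τ : Tri h' h'' b c bc),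
    Tet (le_refl j) h' h'' (lid h' b) τ τ (lid (h''.trans h') bc)

namespace Disp

variable {J : Type u₁} [PartialOrder J] (D : Disp.{w, v, u, w₁, u₁} J)

/-- A section of the data over a monotone map. -/
structure Sec {K : Type t} [PartialOrder K] (e : K → J) (he : Monotone e) where
  ob (k : K) : D.Ob (e k)
  hom (j k : K) (h : k ≤ j) : D.Hom (he h) (ob j) (ob k)
  tri (j k l : K) (h : k ≤ j) (h' : l ≤ k) :
    D.Tri (he h) (he h') (hom j k h) (hom k l h') (hom j l (h'.trans h))
  un (k : K) : D.Un (hom k k (le_refl k))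
  tet (j k l m : K) (h : k ≤ j) (h' : l ≤ k) (h'' : m ≤ l) :
    D.Tet (he h) (he h') (he h'') (tri j k l h h') (tri k l m h' h'') (tri j l m (h'.trans h) h'')
      (tri j k m h (h''.trans h'))
  lu (j k : K) (h : k ≤ j) : D.LU (he h) (un j) (tri j j k (le_refl j) h)
  ru (j k : K) (h : k ≤ j) : D.RU (he h) (un k) (tri j k k h (le_refl k))

namespace Sec

variable {D} {K : Type t} [PartialOrder K] {K' : Type r} [PartialOrder K'] {e : K → J}
  {he : Monotone e}

/-- Restriction of a section along a monotone map. -/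
@[simps]
def res (s : D.Sec e he) (g : K' → K) (hg : Monotone g) : D.Sec (e ∘ g) (he.comp hg) where
  ob k := s.ob (g k)
  hom j k h := s.hom (g j) (g k) (hg h)
  tri j k l h h' := s.tri (g j) (g k) (g l) (hg h) (hg h')
  un k := s.un (g k)
  tet j k l m h h' h'' := s.tet (g j) (g k) (g l) (g m) (hg h) (hg h') (hg h'')
  lu j k h := s.lu (g j) (g k) (hg h)
  ru j k h := s.ru (g j) (g k) (hg h)

theorem hom_eq_of_mk_eq {ob : ∀ k, D.Ob (e k)} {hom hom' : ∀ (j k : K) (_ : k ≤ j), _}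
    {tri un tet lu ru tri' un' tet' lu' ru'}
    (H : (⟨ob, hom, tri, un, tet, lu, ru⟩ : D.Sec e he) = ⟨ob, hom', tri', un', tet', lu', ru'⟩) :
    hom = hom' := by
  cases H
  rfl

theorem tri_eq_of_mk_eq {ob : ∀ k, D.Ob (e k)} {hom : ∀ (j k : K) (_ : k ≤ j), _}
    {tri un tet lu ru tri' un' tet' lu' ru'}
    (H : (⟨ob, hom, tri, un, tet, lu, ru⟩ : D.Sec e he) = ⟨ob, hom, tri', un', tet', lu', ru'⟩) :
    tri = tri' := by
  cases H
  rfl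

theorem un_eq_of_mk_eq {ob : ∀ k, D.Ob (e k)} {hom : ∀ (j k : K) (_ : k ≤ j), _}
    {tri un tet lu ru tri' un' tet' lu' ru'}
    (H : (⟨ob, hom, tri, un, tet, lu, ru⟩ : D.Sec e he) = ⟨ob, hom, tri', un', tet', lu', ru'⟩) :
    un = un' := by
  cases H
  rfl

end Sec

/-- The sections over a subset of the poset. -/
abbrev SecOn (U : Set J) := D.Sec (Subtype.val : U → J) (Subtype.mono_coe _)

/-- Restriction of a section to a smaller subset. -/
abbrev SecOn.restrict {D : Disp.{w, v, u, w₁, u₁} J} {U V : Set J} (h : U ⊆ V) (s : D.SecOn V) :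
    D.SecOn U :=
  s.res (Set.inclusion h) fun _ _ h' => h'

/-- On a lower set, each component of a section lies over some `Set.Iic j`. -/
theorem sep {U : Set J} (hU : IsLowerSet U) (s s' : D.SecOn U)
    (H : ∀ (j : J) (hj : j ∈ U), SecOn.restrict (hU.Iic_subset hj) s =
      SecOn.restrict (hU.Iic_subset hj) s') : s = s' := by
  obtain ⟨ob, hom, tri, un, _, _, _⟩ := s
  obtain ⟨ob', hom', tri', un', _, _, _⟩ := s'
  obtain rfl : ob = ob' := funext fun j =>
    congrFun (congrArg Sec.ob (H j j.2)) ⟨j, le_rfl⟩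
  obtain rfl : hom = hom' := by
    funext j k h
    exact congrFun (congrFun (congrFun (Sec.hom_eq_of_mk_eq (H j j.2)) ⟨j, le_rfl⟩) ⟨k, h⟩) h
  obtain rfl : tri = tri' := by
    funext j k l h h'
    exact congrFun (congrFun (congrFun (congrFun (congrFun (Sec.tri_eq_of_mk_eq (H j j.2))
      ⟨j, le_rfl⟩) ⟨k, h⟩) ⟨l, h'.trans h⟩) h) h'
  obtain rfl : un = un' := funext fun j =>
    congrFun (Sec.un_eq_of_mk_eq (H j j.2)) ⟨j, le_rfl⟩
  rfl

/-- The component of the glued section on a chain of elements is taken from the local section at the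
greatest one of them. -/
theorem glue {U : Set J} (hU : IsLowerSet U) (V : ∀ j : U, D.SecOn (Set.Iic (j : J)))
    (H : ∀ (j k : U) (hk : k ≤ j),
      SecOn.restrict (U := Set.Iic (k : J)) (Set.Iic_subset_Iic.2 hk) (V j) = V k) :
    ∃ s : D.SecOn U, ∀ j : U, SecOn.restrict (hU.Iic_subset j.2) s = V j := by
  let i (j : U) (k : Set.Iic (j : J)) : U := ⟨k, hU k.2 j.2⟩
  obtain ⟨ob, hob⟩ : ∃ ob : ∀ k : U, D.Ob k, ∀ j k, (V j).ob k = ob (i j k) :=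
    ⟨fun k => (V k).ob ⟨k, le_rfl⟩, fun j k =>
      congrFun (congrArg Sec.ob (H j (i j k) k.2)) ⟨k, le_refl (k : J)⟩⟩
  have h₁ : ∀ j, ∃ hom tri un tet lu ru,
      V j = ⟨fun k => ob (i j k), hom, tri, un, tet, lu, ru⟩ := by
    intro j
    have h := hob j
    generalize V j = s at h
    obtain ⟨ob', hom, tri, un, tet, lu, ru⟩ := s
    obtain rfl : ob' = _ := funext h
    exact ⟨hom, tri, un, tet, lu, ru, rfl⟩
  choose hom' tri' un' tet' lu' ru' hV using h₁
  obtain rfl : V = _ := funext hV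
  have H₁ := fun j k hk => Sec.hom_eq_of_mk_eq (H j k hk)
  obtain ⟨hom, hhom⟩ : ∃ hom : ∀ (k l : U) (h : l ≤ k), D.Hom h (ob k) (ob l),
      hom' = fun j k l h => hom (i j k) (i j l) h :=
    ⟨fun k l h => hom' k ⟨k, le_refl (k : J)⟩ ⟨l, h⟩ h, by
      funext j k l h
      exact congrFun (congrFun (congrFun (H₁ j (i j k) k.2) ⟨k, le_refl (k : J)⟩) ⟨l, h⟩) h⟩
  subst hhom
  have H₂ := fun j k hk => Sec.tri_eq_of_mk_eq (H j k hk)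
  have H₃ := fun j k hk => Sec.un_eq_of_mk_eq (H j k hk)
  obtain ⟨tri, htri⟩ : ∃ tri : ∀ (k l m : U) (h : l ≤ k) (h' : m ≤ l), D.Tri h h' (hom k l h)
      (hom l m h') (hom k m (h'.trans h)),
      tri' = fun j k l m h h' => tri (i j k) (i j l) (i j m) h h' :=
    ⟨fun k l m h h' => tri' k ⟨k, le_refl (k : J)⟩ ⟨l, h⟩ ⟨m, h'.trans h⟩ h h', by
      funext j k l m h h'
      exact congrFun (congrFun (congrFun (congrFun (congrFun (H₂ j (i j k) k.2)
        ⟨k, le_refl (k : J)⟩) ⟨l, h⟩) ⟨m, h'.trans h⟩) h) h'⟩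
  obtain ⟨un, hun⟩ : ∃ un : ∀ k : U, D.Un (hom k k le_rfl), un' = fun j k => un (i j k) :=
    ⟨fun k => un' k ⟨k, le_refl (k : J)⟩, by
      funext j k
      exact congrFun (H₃ j (i j k) k.2) ⟨k, le_refl (k : J)⟩⟩
  subst htri hun
  exact ⟨⟨ob, hom, tri, un,
    fun j k l m h h' h'' => tet' j ⟨j, le_rfl⟩ ⟨k, h⟩ ⟨l, h'.trans h⟩
      ⟨m, h''.trans (h'.trans h)⟩ h h' h'',
    fun j k h => lu' j ⟨j, le_rfl⟩ ⟨k, h⟩ h,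
    fun j k h => ru' j ⟨j, le_rfl⟩ ⟨k, h⟩ h⟩, fun j => rfl⟩

/-- The sheaf of sections on lower sets. -/
def lowerSheaf : LowerSheaf J where
  Sec U := D.SecOn U
  res h s := s.restrict h
  res_self _ := rfl
  res_res _ _ _ := rfl
  sep hU s s' H := D.sep hU s s' H
  glue hU V H := by
    obtain ⟨s, hs⟩ := D.glue hU (fun j => V j j.2) fun j k hk => H j k j.2 hk
    exact ⟨s, fun j hj => hs ⟨j, hj⟩⟩

variable {D}

/-- The data that extend a section over `{k | k < j}` to `j`. -/
structure Top {j : J} (s : D.SecOn (Set.Iio j)) where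
  ob : D.Ob j
  hom (k : Set.Iio j) : D.Hom (below_le k) ob (s.ob k)
  tri (k l : Set.Iio j) (h : l ≤ k) : D.Tri (below_le k) h (hom k) (s.hom k l h) (hom l)
  tet (k l m : Set.Iio j) (h : l ≤ k) (h' : m ≤ l) :
    D.Tet (below_le k) h h' (tri k l h) (s.tri k l m h h') (tri l m h') (tri k m (h'.trans h))
  ru (k : Set.Iio j) : D.RU (below_le k) (s.un k) (tri k k (le_refl k))

/-- The value of a section at `j`, as an extension of its restriction to `{k | k < j}`. -/
def SecOn.top {U : Set J} (s : D.SecOn U) (j : J) (hj : Set.Iic j ⊆ U) :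
    Top (s.restrict (Set.Iio_subset_Iic_self.trans hj)) where
  ob := s.ob ⟨j, hj le_rfl⟩
  hom k := s.hom ⟨j, hj le_rfl⟩ (Set.inclusion (Set.Iio_subset_Iic_self.trans hj) k) (below_le k)
  tri k l h := s.tri ⟨j, hj le_rfl⟩ (Set.inclusion (Set.Iio_subset_Iic_self.trans hj) k)
    (Set.inclusion (Set.Iio_subset_Iic_self.trans hj) l) (below_le k) h
  tet k l m h h' := s.tet ⟨j, hj le_rfl⟩ (Set.inclusion (Set.Iio_subset_Iic_self.trans hj) k)
    (Set.inclusion (Set.Iio_subset_Iic_self.trans hj) l)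
    (Set.inclusion (Set.Iio_subset_Iic_self.trans hj) m) (below_le k) h h'
  ru k := s.ru ⟨j, hj le_rfl⟩ (Set.inclusion (Set.Iio_subset_Iic_self.trans hj) k) (below_le k)

/-- The inclusion of `{k | k < j}` into `{k | k ≤ j}`. -/
abbrev below (j : J) : Set.Iio j → Set.Iic j := fun k => ⟨k, below_le k⟩

/-- The greatest element of `{k | k ≤ j}`. -/
abbrev topPt (j : J) : Set.Iic j := ⟨j, le_rfl⟩

/-- Families over `{k | k ≤ j}` are pairs of a family over `{k | k < j}` and a value at `j`. -/
theorem exists_Iic {j : J} {A : Set.Iic j → Sort r} (f : ∀ k : Set.Iio j, A (below j k))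
    (x : A (topPt j)) : ∃ g : ∀ k, A k, (∀ k, g (below j k) = f k) ∧ g (topPt j) = x := by
  classical
  refine ⟨fun k => if h : k = topPt j then h ▸ x else
    f ⟨k, lt_of_le_of_ne k.2 fun h' => h (Subtype.ext h')⟩, fun k => ?_, by simp⟩
  have : ¬ below j k = topPt j := fun h => (ne_of_lt k.2) (congrArg Subtype.val h)
  simp only [this, dite_false]

theorem iic_cases {j : J} {p : Set.Iic j → Prop} (h : p (topPt j)) (h' : ∀ k, p (below j k)) :
    ∀ k, p k := fun k => by
  obtain ⟨k, hk⟩ := k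
  obtain rfl | hk' := eq_or_lt_of_le (show k ≤ j from hk)
  · exact h
  · exact h' ⟨k, hk'⟩

/-- The elements below a point under `j`. -/
abbrev under {j : J} (a : Set.Iio j) (b : Set.Iic j) (h : b ≤ below j a) : Set.Iio j :=
  ⟨b, lt_of_le_of_lt h a.2⟩

/-- The unit at `j` completes extension data to a section over `{k | k ≤ j}`. -/
theorem exists_extension {j : J} (s : D.SecOn (Set.Iio j)) (x : Top s) :
    ∃ s' : D.SecOn (Set.Iic j), (⟨s'.restrict Set.Iio_subset_Iic_self, s'.top j subset_rfl⟩ :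
      Σ s : D.SecOn (Set.Iio j), Top s) = ⟨s, x⟩ := by
  obtain ⟨sob, shom, stri, sun, stet, slu, sru⟩ := s
  obtain ⟨xob, xhom, xtri, xtet, xru⟩ := x
  dsimp only at xhom xtri xtet xru
  -- the data are extended one kind at a time; once the given data are replaced by the
  -- restriction of the extension, the data of the next kind have the right type
  obtain ⟨ob, hob, hob'⟩ := exists_Iic (j := j) (A := fun k => D.Ob k) sob xob
  obtain rfl : sob = _ := funext fun k => (hob k).symm
  subst hob'
  obtain ⟨homj, hhomj, hone⟩ := exists_Iic
    (A := fun k => ∀ h : k ≤ topPt j, D.Hom h (ob (topPt j)) (ob k)) (fun k _ => xhom k)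
    (fun _ => D.one _)
  obtain ⟨hom, hhom, htop⟩ := exists_Iic
    (A := fun k => ∀ (l : Set.Iic j) (h : l ≤ k), D.Hom h (ob k) (ob l))
    (fun k l h => shom k (under k l h) h) (fun l h => homj l h)
  obtain rfl : shom = fun k l h => hom (below j k) (below j l) h := by
    funext k l h
    exact (congrFun (congrFun (hhom k) _) _).symm
  obtain rfl : xhom = fun k => hom (topPt j) (below j k) (below_le k) := by
    funext k
    rw [htop]
    exact (congrFun (hhomj k) _).symm
  replace hone : hom (topPt j) (topPt j) le_rfl = D.one _ := by
    simp only [htop, hone]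
  clear hhom htop hhomj homj hob
  -- the value of `hom` at `j` equals the unit 1-cell `D.one _` only propositionally; the unit data
  -- are stated for arbitrary other 1-cells, so that the statement can be rewritten with `hone`
  have unit : ∃ (un : D.Un (hom (topPt j) (topPt j) le_rfl))
      (L : ∀ (k : Set.Iic j) (h : k ≤ topPt j) (a : D.Hom h (ob (topPt j)) (ob k)),
        D.Tri le_rfl h (hom (topPt j) (topPt j) le_rfl) a a),
      (∀ k h a, D.LU h un (L k h a)) ∧
      D.RU le_rfl un (L _ le_rfl (hom (topPt j) (topPt j) le_rfl)) ∧
      ∀ (k l : Set.Iic j) (h : k ≤ topPt j) (h' : l ≤ k) (b : D.Hom h (ob (topPt j)) (ob k))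
        (c : D.Hom h' (ob k) (ob l)) (bc : D.Hom (h'.trans h) (ob (topPt j)) (ob l))
        (τ : D.Tri h h' b c bc), D.Tet le_rfl h h' (L k h b) τ τ (L l (h'.trans h) bc) := by
    rw [hone]
    exact ⟨D.unOne _, fun k h a => D.lid h a, fun k h a => D.lu_lid h a, D.ru_lid _,
      fun k l h h' b c bc τ => D.tet_lid h h' τ⟩
  obtain ⟨un₀, L, hLU, hRU, hL⟩ := unit
  obtain ⟨trij, htrij, hid⟩ := exists_Iic
    (A := fun k => ∀ (l : Set.Iic j) (h : k ≤ topPt j) (h' : l ≤ k), D.Tri h h'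
      (hom (topPt j) k h) (hom k l h') (hom (topPt j) l (h'.trans h)))
    (fun k l _ h' => xtri k (under k l h') h') (fun l _ h' => L l h' _)
  obtain ⟨tri, htri, htop⟩ := exists_Iic
    (A := fun k => ∀ (l m : Set.Iic j) (h : l ≤ k) (h' : m ≤ l), D.Tri h h'
      (hom k l h) (hom l m h') (hom k m (h'.trans h)))
    (fun k l m h h' => stri k (under k l h) (under k m (h'.trans h)) h h')
    (fun k l h h' => trij k l h h')
  obtain rfl : stri = fun k l m h h' => tri (below j k) (below j l) (below j m) h h' := by
    funext k l m h h'
    simp only [htri k]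
  obtain rfl : xtri = fun k l h => tri (topPt j) (below j k) (below j l) (below_le k) h := by
    funext k l h
    simp only [htop, htrij k]
  replace hid : ∀ l h, tri (topPt j) (topPt j) l le_rfl h = L l h _ := by
    intro l h
    simp only [htop, hid]
  clear htri htop htrij trij
  obtain ⟨un, hun, hun'⟩ := exists_Iic (A := fun k => D.Un (hom k k le_rfl)) sun un₀
  obtain rfl : sun = _ := funext fun k => (hun k).symm
  subst hun'
  refine ⟨⟨ob, hom, tri, un, ?_, ?_, ?_⟩, rfl⟩
  · refine iic_cases (iic_cases ?_ ?_) ?_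
    · intro k l h h' h''
      rw [hid, hid]
      exact hL k l h' h'' _ _ _ _
    · intro k l m h h' h''
      exact xtet k (under k l h') (under k m (h''.trans h')) h' h''
    · intro k l m n h h' h''
      exact stet k (under k l h) (under k m (h'.trans h)) (under k n (h''.trans (h'.trans h)))
        h h' h''
  · refine iic_cases ?_ ?_
    · intro k h
      rw [hid]
      exact hLU k h _
    · intro k l h
      exact slu k (under k l h) h
  · refine iic_cases (iic_cases ?_ ?_) ?_
    · intro h
      rw [hid]
      exact hRU
    · intro k h
      exact xru k
    · intro k l h
      exact sru k (under k l h) h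

/-- If sections over `{k | k < j}` extend to `j` with a property, then there is a global section
with this property at every `j`. -/
theorem exists_sec [WellFoundedLT J] (Q : ∀ (j : J) (s : D.SecOn (Set.Iio j)), Top s → Prop)
    (step : ∀ (j : J) (s : D.SecOn (Set.Iio j)), ∃ x : Top s, Q j s x) :
    ∃ s : D.SecOn Set.univ, ∀ j, Q j _ (s.top j (Set.subset_univ _)) := by
  refine D.lowerSheaf.exists_section (fun j s => Q j _ (SecOn.top s j subset_rfl)) fun j s => ?_
  obtain ⟨x, hx⟩ := step j s
  obtain ⟨s', hs'⟩ := exists_extension s x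
  refine ⟨s', congrArg Sigma.fst hs', ?_⟩
  -- `s'` restricts to `s` only propositionally, so that `Q` is transported on the total type
  have : ∀ y : Σ s : D.SecOn (Set.Iio j), Top s, y = ⟨s, x⟩ → Q j y.1 y.2 := by
    rintro _ rfl
    exact hx
  exact this _ hs'

end Disp

/-! ### Lifting against a morphism of diagrams -/

section LiftPasting

variable {C : Type u} [Bicategory.{w, v} C] {a₁ a₂ a₃ x₁ x₂ x₃ y₁ y₂ y₃ b₁ b₂ b₃ : C}

theorem push_mod_square {z : C} {d₁ : z ⟶ x₁} {d₂ : z ⟶ x₂} {s : x₁ ⟶ x₂} {n : d₂ ⟶ d₁ ≫ s}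
    {f₁ g₁ : x₁ ⟶ y₁} {f₂ g₂ : x₂ ⟶ y₂} {s' : y₁ ⟶ y₂} {N : s ≫ f₂ ⟶ f₁ ≫ s'}
    {N' : s ≫ g₂ ⟶ g₁ ≫ s'} {m₁ : f₁ ⟶ g₁} {m₂ : f₂ ⟶ g₂} (h : s ◁ m₂ ≫ N' = N ≫ m₁ ▷ s') :
    d₂ ◁ m₂ ≫ n ▷ g₂ ≫ (α_ _ _ _).hom ≫ d₁ ◁ N' ≫ (α_ _ _ _).inv =
      (n ▷ f₂ ≫ (α_ _ _ _).hom ≫ d₁ ◁ N ≫ (α_ _ _ _).inv) ≫ (d₁ ◁ m₁) ▷ s' := by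
  calc _ = (d₂ ◁ m₂ ≫ n ▷ g₂) ⊗≫ d₁ ◁ N' ⊗≫ 𝟙 _ := by bicategory
    _ = n ▷ f₂ ⊗≫ d₁ ◁ (s ◁ m₂ ≫ N') ⊗≫ 𝟙 _ := by rw [whisker_exchange]; bicategory
    _ = _ := by rw [h]; bicategory

theorem push_comp_square {z : C} {d₁ : z ⟶ x₁} {d₂ : z ⟶ x₂} {s : x₁ ⟶ x₂} {n : d₂ ⟶ d₁ ≫ s}
    {f₁ : x₁ ⟶ y₁} {f₂ : x₂ ⟶ y₂} {s' : y₁ ⟶ y₂} {N : s ≫ f₂ ⟶ f₁ ≫ s'}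
    {g₁ : y₁ ⟶ b₁} {g₂ : y₂ ⟶ b₂} {s'' : b₁ ⟶ b₂} {N' : s' ≫ g₂ ⟶ g₁ ≫ s''} :
    (α_ d₂ f₂ g₂).hom ≫ n ▷ (f₂ ≫ g₂) ≫ (α_ _ _ _).hom ≫ d₁ ◁ ((α_ _ _ _).inv ≫ N ▷ g₂ ≫
        (α_ _ _ _).hom ≫ f₁ ◁ N' ≫ (α_ _ _ _).inv) ≫ (α_ _ _ _).inv =
      ((n ▷ f₂ ≫ (α_ _ _ _).hom ≫ d₁ ◁ N ≫ (α_ _ _ _).inv) ▷ g₂ ≫ (α_ _ _ _).hom ≫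
        (d₁ ≫ f₁) ◁ N' ≫ (α_ _ _ _).inv) ≫ (α_ d₁ f₁ g₁).hom ▷ s'' := by
  bicategory

variable {ma : a₁ ⟶ a₂} {mx : x₁ ⟶ x₂} {my : y₁ ⟶ y₂} {mb : b₁ ⟶ b₂} {f₁ : a₁ ⟶ y₁}
  {f₂ : a₂ ⟶ y₂} {u₁ : a₁ ⟶ x₁} {u₂ : a₂ ⟶ x₂} {p₁ : y₁ ⟶ b₁} {p₂ : y₂ ⟶ b₂} {g₁ : x₁ ⟶ b₁}
  {g₂ : x₂ ⟶ b₂} {na : ma ≫ f₂ ≅ f₁ ≫ my} {nu : ma ≫ u₂ ≅ u₁ ≫ mx} {np : my ≫ p₂ ≅ p₁ ≫ mb}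
  {nb : mx ≫ g₂ ≅ g₁ ≫ mb}

theorem lift_cell {γ₁ : f₁ ≫ p₁ ⟶ u₁ ≫ g₁} {γ₂ : f₂ ≫ p₂ ⟶ u₂ ≫ g₂} {d₂ : x₂ ⟶ y₂}
    {l₂ : f₂ ⟶ u₂ ≫ d₂} {r₂ : d₂ ≫ p₂ ⟶ g₂}
    (h : ma ◁ γ₂ ≫ (α_ _ _ _).inv ≫ nu.hom ▷ g₂ ≫ (α_ _ _ _).hom ≫ u₁ ◁ nb.hom ≫ (α_ _ _ _).inv =
      ((α_ _ _ _).inv ≫ na.hom ▷ p₂ ≫ (α_ _ _ _).hom ≫ f₁ ◁ np.hom ≫ (α_ _ _ _).inv) ≫ γ₁ ▷ mb)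
    (h₂ : l₂ ▷ p₂ ≫ (α_ _ _ _).hom ≫ u₂ ◁ r₂ = γ₂) :
    (na.inv ≫ ma ◁ l₂ ≫ (α_ _ _ _).inv ≫ nu.hom ▷ d₂ ≫ (α_ _ _ _).hom) ▷ p₂ ≫ (α_ _ _ _).hom ≫
        u₁ ◁ ((α_ _ _ _).hom ≫ mx ◁ r₂ ≫ nb.hom) ≫ (α_ _ _ _).inv =
      ((α_ _ _ _).hom ≫ f₁ ◁ np.hom ≫ (α_ _ _ _).inv) ≫ γ₁ ▷ mb := by
  calc _ = na.inv ▷ p₂ ⊗≫ ma ◁ l₂ ▷ p₂ ⊗≫ (nu.hom ▷ (d₂ ≫ p₂) ≫ (u₁ ≫ mx) ◁ r₂) ⊗≫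
        u₁ ◁ nb.hom ⊗≫ 𝟙 _ := by bicategory
    _ = na.inv ▷ p₂ ⊗≫ ma ◁ (l₂ ▷ p₂ ≫ (α_ _ _ _).hom ≫ u₂ ◁ r₂) ⊗≫ nu.hom ▷ g₂ ⊗≫
        u₁ ◁ nb.hom ⊗≫ 𝟙 _ := by rw [← whisker_exchange]; bicategory
    _ = na.inv ▷ p₂ ⊗≫ (ma ◁ γ₂ ≫ (α_ _ _ _).inv ≫ nu.hom ▷ g₂ ≫ (α_ _ _ _).hom ≫ u₁ ◁ nb.hom ≫
        (α_ _ _ _).inv) := by rw [h₂]; bicategory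
    _ = (na.inv ≫ na.hom) ▷ p₂ ⊗≫ f₁ ◁ np.hom ⊗≫ γ₁ ▷ mb := by rw [h]; bicategory
    _ = _ := by rw [Iso.inv_hom_id]; bicategory

theorem lift_left {d₁ : x₁ ⟶ y₁} {d₂ : x₂ ⟶ y₂} {l₁ : f₁ ⟶ u₁ ≫ d₁} {l₂ : f₂ ⟶ u₂ ≫ d₂}
    {θ : d₁ ≫ my ≅ mx ≫ d₂}
    (h : l₁ ▷ my ≫ (α_ _ _ _).hom ≫ u₁ ◁ θ.hom =
      na.inv ≫ ma ◁ l₂ ≫ (α_ _ _ _).inv ≫ nu.hom ▷ d₂ ≫ (α_ _ _ _).hom) :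
    ma ◁ l₂ ≫ (α_ _ _ _).inv ≫ nu.hom ▷ d₂ ≫ (α_ _ _ _).hom ≫ u₁ ◁ θ.inv ≫ (α_ _ _ _).inv =
      na.hom ≫ l₁ ▷ my := by
  calc _ = na.hom ≫ (na.inv ≫ ma ◁ l₂ ≫ (α_ _ _ _).inv ≫ nu.hom ▷ d₂ ≫ (α_ _ _ _).hom) ≫
        u₁ ◁ θ.inv ≫ (α_ _ _ _).inv := by simp
    _ = na.hom ⊗≫ l₁ ▷ my ⊗≫ u₁ ◁ (θ.hom ≫ θ.inv) ⊗≫ 𝟙 _ := by rw [← h]; bicategory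
    _ = _ := by rw [Iso.hom_inv_id]; bicategory

theorem lift_right {d₁ : x₁ ⟶ y₁} {d₂ : x₂ ⟶ y₂} {r₁ : d₁ ≫ p₁ ⟶ g₁} {r₂ : d₂ ≫ p₂ ⟶ g₂}
    {θ : d₁ ≫ my ≅ mx ≫ d₂}
    (h : θ.hom ▷ p₂ ≫ (α_ _ _ _).hom ≫ mx ◁ r₂ ≫ nb.hom =
      ((α_ _ _ _).hom ≫ d₁ ◁ np.hom ≫ (α_ _ _ _).inv) ≫ r₁ ▷ mb) :
    mx ◁ r₂ ≫ nb.hom = ((α_ _ _ _).inv ≫ θ.inv ▷ p₂ ≫ (α_ _ _ _).hom ≫ d₁ ◁ np.hom ≫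
      (α_ _ _ _).inv) ≫ r₁ ▷ mb := by
  simp only [Category.assoc] at h ⊢
  rw [← h]
  simp

theorem lift_nat_comp {mx' : x₂ ⟶ x₃} {mx'' : x₁ ⟶ x₃} {my' : y₂ ⟶ y₃} {my'' : y₁ ⟶ y₃}
    {cx : mx'' ⟶ mx ≫ mx'} {cy : my'' ⟶ my ≫ my'} {d₁ : x₁ ⟶ y₁} {d₂ : x₂ ⟶ y₂} {d₃ : x₃ ⟶ y₃}
    {θ : d₁ ≫ my ≅ mx ≫ d₂} {θ' : d₁ ≫ my'' ≅ mx'' ≫ d₃} {N : mx' ≫ d₃ ⟶ d₂ ≫ my'}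
    (h : θ'.hom ≫ cx ▷ d₃ ≫ (α_ _ _ _).hom ≫ mx ◁ N ≫ (α_ _ _ _).inv =
      (d₁ ◁ cy ≫ (α_ _ _ _).inv) ≫ θ.hom ▷ my') :
    θ'.inv ≫ d₁ ◁ cy = cx ▷ d₃ ≫ (α_ _ _ _).hom ≫ mx ◁ N ≫ (α_ _ _ _).inv ≫ θ.inv ▷ my' ≫
      (α_ _ _ _).hom := by
  rw [Iso.inv_comp_eq]
  calc _ = ((d₁ ◁ cy ≫ (α_ _ _ _).inv) ≫ θ.hom ▷ my') ≫ θ.inv ▷ my' ≫ (α_ _ _ _).hom := by simp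
    _ = _ := by rw [← h]; simp

end LiftPasting

section LiftPastingUnit

variable {C : Type u} [Bicategory.{w, v} C] {a x y b : C} {ma : a ⟶ a} {mx : x ⟶ x} {my : y ⟶ y}
  {mb : b ⟶ b} {ia : ma ≅ 𝟙 a} {ix : mx ≅ 𝟙 x} {iy : my ≅ 𝟙 y} {ib : mb ≅ 𝟙 b}

/-- The structural 2-cell at an identity of a 1-cell between objects with units. -/
@[simps!]
def unitNat (ix : mx ≅ 𝟙 x) (iy : my ≅ 𝟙 y) (d : x ⟶ y) : mx ≫ d ≅ d ≫ my :=
  whiskerRightIso ix d ≪≫ λ_ d ≪≫ (ρ_ d).symm ≪≫ whiskerLeftIso d iy.symm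

theorem unitNat_nat_id (d : x ⟶ y) :
    (unitNat ix iy d).hom ≫ d ◁ iy.hom = ix.hom ▷ d ≫ (λ_ _).hom ≫ (ρ_ _).inv := by
  simp [← whiskerLeft_comp]

theorem unitNat_left {f : a ⟶ y} {u : a ⟶ x} {d : x ⟶ y} {l : f ⟶ u ≫ d} {na : ma ≫ f ⟶ f ≫ my}
    {nu : ma ≫ u ⟶ u ≫ mx} (ha : na ≫ f ◁ iy.hom = ia.hom ▷ f ≫ (λ_ _).hom ≫ (ρ_ _).inv)
    (hu : nu ≫ u ◁ ix.hom = ia.hom ▷ u ≫ (λ_ _).hom ≫ (ρ_ _).inv) :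
    ma ◁ l ≫ (α_ _ _ _).inv ≫ nu ▷ d ≫ (α_ _ _ _).hom ≫ u ◁ (unitNat ix iy d).hom ≫
      (α_ _ _ _).inv = na ≫ l ▷ my := by
  have hna : na = ia.hom ▷ f ≫ (λ_ _).hom ≫ (ρ_ _).inv ≫ f ◁ iy.inv := by
    rw [← cancel_mono (f ◁ iy.hom), ha]
    simp [← whiskerLeft_comp]
  calc _ = ma ◁ l ⊗≫ (nu ≫ u ◁ ix.hom) ▷ d ⊗≫ u ◁ d ◁ iy.inv ⊗≫ 𝟙 _ := by simp; bicategory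
    _ = (ma ◁ l ≫ ia.hom ▷ (u ≫ d)) ⊗≫ (u ≫ d) ◁ iy.inv := by rw [hu]; bicategory
    _ = ia.hom ▷ f ⊗≫ (l ▷ 𝟙 y ≫ (u ≫ d) ◁ iy.inv) := by rw [whisker_exchange]; bicategory
    _ = _ := by rw [hna, ← whisker_exchange]; bicategory

theorem unitNat_right {p : y ⟶ b} {g : x ⟶ b} {d : x ⟶ y} {s : d ≫ p ⟶ g} {np : my ≫ p ⟶ p ≫ mb}
    {nb : mx ≫ g ⟶ g ≫ mb} (hp : np ≫ p ◁ ib.hom = iy.hom ▷ p ≫ (λ_ _).hom ≫ (ρ_ _).inv)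
    (hb : nb ≫ g ◁ ib.hom = ix.hom ▷ g ≫ (λ_ _).hom ≫ (ρ_ _).inv) :
    mx ◁ s ≫ nb = ((α_ _ _ _).inv ≫ (unitNat ix iy d).hom ▷ p ≫ (α_ _ _ _).hom ≫ d ◁ np ≫
      (α_ _ _ _).inv) ≫ s ▷ mb := by
  have hnb : nb = ix.hom ▷ g ≫ (λ_ _).hom ≫ (ρ_ _).inv ≫ g ◁ ib.inv := by
    rw [← cancel_mono (g ◁ ib.hom), hb]
    simp [← whiskerLeft_comp]
  have hnp : np = iy.hom ▷ p ≫ (λ_ _).hom ≫ (ρ_ _).inv ≫ p ◁ ib.inv := by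
    rw [← cancel_mono (p ◁ ib.hom), hp]
    simp [← whiskerLeft_comp]
  calc _ = (mx ◁ s ≫ ix.hom ▷ g) ⊗≫ g ◁ ib.inv := by rw [hnb]; bicategory
    _ = ix.hom ▷ (d ≫ p) ⊗≫ (s ▷ 𝟙 b ≫ g ◁ ib.inv) := by rw [whisker_exchange]; bicategory
    _ = ix.hom ▷ (d ≫ p) ⊗≫ (d ≫ p) ◁ ib.inv ⊗≫ s ▷ mb := by
      rw [← whisker_exchange]; bicategory
    _ = 𝟙 _ ⊗≫ ix.hom ▷ d ▷ p ⊗≫ d ◁ (iy.inv ≫ iy.hom) ▷ p ⊗≫ (d ≫ p) ◁ ib.inv ⊗≫ s ▷ mb := by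
      rw [Iso.inv_hom_id]; bicategory
    _ = _ := by rw [hnp]; simp; bicategory

theorem unitNat_nat_comp {x' y' : C} {m : x ⟶ x'} {n : y ⟶ y'} {cx : m ≅ mx ≫ m} {cy : n ≅ my ≫ n}
    {d : x ⟶ y} {d' : x' ⟶ y'} {N : m ≫ d' ⟶ d ≫ n} (hx : cx.hom ≫ ix.hom ▷ m = (λ_ _).inv)
    (hy : cy.hom ≫ iy.hom ▷ n = (λ_ _).inv) :
    N ≫ d ◁ cy.hom = cx.hom ▷ d' ≫ (α_ _ _ _).hom ≫ mx ◁ N ≫ (α_ _ _ _).inv ≫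
      (unitNat ix iy d).hom ▷ n ≫ (α_ _ _ _).hom := by
  have hcy : cy.hom = (λ_ _).inv ≫ iy.inv ▷ n := by
    rw [← cancel_mono (iy.hom ▷ n), hy]
    simp [← comp_whiskerRight]
  symm
  calc _ = cx.hom ▷ d' ⊗≫ (mx ◁ N ≫ ix.hom ▷ (d ≫ n)) ⊗≫ d ◁ iy.inv ▷ n := by simp; bicategory
    _ = (cx.hom ≫ ix.hom ▷ m) ▷ d' ⊗≫ N ⊗≫ d ◁ iy.inv ▷ n := by
      rw [whisker_exchange]; bicategory
    _ = _ := by rw [hx, hcy]; bicategory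

end LiftPastingUnit

namespace RawCone

variable {S : Type u₁} [PartialOrder S] {C : Type u} [Bicategory.{w, v} C] {Y B E : Diag S C}
  {x : C}

theorem isMor_push_mod (c : RawCone Y x) {p q : Y ⟶ B} (Γ : p ⟶ q) :
    (c.push p).IsMor (c.push q) fun k => c.app k ◁ Γ.as.app (pt k) :=
  ⟨fun h => push_mod_square (modification_nat Γ h)⟩

theorem isMor_push_comp (c : RawCone Y x) (p : Y ⟶ B) (q : B ⟶ E) :
    ((c.push p).push q).IsMor (c.push (p ≫ q)) fun k => (α_ (c.app k) _ _).hom :=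
  ⟨fun {j k} h => (congrArg (fun t => (α_ (c.app k) (p.app (pt k)) (q.app (pt k))).hom ≫
      (c.nat h).hom ▷ (p.app (pt k) ≫ q.app (pt k)) ≫ (α_ _ _ _).hom ≫ c.app j ◁ t ≫
        (α_ _ _ _).inv) (nat_comp_hom p q h)).trans push_comp_square⟩

theorem isMor_push_comp_inv (c : RawCone Y x) (p : Y ⟶ B) (q : B ⟶ E) :
    (c.push (p ≫ q)).IsMor ((c.push p).push q) fun k => (α_ (c.app k) _ _).inv :=
  IsMor.inv (c := (c.push p).push q) (d := c.push (p ≫ q))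
    (m := fun k => α_ (c.app k) (p.app (pt k)) (q.app (pt k))) (c.isMor_push_comp p q)

end RawCone

section Filler

variable {J : Type u₁} [PartialOrder J] {C : Type u} [Bicategory.{w, v} C] {A X Y B : Diag J C}
  {i : A ⟶ X} {p : Y ⟶ B} {a : A ⟶ Y} {b : X ⟶ B}

/-- A filler of a component of a square of diagrams. -/
structure Filler (γ : a ≫ p ≅ i ≫ b) (j : J) where
  f : X.ob j ⟶ Y.ob j
  l : a.app (pt j) ≅ i.app (pt j) ≫ f
  r : f ≫ p.app (pt j) ≅ b.app (pt j)
  fac : l.hom ▷ p.app (pt j) ≫ (α_ _ _ _).hom ≫ i.app (pt j) ◁ r.hom = γ.hom.as.app (pt j)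

/-- A naturality 2-cell between two fillers. -/
structure Filler.Nat (γ : a ≫ p ≅ i ≫ b) {j k : J} (h : k ≤ j) (x : Filler γ j)
    (y : Filler γ k) where
  iso : X.mp h ≫ y.f ≅ x.f ≫ Y.mp h
  left : A.mp h ◁ y.l.hom ≫ (α_ _ _ _).inv ≫ (nat i h).hom ▷ y.f ≫ (α_ _ _ _).hom ≫
    i.app (pt j) ◁ iso.hom ≫ (α_ _ _ _).inv = (nat a h).hom ≫ x.l.hom ▷ Y.mp h
  right : X.mp h ◁ y.r.hom ≫ (nat b h).hom = ((α_ _ _ _).inv ≫ iso.hom ▷ p.app (pt k) ≫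
    (α_ _ _ _).hom ≫ x.f ◁ (nat p h).hom ≫ (α_ _ _ _).inv) ≫ x.r.hom ▷ B.mp h

/-- The data whose global sections are the fillers of a square of diagrams. -/
def fillerDisp (γ : a ≫ p ≅ i ≫ b) : Disp.{0, w, max v w, 0} J where
  Ob j := Filler γ j
  Hom h x y := Filler.Nat γ h x y
  Tri {_ _ _} h h' x _ z N N' N'' := PLift (N''.iso.hom ≫ x.f ◁ (Y.cmp h h').hom =
    (X.cmp h h').hom ▷ z.f ≫ (α_ _ _ _).hom ≫ X.mp h ◁ N'.iso.hom ≫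
        (α_ _ _ _).inv ≫ N.iso.hom ▷ Y.mp h' ≫ (α_ _ _ _).hom)
  Tet _ _ _ _ _ _ _ _ _ _ _ _ _ _ _ _ _ := True
  Un {j x} N := PLift (N.iso.hom ≫ x.f ◁ (Y.idm j).hom =
      (X.idm j).hom ▷ x.f ≫ (λ_ _).hom ≫ (ρ_ _).inv)
  LU _ _ _ _ _ _ _ := True
  RU _ _ _ _ _ _ _ := True
  one {j} x := ⟨unitNat (X.idm j) (Y.idm j) x.f, unitNat_left (nat_id a j) (nat_id i j),
    unitNat_right (nat_id p j) (nat_id b j)⟩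
  unOne _ := ⟨unitNat_nat_id _⟩
  lid h _ _ _ := ⟨unitNat_nat_comp (X.cmp_id_left h) (Y.cmp_id_left h)⟩
  lu_lid _ _ _ _ := trivial
  ru_lid _ := trivial
  tet_lid _ _ _ _ _ _ _ _ _ := trivial

theorem nat_square_congr {C' : Type u} [Bicategory.{w, v} C'] {x x' y z' : C'} {m : x ⟶ x'}
    {n : y ⟶ z'} {s t : x ⟶ y} {s' t' : x' ⟶ z'} {σ : s ⟶ t} {σ' : s' ⟶ t'} {N N' : m ≫ s' ⟶ s ≫ n}
    {M M' : m ≫ t' ⟶ t ≫ n} (hN : N' = N) (hM : M' = M) (h : m ◁ σ' ≫ M = N ≫ σ ▷ n) :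
    m ◁ σ' ≫ M' = N' ≫ σ ▷ n := by
  rw [hN, hM, h]

variable {γ : a ≫ p ≅ i ≫ b}

/-- The morphism of restricted diagrams that a section of fillers over a subset defines. -/
def fillerMap {S : Set J} (s : (fillerDisp γ).SecOn S) : restrict S X ⟶ restrict S Y :=
  mkTrans (X := restrict S X) (Y := restrict S Y) (fun k => (s.ob k).f)
    (fun {j k} h => (s.hom j k h).iso) (fun k => (s.un k).down)
    (fun {j k l} h h' => (s.tri j k l h h').down)

/-- The left-hand invertible modification of the filler that a section defines. -/
def fillerLeft {S : Set J} (s : (fillerDisp γ).SecOn S) :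
    restrictMap S a ≅ restrictMap S i ≫ fillerMap s :=
  mkModIso (fun k => (s.ob k).l) fun {j k} h =>
    nat_square_congr rfl (nat_comp_hom (restrictMap S i) (fillerMap s) h) (s.hom j k h).left

/-- The right-hand invertible modification of the filler that a section defines. -/
def fillerRight {S : Set J} (s : (fillerDisp γ).SecOn S) :
    fillerMap s ≫ restrictMap S p ≅ restrictMap S b :=
  mkModIso (fun k => (s.ob k).r) fun {j k} h =>
    nat_square_congr (nat_comp_hom (fillerMap s) (restrictMap S p) h) rfl (s.hom j k h).right

/-- The lifting property of the triple of `p` at `j` extends a partial filler to `j`: the partial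
filler and the square at `j` form a triple with vertex `X_j`, and a lift of it is the value at
`j`. -/
theorem exists_top_filler (j : J) (hi : Triple.HasLift (i.app (pt j)) (downTriple p j))
    (s : (fillerDisp γ).SecOn (Set.Iio j)) : Nonempty (Disp.Top s) := by
  have hγ (k : Set.Iio j) : A.mp (below_le k) ◁ γ.hom.as.app (pt (k : J)) ≫ (α_ _ _ _).inv ≫
      (nat i (below_le k)).hom ▷ b.app (pt (k : J)) ≫ (α_ _ _ _).hom ≫
        i.app (pt j) ◁ (nat b (below_le k)).hom ≫ (α_ _ _ _).inv =
      ((α_ _ _ _).inv ≫ (nat a (below_le k)).hom ▷ p.app (pt (k : J)) ≫ (α_ _ _ _).hom ≫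
        a.app (pt j) ◁ (nat p (below_le k)).hom ≫ (α_ _ _ _).inv) ≫
          γ.hom.as.app (pt j) ▷ B.mp (below_le k) :=
    nat_square_congr (nat_comp_hom a p _).symm (nat_comp_hom i b _).symm
      (modification_nat γ.hom (below_le k))
  let S := Set.Iio j
  let D : Triple (restrictMap S p) (downRaw B j) (X.ob j) :=
    { cone := (downRaw X j).push (fillerMap s)
      base := b.app (pt j)
      cell := fun k => α_ _ _ _ ≪≫ whiskerLeftIso _ (s.ob k).r ≪≫ nat b (below_le k)
      isMor_cell := ((downRaw X j).isMor_push_comp (fillerMap s) (restrictMap S p)).comp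
        (((downRaw X j).isMor_push_mod (fillerRight s).hom).comp (downTriple b j).isMor_cell) }
  obtain ⟨g, l, θ, r, hθ, hl, hl'⟩ := hi (a.app (pt j)) D
    (fun k => (nat a (below_le k)).symm ≪≫ whiskerLeftIso _ (s.ob k).l ≪≫ (α_ _ _ _).symm ≪≫
      whiskerRightIso (nat i (below_le k)) _ ≪≫ α_ _ _ _) (isoApp γ j)
    ⟨RawCone.IsMor.comp (RawCone.IsMor.inv (c := (downRaw A j).push (restrictMap S a))
        (d := (downRaw Y j).pull (a.app (pt j))) (m := fun k => nat a (below_le k))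
        (downTriple a j).isMor_cell)
      (((downRaw A j).isMor_push_mod (fillerLeft s).hom).comp
        (((downRaw A j).isMor_push_comp_inv (restrictMap S i) (fillerMap s)).comp
          (((downTriple i j).isMor_cell.push (fillerMap s)).comp
            ((downRaw X j).isMor_push_pull (i.app (pt j)) (fillerMap s))))),
      fun k => lift_cell (hγ k) (s.ob k).fac⟩
  exact ⟨{
    ob := ⟨g, l, r, hl'⟩
    hom := fun k => ⟨(θ k).symm, lift_left (hl k), lift_right (hθ.cell k)⟩
    tri := fun k l h => ⟨lift_nat_comp (hθ.cone.nat h)⟩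
    tet := fun _ _ _ _ _ => trivial
    ru := fun _ => trivial }⟩

/-- A morphism of diagrams lifts against `p` if its components lift against the triples of `p`: a
filler is constructed by recursion on the poset. -/
theorem hasLifting_of_hasLift [WellFoundedLT J] {A X Y B : Diag J C} {i : A ⟶ X} {p : Y ⟶ B}
    (h : ∀ j, Triple.HasLift (i.app (pt j)) (downTriple p j)) : HasLifting i p := by
  intro a b γ
  obtain ⟨s, -⟩ := Disp.exists_sec (D := fillerDisp γ) (fun _ _ _ => True) fun j s =>
    (exists_top_filler j (h j) s).elim fun x => ⟨x, trivial⟩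
  let f : X ⟶ Y := mkTrans (fun k => (s.ob ⟨k, trivial⟩).f)
    (fun {j k} h => (s.hom ⟨j, trivial⟩ ⟨k, trivial⟩ h).iso) (fun k => (s.un ⟨k, trivial⟩).down)
    (fun {j k l} h h' => (s.tri ⟨j, trivial⟩ ⟨k, trivial⟩ ⟨l, trivial⟩ h h').down)
  refine ⟨f, mkModIso (fun k => (s.ob ⟨k, trivial⟩).l) fun {j k} h =>
    nat_square_congr rfl (nat_comp_hom i f h) (s.hom ⟨j, trivial⟩ ⟨k, trivial⟩ h).left,
    mkModIso (fun k => (s.ob ⟨k, trivial⟩).r) fun {j k} h =>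
    nat_square_congr (nat_comp_hom f p h) rfl (s.hom ⟨j, trivial⟩ ⟨k, trivial⟩ h).right,
    mod_ext fun j => (s.ob ⟨j, trivial⟩).fac⟩

end Filler

/-! ### Factorizations of morphisms of diagrams -/

section Factor

variable {J : Type u₁} [PartialOrder J] {C : Type u} [Bicategory.{w, v} C] {X Y : Diag J C}

section Pasting

variable {x₁ x₂ x₃ z₁ z₂ z₃ y₁ y₂ y₃ : C} {mx : x₁ ⟶ x₂} {m : z₁ ⟶ z₂} {my : y₁ ⟶ y₂}
  {f₁ : x₁ ⟶ y₁} {f₂ : x₂ ⟶ y₂} {i₁ : x₁ ⟶ z₁} {i₂ : x₂ ⟶ z₂} {p₁ : z₁ ⟶ y₁} {p₂ : z₂ ⟶ y₂}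

theorem factor_compat {θ : i₁ ≫ m ≅ mx ≫ i₂} {φ₂ : f₂ ≅ i₂ ≫ p₂} {r : i₁ ≫ p₁ ≅ f₁}
    {nf : mx ≫ f₂ ⟶ f₁ ≫ my} {np : m ≫ p₂ ⟶ p₁ ≫ my}
    (h : θ.hom ▷ p₂ ≫ (α_ _ _ _).hom ≫ mx ◁ φ₂.inv ≫ nf =
      ((α_ _ _ _).hom ≫ i₁ ◁ np ≫ (α_ _ _ _).inv) ≫ r.hom ▷ my) :
    mx ◁ φ₂.hom ≫ (α_ _ _ _).inv ≫ θ.inv ▷ p₂ ≫ (α_ _ _ _).hom ≫ i₁ ◁ np ≫ (α_ _ _ _).inv =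
      nf ≫ r.inv ▷ my := by
  rw [← cancel_mono (r.hom ▷ my)]
  calc _ = mx ◁ φ₂.hom ≫ (α_ _ _ _).inv ≫ θ.inv ▷ p₂ ≫ (((α_ _ _ _).hom ≫ i₁ ◁ np ≫
        (α_ _ _ _).inv) ≫ r.hom ▷ my) := by simp
    _ = _ := by rw [← h]; simp [← whiskerLeft_comp_assoc]

theorem triple_nat_comp {m' : z₂ ⟶ z₃} {m'' : z₁ ⟶ z₃} {my' : y₂ ⟶ y₃} {my'' : y₁ ⟶ y₃}
    {p₃ : z₃ ⟶ y₃} {c : m'' ⟶ m ≫ m'} {cy : my'' ⟶ my ≫ my'} {np : m ≫ p₂ ⟶ p₁ ≫ my}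
    {np' : m' ≫ p₃ ⟶ p₂ ≫ my'} {np'' : m'' ≫ p₃ ⟶ p₁ ≫ my''} :
    np'' ≫ p₁ ◁ cy ≫ (α_ _ _ _).inv =
        (c ▷ p₃ ≫ (α_ _ _ _).hom ≫ m ◁ np' ≫ (α_ _ _ _).inv) ≫ np ▷ my' ↔
      np'' ≫ p₁ ◁ cy = c ▷ p₃ ≫ (α_ _ _ _).hom ≫ m ◁ np' ≫ (α_ _ _ _).inv ≫ np ▷ my' ≫
        (α_ _ _ _).hom := by
  rw [← cancel_mono (α_ p₁ my my').hom]
  simp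

end Pasting

/-- A factorization of a component of a morphism of diagrams. -/
structure FactorOb (f : X ⟶ Y) (j : J) where
  z : C
  i : X.ob j ⟶ z
  p : z ⟶ Y.ob j
  φ : f.app (pt j) ≅ i ≫ p

/-- A transition 1-cell between two factorizations. -/
structure FactorHom (f : X ⟶ Y) {j k : J} (h : k ≤ j) (x : FactorOb f j) (y : FactorOb f k) where
  m : x.z ⟶ y.z
  ni : X.mp h ≫ y.i ≅ x.i ≫ m
  np : m ≫ y.p ≅ x.p ≫ Y.mp h
  compat : X.mp h ◁ y.φ.hom ≫ (α_ _ _ _).inv ≫ ni.hom ▷ y.p ≫ (α_ _ _ _).hom ≫ x.i ◁ np.hom ≫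
    (α_ _ _ _).inv = (nat f h).hom ≫ x.φ.hom ▷ Y.mp h

/-- A structural 2-cell for the composition of transition 1-cells between factorizations. -/
structure FactorTri (f : X ⟶ Y) {j k l : J} (h : k ≤ j) (h' : l ≤ k) {x : FactorOb f j}
    {y : FactorOb f k} {z : FactorOb f l} (a : FactorHom f h x y) (b : FactorHom f h' y z)
    (c : FactorHom f (h'.trans h) x z) where
  iso : c.m ≅ a.m ≫ b.m
  left : c.ni.hom ≫ x.i ◁ iso.hom = (X.cmp h h').hom ▷ z.i ≫ (α_ _ _ _).hom ≫
    X.mp h ◁ b.ni.hom ≫ (α_ _ _ _).inv ≫ a.ni.hom ▷ b.m ≫ (α_ _ _ _).hom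
  right : c.np.hom ≫ x.p ◁ (Y.cmp h h').hom = iso.hom ▷ z.p ≫ (α_ _ _ _).hom ≫
    a.m ◁ b.np.hom ≫ (α_ _ _ _).inv ≫ a.np.hom ▷ Y.mp h' ≫ (α_ _ _ _).hom

/-- A structural 2-cell for the unit. -/
structure FactorUnit (f : X ⟶ Y) {j : J} {x : FactorOb f j} (e : FactorHom f (le_refl j) x x) where
  iso : e.m ≅ 𝟙 x.z
  left : e.ni.hom ≫ x.i ◁ iso.hom = (X.idm j).hom ▷ x.i ≫ (λ_ _).hom ≫ (ρ_ _).inv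
  right : e.np.hom ≫ x.p ◁ (Y.idm j).hom = iso.hom ▷ x.p ≫ (λ_ _).hom ≫ (ρ_ _).inv

/-- The data whose global sections are the factorizations of a morphism of diagrams. -/
def factorDisp (f : X ⟶ Y) : Disp.{w, max v w, max u v w, w} J where
  Ob := FactorOb f
  Hom h x y := FactorHom f h x y
  Tri h h' _ _ _ a b c := FactorTri f h h' a b c
  Tet {_ _ _ _} _ _ _ _ _ _ _ a _ c _ _ _ τ₁ τ₂ τ₃ τ₄ :=
    τ₄.iso.hom ≫ a.m ◁ τ₂.iso.hom = τ₃.iso.hom ≫ τ₁.iso.hom ▷ c.m ≫ (α_ _ _ _).hom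
  Un e := FactorUnit f e
  LU {_ _} _ _ _ _ a η τ := τ.iso.hom ≫ η.iso.hom ▷ a.m = (λ_ _).inv
  RU {_ _} _ _ _ _ a η τ := τ.iso.hom ≫ a.m ◁ η.iso.hom = (ρ_ _).inv
  one {j} x := ⟨𝟙 _, unitNat (X.idm j) (Iso.refl _) x.i, unitNat (Iso.refl _) (Y.idm j) x.p,
    unitNat_left (nat_id f j) (unitNat_nat_id _)⟩
  unOne _ := ⟨Iso.refl _, unitNat_nat_id _, unitNat_nat_id _⟩
  lid h _ _ a := ⟨(λ_ a.m).symm, unitNat_nat_comp (X.cmp_id_left h) (by simp),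
    unitNat_nat_comp (cx := (λ_ a.m).symm) (by simp) (Y.cmp_id_left h)⟩
  lu_lid _ _ _ _ := by simp
  ru_lid _ := by simp [unitors_inv_equal]
  tet_lid _ _ _ _ _ _ _ _ _ := by simp

section OnSubset

variable {f : X ⟶ Y} {S : Set J} (s : (factorDisp f).SecOn S)

/-- The diagram that a section of factorizations over a subset defines. -/
def factorDiag : Diag S C :=
  Diag.mk' (fun k => (s.ob k).z) (fun {j k} h => (s.hom j k h).m) (fun k => (s.un k).iso)
    (fun {j k l} h h' => (s.tri j k l h h').iso) (fun {j k l m} h h' h'' => s.tet j k l m h h' h'')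
    (fun {j k} h => s.lu j k h) (fun {j k} h => s.ru j k h)

/-- The left factor that a section of factorizations defines. -/
def factorLeft : restrict S X ⟶ factorDiag s :=
  mkTrans (X := restrict S X) (Y := factorDiag s) (fun k => (s.ob k).i)
    (fun {j k} h => (s.hom j k h).ni) (fun k => (s.un k).left)
    (fun {j k l} h h' => (s.tri j k l h h').left)

/-- The right factor that a section of factorizations defines. -/
def factorRight : factorDiag s ⟶ restrict S Y :=
  mkTrans (X := factorDiag s) (Y := restrict S Y) (fun k => (s.ob k).p)
    (fun {j k} h => (s.hom j k h).np) (fun k => (s.un k).right)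
    (fun {j k l} h h' => (s.tri j k l h h').right)

/-- The factorization that a section of factorizations defines. -/
def factorIso : restrictMap S f ≅ factorLeft s ≫ factorRight s :=
  mkModIso (fun k => (s.ob k).φ) fun {j k} h =>
    nat_square_congr rfl (nat_comp_hom (factorLeft s) (factorRight s) h) (s.hom j k h).compat

end OnSubset

variable {f : X ⟶ Y} {j : J} (s : (factorDisp f).SecOn (Set.Iio j))

/-- The triple below `j` of an extension of factorizations to `j`. -/
def topTriple (x : Disp.Top s) : Triple (factorRight s) (downRaw Y j) x.ob.z where
  cone :=
    { app := fun k => (x.hom k).m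
      nat := fun {k l} h => (x.tri k l h).iso
      nat_id := fun k => x.ru k
      nat_comp := fun {k l m} h h' => x.tet k l m h h' }
  base := x.ob.p
  cell k := (x.hom k).np
  isMor_cell := ⟨fun {k l} h => triple_nat_comp.2 (x.tri k l h).right⟩

/-- The triple with vertex `X_j` that the factorizations below `j` define. -/
def factorTriple : Triple (factorRight s) (downRaw Y j) (X.ob j) where
  cone := (downRaw X j).push (factorLeft s)
  base := f.app (pt j)
  cell k := α_ _ _ _ ≪≫ whiskerLeftIso _ (s.ob k).φ.symm ≪≫ nat f (below_le k)
  isMor_cell := ((downRaw X j).isMor_push_comp (factorLeft s) (factorRight s)).comp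
    (((downRaw X j).isMor_push_mod (factorIso s).inv).comp (downTriple f j).isMor_cell)

/-- A triple `E` that induces `factorTriple s` up to isomorphism along `i : X_j ⟶ z` extends the
factorizations to `j`, with `E` as its triple. -/
theorem exists_top_of_triple {z : C} (E : Triple (factorRight s) (downRaw Y j) z)
    (i : X.ob j ⟶ z) (θ : ∀ k, i ≫ E.cone.app k ≅ (factorTriple s).cone.app k)
    (r : i ≫ E.base ≅ (factorTriple s).base)
    (h : (E.pull i).IsMor (factorTriple s) (fun k => (θ k).hom) r.hom) :
    ∃ x : Disp.Top s, x.ob = ⟨z, i, E.base, r.symm⟩ ∧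
      ∀ {a b : C} (u : a ⟶ b), Triple.HasLift u E → Triple.HasLift u (topTriple s x) :=
  ⟨{ ob := ⟨z, i, E.base, r.symm⟩
     hom := fun k => ⟨E.cone.app k, (θ k).symm, E.cell k, factor_compat (h.cell k)⟩
     tri := fun _ _ h' => ⟨E.cone.nat h', lift_nat_comp (h.cone.nat h'),
      triple_nat_comp.1 (E.isMor_cell.nat h')⟩
     tet := fun _ _ _ h h' => E.cone.nat_comp h h'
     ru := fun k => E.cone.nat_id k }, rfl, fun _ hu => hu⟩

/-- The value at `j` of a factorization: factor the 1-cell from `X_j` to the universal triple. -/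
theorem exists_top_factor (hC : HasFiniteWeightedBilimits C) [Finite (Set.Iio j)]
    {L : MorphismProperty C} (hL : ∀ ⦃X Y : C⦄ (f : X ⟶ Y), ∃ (Z : C) (i : X ⟶ Z) (p : Z ⟶ Y),
      L i ∧ (∀ ⦃A D : C⦄ (u : A ⟶ D), L u → HasLifting u p) ∧ Nonempty (f ≅ i ≫ p)) :
    ∃ x : Disp.Top s, L x.ob.i ∧
      ∀ ⦃a b : C⦄ (u : a ⟶ b), L u → Triple.HasLift u (topTriple s x) := by
  obtain ⟨q, T, hT⟩ := exists_isUniv_triple hC (factorRight s) (downRaw Y j)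
  obtain ⟨g, θ, r, hg⟩ := hT.lift (factorTriple s)
  obtain ⟨z, i, p, hi, hp, ⟨e⟩⟩ := hL g
  obtain ⟨x, hx, hx'⟩ := exists_top_of_triple s (T.pull p) i
    (fun k => (α_ _ _ _).symm ≪≫ whiskerRightIso e.symm _ ≪≫ θ k)
    ((α_ _ _ _).symm ≪≫ whiskerRightIso e.symm _ ≪≫ r)
    ((T.isMor_pull_pull_inv i p).comp ((T.isMor_whiskerRight e.inv).comp hg))
  refine ⟨x, ?_, fun a b u hu => hx' u ?_⟩
  · rw [hx]
    exact hi
  · exact (hT.hasLifting_iff (fun k => Iso.refl _) (Iso.refl _)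
      (T.pull p).isMor_id u).1 (hp u hu)

/-- If 1-cells of `C` factor into a 1-cell of `L` and a 1-cell with the lifting property against
`L`, then morphisms of diagrams factor into a morphism that is pointwise in `L` and a morphism all
of whose triples have the lifting property against `L`. -/
theorem exists_factorization [WellFoundedLT J] (hJ : ∀ j : J, Finite (Set.Iio j))
    (hC : HasFiniteWeightedBilimits C) {L : MorphismProperty C}
    (hL : ∀ ⦃X Y : C⦄ (f : X ⟶ Y), ∃ (Z : C) (i : X ⟶ Z) (p : Z ⟶ Y),
      L i ∧ (∀ ⦃A D : C⦄ (u : A ⟶ D), L u → HasLifting u p) ∧ Nonempty (f ≅ i ≫ p))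
    {X Y : Diag J C} (f : X ⟶ Y) :
    ∃ (Z : Diag J C) (i : X ⟶ Z) (p : Z ⟶ Y), Pointwise J L i ∧
      (∀ (j : J) ⦃a b : C⦄ (u : a ⟶ b), L u → Triple.HasLift u (downTriple p j)) ∧
        Nonempty (f ≅ i ≫ p) := by
  obtain ⟨s, hs⟩ := Disp.exists_sec (D := factorDisp f) (fun j s x => L x.ob.i ∧
    ∀ ⦃a b : C⦄ (u : a ⟶ b), L u → Triple.HasLift u (topTriple s x)) fun j s =>
      have := hJ j
      exists_top_factor s hC hL
  let c (j : J) : (Set.univ : Set J) := ⟨j, trivial⟩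
  let Z : Diag J C :=
    Diag.mk' (fun k => (s.ob (c k)).z) (fun {j k} h => (s.hom (c j) (c k) h).m)
      (fun k => (s.un (c k)).iso) (fun {j k l} h h' => (s.tri (c j) (c k) (c l) h h').iso)
      (fun {j k l m} h h' h'' => s.tet (c j) (c k) (c l) (c m) h h' h'')
      (fun {j k} h => s.lu (c j) (c k) h) (fun {j k} h => s.ru (c j) (c k) h)
  let i : X ⟶ Z := mkTrans (fun k => (s.ob (c k)).i) (fun {j k} h => (s.hom (c j) (c k) h).ni)
    (fun k => (s.un (c k)).left) (fun {j k l} h h' => (s.tri (c j) (c k) (c l) h h').left)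
  let p : Z ⟶ Y := mkTrans (fun k => (s.ob (c k)).p) (fun {j k} h => (s.hom (c j) (c k) h).np)
    (fun k => (s.un (c k)).right) (fun {j k l} h h' => (s.tri (c j) (c k) (c l) h h').right)
  exact ⟨Z, i, p, fun j => (hs j).1, fun j => (hs j).2,
    ⟨mkModIso (fun k => (s.ob (c k)).φ) fun {j k} h =>
      nat_square_congr rfl (nat_comp_hom i p h) (s.hom (c j) (c k) h).compat⟩⟩

end Factor

/-! ### Retracts and lifting properties -/

section Retract

variable {C : Type u} [Bicategory.{w, v} C]

/-- The compatibility of the 2-cells of a lift against `p'` with those of the induced lift against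
its retract `p`. -/
theorem retract_base {a x y z b₀ : C} {f : a ⟶ y} {u : a ⟶ x} {i : y ⟶ z} {s : z ⟶ y} {p : y ⟶ b₀}
    {p' : z ⟶ b₀} {l : 𝟙 y ⟶ i ≫ s} {r : s ≫ p ⟶ p'} {φ : p ≅ i ≫ p'}
    (h : l ▷ p ≫ (α_ _ _ _).hom ≫ i ◁ r = (λ_ p).hom ≫ φ.hom) {d : x ⟶ b₀} {ω : f ≫ p ⟶ u ≫ d}
    {g : x ⟶ z} {l' : f ≫ i ⟶ u ≫ g} {r' : g ≫ p' ⟶ d}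
    (h' : l' ▷ p' ≫ (α_ _ _ _).hom ≫ u ◁ r' = (α_ _ _ _).hom ≫ f ◁ φ.inv ≫ ω) :
    ((ρ_ f).inv ≫ f ◁ l ≫ (α_ _ _ _).inv ≫ l' ▷ s ≫ (α_ _ _ _).hom) ▷ p ≫ (α_ _ _ _).hom ≫
      u ◁ ((α_ _ _ _).hom ≫ g ◁ r ≫ r') = ω := by
  calc _ = 𝟙 _ ⊗≫ f ◁ (l ▷ p ≫ (α_ _ _ _).hom) ⊗≫ (l' ▷ (s ≫ p) ≫ (u ≫ g) ◁ r) ⊗≫ u ◁ r' := by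
        bicategory
    _ = 𝟙 _ ⊗≫ f ◁ (l ▷ p ≫ (α_ _ _ _).hom ≫ i ◁ r) ⊗≫ (l' ▷ p' ≫ (α_ _ _ _).hom ≫ u ◁ r') := by
        rw [← whisker_exchange]; bicategory
    _ = 𝟙 _ ⊗≫ f ◁ (φ.hom ≫ φ.inv) ⊗≫ ω := by rw [h, h']; bicategory
    _ = _ := by rw [Iso.hom_inv_id]; bicategory

theorem retract_base_id {a x y z b₀ : C} {f : a ⟶ y} {u : a ⟶ x} {i : y ⟶ z} {s : z ⟶ y}
    {p : y ⟶ b₀} {p' : z ⟶ b₀} {l : 𝟙 y ⟶ i ≫ s} {r : s ≫ p ⟶ p'} {φ : p ≅ i ≫ p'}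
    (h : l ▷ p ≫ (α_ _ _ _).hom ≫ i ◁ r = (λ_ p).hom ≫ φ.hom) {d : x ⟶ b₀} {ω : f ≫ p ⟶ u ≫ d}
    {g : x ⟶ z} {l' : f ≫ i ⟶ u ≫ g} {r' : g ≫ p' ⟶ d}
    (h' : l' ▷ p' ≫ (α_ _ _ _).hom ≫ u ◁ r' = (α_ _ _ _).hom ≫ f ◁ φ.inv ≫ 𝟙 _ ≫ ω ≫ 𝟙 _) :
    ((ρ_ f).inv ≫ f ◁ l ≫ (α_ _ _ _).inv ≫ l' ▷ s ≫ (α_ _ _ _).hom) ▷ p ≫ (α_ _ _ _).hom ≫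
      u ◁ ((α_ _ _ _).hom ≫ g ◁ r ≫ 𝟙 _ ≫ r' ≫ 𝟙 _) = ω := by
  simp only [Category.id_comp, Category.comp_id] at h' ⊢
  exact retract_base h h'

/-- `p` is a retract of `p'` over its codomain. -/
structure RetractOver {y z b₀ : C} (p : y ⟶ b₀) (p' : z ⟶ b₀) where
  i : y ⟶ z
  s : z ⟶ y
  φ : p ≅ i ≫ p'
  l : 𝟙 y ≅ i ≫ s
  r : s ≫ p ≅ p'
  fac : l.hom ▷ p ≫ (α_ _ _ _).hom ≫ i ◁ r.hom = (λ_ p).hom ≫ φ.hom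

/-- The retract argument: if `p ≅ i ≫ p'` lifts against `i`, then it is a retract of `p'`. -/
theorem exists_retractOver {y z b₀ : C} {p : y ⟶ b₀} {i : y ⟶ z} {p' : z ⟶ b₀} (φ : p ≅ i ≫ p')
    (h : HasLifting i p) : ∃ R : RetractOver p p', R.i = i := by
  obtain ⟨s, l, r, hs⟩ := h (𝟙 y) p' (λ_ p ≪≫ φ)
  exact ⟨⟨i, s, φ, l, r, hs⟩, rfl⟩

/-- `i` is a retract of `i'` under its domain. -/
structure RetractUnder {a x z : C} (i : a ⟶ x) (i' : a ⟶ z) where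
  p : z ⟶ x
  s : x ⟶ z
  φ : i ≅ i' ≫ p
  l : i' ≅ i ≫ s
  r : s ≫ p ≅ 𝟙 x
  fac : l.hom ▷ p ≫ (α_ _ _ _).hom ≫ i ◁ r.hom = φ.inv ≫ (ρ_ i).inv

/-- The dual retract argument: if `i ≅ i' ≫ p` lifts against `p`, then it is a retract of `i'`. -/
theorem exists_retractUnder {a x z : C} {i : a ⟶ x} {i' : a ⟶ z} {p : z ⟶ x} (φ : i ≅ i' ≫ p)
    (h : HasLifting i p) : Nonempty (RetractUnder i i') := by
  obtain ⟨s, l, r, hs⟩ := h i' (𝟙 x) (φ.symm ≪≫ (ρ_ i).symm)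
  exact ⟨⟨p, s, φ, l, r, hs⟩⟩

/-- Left lifting properties pass to retracts. -/
theorem RetractUnder.hasLifting {a x z : C} {i : a ⟶ x} {i' : a ⟶ z} (R : RetractUnder i i')
    {y b₀ : C} {q : y ⟶ b₀} (h : HasLifting i' q) : HasLifting i q := by
  obtain ⟨p, s, φ, l, r, hs⟩ := R
  intro f d γ
  obtain ⟨g, l', r', hg⟩ := h f (p ≫ d) (γ ≪≫ whiskerRightIso φ d ≪≫ α_ _ _ _)
  refine ⟨s ≫ g, l' ≪≫ whiskerRightIso l g ≪≫ α_ _ _ _, α_ _ _ _ ≪≫ whiskerLeftIso s r' ≪≫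
    (α_ _ _ _).symm ≪≫ whiskerRightIso r d ≪≫ λ_ d, ?_⟩
  simp only [Iso.trans_hom, whiskerRightIso_hom, whiskerLeftIso_hom, Iso.symm_hom] at hs hg ⊢
  calc _ = l'.hom ▷ q ⊗≫ (l.hom ▷ (g ≫ q) ≫ (i ≫ s) ◁ r'.hom) ⊗≫ i ◁ r.hom ▷ d ⊗≫ 𝟙 _ := by
        bicategory
    _ = (l'.hom ▷ q ≫ (α_ _ _ _).hom ≫ i' ◁ r'.hom) ⊗≫
          (l.hom ▷ p ≫ (α_ _ _ _).hom ≫ i ◁ r.hom) ▷ d ⊗≫ 𝟙 _ := by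
        rw [← whisker_exchange]; bicategory
    _ = γ.hom ⊗≫ (φ.hom ≫ φ.inv) ▷ d ⊗≫ 𝟙 _ := by rw [hs, hg]; bicategory
    _ = _ := by rw [Iso.hom_inv_id]; bicategory

/-- Retracts of morphisms of diagrams are retracts pointwise. -/
def RetractUnder.app {J : Type u₁} [PartialOrder J] {A X Z : Diag J C} {i : A ⟶ X} {i' : A ⟶ Z}
    (R : RetractUnder i i') (j : J) : RetractUnder (i.app (pt j)) (i'.app (pt j)) where
  p := R.p.app (pt j)
  s := R.s.app (pt j)
  φ := isoApp R.φ j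
  l := isoApp R.l j
  r := isoApp R.r j
  fac := congrArg (fun m : i' ≫ R.p ⟶ i ≫ 𝟙 X => m.as.app (pt j)) R.fac

theorem hasLifting_id_left {x y b : C} (q : y ⟶ b) : HasLifting (𝟙 x) q := by
  intro f d γ
  exact ⟨f, (λ_ f).symm, γ ≪≫ λ_ d, by simp⟩

theorem hasLifting_id_right {a x y : C} (i : a ⟶ x) : HasLifting i (𝟙 y) := by
  intro f d γ
  exact ⟨d, (ρ_ f).symm ≪≫ γ, ρ_ d, by simp⟩

end Retract

namespace Triple

section PushOver

variable {S : Type u₁} [PartialOrder S] {C : Type u} [Bicategory.{w, v} C] {Y Z B : Diag S C}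
  {p : Y ⟶ B} {p' : Z ⟶ B} {b₀ x y : C} {c : RawCone B b₀}

/-- The image of a triple under a morphism over the base. -/
@[simps cone base cell]
def pushOver (T : Triple p c x) (i : Y ⟶ Z) (φ : p ≅ i ≫ p') : Triple p' c x where
  cone := T.cone.push i
  base := T.base
  cell k := α_ _ _ _ ≪≫ whiskerLeftIso _ (isoApp φ k).symm ≪≫ T.cell k
  isMor_cell := (T.cone.isMor_push_comp i p').comp
    ((T.cone.isMor_push_mod φ.inv).comp T.isMor_cell)

theorem pushOver_square {d d' : x ⟶ y} {z b b' : C} {i : y ⟶ z} {p : y ⟶ b} {p' : z ⟶ b}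
    {φ : i ≫ p' ⟶ p} {e e' : x ⟶ b'} {c : b' ⟶ b} {t : d ≫ p ⟶ e ≫ c} {t' : d' ≫ p ⟶ e' ≫ c}
    {θ : d ⟶ d'} {r : e ⟶ e'} (h : θ ▷ p ≫ t' = t ≫ r ▷ c) :
    (θ ▷ i) ▷ p' ≫ (α_ _ _ _).hom ≫ d' ◁ φ ≫ t' = ((α_ _ _ _).hom ≫ d ◁ φ ≫ t) ≫ r ▷ c := by
  calc _ = (α_ _ _ _).hom ≫ (θ ▷ (i ≫ p') ≫ d' ◁ φ) ≫ t' := by simp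
    _ = _ := by rw [← whisker_exchange]; simp [h]

theorem IsMor.pushOver {T T' : Triple p c x} {θ : ∀ k, T.cone.app k ⟶ T'.cone.app k}
    {r : T.base ⟶ T'.base} (h : T.IsMor T' θ r) (i : Y ⟶ Z) (φ : p ≅ i ≫ p') :
    (T.pushOver i φ).IsMor (T'.pushOver i φ) (fun k => θ k ▷ i.app (pt k)) r :=
  ⟨h.cone.push i, fun k => pushOver_square (h.cell k)⟩

theorem pushOver_pull_square {w' z b b' : C} {f : w' ⟶ x} {d : x ⟶ y} {i : y ⟶ z} {p : y ⟶ b}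
    {p' : z ⟶ b} {φ : i ≫ p' ⟶ p} {e : x ⟶ b'} {c : b' ⟶ b} {t : d ≫ p ⟶ e ≫ c} :
    (α_ f d i).hom ▷ p' ≫ (α_ _ _ _).hom ≫ f ◁ ((α_ _ _ _).hom ≫ d ◁ φ ≫ t) ≫ (α_ _ _ _).inv =
      ((α_ _ _ _).hom ≫ (f ≫ d) ◁ φ ≫ (α_ _ _ _).hom ≫ f ◁ t ≫ (α_ _ _ _).inv) ≫ 𝟙 (f ≫ e) ▷ c := by
  bicategory

theorem isMor_pushOver_pull (T : Triple p c x) (i : Y ⟶ Z) (φ : p ≅ i ≫ p') (f : y ⟶ x) :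
    ((T.pull f).pushOver i φ).IsMor ((T.pushOver i φ).pull f)
      (fun k => (α_ f (T.cone.app k) (i.app (pt k))).hom) (𝟙 _) :=
  ⟨T.cone.isMor_push_pull f i, fun _ => pushOver_pull_square⟩

theorem isMor_pull_pushOver (T : Triple p c x) (i : Y ⟶ Z) (φ : p ≅ i ≫ p') (f : y ⟶ x) :
    ((T.pushOver i φ).pull f).IsMor ((T.pull f).pushOver i φ)
      (fun k => (α_ f (T.cone.app k) (i.app (pt k))).inv) (𝟙 _) :=
  IsMor.inv (T := (T.pull f).pushOver i φ) (T' := (T.pushOver i φ).pull f)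
    (θ := fun k => α_ f (T.cone.app k) (i.app (pt k))) (r := Iso.refl _)
    (T.isMor_pushOver_pull i φ f)

theorem retract_unit_square {d : x ⟶ y} {z b b' : C} {i : y ⟶ z} {s : z ⟶ y} {p : y ⟶ b}
    {p' : z ⟶ b} {φ : p ≅ i ≫ p'} {l : 𝟙 y ≅ i ≫ s} {r : s ≫ p ≅ p'} {e : x ⟶ b'} {c : b' ⟶ b}
    {t : d ≫ p ⟶ e ≫ c} (h : l.hom ▷ p ≫ (α_ _ _ _).hom ≫ i ◁ r.hom = (λ_ p).hom ≫ φ.hom) :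
    ((α_ d i s).hom ≫ d ◁ l.inv ≫ (ρ_ d).hom) ▷ p ≫ t =
      ((α_ _ _ _).hom ≫ (d ≫ i) ◁ r.hom ≫ (α_ _ _ _).hom ≫ d ◁ φ.inv ≫ t) ≫ 𝟙 e ▷ c := by
  have h' : i ◁ r.hom ≫ φ.inv = (α_ _ _ _).inv ≫ l.inv ▷ p ≫ (λ_ p).hom := by
    rw [Iso.comp_inv_eq]
    calc _ = (α_ _ _ _).inv ≫ l.inv ▷ p ≫ (l.hom ▷ p ≫ (α_ _ _ _).hom ≫ i ◁ r.hom) := by simp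
      _ = _ := by rw [h]; simp
  symm
  calc _ = 𝟙 _ ⊗≫ d ◁ (i ◁ r.hom ≫ φ.inv) ⊗≫ t := by bicategory
    _ = _ := by rw [h']; bicategory

theorem push_id_square {d : x ⟶ y} {y' : C} {d' : x ⟶ y'} {s : y ⟶ y'} {n : d' ⟶ d ≫ s}
    {N : s ≫ 𝟙 y' ⟶ 𝟙 y ≫ s} (hN : N = (ρ_ s).hom ≫ (λ_ s).inv) :
    (ρ_ d').hom ≫ n = (n ▷ 𝟙 y' ≫ (α_ _ _ _).hom ≫ d ◁ N ≫ (α_ _ _ _).inv) ≫ (ρ_ d).hom ▷ s := by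
  rw [hN]
  bicategory

/-- The unit of a retract is a morphism of triples. -/
theorem isMor_retract_unit (R : RetractOver p p') (T : Triple p c x) :
    ((T.pushOver R.i R.φ).pushOver R.s R.r.symm).IsMor T
      (fun k => (α_ _ _ _).hom ≫ T.cone.app k ◁ R.l.inv.as.app (pt k) ≫ (ρ_ _).hom) (𝟙 _) :=
  ⟨(T.cone.isMor_push_comp R.i R.s).comp ((T.cone.isMor_push_mod R.l.inv).comp
    ⟨fun h => push_id_square (nat_id_hom Y h)⟩), fun k => by
    have h := congrArg (fun m : 𝟙 Y ≫ p ⟶ R.i ≫ p' => m.as.app (pt k)) R.fac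
    exact retract_unit_square (φ := isoApp R.φ k) (l := isoApp R.l k) (r := isoApp R.r k) h⟩

end PushOver

variable {J : Type u₁} [PartialOrder J] {C : Type u} [Bicategory.{w, v} C] {Y Z B : Diag J C}
  {p : Y ⟶ B} {p' : Z ⟶ B}

/-- The restriction of an invertible modification to a subset of the poset. -/
def _root_.TwoBModel.restrictIso (S : Set J) {σ τ : Y ⟶ Z} (Γ : σ ≅ τ) :
    restrictMap S σ ≅ restrictMap S τ :=
  mkModIso (X := restrict S Y) (Y := restrict S Z) (fun k => isoApp Γ (k : J))
    fun {_ _} h => modification_nat Γ.hom h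

theorem retract_cone {a x y₁ y₂ z₁ z₂ : C} {f : a ⟶ y₁} {u : a ⟶ x} {my : y₁ ⟶ y₂} {mz : z₁ ⟶ z₂}
    {i₁ : y₁ ⟶ z₁} {i₂ : y₂ ⟶ z₂} {s₁ : z₁ ⟶ y₁} {s₂ : z₂ ⟶ y₂} {ni : my ≫ i₂ ≅ i₁ ≫ mz}
    {ns : mz ≫ s₂ ≅ s₁ ≫ my} {l₁ : 𝟙 y₁ ⟶ i₁ ≫ s₁} {l₂ : 𝟙 y₂ ≅ i₂ ≫ s₂}
    (hl : my ◁ l₂.hom ≫ (α_ _ _ _).inv ≫ ni.hom ▷ s₂ ≫ (α_ _ _ _).hom ≫ i₁ ◁ ns.hom ≫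
      (α_ _ _ _).inv = ((ρ_ my).hom ≫ (λ_ my).inv) ≫ l₁ ▷ my) {d : x ⟶ y₂} {ω : f ≫ my ⟶ u ≫ d}
    {g : x ⟶ z₁} {l' : f ≫ i₁ ⟶ u ≫ g} {θ : g ≫ mz ⟶ d ≫ i₂}
    (h' : l' ▷ mz ≫ (α_ _ _ _).hom ≫ u ◁ θ = (α_ _ _ _).hom ≫ f ◁ ni.inv ≫ (α_ _ _ _).inv ≫
      ω ▷ i₂ ≫ (α_ _ _ _).hom) :
    ((ρ_ f).inv ≫ f ◁ l₁ ≫ (α_ _ _ _).inv ≫ l' ▷ s₁ ≫ (α_ _ _ _).hom) ▷ my ≫ (α_ _ _ _).hom ≫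
      u ◁ ((α_ _ _ _).hom ≫ g ◁ ns.inv ≫ (α_ _ _ _).inv ≫ θ ▷ s₂ ≫ (α_ _ _ _).hom ≫
        d ◁ l₂.inv ≫ (ρ_ d).hom) = ω := by
  calc _ = 𝟙 _ ⊗≫ f ◁ (l₁ ▷ my) ⊗≫ (l' ▷ (s₁ ≫ my) ≫ (u ≫ g) ◁ ns.inv) ⊗≫ u ◁ θ ▷ s₂ ⊗≫
          u ◁ d ◁ l₂.inv ⊗≫ 𝟙 _ := by bicategory
    _ = 𝟙 _ ⊗≫ f ◁ (((ρ_ my).hom ≫ (λ_ my).inv) ≫ l₁ ▷ my) ⊗≫ f ◁ i₁ ◁ ns.inv ⊗≫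
          (l' ▷ mz ≫ (α_ _ _ _).hom ≫ u ◁ θ) ▷ s₂ ⊗≫ u ◁ d ◁ l₂.inv ⊗≫ 𝟙 _ := by
        rw [← whisker_exchange]; bicategory
    _ = 𝟙 _ ⊗≫ f ◁ my ◁ l₂.hom ⊗≫ f ◁ ni.hom ▷ s₂ ⊗≫ f ◁ i₁ ◁ (ns.hom ≫ ns.inv) ⊗≫
          f ◁ ni.inv ▷ s₂ ⊗≫ (ω ▷ (i₂ ≫ s₂) ≫ (u ≫ d) ◁ l₂.inv) ⊗≫ 𝟙 _ := by
        rw [← hl, h']; bicategory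
    _ = 𝟙 _ ⊗≫ f ◁ my ◁ l₂.hom ⊗≫ f ◁ (ni.hom ≫ ni.inv) ▷ s₂ ⊗≫ f ◁ my ◁ l₂.inv ⊗≫ ω ⊗≫ 𝟙 _ := by
        rw [← whisker_exchange, Iso.hom_inv_id]; bicategory
    _ = 𝟙 _ ⊗≫ f ◁ my ◁ (l₂.hom ≫ l₂.inv) ⊗≫ ω ⊗≫ 𝟙 _ := by rw [Iso.hom_inv_id]; bicategory
    _ = _ := by rw [Iso.hom_inv_id]; bicategory

theorem over_cell {y₁ y₂ z₁ z₂ b₁ b₂ : C} {my : y₁ ⟶ y₂} {mz : z₁ ⟶ z₂} {mb : b₁ ⟶ b₂}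
    {i₁ : y₁ ⟶ z₁} {i₂ : y₂ ⟶ z₂} {p₁ : y₁ ⟶ b₁} {p₂ : y₂ ⟶ b₂} {q₁ : z₁ ⟶ b₁} {q₂ : z₂ ⟶ b₂}
    {np : my ≫ p₂ ⟶ p₁ ≫ mb} {nq : mz ≫ q₂ ⟶ q₁ ≫ mb} {ni : my ≫ i₂ ⟶ i₁ ≫ mz}
    {φ₁ : p₁ ≅ i₁ ≫ q₁} {φ₂ : p₂ ≅ i₂ ≫ q₂}
    (h : my ◁ φ₂.hom ≫ (α_ _ _ _).inv ≫ ni ▷ q₂ ≫ (α_ _ _ _).hom ≫ i₁ ◁ nq ≫ (α_ _ _ _).inv =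
      np ≫ φ₁.hom ▷ mb) :
    ni ▷ q₂ ≫ (α_ _ _ _).hom ≫ i₁ ◁ nq ≫ (α_ _ _ _).inv =
      ((α_ _ _ _).hom ≫ my ◁ φ₂.inv ≫ np) ≫ φ₁.hom ▷ mb := by
  simp only [Category.assoc, ← h]
  simp

/-- A morphism over `B` is compatible with the triples below `j`. -/
theorem isMor_downTriple (i : Y ⟶ Z) (φ : p ≅ i ≫ p') (j : J) :
    ((downTriple p j).pushOver (restrictMap (Set.Iio j) i) (restrictIso _ φ)).IsMor
      ((downTriple p' j).pull (i.app (pt j))) (fun k => (nat i (below_le k)).hom)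
      (φ.hom.as.app (pt j)) :=
  ⟨(downTriple i j).isMor_cell, fun k => over_cell (φ₁ := isoApp φ j) (φ₂ := isoApp φ k)
    (nat_square_congr rfl (nat_comp_hom i p' (below_le k)).symm
      (modification_nat φ.hom (below_le k)))⟩

/-- The lifting property of the triple below `j` passes to retracts. -/
theorem HasLift.of_retract (R : RetractOver p p') {j : J} {a x : C} {u : a ⟶ x}
    (h : HasLift u (downTriple p' j)) : HasLift u (downTriple p j) := by
  let S := Set.Iio j
  let R' : RetractOver (restrictMap S p) (restrictMap S p') :=
    { i := restrictMap S R.i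
      s := restrictMap S R.s
      φ := restrictIso S R.φ
      l := restrictIso S R.l
      r := restrictIso S R.r
      fac := mod_ext fun k => congrArg (fun m : 𝟙 Y ≫ p ⟶ R.i ≫ p' => m.as.app (pt (k : J))) R.fac }
  intro f D s ω hs
  have hi : ((downTriple p' j).pull (R.i.app (pt j))).IsMor
      ((downTriple p j).pushOver R'.i R'.φ) (fun k => (nat R.i (below_le k)).inv)
      (R.φ.inv.as.app (pt j)) :=
    IsMor.inv (T := (downTriple p j).pushOver R'.i R'.φ)
      (T' := (downTriple p' j).pull (R.i.app (pt j))) (θ := fun k => nat R.i (below_le k))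
      (r := isoApp R.φ j) (isMor_downTriple R.i R.φ j)
  have hr : ((downTriple p j).pull (R.s.app (pt j))).IsMor
      ((downTriple p' j).pushOver R'.s R'.r.symm) (fun k => (nat R.s (below_le k)).inv)
      (R.r.hom.as.app (pt j)) :=
    IsMor.inv (T := (downTriple p' j).pushOver R'.s R'.r.symm)
      (T' := (downTriple p j).pull (R.s.app (pt j))) (θ := fun k => nat R.s (below_le k))
      (r := isoApp R.r.symm j) (isMor_downTriple R.s R.r.symm j)
  obtain ⟨g, l', θ, r', hg, hθ, hr'⟩ := h (f ≫ R.i.app (pt j)) (D.pushOver R'.i R'.φ)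
    (fun k => α_ _ _ _ ≪≫ whiskerLeftIso f (nat R.i (below_le k)).symm ≪≫ (α_ _ _ _).symm ≪≫
      whiskerRightIso (s k) _ ≪≫ α_ _ _ _)
    (α_ _ _ _ ≪≫ whiskerLeftIso f (isoApp R.φ j).symm ≪≫ Iso.refl _ ≪≫ ω ≪≫ Iso.refl _)
    (((downTriple p' j).isMor_pull_pull f (R.i.app (pt j))).comp ((hi.pull f).comp
      (((downTriple p j).isMor_pull_pushOver R'.i R'.φ f).comp ((hs.pushOver R'.i R'.φ).comp
        (D.isMor_pushOver_pull R'.i R'.φ u)))))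
  refine ⟨g ≫ R.s.app (pt j), (ρ_ f).symm ≪≫ whiskerLeftIso f (isoApp R.l j) ≪≫ (α_ _ _ _).symm ≪≫
    whiskerRightIso l' _ ≪≫ α_ _ _ _, fun k => α_ _ _ _ ≪≫
      whiskerLeftIso g (nat R.s (below_le k)).symm ≪≫ (α_ _ _ _).symm ≪≫
      whiskerRightIso (θ k) _ ≪≫ α_ _ _ _ ≪≫ whiskerLeftIso _ (isoApp R.l k).symm ≪≫ ρ_ _,
    α_ _ _ _ ≪≫ whiskerLeftIso g (isoApp R.r j) ≪≫ Iso.refl _ ≪≫ r' ≪≫ Iso.refl _,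
    ((downTriple p j).isMor_pull_pull g (R.s.app (pt j))).comp ((hr.pull g).comp
      (((downTriple p' j).isMor_pull_pushOver R'.s R'.r.symm g).comp
        ((hg.pushOver R'.s R'.r.symm).comp (isMor_retract_unit R' D)))), fun k => ?_, ?_⟩
  · exact retract_cone (l₂ := isoApp R.l k)
      (nat_square_congr (nat_id_hom Y _).symm (nat_comp_hom R.i R.s (below_le k)).symm
        (modification_nat R.l.hom (below_le k))) (hθ k)
  · have hR := congrArg (fun m : 𝟙 Y ≫ p ⟶ R.i ≫ p' => m.as.app (pt j)) R.fac
    exact retract_base_id (φ := isoApp R.φ j) hR hr'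

end Triple

/-! ### Components of morphisms with lifting properties -/

section Components

variable {J : Type u₁} [PartialOrder J] {C : Type u} [Bicategory.{w, v} C] {Y B : Diag J C}
  {p : Y ⟶ B}

/-- On a lower set, the lifting property of triples is that of the ambient diagram. -/
theorem Triple.HasLift.restrict {U : Set J} (hU : IsLowerSet U) {k : U} {a x : C} {u : a ⟶ x}
    (h : HasLift u (downTriple p (k : J))) : HasLift u (downTriple (restrictMap U p) k) := by
  intro f D s ω hs
  let c (l : Set.Iio (k : J)) : Set.Iio k := ⟨⟨l, hU (below_le l) k.2⟩, l.2⟩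
  let D' : Triple (restrictMap (Set.Iio (k : J)) p) (downRaw B (k : J)) x :=
    { cone :=
        { app := fun l => D.cone.app (c l)
          nat := fun {l m} h => D.cone.nat (j := c l) (k := c m) h
          nat_id := fun l => D.cone.nat_id (c l)
          nat_comp := fun {l m n} h h' => D.cone.nat_comp (j := c l) (k := c m) (l := c n) h h' }
      base := D.base
      cell := fun l => D.cell (c l)
      isMor_cell := ⟨fun {l m} h => D.isMor_cell.nat (j := c l) (k := c m) h⟩ }
  obtain ⟨g, l, θ, r, hθ, hl, hr⟩ := h f D' (fun l => s (c l)) ω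
    ⟨⟨fun {l m} h => hs.cone.nat (j := c l) (k := c m) h⟩, fun l => hs.cell (c l)⟩
  exact ⟨g, l, fun m => θ ⟨m, m.2⟩, r,
    ⟨⟨fun {m n} h => hθ.cone.nat (j := ⟨m, m.2⟩) (k := ⟨n, n.2⟩) h⟩, fun m => hθ.cell ⟨m, m.2⟩⟩,
    fun m => hl ⟨m, m.2⟩, hr⟩

/-- The cone of transition 1-cells of a diagram over `{k | k ≤ j}`. -/
def upToRaw (Y : Diag J C) (j : J) : RawCone (restrict (Set.Iic j) Y) (Y.ob j) where
  app k := Y.mp (j := j) (k := k) k.2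
  nat {k _} h := Y.cmp (j := j) (k := k) k.2 h
  nat_id k := Y.cmp_id_right (j := j) (k := k) k.2
  nat_comp {k _ _} h h' := Y.cmp_assoc (j := j) (k := k) k.2 h h'

theorem isMor_upToRaw (p : Y ⟶ B) (j : J) :
    ((upToRaw Y j).push (restrictMap (Set.Iic j) p)).IsMor ((upToRaw B j).pull (p.app (pt j)))
      fun k => (nat p (j := j) (k := k) k.2).hom :=
  ⟨fun {k _} h => down_cell (nat_comp p (j := j) (k := k) k.2 h)⟩

theorem component_square {a x y b : C} {f : a ⟶ y} {d : x ⟶ b} {u : a ⟶ x} {p : y ⟶ b}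
    {γ : f ≫ p ⟶ u ≫ d} {my : y ⟶ y} {mb : b ⟶ b} {iy : my ≅ 𝟙 y} {ib : mb ≅ 𝟙 b}
    {np : my ≫ p ⟶ p ≫ mb} (hp : np ≫ p ◁ ib.hom = iy.hom ▷ p ≫ (λ_ _).hom ≫ (ρ_ _).inv)
    {g : x ⟶ y} {l : f ≫ my ⟶ u ≫ g} {r : g ≫ p ⟶ d ≫ mb}
    (h : l ▷ p ≫ (α_ _ _ _).hom ≫ u ◁ r = (α_ _ _ _).hom ≫ f ◁ np ≫ (α_ _ _ _).inv ≫ γ ▷ mb ≫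
      (α_ _ _ _).hom) :
    ((ρ_ f).inv ≫ f ◁ iy.inv ≫ l) ▷ p ≫ (α_ _ _ _).hom ≫ u ◁ (r ≫ d ◁ ib.hom ≫ (ρ_ d).hom) =
      γ := by
  calc _ = 𝟙 _ ⊗≫ f ◁ iy.inv ▷ p ⊗≫ (l ▷ p ≫ (α_ _ _ _).hom ≫ u ◁ r) ⊗≫ u ◁ d ◁ ib.hom ⊗≫ 𝟙 _ := by
        bicategory
    _ = 𝟙 _ ⊗≫ f ◁ iy.inv ▷ p ⊗≫ f ◁ np ⊗≫ (γ ▷ mb ≫ (u ≫ d) ◁ ib.hom) ⊗≫ 𝟙 _ := by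
        rw [h]; bicategory
    _ = 𝟙 _ ⊗≫ f ◁ iy.inv ▷ p ⊗≫ f ◁ (np ≫ p ◁ ib.hom) ⊗≫ γ ⊗≫ 𝟙 _ := by
        rw [← whisker_exchange]; bicategory
    _ = 𝟙 _ ⊗≫ f ◁ (iy.inv ≫ iy.hom) ▷ p ⊗≫ γ ⊗≫ 𝟙 _ := by rw [hp]; bicategory
    _ = _ := by rw [Iso.inv_hom_id]; bicategory

/-- A component of a morphism has the lifting property that the triples of the morphism have: a
square with this component is the same as a square over `{k | k ≤ j}` between constant diagrams
and restrictions. -/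
theorem hasLifting_app [WellFoundedLT J] {a x : C} {u : a ⟶ x} (j : J)
    (h : ∀ k ≤ j, Triple.HasLift u (downTriple p k)) : HasLifting u (p.app (pt j)) := by
  intro f d γ
  let U := Set.Iic j
  let cf := (upToRaw Y j).pull f
  let cd := (upToRaw B j).pull d
  let f' : const _ a ⟶ restrict U Y := cf.toPseudoCone
  let d' : const _ x ⟶ restrict U B := cd.toPseudoCone
  let γ' : f' ≫ restrictMap U p ≅ constMap _ u ≫ d' :=
    mkModIso (X := const _ a) (fun k =>
      α_ _ _ _ ≪≫ whiskerLeftIso f (nat p (j := j) (k := k) k.2) ≪≫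
      (α_ _ _ _).symm ≪≫ whiskerRightIso γ _ ≪≫ α_ _ _ _) fun hk =>
        (raw_mor_iff ((nat_comp_hom (X := const _ a) f' (restrictMap U p) hk).trans (push_nat rfl))
          (cd.constMap_toPseudoCone_nat u hk)).2
          ((((upToRaw Y j).isMor_push_pull f _).comp (((isMor_upToRaw p j).pull f).comp
            (((upToRaw B j).isMor_pull_pull_inv f _).comp
              (((upToRaw B j).isMor_whiskerRight γ.hom).comp
                ((upToRaw B j).isMor_pull_pull u d))))).nat hk)
  obtain ⟨g, l, r, hg⟩ := hasLifting_of_hasLift (J := U) (i := constMap _ u)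
    (p := restrictMap U p) (fun k => (h k k.2).restrict (isLowerSet_Iic j)) f' d' γ'
  let t : U := ⟨j, le_rfl⟩
  exact ⟨g.app (pt t), (ρ_ f).symm ≪≫ whiskerLeftIso f (Y.idm j).symm ≪≫ isoApp l t,
    isoApp r t ≪≫ whiskerLeftIso d (B.idm j) ≪≫ ρ_ d,
    component_square (nat_id p j) (l := (isoApp l t).hom) (r := (isoApp r t).hom)
      (congrArg (fun m : f' ≫ restrictMap U p ⟶ constMap _ u ≫ d' => m.as.app (pt t)) hg)⟩

end Components

/-! ### The model structure on diagrams -/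

section ModelStructure

variable {C : Type u} [Bicategory.{w, v} C] {cof fib weq : MorphismProperty C}

namespace IsClosedTwoBModel

/-- Trivial fibrations are the morphisms with the lifting property against cofibrations: such a
morphism is a weak equivalence by its factorization with an identity. -/
theorem trivFib_iff (h : IsClosedTwoBModel cof fib weq) {Y B : C} (p : Y ⟶ B) :
    fib p ∧ weq p ↔ ∀ ⦃A X : C⦄ (i : A ⟶ X), cof i → HasLifting i p :=
  ⟨fun hp _ _ i hi => (h.cof_iff i).1 hi p hp.1 hp.2,
    fun hp => ⟨(h.fib_iff p).2 fun _ _ i hi _ => hp i hi,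
      (h.weq_iff p).2 ⟨Y, 𝟙 Y, p, ⟨(λ_ p).symm⟩, hp, fun _ _ q _ => hasLifting_id_left q⟩⟩⟩

theorem weq_of_hasLifting_fib (h : IsClosedTwoBModel cof fib weq) {A X : C} {i : A ⟶ X}
    (hi : ∀ ⦃Y B : C⦄ (p : Y ⟶ B), fib p → HasLifting i p) : weq i :=
  (h.weq_iff i).2 ⟨X, i, 𝟙 X, ⟨(ρ_ i).symm⟩, fun _ _ u _ => hasLifting_id_right u, hi⟩

/-- The factorizations of `C` in terms of the lifting property against trivial cofibrations. -/
theorem factor_trivCof (h : IsClosedTwoBModel cof fib weq) ⦃X Y : C⦄ (f : X ⟶ Y) :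
    ∃ (Z : C) (i : X ⟶ Z) (p : Z ⟶ Y), (cof ⊓ weq) i ∧
      (∀ ⦃A D : C⦄ (u : A ⟶ D), (cof ⊓ weq) u → HasLifting u p) ∧ Nonempty (f ≅ i ≫ p) := by
  obtain ⟨Z, i, p, hi, hp, e⟩ := h.factor_trivCof_fib f
  exact ⟨Z, i, p, hi, fun _ _ u hu => (h.fib_iff p).1 hp u hu.1 hu.2, e⟩

/-- The factorizations of `C` in terms of the lifting property against cofibrations. -/
theorem factor_cof (h : IsClosedTwoBModel cof fib weq) ⦃X Y : C⦄ (f : X ⟶ Y) :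
    ∃ (Z : C) (i : X ⟶ Z) (p : Z ⟶ Y), cof i ∧
      (∀ ⦃A D : C⦄ (u : A ⟶ D), cof u → HasLifting u p) ∧ Nonempty (f ≅ i ≫ p) := by
  obtain ⟨Z, i, p, hi, hp, e⟩ := h.factor_cof_trivFib f
  exact ⟨Z, i, p, hi, (h.trivFib_iff p).1 hp, e⟩

end IsClosedTwoBModel

variable {J : Type u₁} [PartialOrder J]

theorem wellFoundedLT_of_finite_Iio (hJ : ∀ j : J, Finite (Set.Iio j)) : WellFoundedLT J := by
  exact ⟨Subrelation.wf (r := InvImage (· < ·) fun j : J => (Set.Iio j).ncard)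
    (fun {a b} hab => Set.ncard_lt_ncard (Set.Iio_ssubset_Iio hab) (Set.toFinite (Set.Iio b)))
    (InvImage.wf _ wellFounded_lt)⟩

/-- A morphism of diagrams lifts against all morphisms that are pointwise in `L` if and only if its
triples lift against `L`: one direction is the recursive construction of fillers, the other one
holds by the retract argument, as the right factors that are constructed by recursion have this
property. -/
theorem hasLifting_pointwise_iff [WellFoundedLT J] (hJ : ∀ j : J, Finite (Set.Iio j))
    (hC : HasFiniteWeightedBilimits C) {L : MorphismProperty C}
    (hL : ∀ ⦃X Y : C⦄ (f : X ⟶ Y), ∃ (Z : C) (i : X ⟶ Z) (p : Z ⟶ Y),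
      L i ∧ (∀ ⦃A D : C⦄ (u : A ⟶ D), L u → HasLifting u p) ∧ Nonempty (f ≅ i ≫ p))
    {Y B : Diag J C} (p : Y ⟶ B) :
    (∀ ⦃A X : Diag J C⦄ (i : A ⟶ X), Pointwise J L i → HasLifting i p) ↔
      ∀ (j : J) ⦃a x : C⦄ (u : a ⟶ x), L u → Triple.HasLift u (downTriple p j) := by
  refine ⟨fun h j a x u hu => ?_, fun h A X i hi => hasLifting_of_hasLift fun j => h j _ (hi j)⟩
  obtain ⟨Z, i, p', hi, hp', ⟨φ⟩⟩ := exists_factorization hJ hC hL p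
  obtain ⟨R, -⟩ := exists_retractOver φ (h i hi)
  exact Triple.HasLift.of_retract R (hp' j u hu)

/-- The 1-cell of a matching datum has the lifting properties of the triple below `j`. -/
theorem Matching.hasLifting_iff {Y B : Diag J C} {p : Y ⟶ B} {j : J} (m : Matching p j) {a x : C}
    (u : a ⟶ x) : HasLifting u m.q ↔ Triple.HasLift u (downTriple p j) := by
  obtain ⟨T, hT, ψ, φ, h⟩ := m.exists_triple
  exact hT.hasLifting_iff ψ φ h u

theorem IsClosedTwoBModel.diagFib_iff (h : IsClosedTwoBModel cof fib weq) [WellFoundedLT J]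
    (hJ : ∀ j : J, Finite (Set.Iio j)) {Y B : Diag J C} (p : Y ⟶ B) :
    DiagFib J cof weq p ↔ ∀ (j : J) ⦃a x : C⦄ (u : a ⟶ x), (cof ⊓ weq) u →
      Triple.HasLift u (downTriple p j) := by
  rw [← hasLifting_pointwise_iff hJ h.bilimits h.factor_trivCof]
  exact ⟨fun hp A X i hi => hp i (fun j => (hi j).1) fun j => (hi j).2,
    fun hp A X i hi hi' => hp i fun j => ⟨hi j, hi' j⟩⟩

/-- Trivial fibrations of diagrams in terms of triples. For a trivial fibration `p ≅ i ≫ q` with `i`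
a pointwise cofibration and `q` lifting against cofibrations, `i` is a pointwise weak equivalence by
two-out-of-three, so that `p` lifts against `i` and is a retract of `q`. -/
theorem IsClosedTwoBModel.diagTrivFib_iff (h : IsClosedTwoBModel cof fib weq) [WellFoundedLT J]
    (hJ : ∀ j : J, Finite (Set.Iio j)) {Y B : Diag J C} (p : Y ⟶ B) :
    DiagFib J cof weq p ∧ Pointwise J weq p ↔
      ∀ (j : J) ⦃a x : C⦄ (u : a ⟶ x), cof u → Triple.HasLift u (downTriple p j) := by
  -- a component lifts against cofibrations if the triples do
  have weq_of {Z : Diag J C} {p' : Z ⟶ B}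
      (hp' : ∀ (j : J) ⦃a x : C⦄ (u : a ⟶ x), cof u → Triple.HasLift u (downTriple p' j)) (j : J) :
      weq (p'.app (pt j)) :=
    ((h.trivFib_iff _).2 fun _ _ u hu => hasLifting_app j fun k _ => hp' k u hu).2
  refine ⟨fun ⟨hp, hp'⟩ j a x u hu => ?_, fun hp =>
    ⟨(h.diagFib_iff hJ p).2 fun j _ _ u hu => hp j u hu.1, weq_of hp⟩⟩
  obtain ⟨Z, i, q, hi, hq, ⟨φ⟩⟩ := exists_factorization hJ h.bilimits h.factor_cof p
  have hi' : Pointwise J weq i := fun j =>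
    h.weq_left _ _ _ ⟨isoApp φ j⟩ (weq_of hq j) (hp' j)
  obtain ⟨R, -⟩ := exists_retractOver φ (hp i hi hi')
  exact Triple.HasLift.of_retract R (hq j u hu)

theorem IsClosedTwoBModel.diagTrivFib_iff_hasLifting (h : IsClosedTwoBModel cof fib weq)
    [WellFoundedLT J] (hJ : ∀ j : J, Finite (Set.Iio j)) {Y B : Diag J C} (p : Y ⟶ B) :
    DiagFib J cof weq p ∧ Pointwise J weq p ↔
      ∀ ⦃A X : Diag J C⦄ (i : A ⟶ X), Pointwise J cof i → HasLifting i p := by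
  rw [h.diagTrivFib_iff hJ, hasLifting_pointwise_iff hJ h.bilimits h.factor_cof]

/-- The model structure on diagrams with pointwise cofibrations and weak equivalences. -/
theorem IsClosedTwoBModel.diag (h : IsClosedTwoBModel cof fib weq) [WellFoundedLT J]
    (hJ : ∀ j : J, Finite (Set.Iio j)) :
    IsClosedTwoBModel (Pointwise J cof) (DiagFib J cof weq) (Pointwise J weq) where
  strict := strict_pseudofunctor h.strict
  bilimits := Diag.hasFiniteWeightedBilimits h.bilimits
  bicolimits := Diag.hasFiniteWeightedBicolimits h.bicolimits
  factor_trivCof_fib X Y f := by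
    obtain ⟨Z, i, p, hi, hp, e⟩ := exists_factorization hJ h.bilimits h.factor_trivCof f
    exact ⟨Z, i, p, ⟨fun j => (hi j).1, fun j => (hi j).2⟩, (h.diagFib_iff hJ p).2 hp, e⟩
  factor_cof_trivFib X Y f := by
    obtain ⟨Z, i, p, hi, hp, e⟩ := exists_factorization hJ h.bilimits h.factor_cof f
    exact ⟨Z, i, p, hi, (h.diagTrivFib_iff hJ p).2 hp, e⟩
  weq_comp _ _ _ _ _ _ := fun ⟨e⟩ hf hg j => h.weq_comp _ _ _ ⟨isoApp e j⟩ (hf j) (hg j)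
  weq_right _ _ _ _ _ _ := fun ⟨e⟩ hf hg j => h.weq_right _ _ _ ⟨isoApp e j⟩ (hf j) (hg j)
  weq_left _ _ _ _ _ _ := fun ⟨e⟩ hf hg j => h.weq_left _ _ _ ⟨isoApp e j⟩ (hf j) (hg j)
  weq_of_iso X Y f g hfg hgf j := h.weq_of_iso _ (g.app (pt j))
    (congrArg (fun m : X ⟶ X => m.app (pt j)) hfg) (congrArg (fun m : Y ⟶ Y => m.app (pt j)) hgf)
  fib_iff _ _ _ := Iff.rfl
  -- a morphism that lifts against trivial fibrations is a retract of the left factor of its own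
  -- factorization, which is a pointwise cofibration
  cof_iff A X i := by
    refine ⟨fun hi Y B p hp hp' => (h.diagTrivFib_iff_hasLifting hJ p).1 ⟨hp, hp'⟩ i hi,
      fun hi j => ?_⟩
    obtain ⟨Z, i', p, hi', hp, ⟨φ⟩⟩ := exists_factorization hJ h.bilimits h.factor_cof i
    have hp := (h.diagTrivFib_iff hJ p).2 hp
    obtain ⟨R⟩ := exists_retractUnder φ (hi p hp.1 hp.2)
    exact (h.cof_iff _).2 fun Y B q hq hq' =>
      (R.app j).hasLifting ((h.cof_iff _).1 (hi' j) q hq hq')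
  weq_iff X Y f := by
    constructor
    · intro hf
      obtain ⟨Z, i, p, hi, hp, ⟨φ⟩⟩ := exists_factorization hJ h.bilimits h.factor_cof f
      have hp := (h.diagTrivFib_iff hJ p).2 hp
      exact ⟨Z, i, p, ⟨φ⟩, (h.diagTrivFib_iff_hasLifting hJ p).1 hp, fun _ _ q hq =>
        hq i hi fun j => h.weq_left _ _ _ ⟨isoApp φ j⟩ (hp.2 j) (hf j)⟩
    · -- `r` is a retract of a pointwise trivial cofibration; in `C`, these lift against fibrations
      rintro ⟨Z, r, s, ⟨e⟩, hs, hr⟩ j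
      obtain ⟨Z', i, p, hi, hp, ⟨φ⟩⟩ := exists_factorization hJ h.bilimits h.factor_trivCof r
      obtain ⟨R⟩ := exists_retractUnder φ (hr p ((h.diagFib_iff hJ p).2 hp))
      exact h.weq_comp _ _ _ ⟨isoApp e j⟩
        (h.weq_of_hasLifting_fib fun _ _ q hq =>
          (R.app j).hasLifting ((h.fib_iff q).1 hq _ (hi j).1 (hi j).2))
        (((h.diagTrivFib_iff_hasLifting hJ s).2 hs).2 j)

theorem IsClosedTwoBModel.diagFib_iff_matching (h : IsClosedTwoBModel cof fib weq)
    [WellFoundedLT J] (hJ : ∀ j : J, Finite (Set.Iio j)) {Y B : Diag J C} {p : Y ⟶ B}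
    (m : ∀ j : J, Matching p j) : DiagFib J cof weq p ↔ ∀ j, fib (m j).q := by
  rw [h.diagFib_iff hJ]
  refine forall_congr' fun j => ?_
  rw [h.fib_iff]
  exact ⟨fun hp A X i hi hi' => ((m j).hasLifting_iff i).2 (hp i ⟨hi, hi'⟩),
    fun hp a x u hu => ((m j).hasLifting_iff u).1 (hp u hu.1 hu.2)⟩

theorem IsClosedTwoBModel.diagTrivFib_iff_matching (h : IsClosedTwoBModel cof fib weq)
    [WellFoundedLT J] (hJ : ∀ j : J, Finite (Set.Iio j)) {Y B : Diag J C} {p : Y ⟶ B}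
    (m : ∀ j : J, Matching p j) :
    DiagFib J cof weq p ∧ Pointwise J weq p ↔ ∀ j, fib (m j).q ∧ weq (m j).q := by
  rw [h.diagTrivFib_iff hJ]
  refine forall_congr' fun j => ?_
  rw [h.trivFib_iff]
  exact ⟨fun hp A X i hi => ((m j).hasLifting_iff i).2 (hp i hi),
    fun hp a x u hu => ((m j).hasLifting_iff u).1 (hp u hu)⟩

end ModelStructure

end TwoBModel

theorem mainTheorem3 {J : Type*} [PartialOrder J] [OrderBot J] [IsDirectedOrder J]
    (hJ : ∀ j : J, (Set.Iic j).Finite)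
    {C : Type*} [Bicategory C] (cof fib weq : MorphismProperty C)
    (hC : TwoBModel.IsClosedTwoBModel cof fib weq) :
    TwoBModel.IsClosedTwoBModel (TwoBModel.Pointwise J cof) (TwoBModel.DiagFib J cof weq)
        (TwoBModel.Pointwise J weq) ∧
      ∀ {Y B : TwoBModel.Diag J C} (p : Y ⟶ B),
        (∀ j : J, Nonempty (TwoBModel.Matching p j)) ∧
        ∀ m : ∀ j : J, TwoBModel.Matching p j,
          (TwoBModel.DiagFib J cof weq p ↔ ∀ j, fib (m j).q) ∧
          ((TwoBModel.DiagFib J cof weq p ∧ TwoBModel.Pointwise J weq p) ↔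
            ∀ j, fib (m j).q ∧ weq (m j).q) := by
  have hJ' (j : J) : (Set.Iio j).Finite := (hJ j).subset Set.Iio_subset_Iic_self
  have hJ'' (j : J) : Finite (Set.Iio j) := (hJ' j).to_subtype
  have : WellFoundedLT J := TwoBModel.wellFoundedLT_of_finite_Iio hJ''
  exact ⟨hC.diag hJ'', fun p => ⟨fun j => TwoBModel.Matching.nonempty hC.bilimits p (hJ' j),
    fun m => ⟨hC.diagFib_iff_matching hJ'' m, hC.diagTrivFib_iff_matching hJ'' m⟩⟩⟩
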